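/- **Setting.** All Banach spaces are real, and $\mathcal X(x,r)$ denotes the open ball of centre $x$ and radius $r$ of $\mathcal X$. For a partially defined map $T$ on a Banach space $\mathcal X$ and $\varepsilon>0$: * $W^s_\varepsilon(x)$ is the set of all $y$ all of whose iterates are defined, with $T^n(y)\in\mathcal X(T^n(x),\varepsilon)$ for all $n\ge 0$ and $\|T^n(y)-T^n(x)\|\to0$; * if $T$ is invertible on an invariant set containing $x$, $W^u_\varepsilon(x)$ is the set of all $y=y_0$ for which there are $y_n\in\mathcal X(T^{-n}(x),\varepsilon)$ with $T(y_{n+1})=y_n$ for all $n\ge 0$ and $\|T^{-n}(x)-y_n\|\to0$. *Hyperbolic set.* Let $\mathcal O_{\mathcal A}$ be open in a Banach space $\mathcal A$, let $T:\mathcal O_{\mathcal A}\to\mathcal A$ be $C^2$, and let $\mathbb K\subset\mathcal O_{\mathcal A}$ be a hyperbolic basic set of $T$ with one-dimensional unstable spaces. That is: $\mathbb K$ is compact, $T|\mathbb K$ is a topologically transitive homeomorphism of $\mathbb K$ with dense periodic points; if all iterates of $y\in\mathcal O_{\mathcal A}$ are defined then $T^n(y)$ converges to $\mathbb K$; and there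 are a continuous $DT$-invariant splitting $\mathcal A=E^s_x\oplus E^u_x$ ($x\in\mathbb K$), $\dim E^u_x=1$, and constants $c,c'>0$, $0<\theta<1$ with $\|DT^n(x)v\|\le c\,\theta^n\|v\|$ on $E^s_x$ and $\|DT^n(x)v\|\ge c'\theta^{-n}\|v\|$ on $E^u_x$, for all $n\ge0$. Let $\mathbf u_x\in E^u_x$ be unit vectors depending continuously on $x\in\mathbb K$ with $DT(x)\mathbf u_x=\delta_x\mathbf u_{T(x)}$, $\delta_x>0$, and let $C_0>0$, $\lambda>1$ be such that $\delta_{T^{m-1}(x)}\cdots\delta_x>C_0\lambda^m$ for all $x\in\mathbb K$, $m\ge1$. *Compatibility.* Let $\mathcal A\subseteq\mathcal X\subseteq\mathcal Y$ be Banach spaces. The pair $(\mathcal X,\mathcal Y)$ is $\rho$-compatible with $(T,\mathbb K)$, where $\theta<\rho<\lambda$, if both inclusions are compact; the operators $DT(x)$, $x\in\mathbb K$, extend to linear operators $\hat L_x$ of $\mathcal Y$ which preserve $\mathcal X$ and are bounded on $\mathcal Y$ and on $\mathcal X$ uniformly in $x$; $x\mapsto\hat L_x|\mathcal X\in\mathcal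 L(\mathcal X,\mathcal Y)$ is continuous on $\mathbb K$; and there are $\Delta>1$, $\kappa>1$ and an integer $m\ge1$ such that every point of $\mathcal X(0,1)$ is a $\mathcal Y$-limit of points of $\mathcal A\cap\mathcal X(0,\Delta)$ and, for all $x\in\mathbb K$ and $v\in\mathcal X$, $$\|\hat L_{T^{m-1}(x)}\cdots\hat L_x v\|_{\mathcal X}\le\max\Big\{\frac{\rho^m}{2(1+\Delta)}\|v\|_{\mathcal X},\ \kappa\|v\|_{\mathcal Y}\Big\}.$$ *Robustness.* Let $\mathcal A\subseteq\mathcal B\subseteq\mathcal C\subseteq\mathcal D$ be Banach spaces with compact inclusions and let $\mathcal O_{\mathcal B}\supseteq\mathcal O_{\mathcal A}$ be open in $\mathcal B$. $T$ is robust with respect to $(\mathcal B,\mathcal C,\mathcal D)$ if it has an extension $T:\mathcal O_{\mathcal B}\to\mathcal B$ with the following properties, where, for $m\ge1$, $\mathcal O^{(m)}_{\mathcal B}$ is the interior of $\{f\in\mathcal O_{\mathcal B}:T^i(f)\in\mathcal O_{\mathcal B},\ i<m\}$ and $DT^m(f)$ is the derivative of $T^m:\mathcal O_{\mathcal B}^{(m)}\to\mathcal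 C$. 1. $(\mathcal B,\mathcal D)$ is $1$-compatible, and $(\mathcal C,\mathcal D)$ is $\rho_{\mathcal C}$-compatible for some $\rho_{\mathcal C}<\lambda$, with $(T,\mathbb K)$. 2. For all $m\ge1$: $\mathbb K\subset\mathcal O^{(m)}_{\mathcal B}$, $T^m:\mathcal O^{(m)}_{\mathcal B}\to\mathcal C$ is $C^1$ with derivative uniformly continuous on a neighbourhood of $\mathbb K$, and for $f\in\mathcal A\cap\mathcal O^{(m)}_{\mathcal B}$ the map $DT^m(f):\mathcal B\to\mathcal C$ extends to a continuous linear operator of $\mathcal D$ that maps $\mathcal B$ to $\mathcal B$ and $\mathcal C$ to $\mathcal C$. 3. For all $m\ge1$ there is $C_{m,1}>1$ such that each $g\in\mathbb K$ has a neighbourhood in $\mathcal B$ on which $\|DT^m(f)\mathbf u_g-DT^m(g)\mathbf u_g\|_{\mathcal C}\le C_{m,1}\|f-g\|_{\mathcal B}$. 4. There are $C_1>1$, $\rho>1$ such that each $g\in\mathbb K$ has a neighbourhood in $\mathcal B$ on which $\|T(f_1)-T(f_2)-DT(f_2)(f_1-f_2)\|_{\mathcal C}\le C_1\|f_1-f_2\|_{\mathcal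 C}^{\rho}$. 5. There are $\nu_m,C_{m,2}>0$ ($m\ge1$), with $C_{m,2}<C_0/8$ for all large $m$, such that $\|(DT^m(f)-DT^m(g))v\|_{\mathcal C}\le C_{m,2}\lambda^m\|v\|_{\mathcal C}$ for all $g\in\mathbb K$, $f\in\mathcal O^{(m)}_{\mathcal B}$ with $\|f-g\|_{\mathcal B}<\nu_m$, and $v\in\mathcal B$. 6. With the same $\nu_m$, there are $C_{m,3}>0$, with $C_{m,3}<1/4$ for all large $m$, such that $\|T^m(f+v)-T^m(f)-DT^m(g)v\|_{\mathcal B}\le C_{m,3}\|v\|_{\mathcal B}$ for all $g\in\mathbb K$, $f\in\mathcal A$ with $\|f-g\|_{\mathcal A}<\nu_m$, $v\in\mathcal B$ with $\|v\|_{\mathcal B}<\nu_m$, and $f,f+v\in\mathcal O^{(m)}_{\mathcal B}$. *Unstable manifolds and bounded geometry.* Let $H:X\to\mathbb K$ be a homeomorphism that conjugates a two-sided shift of finite type $X\subseteq\Theta^{\mathbb Z}$ ($\Theta$ finite; for instance $X=\Theta^{\mathbb Z}$) to $T|\mathbb K$. Let $\eta>0$ and let $u_g:[a_g,b_g]\to\mathcal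 A$ ($a_g<0<b_g$, $g\in\mathbb K$) be injective $C^2$ curves with nowhere vanishing derivative, with $u_g((a_g,b_g))=W^u_\eta(g)$ (in $\mathcal A$), $u_g(0)=g$, $u_g'(0)=\mathbf u_g$, varying continuously with $g$: for some $\mu>0$ with $[-\mu,\mu]\subset(a_g,b_g)$ for all $g$, the maps $u_g(t),u_g'(t),u_g''(t)$ are continuous in $(g,t)\in\mathbb K\times[-\mu,\mu]$. For $0<\varepsilon_1\le\eta$ and $k\ge0$ let $\mathbf C_k(g)$ be the collection of the smallest intervals $\Delta\subset\mathbb R$ with $u_g(\Delta)\supset H(\Sigma)\cap\overline{W^u_{\varepsilon_1}(g)}$, one for each set $\Sigma$ of all sequences of $X$ with prescribed entries at the places $j\le k$ for which the right-hand side is non-empty. The manifolds $W^u_{\varepsilon_1}(g)$ have *bounded geometry* if there is $\alpha\in(0,1)$ such that for all $g\in\mathbb K$, $k\ge1$ and $\Delta\in\mathbf C_k(g)$: $\alpha<|I|/|\Delta|<1-\alpha$ whenever $I\in\mathbf C_{k+1}(g)$ is contained in $\Delta$, and whenever $I$ is a connected component of $\Delta\setminus\bigcup\mathbf C_{k+1}(g)$.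 *Ordered transversals.* In the following the stable sets are those of the extended operator $T$ in $\mathcal B$, and the unstable ones those of $T$ in $\mathcal A$. Let $g\in\mathbb K$, and let $F:[-\mu_0,\mu_0]\to\mathcal B(g,\varepsilon)$ be an injective $C^2$ curve with nowhere vanishing derivative. Let $K_F$ be the set of all $r$ such that $F(r)\in W^s_{\varepsilon_0}(g_0)$ for some $g_0\in\mathbb K\cap W^u_{\varepsilon_0}(g)$. The holonomy $\phi_F:F(K_F)\to W^u_{\varepsilon_0}(g)$ takes $F(r)$ to this point $g_0$. $F$ is an *ordered transversal* to the stable lamination if at each of its intersections with a local stable manifold $W^s_{\varepsilon_0}(g')$, $g'\in\mathbb K$, its derivative is not tangent to it, and if $\phi_F$ is well defined and extends to a homeomorphism $\hat\phi_F$ of $F([-\mu_0,\mu_0])$ onto its image in $W^u_{\varepsilon_0}(g)$ with $\phi_F(F(K_F))=\hat\phi_F(F([-\mu_0,\mu_0]))\cap\mathbb K$. **Theorem.** Let $T$, $\mathbb K$, $H$ and $(u_g)_{g\in\mathbb K}$ be as above, with $T$ robust with respect to $(\mathcal B,\mathcal C,\mathcal D)$. There is $\varepsilon_{\max}>0$ such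 that the following holds for all $0<\varepsilon_0<\varepsilon_{\max}$ and $\varepsilon_0\le\varepsilon_1\le\eta$ (for instance $\varepsilon_1=\varepsilon_0$). If the local unstable manifolds $W^u_{\varepsilon_1}(g)$, $g\in\mathbb K$, have bounded geometry, then there is $0<\varepsilon<\varepsilon_0$ such that for every $g\in\mathbb K$, every $\mu_0>0$ and every $C^2$ ordered transversal $F:[-\mu_0,\mu_0]\to\mathcal B(g,\varepsilon)$ to the stable lamination, there is $\theta'\in(0,1)$ such that the holonomy $\phi_F:F(K_F)\to W^u_{\varepsilon_0}(g)$ extends to a $C^{1+\theta'}$ diffeomorphism $\Phi$ of $F([-\mu_0,\mu_0])$ onto its image in $W^u_{\varepsilon_0}(g)$; that is, $\Phi\circ F=u_g\circ\Psi$ where $\Psi:[-\mu_0,\mu_0]\to(a_g,b_g)$ is injective and $C^1$, $\Psi'$ vanishes nowhere and is Hölder continuous with exponent $\theta'$. -/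

import Mathlib

open Set Filter Topology Metric

/-! ### Hyperbolic basic sets and local invariant sets -/

/-- `K` is a hyperbolic basic set of `T : O → E`, with contraction exponent `θ` and with unstable
spaces of dimension `d`. The splitting `E = E^s_x ⊕ E^u_x` is given by the bounded projections
`P x` onto `E^u_x = range (P x)` along `E^s_x = ker (P x)`. As `K` is compact, a continuous bijection
of `K` is a homeomorphism. -/
structure IsHyperbolicBasicSet {E : Type*} [NormedAddCommGroup E] [NormedSpace ℝ E]
    (O : Set E) (T : E → E) (K : Set E) (P : E → E →L[ℝ] E) (θ : ℝ) (d : ℕ) : Prop where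
  isCompact : IsCompact K
  subset : K ⊆ O
  bijOn : BijOn T K K
  transitive : ∀ U V : Set E, IsOpen U → IsOpen V → (U ∩ K).Nonempty → (V ∩ K).Nonempty →
    ∃ n : ℕ, (T^[n] '' (U ∩ K) ∩ V).Nonempty
  periodic_dense : K ⊆ closure {x | x ∈ K ∧ ∃ n : ℕ, 0 < n ∧ T^[n] x = x}
  attracts : ∀ y, (∀ n : ℕ, T^[n] y ∈ O) → Tendsto (fun n : ℕ => infDist (T^[n] y) K) atTop (𝓝 0)
  projection : ∀ x ∈ K, (P x).comp (P x) = P x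
  continuous_splitting : ContinuousOn P K
  invariant_stable : ∀ x ∈ K, ∀ v, P x v = 0 → P (T x) (fderiv ℝ T x v) = 0
  invariant_unstable : ∀ x ∈ K, ∀ v, P x v = v → P (T x) (fderiv ℝ T x v) = fderiv ℝ T x v
  exponent_pos : 0 < θ
  exponent_lt_one : θ < 1
  contracting : ∃ c > 0, ∀ x ∈ K, ∀ n : ℕ,
    (∀ v, P x v = 0 → ‖fderiv ℝ (T^[n]) x v‖ ≤ c * θ ^ n * ‖v‖)
  expanding : ∃ c > 0, ∀ x ∈ K, ∀ n : ℕ,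
    (∀ v, P x v = v → c * (θ ^ n)⁻¹ * ‖v‖ ≤ ‖fderiv ℝ (T^[n]) x v‖)
  finite_dim : ∀ x ∈ K, FiniteDimensional ℝ (LinearMap.range (P x : E →ₗ[ℝ] E))
  finrank_eq : ∀ x ∈ K, Module.finrank ℝ (LinearMap.range (P x : E →ₗ[ℝ] E)) = d

/-- A continuous choice of unit vectors `w x ∈ E^u_x` (one-dimensional unstable spaces) with
`DT(x) w x = δ x • w (T x)`, `δ x > 0`, and `δ_{T^{m-1}(x)} ⋯ δ_x > C₀ lam ^ m` for `m ≥ 1`. -/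
structure IsUnstableDirection {E : Type*} [NormedAddCommGroup E] [NormedSpace ℝ E]
    (T : E → E) (K : Set E) (P : E → E →L[ℝ] E) (w : E → E) (δ : E → ℝ) (C₀ lam : ℝ) : Prop where
  continuousOn : ContinuousOn w K
  norm_eq_one : ∀ x ∈ K, ‖w x‖ = 1
  mem_unstable : ∀ x ∈ K, P x (w x) = w x
  deriv_eq : ∀ x ∈ K, fderiv ℝ T x (w x) = δ x • w (T x)
  δ_pos : ∀ x ∈ K, 0 < δ x
  C₀_pos : 0 < C₀
  one_lt_lam : 1 < lam
  growth : ∀ x ∈ K, ∀ m : ℕ, 0 < m → C₀ * lam ^ m < ∏ j ∈ Finset.range m, δ (T^[j] x)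

/-- The local stable set `W^s_ε(x)` of `T : O → E`. -/
def localStableSet {E : Type*} [NormedAddCommGroup E] (O : Set E) (T : E → E) (ε : ℝ) (x : E) :
    Set E :=
  {y | (∀ n : ℕ, T^[n] y ∈ O) ∧ (∀ n : ℕ, T^[n] y ∈ ball (T^[n] x) ε) ∧
    Tendsto (fun n : ℕ => ‖T^[n] y - T^[n] x‖) atTop (𝓝 0)}

/-- The local unstable set `W^u_ε(x)` of `T : O → E` at `x ∈ K`. Here `p n` is `T^{-n}(x)` for the
homeomorphism `T|K`. -/
def localUnstableSet {E : Type*} [NormedAddCommGroup E] (O : Set E) (T : E → E) (K : Set E)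
    (ε : ℝ) (x : E) : Set E :=
  {y | ∃ p q : ℕ → E, p 0 = x ∧ q 0 = y ∧
    (∀ n, p n ∈ K ∧ T (p (n + 1)) = p n) ∧
    (∀ n, q n ∈ ball (p n) ε ∧ q (n + 1) ∈ O ∧ T (q (n + 1)) = q n) ∧
    Tendsto (fun n => ‖p n - q n‖) atTop (𝓝 0)}

/-! ### Compatibility and robustness -/

/-- A compact inclusion of Banach spaces. -/
structure IsCompactInclusion {X Y : Type*} [NormedAddCommGroup X] [NormedSpace ℝ X]
    [NormedAddCommGroup Y] [NormedSpace ℝ Y] (i : X →L[ℝ] Y) : Prop where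
  injective : Function.Injective i
  compact : IsCompactOperator i

/-- The linear cocycle `L_{T^{n-1}(x)} ∘ ⋯ ∘ L_x`. -/
def linearCocycle {A X : Type*} [NormedAddCommGroup X] [NormedSpace ℝ X]
    (T : A → A) (L : A → X →L[ℝ] X) : ℕ → A → X →L[ℝ] X
  | 0, _ => ContinuousLinearMap.id ℝ X
  | n + 1, x => (L (T^[n] x)).comp (linearCocycle T L n x)

/-- The pair `(X, Y)`, with `A ⊆ X ⊆ Y` through `i` and `j`, is `ρ`-compatible with `(T, K)`.
The operators `LY x` are the extensions to `Y` of `DT(x)`, and `LX x` are their restrictions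
to `X`. -/
def IsCompatible {A X Y : Type*} [NormedAddCommGroup A] [NormedSpace ℝ A]
    [NormedAddCommGroup X] [NormedSpace ℝ X] [NormedAddCommGroup Y] [NormedSpace ℝ Y]
    (i : A →L[ℝ] X) (j : X →L[ℝ] Y) (T : A → A) (K : Set A) (θ lam ρ : ℝ) : Prop :=
  θ < ρ ∧ ρ < lam ∧
  -- compact inclusions
  IsCompactInclusion i ∧ IsCompactInclusion j ∧
  ∃ (LX : A → X →L[ℝ] X) (LY : A → Y →L[ℝ] Y),
    -- bounded extensions, uniformly in `x`
    (∀ x ∈ K, ∀ v : A, LY x (j (i v)) = j (i (fderiv ℝ T x v))) ∧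
    (∀ x ∈ K, ∀ v : X, LY x (j v) = j (LX x v)) ∧
    (∃ M > 0, ∀ x ∈ K, ‖LY x‖ ≤ M ∧ ‖LX x‖ ≤ M) ∧
    -- continuity in `x` as operators from `X` to `Y`
    ContinuousOn (fun x => (LY x).comp j) K ∧
    -- approximation by elements of `A`, and the inequality for an iterate on `X`
    ∃ Δ > 1,
      j '' ball 0 1 ⊆ closure (j '' (ball 0 Δ ∩ range i)) ∧
      ∃ κ > 1, ∃ m : ℕ, 0 < m ∧ ∀ x ∈ K, ∀ v : X,
        ‖linearCocycle T LX m x v‖ ≤ max (ρ ^ m / (2 * (1 + Δ)) * ‖v‖) (κ * ‖j v‖)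

/-- The interior of the set of points of `O` whose iterates `T^i`, `i < m`, stay in `O`. -/
def iterateDomain {X : Type*} [TopologicalSpace X] (O : Set X) (T : X → X) (m : ℕ) : Set X :=
  interior {f | f ∈ O ∧ ∀ i < m, T^[i] f ∈ O}

/-- `T : OA → A` is robust with respect to `(B, C, D)`, the extension being `TB : OB → B`.
The derivative of `T^m` as a map from `B` to `C` at `f` is `fderiv ℝ (fun x => iBC (TB^[m] x)) f`. -/
structure IsRobust {A B C D : Type*} [NormedAddCommGroup A] [NormedSpace ℝ A]
    [NormedAddCommGroup B] [NormedSpace ℝ B] [NormedAddCommGroup C] [NormedSpace ℝ C]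
    [NormedAddCommGroup D] [NormedSpace ℝ D]
    (iAB : A →L[ℝ] B) (iBC : B →L[ℝ] C) (iCD : C →L[ℝ] D)
    (OA : Set A) (T : A → A) (K : Set A) (θ : ℝ) (w : A → A) (C₀ lam : ℝ)
    (OB : Set B) (TB : B → B) : Prop where
  inclusion_AB : IsCompactInclusion iAB
  inclusion_BC : IsCompactInclusion iBC
  inclusion_CD : IsCompactInclusion iCD
  isOpen : IsOpen OB
  image_subset : iAB '' OA ⊆ OB
  mapsTo : ∀ f ∈ OA, TB (iAB f) = iAB (T f)
  compatible : IsCompatible iAB (iCD.comp iBC) T K θ lam 1 ∧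
    ∃ ρC, IsCompatible (iBC.comp iAB) iCD T K θ lam ρC
  smooth : ∀ m : ℕ, 0 < m →
    iAB '' K ⊆ iterateDomain OB TB m ∧
    ContDiffOn ℝ 1 (fun x => iBC (TB^[m] x)) (iterateDomain OB TB m) ∧
    (∃ U, IsOpen U ∧ iAB '' K ⊆ U ∧ U ⊆ iterateDomain OB TB m ∧
      UniformContinuousOn (fderiv ℝ (fun x => iBC (TB^[m] x))) U) ∧
    ∀ f : A, iAB f ∈ iterateDomain OB TB m → ∃ L : D →L[ℝ] D,
      (∀ v : B, L (iCD (iBC v)) = iCD (fderiv ℝ (fun x => iBC (TB^[m] x)) (iAB f) v)) ∧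
      (∀ v : B, ∃ v' : B, L (iCD (iBC v)) = iCD (iBC v')) ∧
      (∀ v : C, ∃ v' : C, L (iCD v) = iCD v')
  lipschitz_unstable : ∀ m : ℕ, 0 < m → ∃ C₁ > (1 : ℝ), ∀ g ∈ K, ∃ V, IsOpen V ∧ V ⊆ iterateDomain OB TB m ∧
    iAB g ∈ V ∧ ∀ f ∈ V,
      ‖fderiv ℝ (fun x => iBC (TB^[m] x)) f (iAB (w g)) -
        fderiv ℝ (fun x => iBC (TB^[m] x)) (iAB g) (iAB (w g))‖ ≤ C₁ * ‖f - iAB g‖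
  remainder : ∃ C₁ > (1 : ℝ), ∃ ρ > (1 : ℝ), ∀ g ∈ K, ∃ V, IsOpen V ∧ V ⊆ OB ∧ iAB g ∈ V ∧
    ∀ f₁ ∈ V, ∀ f₂ ∈ V,
      ‖iBC (TB f₁) - iBC (TB f₂) - fderiv ℝ (fun x => iBC (TB x)) f₂ (f₁ - f₂)‖ ≤
        C₁ * ‖iBC (f₁ - f₂)‖ ^ ρ
  /-- The operator norm in `C` of `DT^m(f) - DT^m(g)`, which is defined on `B`, is its norm with
  respect to the norm of `C`. In the last estimate `v'` is the vector `DT^m(g) v` of `B`. -/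
  approximation : ∃ ν : ℕ → ℝ, (∀ m, 0 < m → 0 < ν m) ∧
    (∃ C₂ : ℕ → ℝ,
      (∀ m, 0 < m → 0 < C₂ m ∧ ∀ g ∈ K, ∀ f ∈ iterateDomain OB TB m, ‖f - iAB g‖ < ν m →
        ∀ v : B, ‖fderiv ℝ (fun x => iBC (TB^[m] x)) f v -
          fderiv ℝ (fun x => iBC (TB^[m] x)) (iAB g) v‖ ≤ C₂ m * lam ^ m * ‖iBC v‖) ∧
      ∃ m₀ > 0, ∀ m > m₀, C₂ m < C₀ / 8) ∧
    (∃ C₃ : ℕ → ℝ,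
      (∀ m, 0 < m → 0 < C₃ m ∧ ∀ g ∈ K, ∀ f : A, ‖f - g‖ < ν m → ∀ v : B, ‖v‖ < ν m →
        iAB f ∈ iterateDomain OB TB m → iAB f + v ∈ iterateDomain OB TB m →
        ∃ v' : B, iBC v' = fderiv ℝ (fun x => iBC (TB^[m] x)) (iAB g) v ∧
          ‖TB^[m] (iAB f + v) - TB^[m] (iAB f) - v'‖ ≤ C₃ m * ‖v‖) ∧
      ∃ m₀ > 0, ∀ m > m₀, C₃ m < 1 / 4)

/-! ### Symbolic dynamics and bounded geometry -/

/-- The two-sided shift. -/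
def shiftMap {S : Type*} (x : ℤ → S) : ℤ → S := fun i => x (i + 1)

/-- A two-sided shift of finite type over the alphabet `S`: the sequences all of whose words of
a given length `N` are allowed. The full shift is `univ`. -/
def IsShiftOfFiniteType {S : Type*} (X : Set (ℤ → S)) : Prop :=
  ∃ (N : ℕ) (allowed : Set (Fin N → S)),
    X = {x | ∀ i : ℤ, (fun k : Fin N => x (i + ((k : ℕ) : ℤ))) ∈ allowed}

/-- `H` conjugates the shift on `X` to the restriction of `T` to `K`. -/
def IsShiftConjugacy {S A : Type*} [TopologicalSpace S] [TopologicalSpace A] {X : Set (ℤ → S)}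
    {K : Set A} (H : X ≃ₜ K) (T : A → A) : Prop :=
  ∀ x y : X, (y : ℤ → S) = shiftMap (x : ℤ → S) → (H y : A) = T (H x : A)

/-- The sequences of `X` which agree with `s` at all places `j ≤ k`. -/
def pastCylinder {S : Type*} {X : Set (ℤ → S)} (s : X) (k : ℕ) : Set X :=
  {x | ∀ j : ℤ, j ≤ (k : ℤ) → (x : ℤ → S) j = (s : ℤ → S) j}

/-- The collection `C_k` of the intervals of level `k` in the parameter line of a curve
`u : [a, b] → A`: the smallest intervals whose images contain the nonempty sets
`H(Σ) ∩ closure W`, where `Σ` runs through the cylinders fixing the places `j ≤ k`. -/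
def levelIntervals {S A : Type*} [TopologicalSpace S] [TopologicalSpace A] {X : Set (ℤ → S)}
    {K : Set A} (H : X ≃ₜ K) (W : Set A) (a b : ℝ) (u : ℝ → A) (k : ℕ) : Set (Set ℝ) :=
  {Δ | ∃ s : X, ∃ Q : Set ℝ,
    Q = {t | t ∈ Icc a b ∧ u t ∈ closure W ∧ ∃ x ∈ pastCylinder s k, (H x : A) = u t} ∧
    Q.Nonempty ∧ Δ = convexHull ℝ Q}

/-- Geometry bounded by `τ` with respect to a sequence of collections of intervals. The length of
an interval is its diameter. -/
def HasGeometryBoundedBy (𝒞 : ℕ → Set (Set ℝ)) (τ : ℝ) : Prop :=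
  ∀ k : ℕ, 1 ≤ k → ∀ Δ ∈ 𝒞 k,
    (∀ Δ' ∈ 𝒞 (k + 1), Δ' ⊆ Δ → τ < diam Δ' / diam Δ ∧ diam Δ' / diam Δ < 1 - τ) ∧
    (∀ t ∈ Δ \ ⋃₀ 𝒞 (k + 1),
      τ < diam (connectedComponentIn (Δ \ ⋃₀ 𝒞 (k + 1)) t) / diam Δ ∧
      diam (connectedComponentIn (Δ \ ⋃₀ 𝒞 (k + 1)) t) / diam Δ < 1 - τ)

/-- `u g : [a g, b g] → A`, for `g ∈ K`, are `C²` parametrizations of the (closed) local unstable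
manifolds `W^u_η(g)`, with `(u g)'(0) = w g`, varying continuously with `g` in the `C²` sense
near `t = 0`. -/
structure IsUnstableParametrization {A : Type*} [NormedAddCommGroup A] [NormedSpace ℝ A]
    (OA : Set A) (T : A → A) (K : Set A) (w : A → A) (η : ℝ) (a b : A → ℝ) (u : A → ℝ → A) :
    Prop where
  contDiffOn : ∀ g ∈ K, ContDiffOn ℝ 2 (u g) (Icc (a g) (b g))
  injOn : ∀ g ∈ K, InjOn (u g) (Icc (a g) (b g))
  deriv_ne_zero : ∀ g ∈ K, ∀ t ∈ Icc (a g) (b g), derivWithin (u g) (Icc (a g) (b g)) t ≠ 0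
  image_eq : ∀ g ∈ K, u g '' Ioo (a g) (b g) = localUnstableSet OA T K η g
  map_zero : ∀ g ∈ K, u g 0 = g
  deriv_zero : ∀ g ∈ K, deriv (u g) 0 = w g
  continuity : ∃ μ > 0, (∀ g ∈ K, a g < -μ ∧ μ < b g) ∧
    ∀ n ≤ 2, ContinuousOn (fun p : A × ℝ => iteratedDeriv n (u p.1) p.2) (K ×ˢ Icc (-μ) μ)

/-- The local unstable manifolds `W^u_ε(g)` have bounded geometry. -/
def HasBoundedGeometry {S A : Type*} [TopologicalSpace S] [NormedAddCommGroup A]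
    {X : Set (ℤ → S)} {K : Set A} (H : X ≃ₜ K) (OA : Set A) (T : A → A)
    (a b : A → ℝ) (u : A → ℝ → A) (ε : ℝ) : Prop :=
  ∃ α > 0, α < 1 ∧ ∀ g ∈ K,
    HasGeometryBoundedBy (levelIntervals H (localUnstableSet OA T K ε g) (a g) (b g) (u g)) α

/-! ### Transversals and their holonomy -/

section Holonomy

variable {A B : Type*} [NormedAddCommGroup A] [NormedSpace ℝ A] [NormedAddCommGroup B]
  [NormedSpace ℝ B]

/-- The holonomy relation `φ_F(f) = g₀`: the point `g₀` of `K ∩ W^u_ε₀(g)` has the point `f` of `B`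
on its local stable manifold `W^s_ε₀(g₀)` in `B`. -/
def IsHolonomyImage (iAB : A →L[ℝ] B) (OA : Set A) (T : A → A) (K : Set A) (OB : Set B)
    (TB : B → B) (ε₀ : ℝ) (g : A) (f : B) (g₀ : A) : Prop :=
  g₀ ∈ K ∧ g₀ ∈ localUnstableSet OA T K ε₀ g ∧ f ∈ localStableSet OB TB ε₀ (iAB g₀)

/-- `F : [-μ₀, μ₀] → B(g, ε)` is a `C²` (regular, simple) curve which is an ordered transversal to
the stable lamination, formed by the local stable manifolds `W^s_ε₀(g')`, `g' ∈ K`, in `B`. -/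
structure IsOrderedTransversal (iAB : A →L[ℝ] B) (OA : Set A) (T : A → A) (K : Set A) (OB : Set B)
    (TB : B → B) (ε₀ ε : ℝ) (g : A) (μ₀ : ℝ) (F : ℝ → B) : Prop where
  contDiffOn : ContDiffOn ℝ 2 F (Icc (-μ₀) μ₀)
  injOn : InjOn F (Icc (-μ₀) μ₀)
  regular : ∀ r ∈ Icc (-μ₀) μ₀, derivWithin F (Icc (-μ₀) μ₀) r ≠ 0
  mapsTo : MapsTo F (Icc (-μ₀) μ₀) (ball (iAB g) ε)
  /-- The tangent vector of the curve is not tangent to the leaf (of codimension one). -/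
  transversal : ∀ r ∈ Icc (-μ₀) μ₀, ∀ g' ∈ K, F r ∈ localStableSet OB TB ε₀ (iAB g') →
    derivWithin F (Icc (-μ₀) μ₀) r ∉ tangentConeAt ℝ (localStableSet OB TB ε₀ (iAB g')) (F r)
  /-- The holonomy extends to a homeomorphism `Φ` of the compact arc `F([-μ₀, μ₀])` onto its image
  in `W^u_ε₀(g)`, and it takes all the values in `K` of `Φ`. -/
  ordered : ∃ Φ : B → A, ContinuousOn Φ (F '' Icc (-μ₀) μ₀) ∧ InjOn Φ (F '' Icc (-μ₀) μ₀) ∧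
    MapsTo Φ (F '' Icc (-μ₀) μ₀) (localUnstableSet OA T K ε₀ g) ∧
    (∀ r ∈ Icc (-μ₀) μ₀, ∀ g₀, IsHolonomyImage iAB OA T K OB TB ε₀ g (F r) g₀ → Φ (F r) = g₀) ∧
    {g₀ | ∃ r ∈ Icc (-μ₀) μ₀, IsHolonomyImage iAB OA T K OB TB ε₀ g (F r) g₀} =
      Φ '' (F '' Icc (-μ₀) μ₀) ∩ K

/-- `Ψ` is a `C^{1+θ}` diffeomorphism of `[-μ₀, μ₀]` onto its image. -/
structure IsC1HolderDiffeo (θ μ₀ : ℝ) (Ψ : ℝ → ℝ) : Prop where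
  contDiffOn : ContDiffOn ℝ 1 Ψ (Icc (-μ₀) μ₀)
  injOn : InjOn Ψ (Icc (-μ₀) μ₀)
  deriv_ne_zero : ∀ r ∈ Icc (-μ₀) μ₀, derivWithin Ψ (Icc (-μ₀) μ₀) r ≠ 0
  holder : ∃ M : ℝ, ∀ r ∈ Icc (-μ₀) μ₀, ∀ s ∈ Icc (-μ₀) μ₀,
    |derivWithin Ψ (Icc (-μ₀) μ₀) r - derivWithin Ψ (Icc (-μ₀) μ₀) s| ≤ M * |r - s| ^ θ

/-- The holonomy of `F` has a `C^{1+θ}` diffeomorphic extension `Φ : F([-μ₀, μ₀]) → W^u_ε₀(g)`;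
`Ψ` is the expression of `Φ` in the `C²` coordinates `F` and `u : [a, b] → A`. -/
def HolonomyExtendsToC1HolderDiffeo (iAB : A →L[ℝ] B) (OA : Set A) (T : A → A) (K : Set A)
    (OB : Set B) (TB : B → B) (ε₀ : ℝ) (g : A) (a b : ℝ) (u : ℝ → A) (μ₀ : ℝ) (F : ℝ → B)
    (θ : ℝ) : Prop :=
  ∃ Φ : B → A, MapsTo Φ (F '' Icc (-μ₀) μ₀) (localUnstableSet OA T K ε₀ g) ∧
    (∀ r ∈ Icc (-μ₀) μ₀, ∀ g₀, IsHolonomyImage iAB OA T K OB TB ε₀ g (F r) g₀ → Φ (F r) = g₀) ∧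
    ∃ Ψ : ℝ → ℝ, IsC1HolderDiffeo θ μ₀ Ψ ∧
      ∀ r ∈ Icc (-μ₀) μ₀, Ψ r ∈ Ioo a b ∧ Φ (F r) = u (Ψ r)

end Holonomy

/-!
# Holonomies along the stable lamination of a robust operator are `C^{1+θ}`

The extended operator is hyperbolic along the basic set `K` only in a weak sense: its iterates are
differentiable as maps from `B` to `C`, and the derivative at a point `f` near `K` is close to that
at `K` in the norm of `C`, Hölder continuously in `f` on the unstable direction. This is enough for
cone estimates for differences of orbits, whose constants improve with the distance to `K`.

*The splitting.* Compactness of the inclusions and the inequality in the definition of a compatible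
pair show that the unstable coefficient of a vector of `A` extends to a continuous functional `p x`
on the larger spaces, and that the cocycle grows slower on the kernel of `p x`
(`IsCompatible.exists_isDominatedSplitting`). A large iterate of the operator then satisfies all the
estimates collected in `RobustStep` (`IsRobust.nonempty_robustStep`), from which everything else is
deduced.

*Entering the cone.* Let `y = F r₀` be on the stable leaf of a point of `K`. If the images of a
vector `v` under the derivatives of the iterates never enter the unstable cone, they grow slower than
the unstable direction. A point `y + h v + s w` with `s` in a small interval is then pushed away to
one side at one end of the interval and to the other side at the other end; the two open sets of
values of `s` for which the orbit escapes on either side do not cover the connected interval, so that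
there is a point of the leaf near `y + h v`, and `v` is tangent to the leaf
(`RobustStep.exists_expansion`). Hence a transversal vector enters the cone.

*Comparison of ratios.* Let `r₁`, `r₂`, `r₃` be parameters near `r₀` at which `F` meets the leaves of
points `γ r₁`, `γ r₂`, `γ r₃` of the unstable manifold. The differences `F r₂ - F r₁` and
`γ r₂ - γ r₁` are in the cone, grow exponentially, and separate after a time `N` that is
logarithmic in the distance. The ratio of the differences for the pairs `(r₁, r₂)` and `(r₁, r₃)` is
nearly constant in time on each of the two curves (`RobustStep.exists_deviation`), and at a time
which is a fixed fraction of `N` before the separation the two curves are so close that the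
differences on them agree (`RobustStep.exists_agreement`). Therefore the difference quotients of the
holonomy in the parameters of the curves vary in a Hölder continuous way
(`RobustStep.exists_ratio_comparison`, `RobustStep.HolonomyGerm.exists_slope_comparison`).

*Extension.* A monotone function on a compact subset of the line whose difference quotients vary in
this way has a jet of order one, and an extension by polynomials to the gaps, in the manner of
Whitney, is a `C^{1+θ}` diffeomorphism (`exists_diffeo_extension`). Monotonicity is provided by the
homeomorphic extension of the holonomy of an ordered transversal.
-/

/-! ### Linear cocycles over the hyperbolic set -/

section Cocycle

variable {A X : Type*} [NormedAddCommGroup X] [NormedSpace ℝ X]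

theorem linearCocycle_add (T : A → A) (L : A → X →L[ℝ] X) (n k : ℕ) (x : A) :
    linearCocycle T L (n + k) x =
      (linearCocycle T L n (T^[k] x)).comp (linearCocycle T L k x) := by
  induction n with
  | zero => ext v; simp [linearCocycle]
  | succ n ih =>
    rw [Nat.succ_add]
    simp only [linearCocycle]
    rw [ih, Function.iterate_add_apply]
    rfl

theorem norm_linearCocycle_le {T : A → A} {L : A → X →L[ℝ] X} {K : Set A} (hT : MapsTo T K K)
    {M : ℝ} (hM : 1 ≤ M) (hL : ∀ x ∈ K, ‖L x‖ ≤ M) (n : ℕ) {x : A} (hx : x ∈ K) :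
    ‖linearCocycle T L n x‖ ≤ M ^ n := by
  induction n with
  | zero => simpa [linearCocycle] using ContinuousLinearMap.norm_id_le
  | succ n ih =>
    simp only [linearCocycle]
    refine (ContinuousLinearMap.opNorm_comp_le _ _).trans ?_
    rw [pow_succ']
    exact mul_le_mul (hL _ (hT.iterate n hx)) ih (norm_nonneg _) (by linarith)

/-- A cocycle of extensions acts on the subspace by the cocycle that it extends. -/
theorem linearCocycle_map {Y : Type*} [NormedAddCommGroup Y] [NormedSpace ℝ Y]
    {T : A → A} {L : A → X →L[ℝ] X} {L' : A → Y →L[ℝ] Y} {K : Set A} (hT : MapsTo T K K)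
    (i : X →L[ℝ] Y) (h : ∀ x ∈ K, ∀ v, L' x (i v) = i (L x v)) (n : ℕ) {x : A} (hx : x ∈ K)
    (v : X) : linearCocycle T L' n x (i v) = i (linearCocycle T L n x v) := by
  induction n with
  | zero => simp [linearCocycle]
  | succ n ih =>
    simp only [linearCocycle, ContinuousLinearMap.comp_apply]
    rw [ih, h _ (hT.iterate n hx)]

end Cocycle

/-- The expansion of `T^n` along the unstable direction: the product of `δ` along an orbit. -/
def unstableGrowth {A : Type*} (T : A → A) (δ : A → ℝ) (n : ℕ) (x : A) : ℝ :=
  ∏ j ∈ Finset.range n, δ (T^[j] x)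

theorem unstableGrowth_add {A : Type*} (T : A → A) (δ : A → ℝ) (n k : ℕ) (x : A) :
    unstableGrowth T δ (n + k) x = unstableGrowth T δ k x * unstableGrowth T δ n (T^[k] x) := by
  unfold unstableGrowth
  rw [add_comm n k, Finset.prod_range_add]
  congr 1
  refine Finset.prod_congr rfl fun j _ => ?_
  rw [← Function.iterate_add_apply, add_comm]

section Hyperbolic

variable {A : Type*} [NormedAddCommGroup A] [NormedSpace ℝ A]
  {OA : Set A} {T : A → A} {K : Set A} {P : A → A →L[ℝ] A} {θ : ℝ}
  {w : A → A} {δ : A → ℝ} {C₀ lam : ℝ}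

theorem IsHyperbolicBasicSet.mapsTo (hK : IsHyperbolicBasicSet OA T K P θ 1) : MapsTo T K K :=
  hK.bijOn.mapsTo

theorem IsHyperbolicBasicSet.iterate_mem (hK : IsHyperbolicBasicSet OA T K P θ 1) (n : ℕ) {x : A}
    (hx : x ∈ K) : T^[n] x ∈ K := hK.mapsTo.iterate n hx

theorem IsHyperbolicBasicSet.contDiffAt (hK : IsHyperbolicBasicSet OA T K P θ 1)
    (hOA : IsOpen OA) (hT : ContDiffOn ℝ 2 T OA) {x : A} (hx : x ∈ K) : ContDiffAt ℝ 2 T x :=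
  hT.contDiffAt (hOA.mem_nhds (hK.subset hx))

theorem IsHyperbolicBasicSet.hasFDerivAt_iterate (hK : IsHyperbolicBasicSet OA T K P θ 1)
    (hOA : IsOpen OA) (hT : ContDiffOn ℝ 2 T OA) (n : ℕ) {x : A} (hx : x ∈ K) :
    HasFDerivAt (T^[n]) (linearCocycle T (fderiv ℝ T) n x) x := by
  induction n with
  | zero => simpa [linearCocycle] using hasFDerivAt_id x
  | succ n ih =>
    rw [Function.iterate_succ']
    have h := ((hK.contDiffAt hOA hT (hK.iterate_mem n hx)).differentiableAt
      (by norm_num)).hasFDerivAt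
    exact h.comp x ih

theorem IsHyperbolicBasicSet.fderiv_iterate (hK : IsHyperbolicBasicSet OA T K P θ 1)
    (hOA : IsOpen OA) (hT : ContDiffOn ℝ 2 T OA) (n : ℕ) {x : A} (hx : x ∈ K) :
    fderiv ℝ (T^[n]) x = linearCocycle T (fderiv ℝ T) n x :=
  (hK.hasFDerivAt_iterate hOA hT n hx).fderiv

theorem IsHyperbolicBasicSet.exists_projection_eq_smul (hK : IsHyperbolicBasicSet OA T K P θ 1)
    (hw : IsUnstableDirection T K P w δ C₀ lam) {x : A} (hx : x ∈ K) (v : A) :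
    ∃ t : ℝ, P x v = t • w x := by
  have h1 := hK.finrank_eq x hx
  let w' : LinearMap.range (P x : A →ₗ[ℝ] A) := ⟨w x, ⟨w x, hw.mem_unstable x hx⟩⟩
  have hw' : w' ≠ 0 := by
    intro h
    have : w x = 0 := congrArg Subtype.val h
    have h2 := hw.norm_eq_one x hx
    rw [this, norm_zero] at h2
    exact zero_ne_one h2
  obtain ⟨c, hc⟩ := (finrank_eq_one_iff_of_nonzero' w' hw').1 h1 ⟨P x v, ⟨v, rfl⟩⟩
  exact ⟨c, (congrArg Subtype.val hc).symm⟩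

theorem IsUnstableDirection.growth_pos (hK : IsHyperbolicBasicSet OA T K P θ 1)
    (hw : IsUnstableDirection T K P w δ C₀ lam) (n : ℕ) {x : A} (hx : x ∈ K) :
    0 < unstableGrowth T δ n x :=
  Finset.prod_pos fun j _ => hw.δ_pos _ (hK.iterate_mem j hx)

theorem IsUnstableDirection.lt_growth
    (hw : IsUnstableDirection T K P w δ C₀ lam) {n : ℕ} (hn : 0 < n) {x : A} (hx : x ∈ K) :
    C₀ * lam ^ n < unstableGrowth T δ n x := hw.growth x hx n hn

theorem IsUnstableDirection.min_growth
    (hw : IsUnstableDirection T K P w δ C₀ lam) (n : ℕ) {x : A} (hx : x ∈ K) :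
    min C₀ 1 * lam ^ n ≤ unstableGrowth T δ n x := by
  rcases Nat.eq_zero_or_pos n with rfl | hn
  · simp [unstableGrowth]
  · refine le_trans ?_ (hw.lt_growth hn hx).le
    have := hw.one_lt_lam
    gcongr
    exact min_le_left _ _

theorem IsUnstableDirection.linearCocycle_apply (hK : IsHyperbolicBasicSet OA T K P θ 1)
    (hw : IsUnstableDirection T K P w δ C₀ lam) (n : ℕ) {x : A} (hx : x ∈ K) :
    linearCocycle T (fderiv ℝ T) n x (w x) = unstableGrowth T δ n x • w (T^[n] x) := by
  induction n with
  | zero => simp [linearCocycle, unstableGrowth]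
  | succ n ih =>
    simp only [linearCocycle, ContinuousLinearMap.comp_apply]
    rw [ih, map_smul, hw.deriv_eq _ (hK.iterate_mem n hx), smul_smul,
      Function.iterate_succ_apply', unstableGrowth, unstableGrowth, Finset.prod_range_succ]

theorem IsHyperbolicBasicSet.exists_bound_projection (hK : IsHyperbolicBasicSet OA T K P θ 1) :
    ∃ Q ≥ 1, ∀ x ∈ K, ‖P x‖ ≤ Q := by
  obtain ⟨Q, hQ⟩ := hK.isCompact.exists_bound_of_continuousOn hK.continuous_splitting
  exact ⟨max Q 1, le_max_right _ _, fun x hx => (hQ x hx).trans (le_max_left _ _)⟩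

/-- By compactness the unit vectors `w x` keep a definite size in a larger space. -/
theorem IsUnstableDirection.exists_lower_bound {X : Type*} [NormedAddCommGroup X]
    [NormedSpace ℝ X] (hK : IsHyperbolicBasicSet OA T K P θ 1)
    (hw : IsUnstableDirection T K P w δ C₀ lam) (i : A →L[ℝ] X) (hi : Function.Injective i) :
    ∃ c > 0, ∀ x ∈ K, c ≤ ‖i (w x)‖ := by
  rcases K.eq_empty_or_nonempty with h | h
  · exact ⟨1, one_pos, by simp [h]⟩
  have hc : ContinuousOn (fun x => ‖i (w x)‖) K :=
    (i.continuous.comp_continuousOn hw.continuousOn).norm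
  obtain ⟨x, hx, hmin⟩ := hK.isCompact.exists_isMinOn h hc
  refine ⟨‖i (w x)‖, ?_, fun y hy => hmin hy⟩
  rw [gt_iff_lt, norm_pos_iff]
  intro h0
  have h1 : w x = 0 := hi (by rw [h0, map_zero])
  have h2 := hw.norm_eq_one x hx
  rw [h1, norm_zero] at h2
  exact zero_ne_one h2

end Hyperbolic

/-! ### The dominated splitting in a compatible pair of spaces -/

section Splitting

variable {A X Y : Type*} [NormedAddCommGroup A] [NormedSpace ℝ A]
  [NormedAddCommGroup X] [NormedSpace ℝ X] [NormedAddCommGroup Y] [NormedSpace ℝ Y]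
  {OA : Set A} {T : A → A} {K : Set A} {P : A → A →L[ℝ] A} {θ : ℝ}
  {w : A → A} {δ : A → ℝ} {C₀ lam : ℝ}

/-- The unit ball of `X`, being relatively compact in `Y`, is approximated within `e` in the norm
of `Y` by a bounded set of elements of `A`. -/
theorem exists_bounded_net {i : A →L[ℝ] X} {j : X →L[ℝ] Y} (hj : IsCompactOperator j) {Δ : ℝ}
    (hΔ : j '' ball 0 1 ⊆ closure (j '' (ball 0 Δ ∩ range i))) {e : ℝ} (he : 0 < e) :
    ∃ R > 0, ∀ v : X, ‖v‖ < 1 → ∃ α : A, ‖α‖ ≤ R ∧ ‖i α‖ < Δ ∧ ‖j v - j (i α)‖ < e := by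
  have htb : TotallyBounded (j '' ball (0 : X) 1) :=
    (hj.isCompact_closure_image_ball (f := (j : X →ₗ[ℝ] Y)) 1).totallyBounded.subset
      subset_closure
  obtain ⟨t, hts, htf, hcov⟩ := Metric.finite_approx_of_totallyBounded htb (e / 2) (half_pos he)
  have h1 : ∀ y ∈ t, ∃ α : A, ‖i α‖ < Δ ∧ ‖y - j (i α)‖ < e / 2 := by
    intro y hy
    obtain ⟨_, ⟨_, ⟨hb, ⟨α, rfl⟩⟩, rfl⟩, hd⟩ :=
      Metric.mem_closure_iff.1 (hΔ (hts hy)) (e / 2) (half_pos he)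
    exact ⟨α, by simpa using hb, by rwa [dist_eq_norm] at hd⟩
  choose! f hf using h1
  obtain ⟨R, hR⟩ := (htf.image fun y => ‖f y‖).bddAbove
  refine ⟨max R 1, by positivity, fun v hv => ?_⟩
  obtain ⟨y, hy, hvy⟩ := mem_iUnion₂.1 (hcov ⟨v, by simpa using hv, rfl⟩)
  refine ⟨f y, (hR ⟨y, hy, rfl⟩).trans (le_max_left _ _), (hf y hy).1, ?_⟩
  have h2 := (hf y hy).2
  rw [mem_ball, dist_eq_norm] at hvy
  calc ‖j v - j (i (f y))‖ = ‖(j v - y) + (y - j (i (f y)))‖ := by congr 1; abel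
    _ ≤ ‖j v - y‖ + ‖y - j (i (f y))‖ := norm_add_le _ _
    _ < e := by linarith

/-- The greedy approximation: over one block of iterates every `v` of `X` is approximated by
elements of `A`, of comparable size, with an error that grows strictly slower than `ρ ^ m`. -/
theorem exists_greedy_step {i : A →L[ℝ] X} {j : X →L[ℝ] Y} (hj : IsCompactOperator j) {Δ ρ κ : ℝ}
    (hΔ1 : 1 < Δ) (hρ : 0 < ρ) (hκ : 1 < κ) {L : A → X →L[ℝ] X} {m : ℕ}
    (hΔ : j '' ball 0 1 ⊆ closure (j '' (ball 0 Δ ∩ range i)))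
    (hL : ∀ x ∈ K, ∀ v : X,
      ‖linearCocycle T L m x v‖ ≤ max (ρ ^ m / (2 * (1 + Δ)) * ‖v‖) (κ * ‖j v‖)) :
    ∃ R > 0, ∀ x ∈ K, ∀ v : X, ∀ b : ℝ, ‖v‖ < b →
      ∃ α : A, ‖α‖ ≤ R * b ∧ ‖linearCocycle T L m x (v - i α)‖ < 3 / 4 * ρ ^ m * b := by
  have hρm : 0 < ρ ^ m := by positivity
  -- with the accuracy `ρ ^ m / (2 * κ)` both terms of the maximum are at most `ρ ^ m / 2`
  obtain ⟨R, hR, h⟩ := exists_bounded_net hj hΔ (e := ρ ^ m / (2 * κ)) (by positivity)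
  refine ⟨R, hR, fun x hx v b hb => ?_⟩
  have hb0 : 0 < b := (norm_nonneg v).trans_lt hb
  obtain ⟨α, h1, h2, h3⟩ := h (b⁻¹ • v) (by
    rw [norm_smul, norm_inv, Real.norm_of_nonneg hb0.le, inv_mul_lt_iff₀ hb0]; simpa using hb)
  have hvb : b • (b⁻¹ • v - i α) = v - i (b • α) := by
    rw [smul_sub, smul_smul, mul_inv_cancel₀ hb0.ne', one_smul, map_smul]
  refine ⟨b • α, ?_, ?_⟩
  · rw [norm_smul, Real.norm_of_nonneg hb0.le, mul_comm]
    gcongr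
  · rw [← hvb, map_smul, norm_smul, Real.norm_of_nonneg hb0.le, mul_comm]
    gcongr
    refine (hL x hx _).trans_lt (max_lt ?_ ?_)
    · have h4 : ‖b⁻¹ • v - i α‖ ≤ 1 + Δ := by
        refine (norm_sub_le _ _).trans (add_le_add ?_ h2.le)
        rw [norm_smul, norm_inv, Real.norm_of_nonneg hb0.le, inv_mul_le_iff₀ hb0]
        simpa using hb.le
      calc ρ ^ m / (2 * (1 + Δ)) * ‖b⁻¹ • v - i α‖ ≤ ρ ^ m / (2 * (1 + Δ)) * (1 + Δ) := by gcongr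
        _ = ρ ^ m / 2 := by field_simp
        _ < _ := by linarith
    · rw [map_sub]
      calc κ * ‖j (b⁻¹ • v) - j (i α)‖ ≤ κ * (ρ ^ m / (2 * κ)) := by gcongr
        _ = ρ ^ m / 2 := by field_simp
        _ < _ := by linarith

theorem exists_nat_mul_pow_le {μ ν : ℝ} (hμ : 0 < μ) (hμν : μ < ν) :
    ∃ C > 0, ∀ k : ℕ, (k : ℝ) * μ ^ k ≤ C * ν ^ k := by
  have hν : 0 < ν := hμ.trans hμν
  have h := tendsto_self_mul_const_pow_of_lt_one (r := μ / ν) (by positivity)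
    ((div_lt_one hν).2 hμν)
  obtain ⟨C, hC⟩ := h.bddAbove_range
  refine ⟨max C 1, by positivity, fun k => ?_⟩
  have h1 : (k : ℝ) * (μ / ν) ^ k ≤ C := hC ⟨k, rfl⟩
  rw [div_pow, mul_div_assoc', div_le_iff₀ (by positivity)] at h1
  exact h1.trans (by gcongr; exact le_max_left _ _)

/-- Existence of the unstable coefficient `t` of a vector `v` of `X`: the greedy approximations of
`v` by elements of `A` are decomposed along the splitting of `A`; their unstable parts add up to
`t`, and what remains grows slower than `ρ ^ n`. -/
theorem exists_unstable_coefficient (hK : IsHyperbolicBasicSet OA T K P θ 1)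
    (hOA : IsOpen OA) (hT : ContDiffOn ℝ 2 T OA)
    (hw : IsUnstableDirection T K P w δ C₀ lam) (i : A →L[ℝ] X) {L : A → X →L[ℝ] X}
    (hLi : ∀ x ∈ K, ∀ v, L x (i v) = i (fderiv ℝ T x v)) {m : ℕ} {R ϑ ν : ℝ}
    (hR : 0 < R) (hϑ : 0 < ϑ) (hϑl : ϑ < lam ^ m) (hϑν : ϑ < ν) (hθν : θ ^ m < ν)
    (hstep : ∀ x ∈ K, ∀ v : X, ∀ b : ℝ, ‖v‖ < b →
      ∃ α : A, ‖α‖ ≤ R * b ∧ ‖linearCocycle T L m x (v - i α)‖ < ϑ * b) :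
    ∃ C > 0, ∀ x ∈ K, ∀ v : X, ∀ b : ℝ, ‖v‖ < b → ∃ t : ℝ, ∀ k : ℕ,
      ‖linearCocycle T L (m * k) x (v - t • i (w x))‖ ≤ C * ν ^ k * b := by
  obtain ⟨Q, hQ1, hQ⟩ := hK.exists_bound_projection
  obtain ⟨c, hc, hcontr⟩ := hK.contracting
  have hC0 : 0 < min C₀ 1 := lt_min hw.C₀_pos one_pos
  have hl := hw.one_lt_lam
  have hlm : 0 < lam ^ m := by positivity
  have hν : 0 < ν := hϑ.trans hϑν
  have hθ := hK.exponent_pos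
  set q : ℝ := ϑ / lam ^ m with hq
  have hq0 : 0 < q := by positivity
  have hq1 : q < 1 := (div_lt_one hlm).2 hϑl
  set μ : ℝ := max (θ ^ m) ϑ with hμ
  have hμ0 : 0 < μ := lt_max_of_lt_right hϑ
  obtain ⟨E, hE, hEk⟩ := exists_nat_mul_pow_le hμ0 (max_lt hθν hϑν)
  refine ⟨1 + Q * R / min C₀ 1 * (1 - q)⁻¹ * ‖i‖ + ‖i‖ * c * ((1 + Q) * R) * E, ?_, ?_⟩
  · have : 0 < 1 - q := by linarith
    positivity
  intro x hx v b hb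
  have hb0 : 0 < b := (norm_nonneg v).trans_lt hb
  choose! f hf using hstep
  -- the greedy sequence
  let V : ℕ → X := fun k => Nat.rec v
    (fun k u => linearCocycle T L m (T^[m * k] x) (u - i (f (T^[m * k] x) u (ϑ ^ k * b)))) k
  let α : ℕ → A := fun k => f (T^[m * k] x) (V k) (ϑ ^ k * b)
  have hxk : ∀ k, T^[m * k] x ∈ K := fun k => hK.iterate_mem _ hx
  have hVs : ∀ k, V (k + 1) = linearCocycle T L m (T^[m * k] x) (V k - i (α k)) := fun k => rfl
  have hV : ∀ k, ‖V k‖ < ϑ ^ k * b := by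
    intro k
    induction k with
    | zero => simpa [V] using hb
    | succ k ih =>
      have := (hf _ (hxk k) (V k) _ ih).2
      rw [hVs, pow_succ', mul_assoc]
      exact this
  have hα : ∀ k, ‖α k‖ ≤ R * (ϑ ^ k * b) := fun k => (hf _ (hxk k) (V k) _ (hV k)).1
  choose t ht using fun k => hK.exists_projection_eq_smul hw (hxk k) (α k)
  have htb : ∀ k, |t k| ≤ Q * R * b * ϑ ^ k := by
    intro k
    have h1 : ‖P (T^[m * k] x) (α k)‖ = |t k| := by
      rw [ht k, norm_smul, hw.norm_eq_one _ (hxk k), mul_one, Real.norm_eq_abs]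
    rw [← h1]
    calc _ ≤ ‖P (T^[m * k] x)‖ * ‖α k‖ := ContinuousLinearMap.le_opNorm _ _
      _ ≤ Q * (R * (ϑ ^ k * b)) := by gcongr; exacts [hQ _ (hxk k), hα k]
      _ = _ := by ring
  -- the tails of the series of the unstable parts
  let g : ℕ → ℕ → ℝ := fun k l => t (k + l) / unstableGrowth T δ (m * l) (T^[m * k] x)
  have hgb : ∀ k l, ‖g k l‖ ≤ Q * R / min C₀ 1 * (ϑ ^ k * b) * q ^ l := by
    intro k l
    have h1 := hw.min_growth (m * l) (hxk k)
    have h2 : 0 < min C₀ 1 * lam ^ (m * l) := by positivity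
    simp only [g]
    rw [norm_div, Real.norm_eq_abs, Real.norm_of_nonneg (h2.le.trans h1),
      div_le_iff₀ (h2.trans_le h1)]
    calc |t (k + l)| ≤ Q * R * b * ϑ ^ (k + l) := htb _
      _ = Q * R / min C₀ 1 * (ϑ ^ k * b) * q ^ l * (min C₀ 1 * lam ^ (m * l)) := by
        rw [hq, div_pow, pow_mul, pow_add]; field_simp
      _ ≤ _ := by gcongr
  have hgs : ∀ k, Summable (g k) := fun k => Summable.of_norm_bounded
    ((summable_geometric_of_lt_one hq0.le hq1).mul_left _) (hgb k)
  let τ : ℕ → ℝ := fun k => ∑' l, g k l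
  have hτb : ∀ k, ‖τ k‖ ≤ Q * R / min C₀ 1 * (1 - q)⁻¹ * (ϑ ^ k * b) := by
    intro k
    refine (tsum_of_norm_bounded ((hasSum_geometric_of_lt_one hq0.le hq1).mul_left _)
      (hgb k)).trans_eq (by ring)
  have hτs : ∀ k, (t k - τ k) * unstableGrowth T δ m (T^[m * k] x) = - τ (k + 1) := by
    intro k
    have h1 := (hgs k).tsum_eq_zero_add
    have h0 : g k 0 = t k := by simp [g, unstableGrowth]
    have hpos := hw.growth_pos hK m (hxk k)
    have h2 : ∀ l, g k (l + 1) = g (k + 1) l / unstableGrowth T δ m (T^[m * k] x) := by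
      intro l
      simp only [g]
      rw [Nat.mul_succ, unstableGrowth_add, ← Function.iterate_add_apply, div_div,
        mul_comm (unstableGrowth T δ m _), Nat.mul_succ, add_comm (m * k) m]
      congr 2
      ring
    simp only [h2, h0, tsum_div_const] at h1
    change τ k = t k + τ (k + 1) / _ at h1
    rw [h1]
    field_simp
    ring
  let s : ℕ → A := fun k => α k - t k • w (T^[m * k] x)
  have hs0 : ∀ k, P (T^[m * k] x) (s k) = 0 := by
    intro k
    simp only [s]
    rw [map_sub, map_smul, hw.mem_unstable _ (hxk k), ht, sub_self]
  have hsb : ∀ k, ‖s k‖ ≤ (1 + Q) * R * (ϑ ^ k * b) := by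
    intro k
    simp only [s]
    refine (norm_sub_le _ _).trans ?_
    rw [norm_smul, hw.norm_eq_one _ (hxk k), mul_one, Real.norm_eq_abs]
    calc _ ≤ R * (ϑ ^ k * b) + Q * R * b * ϑ ^ k := add_le_add (hα k) (htb k)
      _ = _ := by ring
  let σ : ℕ → A := fun k => ∑ l ∈ Finset.range k,
    linearCocycle T (fderiv ℝ T) (m * (k - l)) (T^[m * l] x) (s l)
  have hLi' : ∀ n, ∀ y ∈ K, ∀ u, linearCocycle T L n y (i u) =
      i (linearCocycle T (fderiv ℝ T) n y u) :=
    fun n y hy u => linearCocycle_map hK.mapsTo i hLi n hy u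
  have key : ∀ k, linearCocycle T L (m * k) x (v - τ 0 • i (w x)) =
      V k - τ k • i (w (T^[m * k] x)) + i (σ k) := by
    intro k
    induction k with
    | zero => simp [linearCocycle, V, σ]
    | succ k ih =>
      have e1 : linearCocycle T L (m * (k + 1)) x =
          (linearCocycle T L m (T^[m * k] x)).comp (linearCocycle T L (m * k) x) := by
        rw [← linearCocycle_add, Nat.mul_succ, add_comm]
      have e2 : σ (k + 1) = linearCocycle T (fderiv ℝ T) m (T^[m * k] x) (σ k) +
          linearCocycle T (fderiv ℝ T) m (T^[m * k] x) (s k) := by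
        simp only [σ]
        rw [Finset.sum_range_succ, map_sum]
        congr 1
        · refine Finset.sum_congr rfl fun l hl => ?_
          have hl' := Finset.mem_range.1 hl
          have e3 : m * (k + 1 - l) = m + m * (k - l) := by
            rw [Nat.succ_sub hl'.le, Nat.mul_succ, add_comm]
          rw [e3, linearCocycle_add, ContinuousLinearMap.comp_apply, ← Function.iterate_add_apply,
            ← Nat.mul_add, Nat.sub_add_cancel hl'.le]
        · simp
      rw [e1, ContinuousLinearMap.comp_apply, ih, e2, hVs]
      have e4 : T^[m * (k + 1)] x = T^[m] (T^[m * k] x) := by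
        rw [← Function.iterate_add_apply, Nat.mul_succ, add_comm]
      have e5 : V k = (V k - i (α k)) + t k • i (w (T^[m * k] x)) + i (s k) := by
        simp only [s, map_sub, map_smul]; abel
      have e6 : linearCocycle T L m (T^[m * k] x) (i (w (T^[m * k] x))) =
          unstableGrowth T δ m (T^[m * k] x) • i (w (T^[m * (k + 1)] x)) := by
        rw [hLi' _ _ (hxk k), hw.linearCocycle_apply hK m (hxk k), map_smul, e4]
      have e7 : τ (k + 1) = - ((t k - τ k) * unstableGrowth T δ m (T^[m * k] x)) := by
        rw [hτs]; ring
      conv_lhs => rw [e5]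
      simp only [map_add, map_sub, map_smul, e6, hLi' m _ (hxk k), e7]
      module
  refine ⟨τ 0, fun k => ?_⟩
  rw [key]
  have hσ : ‖σ k‖ ≤ c * ((1 + Q) * R) * b * (k * μ ^ k) := by
    have h1 : ∀ l ∈ Finset.range k,
        ‖linearCocycle T (fderiv ℝ T) (m * (k - l)) (T^[m * l] x) (s l)‖ ≤
          c * ((1 + Q) * R) * b * μ ^ k := by
      intro l hl
      have hl' := (Finset.mem_range.1 hl).le
      have h2 := hcontr _ (hxk l) (m * (k - l)) (s l) (hs0 l)
      rw [hK.fderiv_iterate hOA hT _ (hxk l)] at h2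
      calc _ ≤ c * θ ^ (m * (k - l)) * ‖s l‖ := h2
        _ ≤ c * μ ^ (k - l) * ((1 + Q) * R * (μ ^ l * b)) := by
          rw [pow_mul]
          gcongr
          · exact le_max_left _ _
          · refine (hsb l).trans ?_
            gcongr
            exact le_max_right _ _
        _ = c * ((1 + Q) * R) * b * (μ ^ (k - l) * μ ^ l) := by ring
        _ = _ := by rw [← pow_add, Nat.sub_add_cancel hl']
    refine (norm_sum_le_of_le _ h1).trans_eq ?_
    rw [Finset.sum_const, Finset.card_range, nsmul_eq_mul]; ring
  have hϑk : ϑ ^ k ≤ ν ^ k := by gcongr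
  have hiw : ‖i (w (T^[m * k] x))‖ ≤ ‖i‖ := by
    simpa [hw.norm_eq_one _ (hxk k)] using i.le_opNorm (w (T^[m * k] x))
  have hq2 : 0 < 1 - q := by linarith
  calc _ ≤ ‖V k‖ + ‖τ k‖ * ‖i (w (T^[m * k] x))‖ + ‖i (σ k)‖ := by
        refine (norm_add_le _ _).trans ?_
        gcongr
        exact (norm_sub_le _ _).trans (by rw [norm_smul])
    _ ≤ ν ^ k * b + Q * R / min C₀ 1 * (1 - q)⁻¹ * (ν ^ k * b) * ‖i‖ +
        ‖i‖ * (c * ((1 + Q) * R) * b * (E * ν ^ k)) := by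
      gcongr
      · exact (hV k).le.trans (by gcongr)
      · exact (hτb k).trans (by gcongr)
      · refine (i.le_opNorm _).trans ?_
        gcongr
        exact hσ.trans (mul_le_mul_of_nonneg_left (hEk k) (by positivity))
    _ = _ := by ring

end Splitting

section Functional

variable {A X Y : Type*} [NormedAddCommGroup A] [NormedSpace ℝ A]
  [NormedAddCommGroup X] [NormedSpace ℝ X] [NormedAddCommGroup Y] [NormedSpace ℝ Y]
  {OA : Set A} {T : A → A} {K : Set A} {P : A → A →L[ℝ] A} {θ : ℝ}
  {w : A → A} {δ : A → ℝ} {C₀ lam : ℝ}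

/-- A multiple of the unstable vector whose iterates grow slower than `lam ^ n` is zero. -/
theorem eq_zero_of_slow_growth (hK : IsHyperbolicBasicSet OA T K P θ 1)
    (hw : IsUnstableDirection T K P w δ C₀ lam) {i : A →L[ℝ] X} (hi : Function.Injective i)
    {L : A → X →L[ℝ] X} (hLi : ∀ x ∈ K, ∀ v, L x (i v) = i (fderiv ℝ T x v)) {x : A} (hx : x ∈ K)
    {r C ϱ : ℝ} (hϱ : 0 < ϱ) (hϱl : ϱ < lam)
    (h : ∀ n, ‖linearCocycle T L n x (r • i (w x))‖ ≤ C * ϱ ^ n) : r = 0 := by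
  obtain ⟨c, hc, hcw⟩ := hw.exists_lower_bound hK i hi
  have hC0 : 0 < min C₀ 1 := lt_min hw.C₀_pos one_pos
  have hl := hw.one_lt_lam
  have h1 : ∀ n : ℕ, |r| * (min C₀ 1 * c) ≤ C * (ϱ / lam) ^ n := by
    intro n
    have h2 := h n
    have hg := hw.growth_pos hK n hx
    rw [map_smul, linearCocycle_map hK.mapsTo i hLi n hx, hw.linearCocycle_apply hK n hx,
      map_smul, norm_smul, norm_smul, Real.norm_eq_abs, Real.norm_of_nonneg hg.le] at h2
    have h3 : |r| * ((min C₀ 1 * lam ^ n) * c) ≤ C * ϱ ^ n := by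
      refine le_trans ?_ h2
      gcongr
      · exact hw.min_growth n hx
      · exact hcw _ (hK.iterate_mem n hx)
    rw [div_pow, mul_div_assoc', le_div_iff₀ (by positivity)]
    calc _ = |r| * ((min C₀ 1 * lam ^ n) * c) := by ring
      _ ≤ _ := h3
  have h4 : Tendsto (fun n : ℕ => C * (ϱ / lam) ^ n) atTop (𝓝 (C * 0)) :=
    (tendsto_pow_atTop_nhds_zero_of_lt_one (by positivity)
      ((div_lt_one (by positivity)).2 hϱl)).const_mul _
  rw [mul_zero] at h4
  have h5 : |r| * (min C₀ 1 * c) ≤ 0 := ge_of_tendsto' h4 h1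
  have h6 : 0 < min C₀ 1 * c := by positivity
  have : |r| ≤ 0 := by nlinarith [abs_nonneg r]
  exact abs_eq_zero.1 (le_antisymm this (abs_nonneg r))

/-- The splitting `X = ker (p x) ⊕ ℝ w x` of a space `X`, between `A` and `Y`, for a cocycle `L`
extending the derivative of `T`: on `ker (p x)` the iterates of the cocycle grow at most
like `ϱ ^ n`. -/
structure IsDominatedSplitting (T : A → A) (K : Set A) (w : A → A) (i : A →L[ℝ] X)
    (L : A → X →L[ℝ] X) (p : A → X →L[ℝ] ℝ) (ϱ C : ℝ) : Prop where
  rate_pos : 0 < ϱ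
  one_le : 1 ≤ C
  injective : Function.Injective i
  map_deriv : ∀ x ∈ K, ∀ v, L x (i v) = i (fderiv ℝ T x v)
  norm_le : ∀ x ∈ K, ‖L x‖ ≤ C
  coeff_norm_le : ∀ x ∈ K, ‖p x‖ ≤ C
  coeff_unstable : ∀ x ∈ K, p x (i (w x)) = 1
  slow : ∀ x ∈ K, ∀ v n, ‖linearCocycle T L n x (v - p x v • i (w x))‖ ≤ C * ϱ ^ n * ‖v‖

theorem IsDominatedSplitting.coeff_unique {i : A →L[ℝ] X} {L : A → X →L[ℝ] X}
    {p : A → X →L[ℝ] ℝ} {ϱ C : ℝ} (h : IsDominatedSplitting T K w i L p ϱ C) (hϱ : ϱ < lam)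
    (hK : IsHyperbolicBasicSet OA T K P θ 1) (hw : IsUnstableDirection T K P w δ C₀ lam)
    {x : A} (hx : x ∈ K) {v : X} {t C' ϱ' : ℝ} (hϱ'0 : 0 < ϱ') (hϱ' : ϱ' < lam)
    (ht : ∀ n, ‖linearCocycle T L n x (v - t • i (w x))‖ ≤ C' * ϱ' ^ n) : p x v = t := by
  have hC' : 0 ≤ C' := by simpa using (norm_nonneg _).trans (ht 0)
  have hC := h.one_le
  have := h.rate_pos
  rw [← sub_eq_zero]
  refine eq_zero_of_slow_growth hK hw h.injective h.map_deriv hx (r := p x v - t)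
    (C := C' + C * ‖v‖) (ϱ := max ϱ ϱ') (lt_max_of_lt_left h.rate_pos) (max_lt hϱ hϱ') fun n => ?_
  have e : (p x v - t) • i (w x) = (v - t • i (w x)) - (v - p x v • i (w x)) := by module
  rw [e, map_sub]
  refine (norm_sub_le _ _).trans ((add_le_add (ht n) (h.slow x hx v n)).trans ?_)
  calc C' * ϱ' ^ n + C * ϱ ^ n * ‖v‖
      ≤ C' * max ϱ ϱ' ^ n + C * max ϱ ϱ' ^ n * ‖v‖ := by
        gcongr
        exacts [le_max_right _ _, le_max_left _ _]
    _ = _ := by ring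

theorem IsDominatedSplitting.linearCocycle_unstable {i : A →L[ℝ] X} {L : A → X →L[ℝ] X}
    {p : A → X →L[ℝ] ℝ} {ϱ C : ℝ} (h : IsDominatedSplitting T K w i L p ϱ C)
    (hK : IsHyperbolicBasicSet OA T K P θ 1) (hw : IsUnstableDirection T K P w δ C₀ lam)
    (n : ℕ) {x : A} (hx : x ∈ K) :
    linearCocycle T L n x (i (w x)) = unstableGrowth T δ n x • i (w (T^[n] x)) := by
  rw [linearCocycle_map hK.mapsTo i h.map_deriv n hx, hw.linearCocycle_apply hK n hx, map_smul]

theorem IsDominatedSplitting.coeff_linearCocycle {i : A →L[ℝ] X} {L : A → X →L[ℝ] X}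
    {p : A → X →L[ℝ] ℝ} {ϱ C : ℝ} (h : IsDominatedSplitting T K w i L p ϱ C) (hϱ : ϱ < lam)
    (hK : IsHyperbolicBasicSet OA T K P θ 1) (hw : IsUnstableDirection T K P w δ C₀ lam)
    (n : ℕ) {x : A} (hx : x ∈ K) (v : X) :
    p (T^[n] x) (linearCocycle T L n x v) = unstableGrowth T δ n x * p x v := by
  refine h.coeff_unique hϱ hK hw (hK.iterate_mem n hx) (C' := C * ϱ ^ n * ‖v‖) h.rate_pos hϱ
    fun k => ?_
  have e : linearCocycle T L n x v - (unstableGrowth T δ n x * p x v) • i (w (T^[n] x)) =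
      linearCocycle T L n x (v - p x v • i (w x)) := by
    rw [map_sub, map_smul, h.linearCocycle_unstable hK hw n hx, smul_smul, mul_comm]
  rw [e, ← ContinuousLinearMap.comp_apply, ← linearCocycle_add]
  refine (h.slow x hx v _).trans_eq ?_
  rw [pow_add]; ring

/-- A compatible pair of spaces carries a dominated splitting. -/
theorem IsCompatible.exists_isDominatedSplitting {i : A →L[ℝ] X} {j : X →L[ℝ] Y} {ρ : ℝ}
    (hc : IsCompatible i j T K θ lam ρ) (hK : IsHyperbolicBasicSet OA T K P θ 1)
    (hOA : IsOpen OA) (hT : ContDiffOn ℝ 2 T OA)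
    (hw : IsUnstableDirection T K P w δ C₀ lam) :
    ∃ (LX : A → X →L[ℝ] X) (LY : A → Y →L[ℝ] Y) (p : A → X →L[ℝ] ℝ) (ϱ C : ℝ),
      IsDominatedSplitting T K w i LX p ϱ C ∧ ϱ < ρ ∧
      (∀ x ∈ K, ∀ v : A, LY x (j (i v)) = j (i (fderiv ℝ T x v))) ∧
      (∀ x ∈ K, ∀ v : X, LY x (j v) = j (LX x v)) ∧
      ∀ v : X, j v ∈ closure (range fun a : A => j (i a)) := by
  obtain ⟨hθρ, hρl, hi, hj, LX, LY, hLY, hLYX, ⟨M, hM0, hM⟩, -, Δ, hΔ1, hΔ, κ, hκ, m, hm, hL⟩ := hc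
  have hθ := hK.exponent_pos
  have hρ : 0 < ρ := hθ.trans hθρ
  have hl := hw.one_lt_lam
  have hLX : ∀ x ∈ K, ∀ v, LX x (i v) = i (fderiv ℝ T x v) := fun x hx v =>
    hj.injective (by rw [← hLYX x hx, hLY x hx])
  have hdense : ∀ v : X, j v ∈ closure (range fun a : A => j (i a)) := by
    intro v
    have hb0 : 0 < ‖v‖ + 1 := by positivity
    have h1 : j ((‖v‖ + 1)⁻¹ • v) ∈ closure (range fun a : A => j (i a)) := by
      refine closure_mono ?_ (hΔ ⟨_, ?_, rfl⟩)
      · rintro _ ⟨_, ⟨-, ⟨a, rfl⟩⟩, rfl⟩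
        exact ⟨a, rfl⟩
      · rw [mem_ball_zero_iff, norm_smul, norm_inv, Real.norm_of_nonneg hb0.le,
          inv_mul_lt_iff₀ hb0]
        linarith
    have h2 : j v = (‖v‖ + 1) • j ((‖v‖ + 1)⁻¹ • v) := by
      rw [map_smul, smul_smul, mul_inv_cancel₀ hb0.ne', one_smul]
    rw [h2]
    refine map_mem_closure (f := fun y : Y => (‖v‖ + 1) • y) (continuous_const_smul _) h1 ?_
    rintro _ ⟨a, rfl⟩
    exact ⟨(‖v‖ + 1) • a, by simp⟩
  obtain ⟨R, hR, hstep⟩ := exists_greedy_step hj.compact hΔ1 hρ hκ hΔ hL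
  -- a rate `ϱ < ρ` that is larger than those of the two sources of error
  obtain ⟨ϱ, ⟨hϱ0, hϱ1, hϱ2⟩, hϱρ⟩ : ∃ ϱ, (0 < ϱ ∧ 3 / 4 * ρ ^ m < ϱ ^ m ∧ θ ^ m < ϱ ^ m) ∧ ϱ < ρ := by
    have hcont : ContinuousAt (fun r : ℝ => r ^ m) ρ := (continuous_pow m).continuousAt
    have h1 : ∀ᶠ r in 𝓝 ρ, 0 < r ∧ 3 / 4 * ρ ^ m < r ^ m ∧ θ ^ m < r ^ m := by
      refine (lt_mem_nhds hρ).and ((hcont.eventually (lt_mem_nhds ?_)).and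
        (hcont.eventually (lt_mem_nhds ?_)))
      · have : 0 < ρ ^ m := by positivity
        linarith
      · exact pow_lt_pow_left₀ hθρ hθ.le hm.ne'
    have h2 : ∀ᶠ r in 𝓝[<] ρ, r < ρ := self_mem_nhdsWithin
    exact ((h1.filter_mono nhdsWithin_le_nhds).and h2).exists
  have hϑ : 0 < 3 / 4 * ρ ^ m := by positivity
  have hϑl : 3 / 4 * ρ ^ m < lam ^ m := by
    have : ρ ^ m < lam ^ m := pow_lt_pow_left₀ hρl hρ.le hm.ne'
    linarith
  obtain ⟨C, hC, hcoef⟩ := exists_unstable_coefficient hK hOA hT hw i hLX hR hϑ hϑl hϱ1 hϱ2 hstep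
  set M' : ℝ := max M 1 with hM'
  have hM'1 : 1 ≤ M' := le_max_right _ _
  set D : ℝ := (max 1 ϱ⁻¹) ^ m with hD
  have hD1 : 1 ≤ D := one_le_pow₀ (le_max_left _ _)
  set C₁ : ℝ := 2 * M' ^ m * D * C with hC₁
  have hC₁0 : 0 < C₁ := by positivity
  have hex : ∀ x ∈ K, ∀ v : X, ∃ t : ℝ, ∀ n,
      ‖linearCocycle T LX n x (v - t • i (w x))‖ ≤ C₁ * ϱ ^ n * ‖v‖ := by
    intro x hx v
    rcases eq_or_ne v 0 with rfl | hv
    · exact ⟨0, fun n => by simp⟩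
    have hv' : 0 < ‖v‖ := norm_pos_iff.2 hv
    obtain ⟨t, ht⟩ := hcoef x hx v (2 * ‖v‖) (by linarith)
    refine ⟨t, fun n => ?_⟩
    set u := v - t • i (w x)
    have hn : n = n % m + m * (n / m) := (Nat.mod_add_div n m).symm
    have hr : n % m ≤ m := (Nat.mod_lt n hm).le
    have h1 : ‖linearCocycle T LX n x u‖ ≤ M' ^ m * (C * (ϱ ^ m) ^ (n / m) * (2 * ‖v‖)) := by
      conv_lhs => rw [hn]
      rw [linearCocycle_add, ContinuousLinearMap.comp_apply]
      refine (ContinuousLinearMap.le_opNorm _ _).trans ?_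
      gcongr
      · refine (norm_linearCocycle_le hK.mapsTo hM'1
          (fun y hy => (hM y hy).2.trans (le_max_left _ _)) _ (hK.iterate_mem _ hx)).trans ?_
        exact pow_le_pow_right₀ hM'1 hr
      · exact ht _
    have h2 : (ϱ ^ m) ^ (n / m) ≤ D * ϱ ^ n := by
      have h3 : ϱ ^ n = ϱ ^ (n % m) * (ϱ ^ m) ^ (n / m) := by
        conv_lhs => rw [hn]
        rw [pow_add, pow_mul]
      have h4 : 1 ≤ D * ϱ ^ (n % m) := by
        calc (1 : ℝ) ≤ (max 1 ϱ⁻¹ * ϱ) ^ (n % m) := by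
              refine one_le_pow₀ ?_
              calc 1 = ϱ⁻¹ * ϱ := (inv_mul_cancel₀ hϱ0.ne').symm
                _ ≤ _ := by gcongr; exact le_max_right _ _
          _ = (max 1 ϱ⁻¹) ^ (n % m) * ϱ ^ (n % m) := mul_pow _ _ _
          _ ≤ _ := by
            gcongr
            exact pow_le_pow_right₀ (le_max_left _ _) hr
      rw [h3, ← mul_assoc]
      exact le_mul_of_one_le_left (by positivity) h4
    calc _ ≤ _ := h1
      _ ≤ M' ^ m * (C * (D * ϱ ^ n) * (2 * ‖v‖)) := by gcongr
      _ = _ := by rw [hC₁]; ring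
  choose! p hp using hex
  have huniq : ∀ x ∈ K, ∀ (v : X) (t C' : ℝ), (∀ n,
      ‖linearCocycle T LX n x (v - t • i (w x))‖ ≤ C' * ϱ ^ n) → p x v = t := by
    intro x hx v t C' ht
    rw [← sub_eq_zero]
    refine eq_zero_of_slow_growth hK hw hi.injective hLX hx (r := p x v - t)
      (C := C' + C₁ * ‖v‖) hϱ0 (hϱρ.trans hρl) fun n => ?_
    have e : (p x v - t) • i (w x) = (v - t • i (w x)) - (v - p x v • i (w x)) := by module
    rw [e, map_sub]
    refine (norm_sub_le _ _).trans ((add_le_add (ht n) (hp x hx v n)).trans_eq ?_)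
    ring
  obtain ⟨c, hc, hcw⟩ := hw.exists_lower_bound hK i hi.injective
  have hpb : ∀ x ∈ K, ∀ v, ‖p x v‖ ≤ (1 + C₁) / c * ‖v‖ := by
    intro x hx v
    have h1 : ‖v - p x v • i (w x)‖ ≤ C₁ * ‖v‖ := by simpa [linearCocycle] using hp x hx v 0
    have h2 : ‖p x v‖ * ‖i (w x)‖ ≤ ‖v‖ + C₁ * ‖v‖ := by
      rw [← norm_smul]
      calc ‖p x v • i (w x)‖ = ‖v - (v - p x v • i (w x))‖ := by congr 1; abel
        _ ≤ _ := (norm_sub_le _ _).trans (by gcongr)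
    have h3 := hcw x hx
    rw [div_mul_eq_mul_div, le_div_iff₀ hc]
    calc ‖p x v‖ * c ≤ ‖p x v‖ * ‖i (w x)‖ := by gcongr
      _ ≤ _ := h2.trans_eq (by ring)
  have hadd : ∀ x ∈ K, ∀ u v, p x (u + v) = p x u + p x v := by
    intro x hx u v
    refine huniq x hx _ _ (C₁ * ‖u‖ + C₁ * ‖v‖) fun n => ?_
    have e : u + v - (p x u + p x v) • i (w x) =
        (u - p x u • i (w x)) + (v - p x v • i (w x)) := by module
    rw [e, map_add]
    exact (norm_add_le _ _).trans ((add_le_add (hp x hx u n) (hp x hx v n)).trans_eq (by ring))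
  have hsmul : ∀ x ∈ K, ∀ (r : ℝ) v, p x (r • v) = r * p x v := by
    intro x hx r v
    refine huniq x hx _ _ (|r| * (C₁ * ‖v‖)) fun n => ?_
    have e : r • v - (r * p x v) • i (w x) = r • (v - p x v • i (w x)) := by module
    rw [e, map_smul, norm_smul, Real.norm_eq_abs]
    exact (mul_le_mul_of_nonneg_left (hp x hx v n) (abs_nonneg r)).trans_eq (by ring)
  classical
  let p' : A → X →L[ℝ] ℝ := fun x => if hx : x ∈ K then
    LinearMap.mkContinuous ⟨⟨p x, hadd x hx⟩, hsmul x hx⟩ ((1 + C₁) / c) (hpb x hx) else 0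
  have hp' : ∀ x ∈ K, ∀ v, p' x v = p x v := fun x hx v => by simp [p', hx]
  refine ⟨LX, LY, p', ϱ, max (max C₁ M') ((1 + C₁) / c), ⟨hϱ0,
    hM'1.trans ((le_max_right _ _).trans (le_max_left _ _)), hi.injective, hLX, ?_, ?_, ?_, ?_⟩,
    hϱρ, hLY, hLYX, hdense⟩
  · intro x hx
    exact (hM x hx).2.trans
      ((le_max_left _ _).trans ((le_max_right _ _).trans (le_max_left _ _)))
  · intro x hx
    refine ContinuousLinearMap.opNorm_le_bound _ (by positivity) fun v => ?_
    rw [hp' x hx]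
    exact (hpb x hx v).trans (by gcongr; exact le_max_right _ _)
  · intro x hx
    rw [hp' x hx]
    exact huniq x hx _ _ 0 fun n => by simp
  · intro x hx v n
    rw [hp' x hx]
    refine (hp x hx v n).trans ?_
    gcongr
    exact (le_max_left _ _).trans (le_max_left _ _)

end Functional

/-! ### The splittings of a robust operator -/

section RobustSplitting

variable {A B C D : Type*}
  [NormedAddCommGroup A] [NormedSpace ℝ A] [NormedAddCommGroup B] [NormedSpace ℝ B]
  [NormedAddCommGroup C] [NormedSpace ℝ C] [NormedAddCommGroup D] [NormedSpace ℝ D]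
  {iAB : A →L[ℝ] B} {iBC : B →L[ℝ] C} {iCD : C →L[ℝ] D}
  {OA : Set A} {T : A → A} {K : Set A} {P : A → A →L[ℝ] A} {θ : ℝ}
  {w : A → A} {δ : A → ℝ} {C₀ lam : ℝ} {OB : Set B} {TB : B → B}

theorem IsHyperbolicBasicSet.eventually_iterate_mem (hK : IsHyperbolicBasicSet OA T K P θ 1)
    (hOA : IsOpen OA) (hT : ContDiffOn ℝ 2 T OA) {x : A} (hx : x ∈ K) (n : ℕ) :
    ∀ᶠ y in 𝓝 x, T^[n] y ∈ OA :=
  (hK.hasFDerivAt_iterate hOA hT n hx).continuousAt.eventually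
    (hOA.mem_nhds (hK.subset (hK.iterate_mem n hx)))

theorem IsRobust.iterate_map (hR : IsRobust iAB iBC iCD OA T K θ w C₀ lam OB TB) {n : ℕ} {y : A}
    (hy : ∀ k < n, T^[k] y ∈ OA) : TB^[n] (iAB y) = iAB (T^[n] y) := by
  induction n with
  | zero => rfl
  | succ n ih =>
    rw [Function.iterate_succ_apply', Function.iterate_succ_apply', ih fun k hk => hy k (by omega),
      hR.mapsTo _ (hy n (by omega))]

theorem IsRobust.iterate_map_of_mem (hR : IsRobust iAB iBC iCD OA T K θ w C₀ lam OB TB)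
    (hK : IsHyperbolicBasicSet OA T K P θ 1) (n : ℕ) {x : A} (hx : x ∈ K) :
    TB^[n] (iAB x) = iAB (T^[n] x) :=
  hR.iterate_map fun k _ => hK.subset (hK.iterate_mem k hx)

theorem IsRobust.differentiableAt (hR : IsRobust iAB iBC iCD OA T K θ w C₀ lam OB TB) {n : ℕ}
    {f : B} (hf : f ∈ iterateDomain OB TB n) :
    DifferentiableAt ℝ (fun y => iBC (TB^[n] y)) f := by
  rcases Nat.eq_zero_or_pos n with rfl | hn
  · exact iBC.differentiableAt
  · exact ((hR.smooth n hn).2.1.contDiffAt (isOpen_interior.mem_nhds hf)).differentiableAt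
      (by norm_num)

theorem IsRobust.map_mem_iterateDomain (hR : IsRobust iAB iBC iCD OA T K θ w C₀ lam OB TB)
    {x : A} (hx : x ∈ K) {n : ℕ} (hn : 0 < n) : iAB x ∈ iterateDomain OB TB n :=
  (hR.smooth n hn).1 ⟨x, hx, rfl⟩

theorem IsRobust.fderiv_map (hR : IsRobust iAB iBC iCD OA T K θ w C₀ lam OB TB)
    (hK : IsHyperbolicBasicSet OA T K P θ 1) (hOA : IsOpen OA) (hT : ContDiffOn ℝ 2 T OA)
    {n : ℕ} (hn : 0 < n) {x : A} (hx : x ∈ K) (v : A) :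
    fderiv ℝ (fun y => iBC (TB^[n] y)) (iAB x) (iAB v) =
      iBC (iAB (linearCocycle T (fderiv ℝ T) n x v)) := by
  have h1 := (hR.differentiableAt (hR.map_mem_iterateDomain hx hn)).hasFDerivAt.comp x
    iAB.hasFDerivAt
  have h2 := (iBC.comp iAB).hasFDerivAt.comp x (hK.hasFDerivAt_iterate hOA hT n hx)
  have h3 : ∀ᶠ y in 𝓝 x, iBC (TB^[n] (iAB y)) = iBC (iAB (T^[n] y)) := by
    have : ∀ᶠ y in 𝓝 x, ∀ k ∈ Finset.range n, T^[k] y ∈ OA :=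
      (Filter.eventually_all_finset _).2 fun k _ => hK.eventually_iterate_mem hOA hT hx k
    filter_upwards [this] with y hy
    rw [hR.iterate_map fun k hk => hy k (Finset.mem_range.2 hk)]
  have h4 := h1.unique (h2.congr_of_eventuallyEq h3)
  exact DFunLike.congr_fun h4 v

/-- The splittings of `B` and of `C` of a robust operator. They have the same unstable
coefficient `p`, which on `A` is that of the hyperbolic splitting; the derivatives of the iterates
at the points of the basic set are given by the two cocycles. -/
structure IsRobustSplitting (iAB : A →L[ℝ] B) (iBC : B →L[ℝ] C) (T : A → A) (K : Set A)
    (P : A → A →L[ℝ] A) (w : A → A) (lam : ℝ) (TB : B → B) (LB : A → B →L[ℝ] B)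
    (LC : A → C →L[ℝ] C) (p : A → C →L[ℝ] ℝ) (ϱB ϱC E : ℝ) : Prop where
  split_B : IsDominatedSplitting T K w iAB LB (fun x => (p x).comp iBC) ϱB E
  rate_B : ϱB < 1
  split_C : IsDominatedSplitting T K w (iBC.comp iAB) LC p ϱC E
  rate_C : ϱC < lam
  map_cocycle : ∀ x ∈ K, ∀ v, LC x (iBC v) = iBC (LB x v)
  fderiv_eq : ∀ n, 0 < n → ∀ x ∈ K, ∀ v,
    fderiv ℝ (fun y => iBC (TB^[n] y)) (iAB x) v = iBC (linearCocycle T LB n x v)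
  projection_eq : ∀ x ∈ K, ∀ v, P x v = p x (iBC (iAB v)) • w x

theorem IsDominatedSplitting.mono {X : Type*} [NormedAddCommGroup X] [NormedSpace ℝ X]
    {i : A →L[ℝ] X} {L : A → X →L[ℝ] X} {p : A → X →L[ℝ] ℝ} {ϱ E E' : ℝ}
    (h : IsDominatedSplitting T K w i L p ϱ E) (hE : E ≤ E') :
    IsDominatedSplitting T K w i L p ϱ E' where
  rate_pos := h.rate_pos
  one_le := h.one_le.trans hE
  injective := h.injective
  map_deriv := h.map_deriv
  norm_le x hx := (h.norm_le x hx).trans hE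
  coeff_norm_le x hx := (h.coeff_norm_le x hx).trans hE
  coeff_unstable := h.coeff_unstable
  slow x hx v n := (h.slow x hx v n).trans (by have := h.rate_pos; gcongr)

/-- The two compatible pairs `(B, D)` and `(C, D)` yield splittings with the same unstable
coefficient, since both extend the splitting of `A` and since the coefficient is unique. -/
theorem IsRobust.exists_isRobustSplitting (hR : IsRobust iAB iBC iCD OA T K θ w C₀ lam OB TB)
    (hK : IsHyperbolicBasicSet OA T K P θ 1) (hOA : IsOpen OA) (hT : ContDiffOn ℝ 2 T OA)
    (hw : IsUnstableDirection T K P w δ C₀ lam) :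
    ∃ (LB : A → B →L[ℝ] B) (LC : A → C →L[ℝ] C) (p : A → C →L[ℝ] ℝ) (ϱB ϱC E : ℝ),
      IsRobustSplitting iAB iBC T K P w lam TB LB LC p ϱB ϱC E := by
  obtain ⟨ρC, hcC⟩ := hR.compatible.2
  obtain ⟨LB, LD, pB, ϱB, EB, hB, hϱB, hLDA, hLD, hdB⟩ :=
    hR.compatible.1.exists_isDominatedSplitting hK hOA hT hw
  obtain ⟨LC, LD', p, ϱC, EC, hC, hϱC, hLDA', hLD', hdC⟩ :=
    hcC.exists_isDominatedSplitting hK hOA hT hw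
  have hl := hw.one_lt_lam
  have hϱCl : ϱC < lam := hϱC.trans hcC.2.1
  have hjB : Function.Injective iBC := hR.inclusion_BC.injective
  have hjC : Function.Injective iCD := hR.inclusion_CD.injective
  have hagree : ∀ L₁ L₂ : D →L[ℝ] D, (∀ a : A, L₁ (iCD (iBC (iAB a))) = L₂ (iCD (iBC (iAB a)))) →
      ∀ v : B, L₁ (iCD (iBC v)) = L₂ (iCD (iBC v)) := by
    intro L₁ L₂ h v
    have h1 : EqOn L₁ L₂ (range fun a : A => (iCD.comp iBC) (iAB a)) := by
      rintro _ ⟨a, rfl⟩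
      exact h a
    exact h1.closure L₁.continuous L₂.continuous (hdB v)
  have hmapC : ∀ x ∈ K, ∀ v, LC x (iBC v) = iBC (LB x v) := by
    intro x hx v
    apply hjC
    rw [← hLD' x hx]
    have h1 := hLD x hx v
    simp only [ContinuousLinearMap.comp_apply] at h1
    rw [← h1]
    refine hagree _ _ (fun a => ?_) v
    have h2 := hLDA x hx a
    have h3 := hLDA' x hx a
    simp only [ContinuousLinearMap.comp_apply] at h2 h3
    rw [h2, h3]
  have hcoc : ∀ n, ∀ x ∈ K, ∀ v, linearCocycle T LC n x (iBC v) = iBC (linearCocycle T LB n x v) :=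
    fun n x hx v => linearCocycle_map hK.mapsTo iBC hmapC n hx v
  have hpB : ∀ x ∈ K, ∀ v, pB x v = p x (iBC v) := by
    intro x hx v
    symm
    refine hC.coeff_unique hϱCl hK hw hx (C' := ‖iBC‖ * (EB * ‖v‖)) hB.rate_pos
      (hϱB.trans hl) fun n => ?_
    have e : iBC v - pB x v • (iBC.comp iAB) (w x) = iBC (v - pB x v • iAB (w x)) := by simp
    rw [e, hcoc n x hx]
    refine (iBC.le_opNorm _).trans ?_
    calc ‖iBC‖ * _ ≤ ‖iBC‖ * (EB * ϱB ^ n * ‖v‖) := by gcongr; exact hB.slow x hx v n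
      _ = _ := by ring
  refine ⟨LB, LC, p, ϱB, ϱC, max (max EB EC) (EC * ‖iBC‖), ⟨?_, hϱB, ?_, hϱCl, hmapC, ?_, ?_⟩⟩
  · have h := hB.mono ((le_max_left EB EC).trans (le_max_left _ (EC * ‖iBC‖)))
    refine ⟨h.rate_pos, h.one_le, h.injective, h.map_deriv, h.norm_le, ?_, ?_, ?_⟩
    · intro x hx
      refine (ContinuousLinearMap.opNorm_comp_le _ _).trans (le_trans ?_ (le_max_right _ _))
      gcongr
      exact hC.coeff_norm_le x hx
    · intro x hx
      exact hC.coeff_unstable x hx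
    · intro x hx v n
      have := h.slow x hx v n
      rwa [hpB x hx] at this
  · exact hC.mono ((le_max_right EB EC).trans (le_max_left _ _))
  · intro n hn x hx v
    obtain ⟨L, hL, -, -⟩ := (hR.smooth n hn).2.2.2 x (hR.map_mem_iterateDomain hx hn)
    have h1 : ∀ v, linearCocycle T LD n x (iCD (iBC v)) = iCD (iBC (linearCocycle T LB n x v)) :=
      fun v => linearCocycle_map hK.mapsTo (iCD.comp iBC) hLD n hx v
    apply hjC
    rw [← hL, ← h1]
    refine hagree _ _ (fun a => ?_) v
    rw [hL, h1, hR.fderiv_map hK hOA hT hn hx, linearCocycle_map hK.mapsTo iAB hB.map_deriv n hx]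
  · intro x hx v
    obtain ⟨t, ht⟩ := hK.exists_projection_eq_smul hw hx v
    obtain ⟨c, hc, hcontr⟩ := hK.contracting
    rw [ht]
    congr 1
    symm
    refine hC.coeff_unique hϱCl hK hw hx (C' := ‖iBC.comp iAB‖ * (c * ‖v - P x v‖))
      hK.exponent_pos (hK.exponent_lt_one.trans hl) fun n => ?_
    have e : iBC (iAB v) - t • (iBC.comp iAB) (w x) = (iBC.comp iAB) (v - P x v) := by
      rw [ht]; simp
    have h0 : P x (v - P x v) = 0 := by
      rw [map_sub, sub_eq_zero]
      exact (DFunLike.congr_fun (hK.projection x hx) v).symm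
    rw [e, linearCocycle_map hK.mapsTo _ hC.map_deriv n hx]
    refine (ContinuousLinearMap.le_opNorm _ _).trans ?_
    have h2 := hcontr x hx n (v - P x v) h0
    rw [hK.fderiv_iterate hOA hT n hx] at h2
    calc _ ≤ ‖iBC.comp iAB‖ * (c * θ ^ n * ‖v - P x v‖) := by gcongr
      _ = _ := by ring

end RobustSplitting

/-! ### Uniform estimates near the basic set -/

section Estimates

variable {A B C D : Type*}
  [NormedAddCommGroup A] [NormedSpace ℝ A] [NormedAddCommGroup B] [NormedSpace ℝ B]
  [NormedAddCommGroup C] [NormedSpace ℝ C] [NormedAddCommGroup D] [NormedSpace ℝ D]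
  {iAB : A →L[ℝ] B} {iBC : B →L[ℝ] C} {iCD : C →L[ℝ] D}
  {OA : Set A} {T : A → A} {K : Set A} {P : A → A →L[ℝ] A} {θ : ℝ}
  {w : A → A} {δ : A → ℝ} {C₀ lam : ℝ} {OB : Set B} {TB : B → B}
  {LB : A → B →L[ℝ] B} {LC : A → C →L[ℝ] C} {p : A → C →L[ℝ] ℝ} {ϱB ϱC E : ℝ}

theorem iterateDomain_antitone {E : Type*} [TopologicalSpace E] {O : Set E} {F : E → E} {n k : ℕ} (h : n ≤ k) :
    iterateDomain O F k ⊆ iterateDomain O F n :=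
  interior_mono fun _ hf => ⟨hf.1, fun i hi => hf.2 i (hi.trans_le h)⟩

theorem IsRobust.exists_ball_subset_iterateDomain
    (hR : IsRobust iAB iBC iCD OA T K θ w C₀ lam OB TB)
    (hK : IsHyperbolicBasicSet OA T K P θ 1) (n : ℕ) :
    ∃ r > 0, ∀ x ∈ K, ball (iAB x) r ⊆ iterateDomain OB TB n := by
  have h1 : iAB '' K ⊆ iterateDomain OB TB n :=
    (hR.smooth (n + 1) n.succ_pos).1.trans (iterateDomain_antitone n.le_succ)
  obtain ⟨r, hr, h⟩ := (hK.isCompact.image iAB.continuous).exists_thickening_subset_open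
    isOpen_interior h1
  exact ⟨r, hr, fun x hx => (ball_subset_thickening (mem_image_of_mem iAB hx) r).trans h⟩

/-- At the points of the basic set the iterates are differentiable in `B` up to an error which,
for large iterates, is at most a quarter of the increment. -/
theorem IsRobust.exists_approximation_B (hR : IsRobust iAB iBC iCD OA T K θ w C₀ lam OB TB)
    (hK : IsHyperbolicBasicSet OA T K P θ 1)
    (hS : IsRobustSplitting iAB iBC T K P w lam TB LB LC p ϱB ϱC E) :
    ∃ c : ℕ → ℝ, (∃ m₀ > 0, ∀ m > m₀, c m < 1 / 4) ∧ ∀ n, 0 < n → 0 < c n ∧ ∃ r > 0, ∀ x ∈ K,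
      ∀ v : B, ‖v‖ < r →
        ‖TB^[n] (iAB x + v) - iAB (T^[n] x) - linearCocycle T LB n x v‖ ≤ c n * ‖v‖ := by
  obtain ⟨ν, hν, -, C₃, hC₃, hm₀⟩ := hR.approximation
  refine ⟨C₃, hm₀, fun n hn => ⟨(hC₃ n hn).1, ?_⟩⟩
  obtain ⟨r, hr, hball⟩ := hR.exists_ball_subset_iterateDomain hK n
  refine ⟨min r (ν n), lt_min hr (hν n hn), fun x hx v hv => ?_⟩
  obtain ⟨v', hv', h⟩ := (hC₃ n hn).2 x hx x (by simpa using hν n hn) v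
    (hv.trans_le (min_le_right _ _)) (hR.map_mem_iterateDomain hx hn)
    (hball x hx (by simpa using hv.trans_le (min_le_left _ _)))
  rw [hS.fderiv_eq n hn x hx] at hv'
  rw [hR.inclusion_BC.injective hv', hR.iterate_map_of_mem hK n hx] at h
  exact h

theorem IsRobust.exists_lipschitz_B (hR : IsRobust iAB iBC iCD OA T K θ w C₀ lam OB TB)
    (hK : IsHyperbolicBasicSet OA T K P θ 1)
    (hS : IsRobustSplitting iAB iBC T K P w lam TB LB LC p ϱB ϱC E) (n : ℕ) :
    ∃ M ≥ 1, ∃ r > 0, ∀ x ∈ K, ∀ y : B, ‖y - iAB x‖ < r →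
      ‖TB^[n] y - iAB (T^[n] x)‖ ≤ M * ‖y - iAB x‖ := by
  rcases Nat.eq_zero_or_pos n with rfl | hn
  · exact ⟨1, le_rfl, 1, one_pos, fun x _ y _ => by simp⟩
  obtain ⟨c, -, hc⟩ := hR.exists_approximation_B hK hS
  obtain ⟨hc0, r, hr, h⟩ := hc n hn
  have hE := hS.split_B.one_le
  refine ⟨E ^ n + c n, by linarith [one_le_pow₀ hE (n := n)], r, hr, fun x hx y hy => ?_⟩
  have h1 := h x hx (y - iAB x) hy
  rw [add_sub_cancel] at h1
  have h2 := (linearCocycle T LB n x).le_opNorm (y - iAB x)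
  have h3 := norm_linearCocycle_le hK.mapsTo hE hS.split_B.norm_le n hx
  calc ‖TB^[n] y - iAB (T^[n] x)‖ = ‖linearCocycle T LB n x (y - iAB x) +
        (TB^[n] y - iAB (T^[n] x) - linearCocycle T LB n x (y - iAB x))‖ := by congr 1; abel
    _ ≤ ‖linearCocycle T LB n x‖ * ‖y - iAB x‖ + c n * ‖y - iAB x‖ :=
      (norm_add_le _ _).trans (add_le_add h2 h1)
    _ ≤ _ := by rw [add_mul]; gcongr

theorem IsRobust.exists_approximation_C (hR : IsRobust iAB iBC iCD OA T K θ w C₀ lam OB TB)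
    (hK : IsHyperbolicBasicSet OA T K P θ 1)
    (hS : IsRobustSplitting iAB iBC T K P w lam TB LB LC p ϱB ϱC E) :
    ∃ c : ℕ → ℝ, (∃ m₀ > 0, ∀ m > m₀, c m < C₀ / 8) ∧ ∀ n, 0 < n → 0 < c n ∧ ∃ r > 0, ∀ x ∈ K,
      ∀ f : B, ‖f - iAB x‖ < r → ∀ v : B,
        ‖fderiv ℝ (fun y => iBC (TB^[n] y)) f v - linearCocycle T LC n x (iBC v)‖ ≤
          c n * lam ^ n * ‖iBC v‖ := by
  obtain ⟨ν, hν, ⟨C₂, hC₂, hm₀⟩, -⟩ := hR.approximation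
  refine ⟨C₂, hm₀, fun n hn => ⟨(hC₂ n hn).1, ?_⟩⟩
  obtain ⟨r, hr, hball⟩ := hR.exists_ball_subset_iterateDomain hK n
  refine ⟨min r (ν n), lt_min hr (hν n hn), fun x hx f hf v => ?_⟩
  have h := (hC₂ n hn).2 x hx f (hball x hx (by
    rw [mem_ball, dist_eq_norm]; exact hf.trans_le (min_le_left _ _)))
    (hf.trans_le (min_le_right _ _)) v
  rwa [hS.fderiv_eq n hn x hx,
    ← linearCocycle_map hK.mapsTo iBC hS.map_cocycle n hx] at h

/-- The derivatives of the iterates near the basic set are bounded in the norm of `C`. -/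
theorem IsRobust.exists_bound_fderiv (hR : IsRobust iAB iBC iCD OA T K θ w C₀ lam OB TB)
    (hK : IsHyperbolicBasicSet OA T K P θ 1) (hw : IsUnstableDirection T K P w δ C₀ lam)
    (hS : IsRobustSplitting iAB iBC T K P w lam TB LB LC p ϱB ϱC E) (n : ℕ) :
    ∃ M ≥ 1, ∃ r > 0, ∀ x ∈ K, ∀ f : B, ‖f - iAB x‖ < r → ∀ v : B,
      ‖fderiv ℝ (fun y => iBC (TB^[n] y)) f v‖ ≤ M * ‖iBC v‖ := by
  have hl := hw.one_lt_lam
  rcases Nat.eq_zero_or_pos n with rfl | hn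
  · refine ⟨1, le_rfl, 1, one_pos, fun x _ f _ v => ?_⟩
    have : fderiv ℝ (fun y => iBC (TB^[0] y)) f = iBC := iBC.fderiv
    rw [this, one_mul]
  obtain ⟨c, -, hc⟩ := hR.exists_approximation_C hK hS
  obtain ⟨hc0, r, hr, h⟩ := hc n hn
  have hE := hS.split_C.one_le
  have h0 : 0 < c n * lam ^ n := by positivity
  refine ⟨E ^ n + c n * lam ^ n, by linarith [one_le_pow₀ hE (n := n)], r, hr,
    fun x hx f hf v => ?_⟩
  have h1 := h x hx f hf v
  have h2 := (linearCocycle T LC n x).le_opNorm (iBC v)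
  have h3 := norm_linearCocycle_le hK.mapsTo hE hS.split_C.norm_le n hx
  set Df := fderiv ℝ (fun y => iBC (TB^[n] y)) f v
  calc ‖Df‖ = ‖linearCocycle T LC n x (iBC v) + (Df - linearCocycle T LC n x (iBC v))‖ := by
        congr 1; abel
    _ ≤ ‖linearCocycle T LC n x‖ * ‖iBC v‖ + c n * lam ^ n * ‖iBC v‖ :=
      (norm_add_le _ _).trans (add_le_add h2 h1)
    _ ≤ _ := by rw [add_mul]; gcongr

theorem IsRobust.exists_remainder (hR : IsRobust iAB iBC iCD OA T K θ w C₀ lam OB TB)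
    (hK : IsHyperbolicBasicSet OA T K P θ 1) :
    ∃ ρ > (1 : ℝ), ∃ M > 0, ∃ r > 0, ∀ x ∈ K, ∀ f₁ f₂ : B, ‖f₁ - iAB x‖ < r → ‖f₂ - iAB x‖ < r →
      ‖iBC (TB f₁) - iBC (TB f₂) - fderiv ℝ (fun y => iBC (TB y)) f₂ (f₁ - f₂)‖ ≤
        M * ‖iBC (f₁ - f₂)‖ ^ ρ := by
  obtain ⟨C₁, hC₁, ρ, hρ, h⟩ := hR.remainder
  choose! V hVo _ hgV hV using h
  obtain ⟨r, hr, hleb⟩ := lebesgue_number_lemma_of_metric (c := fun g : K => V g)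
    (hK.isCompact.image iAB.continuous) (fun g => hVo g g.2) (by
      rintro _ ⟨g, hg, rfl⟩
      exact mem_iUnion.2 ⟨⟨g, hg⟩, hgV g hg⟩)
  refine ⟨ρ, hρ, C₁, by linarith, r, hr, fun x hx f₁ f₂ h1 h2 => ?_⟩
  obtain ⟨g, hg⟩ := hleb _ ⟨x, hx, rfl⟩
  exact hV g g.2 f₁ (hg (by rwa [mem_ball, dist_eq_norm])) f₂ (hg (by rwa [mem_ball, dist_eq_norm]))

/-- The chain rule for `T^{n+1} = T ∘ T^n` holds after extension by continuity in the norm of `C`,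
although the derivative of `T^n` takes its values in `C` and that of `T` is only defined on `B`. -/
theorem norm_fderiv_sub_fderiv_iterate_le {n : ℕ} {f z : B} {N M ρ : ℝ} (hρ : 1 < ρ)
    (hdn : DifferentiableAt ℝ (fun y => iBC (TB^[n] y)) f)
    (hdn' : DifferentiableAt ℝ (fun y => iBC (TB^[n + 1] y)) f)
    (hN : ∀ v, ‖fderiv ℝ (fun y => iBC (TB y)) (TB^[n] f) v‖ ≤ N * ‖iBC v‖)
    (hrem : ∀ᶠ y in 𝓝 f, ‖iBC (TB (TB^[n] y)) - iBC (TB (TB^[n] f)) -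
      fderiv ℝ (fun y => iBC (TB y)) (TB^[n] f) (TB^[n] y - TB^[n] f)‖ ≤
        M * ‖iBC (TB^[n] y - TB^[n] f)‖ ^ ρ) (u : B) :
    ‖fderiv ℝ (fun y => iBC (TB y)) (TB^[n] f) u -
        fderiv ℝ (fun y => iBC (TB^[n + 1] y)) f z‖ ≤
      N * ‖iBC u - fderiv ℝ (fun y => iBC (TB^[n] y)) f z‖ := by
  set L := fderiv ℝ (fun y => iBC (TB y)) (TB^[n] f) with hL
  let y : ℕ → B := fun k => f + ((k : ℝ))⁻¹ • z
  let q : ℕ → B := fun k => (k : ℝ) • (TB^[n] (y k) - TB^[n] f)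
  have hk : Tendsto (fun k : ℕ => ‖(k : ℝ)‖) atTop atTop :=
    tendsto_norm_atTop_atTop.comp tendsto_natCast_atTop_atTop
  have hy : Tendsto y atTop (𝓝 f) := by
    have : Tendsto (fun k : ℕ => f + ((k : ℝ))⁻¹ • z) atTop (𝓝 (f + (0 : ℝ) • z)) :=
      tendsto_const_nhds.add (tendsto_inv_atTop_nhds_zero_nat.smul_const z)
    simpa using this
  have h1 : Tendsto (fun k => iBC (q k)) atTop
      (𝓝 (fderiv ℝ (fun y => iBC (TB^[n] y)) f z)) := by
    have := hdn.hasFDerivAt.lim z hk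
    simpa [q, y] using this
  have h2 : Tendsto (fun k : ℕ => (k : ℝ) • (iBC (TB (TB^[n] (y k))) - iBC (TB (TB^[n] f)))) atTop
      (𝓝 (fderiv ℝ (fun y => iBC (TB^[n + 1] y)) f z)) := by
    have := hdn'.hasFDerivAt.lim z hk
    simpa only [Function.iterate_succ_apply'] using this
  have h3 : Tendsto (fun k : ℕ => (k : ℝ) • (iBC (TB (TB^[n] (y k))) - iBC (TB (TB^[n] f))) -
      L (q k)) atTop (𝓝 0) := by
    have hb : Tendsto (fun k : ℕ => M * (((k : ℝ)⁻¹) ^ (ρ - 1) * ‖iBC (q k)‖ ^ ρ)) atTop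
        (𝓝 (M * ((0 : ℝ) ^ (ρ - 1) *
          ‖fderiv ℝ (fun y => iBC (TB^[n] y)) f z‖ ^ ρ))) := by
      refine ((tendsto_inv_atTop_nhds_zero_nat.rpow_const (Or.inr (by linarith))).mul
        (h1.norm.rpow_const (Or.inr (by linarith)))).const_mul _
    rw [Real.zero_rpow (by linarith), zero_mul, mul_zero] at hb
    refine squeeze_zero_norm' ?_ hb
    filter_upwards [hy.eventually hrem, eventually_gt_atTop 0] with k hk1 hk0
    have hk0' : (0 : ℝ) < k := by exact_mod_cast hk0
    have e1 : TB^[n] (y k) - TB^[n] f = (k : ℝ)⁻¹ • q k := by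
      simp only [q]
      rw [smul_smul, inv_mul_cancel₀ hk0'.ne', one_smul]
    have e2 : (k : ℝ) • (iBC (TB (TB^[n] (y k))) - iBC (TB (TB^[n] f))) - L (q k) =
        (k : ℝ) • (iBC (TB (TB^[n] (y k))) - iBC (TB (TB^[n] f)) -
          L (TB^[n] (y k) - TB^[n] f)) := by
      simp only [q, map_smul]
      module
    rw [e2, norm_smul, Real.norm_of_nonneg hk0'.le]
    have e3 : (k : ℝ) * ((k : ℝ)⁻¹) ^ ρ = ((k : ℝ)⁻¹) ^ (ρ - 1) := by
      rw [Real.rpow_sub (by positivity), Real.rpow_one]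
      field_simp
    calc (k : ℝ) * _ ≤ k * (M * ‖iBC (TB^[n] (y k) - TB^[n] f)‖ ^ ρ) := by gcongr
      _ = k * (M * (((k : ℝ)⁻¹) ^ ρ * ‖iBC (q k)‖ ^ ρ)) := by
        rw [e1, map_smul, norm_smul, Real.norm_of_nonneg (by positivity : (0 : ℝ) ≤ (k : ℝ)⁻¹),
          Real.mul_rpow (by positivity) (norm_nonneg _)]
      _ = M * ((k * ((k : ℝ)⁻¹) ^ ρ) * ‖iBC (q k)‖ ^ ρ) := by ring
      _ = _ := by rw [e3]
  have h4 : Tendsto (fun k => L (q k)) atTop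
      (𝓝 (fderiv ℝ (fun y => iBC (TB^[n + 1] y)) f z)) := by
    simpa using h2.sub h3
  refine le_of_tendsto_of_tendsto' ((tendsto_const_nhds.sub h4).norm)
    (((tendsto_const_nhds.sub h1).norm).const_mul N) fun k => ?_
  rw [← map_sub, ← map_sub]
  exact hN _

/-- The iterates satisfy the same remainder estimate as the operator itself. -/
theorem IsRobust.exists_remainder_iterate (hR : IsRobust iAB iBC iCD OA T K θ w C₀ lam OB TB)
    (hK : IsHyperbolicBasicSet OA T K P θ 1) (hw : IsUnstableDirection T K P w δ C₀ lam)
    (hS : IsRobustSplitting iAB iBC T K P w lam TB LB LC p ϱB ϱC E) :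
    ∃ ρ > (1 : ℝ), ∀ n, ∃ M > 0, ∃ r > 0, ∀ x ∈ K, ∀ f₁ f₂ : B,
      ‖f₁ - iAB x‖ < r → ‖f₂ - iAB x‖ < r →
      ‖iBC (TB^[n] f₁) - iBC (TB^[n] f₂) - fderiv ℝ (fun y => iBC (TB^[n] y)) f₂ (f₁ - f₂)‖ ≤
        M * ‖iBC (f₁ - f₂)‖ ^ ρ := by
  obtain ⟨ρ, hρ, M₁, hM₁, r₁, hr₁, h₁⟩ := hR.exists_remainder hK
  obtain ⟨N, hN1, r₂, hr₂, h₂⟩ := hR.exists_bound_fderiv hK hw hS 1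
  refine ⟨ρ, hρ, fun n => ?_⟩
  induction n with
  | zero =>
    refine ⟨1, one_pos, 1, one_pos, fun x _ f₁ f₂ _ _ => ?_⟩
    have : fderiv ℝ (fun y => iBC (TB^[0] y)) f₂ = iBC := iBC.fderiv
    rw [this]
    simp only [Function.iterate_zero, id_eq, map_sub, sub_self, norm_zero]
    positivity
  | succ n ih =>
    obtain ⟨M, hM, r, hr, h⟩ := ih
    obtain ⟨N', hN', r₃, hr₃, h₃⟩ := hR.exists_bound_fderiv hK hw hS n
    obtain ⟨Λ, hΛ, r₄, hr₄, h₄⟩ := hR.exists_lipschitz_B hK hS n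
    obtain ⟨r₅, hr₅, h₅⟩ := hR.exists_ball_subset_iterateDomain hK (n + 1)
    have hs : 0 < min r₁ r₂ / Λ := by positivity
    have hc : 0 < (2 * (‖iBC‖ + 1))⁻¹ := by positivity
    refine ⟨N * M + M₁ * (N' + M) ^ ρ, by positivity,
      min (min (min r r₃) (min r₄ r₅)) (min (min r₁ r₂ / Λ) ((2 * (‖iBC‖ + 1))⁻¹)),
      by positivity, ?_⟩
    intro x hx f₁ f₂ hf₁ hf₂
    simp only [lt_min_iff] at hf₁ hf₂
    have hx' := hK.iterate_mem n hx
    have hclose : ∀ f : B, ‖f - iAB x‖ < r₄ → ‖f - iAB x‖ < min r₁ r₂ / Λ →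
        ‖TB^[n] f - iAB (T^[n] x)‖ < min r₁ r₂ := by
      intro f ha hb
      refine (h₄ x hx f ha).trans_lt ?_
      rw [lt_div_iff₀ (by linarith)] at hb
      linarith
    have hcl₁ := hclose f₁ hf₁.1.2.1 hf₁.2.1
    have hcl₂ := hclose f₂ hf₂.1.2.1 hf₂.2.1
    have hdom : f₂ ∈ iterateDomain OB TB (n + 1) :=
      h₅ x hx (by rw [mem_ball, dist_eq_norm]; exact hf₂.1.2.2)
    have hz1 : ‖iBC (f₁ - f₂)‖ ≤ 1 := by
      have e : f₁ - f₂ = (f₁ - iAB x) - (f₂ - iAB x) := by abel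
      have h6 : ‖f₁ - f₂‖ ≤ 2 * (2 * (‖iBC‖ + 1))⁻¹ := by
        rw [e]
        refine (norm_sub_le _ _).trans ?_
        linarith [hf₁.2.2, hf₂.2.2]
      calc ‖iBC (f₁ - f₂)‖ ≤ ‖iBC‖ * ‖f₁ - f₂‖ := iBC.le_opNorm _
        _ ≤ (‖iBC‖ + 1) * (2 * (2 * (‖iBC‖ + 1))⁻¹) := by gcongr; linarith
        _ = 1 := by field_simp
    set Z := ‖iBC (f₁ - f₂)‖ with hZ
    have hZ0 : 0 ≤ Z := norm_nonneg _
    have hZρ : Z ^ ρ ≤ Z := by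
      simpa using Real.rpow_le_rpow_of_exponent_ge' hZ0 hz1 zero_le_one hρ.le
    have hrem := h x hx f₁ f₂ hf₁.1.1.1 hf₂.1.1.1
    have hder := h₃ x hx f₂ hf₂.1.1.2 (f₁ - f₂)
    set u := TB^[n] f₁ - TB^[n] f₂ with hu
    have hu' : iBC u = iBC (TB^[n] f₁) - iBC (TB^[n] f₂) := map_sub _ _ _
    have hub : ‖iBC u‖ ≤ (N' + M) * Z := by
      set Df := fderiv ℝ (fun y => iBC (TB^[n] y)) f₂ (f₁ - f₂)
      calc ‖iBC u‖ = ‖Df + (iBC (TB^[n] f₁) - iBC (TB^[n] f₂) - Df)‖ := by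
            rw [hu']; congr 1; abel
        _ ≤ N' * Z + M * Z ^ ρ := (norm_add_le _ _).trans (add_le_add hder hrem)
        _ ≤ N' * Z + M * Z := by gcongr
        _ = _ := by ring
    have hchain := norm_fderiv_sub_fderiv_iterate_le (TB := TB) (n := n) (f := f₂) (z := f₁ - f₂)
      (M := M₁) hρ
      (hR.differentiableAt (iterateDomain_antitone n.le_succ hdom)) (hR.differentiableAt hdom)
      (h₂ _ hx' _ (hcl₂.trans_le (min_le_right _ _))) (by
        have hnear : ∀ᶠ y in 𝓝 f₂, ‖y - iAB x‖ < r₄ ∧ ‖y - iAB x‖ < min r₁ r₂ / Λ := by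
          have hcont : ContinuousAt (fun y : B => ‖y - iAB x‖) f₂ := by fun_prop
          exact (hcont.eventually (gt_mem_nhds hf₂.1.2.1)).and
            (hcont.eventually (gt_mem_nhds hf₂.2.1))
        filter_upwards [hnear] with y hy
        exact h₁ _ hx' _ _ ((hclose y hy.1 hy.2).trans_le (min_le_left _ _))
          (hcl₂.trans_le (min_le_left _ _))) u
    have hlast := h₁ _ hx' _ _ (hcl₁.trans_le (min_le_left _ _)) (hcl₂.trans_le (min_le_left _ _))
    rw [← hu] at hlast
    simp only [Function.iterate_succ_apply'] at hchain ⊢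
    set Df' := fderiv ℝ (fun y => iBC (TB (TB^[n] y))) f₂ (f₁ - f₂)
    set Lu := fderiv ℝ (fun y => iBC (TB y)) (TB^[n] f₂) u
    calc ‖iBC (TB (TB^[n] f₁)) - iBC (TB (TB^[n] f₂)) - Df'‖
        = ‖(Lu - Df') + (iBC (TB (TB^[n] f₁)) - iBC (TB (TB^[n] f₂)) - Lu)‖ := by
          congr 1; abel
      _ ≤ N * (M * Z ^ ρ) + M₁ * ((N' + M) * Z) ^ ρ := by
          refine (norm_add_le _ _).trans (add_le_add (hchain.trans ?_) (hlast.trans ?_))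
          · rw [hu']; gcongr
          · gcongr
      _ = _ := by rw [Real.mul_rpow (by positivity) hZ0]; ring

/-- Near the basic set the derivative in the unstable direction is Hölder continuous. -/
theorem IsRobustSplitting.exists_holder_unstable
    (hw : IsUnstableDirection T K P w δ C₀ lam) {ρ : ℝ} (hρ : 1 < ρ) {n : ℕ} (hn : 0 < n)
    (hS : IsRobustSplitting iAB iBC T K P w lam TB LB LC p ϱB ϱC E)
    (hK : IsHyperbolicBasicSet OA T K P θ 1) {M r : ℝ} (hM : 0 < M) (hr : 0 < r)
    (h : ∀ x ∈ K, ∀ f₁ f₂ : B, ‖f₁ - iAB x‖ < r → ‖f₂ - iAB x‖ < r →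
      ‖iBC (TB^[n] f₁) - iBC (TB^[n] f₂) - fderiv ℝ (fun y => iBC (TB^[n] y)) f₂ (f₁ - f₂)‖ ≤
        M * ‖iBC (f₁ - f₂)‖ ^ ρ) :
    ∃ M' > 0, ∃ r' > 0, ∀ x ∈ K, ∀ f : B, ‖f - iAB x‖ < r' →
      ‖fderiv ℝ (fun y => iBC (TB^[n] y)) f (iAB (w x)) -
        linearCocycle T LC n x (iBC (iAB (w x)))‖ ≤ M' * ‖f - iAB x‖ ^ (ρ - 1) := by
  set c : ℝ := (‖iBC‖ + 1) * (1 + ‖iAB‖) with hc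
  have hc0 : 0 < c := by positivity
  refine ⟨3 * M * c ^ ρ, by positivity, r / (1 + ‖iAB‖), by positivity, fun x hx f hf => ?_⟩
  rw [linearCocycle_map hK.mapsTo iBC hS.map_cocycle n hx, ← hS.fderiv_eq n hn x hx]
  rcases eq_or_ne f (iAB x) with rfl | hne
  · rw [sub_self, norm_zero]; positivity
  set h₀ : ℝ := ‖f - iAB x‖ with hh₀
  have hpos : 0 < h₀ := norm_pos_iff.2 (sub_ne_zero.2 hne)
  rw [lt_div_iff₀ (by positivity)] at hf
  have hwB : ‖iAB (w x)‖ ≤ ‖iAB‖ := by simpa [hw.norm_eq_one x hx] using iAB.le_opNorm (w x)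
  set W := iAB (w x)
  have hfr : h₀ < r := lt_of_le_of_lt (by nlinarith [norm_nonneg iAB]) hf
  have hhW : ‖h₀ • W‖ ≤ h₀ * ‖iAB‖ := by
    rw [norm_smul, Real.norm_of_nonneg hpos.le]; gcongr
  have hg : ‖f + h₀ • W - iAB x‖ ≤ h₀ * (1 + ‖iAB‖) := by
    rw [add_sub_right_comm]
    exact (norm_add_le _ _).trans (by rw [← hh₀]; linarith)
  have hx0 : ‖iAB x - iAB x‖ < r := by simpa using hr
  have e1 := h x hx (f + h₀ • W) f (hg.trans_lt hf) hfr
  have e2 := h x hx (f + h₀ • W) (iAB x) (hg.trans_lt hf) hx0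
  have e3 := h x hx f (iAB x) hfr hx0
  have hb : ∀ z : B, ‖z‖ ≤ h₀ * (1 + ‖iAB‖) → M * ‖iBC z‖ ^ ρ ≤ M * (c ^ ρ * h₀ ^ ρ) := by
    intro z hz
    rw [← Real.mul_rpow hc0.le hpos.le]
    gcongr
    calc ‖iBC z‖ ≤ ‖iBC‖ * ‖z‖ := iBC.le_opNorm _
      _ ≤ (‖iBC‖ + 1) * (h₀ * (1 + ‖iAB‖)) := by gcongr; linarith
      _ = c * h₀ := by rw [hc]; ring
  replace e1 := e1.trans (hb _ (by rw [add_sub_cancel_left]; nlinarith))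
  replace e2 := e2.trans (hb _ hg)
  replace e3 := e3.trans (hb _ (by rw [← hh₀]; nlinarith [norm_nonneg iAB]))
  rw [add_sub_cancel_left, map_smul] at e1
  rw [add_sub_right_comm, map_add, map_smul] at e2
  set D₁ := fderiv ℝ (fun y => iBC (TB^[n] y)) f W
  set D₂ := fderiv ℝ (fun y => iBC (TB^[n] y)) (iAB x) W
  set D₃ := fderiv ℝ (fun y => iBC (TB^[n] y)) (iAB x) (f - iAB x)
  set a₁ := iBC (TB^[n] (f + h₀ • W))
  set a₂ := iBC (TB^[n] f)
  set a₃ := iBC (TB^[n] (iAB x))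
  have e4 : h₀ * ‖D₁ - D₂‖ ≤ 3 * (M * (c ^ ρ * h₀ ^ ρ)) := by
    rw [← Real.norm_of_nonneg hpos.le, ← norm_smul, Real.norm_of_nonneg hpos.le]
    calc ‖h₀ • (D₁ - D₂)‖ = ‖(a₁ - a₃ - (D₃ + h₀ • D₂)) - (a₂ - a₃ - D₃) -
          (a₁ - a₂ - h₀ • D₁)‖ := by congr 1; module
      _ ≤ _ := (norm_sub_le _ _).trans (add_le_add (norm_sub_le _ _) le_rfl)
      _ ≤ _ := by linarith
  have e5 : h₀ ^ ρ = h₀ * h₀ ^ (ρ - 1) := by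
    rw [Real.rpow_sub hpos, Real.rpow_one]; field_simp
  rw [e5] at e4
  have e6 : h₀ * ‖D₁ - D₂‖ ≤ h₀ * (3 * M * c ^ ρ * h₀ ^ (ρ - 1)) := by linarith
  exact le_of_mul_le_mul_left e6 hpos

end Estimates

/-! ### A large iterate of a robust operator -/

/-- The data and the estimates that are used of a large iterate of a robust operator: `φ` is the
iterate `T^m` on `A` and `G` the same iterate of the extended operator on `B`. The functional `p x`
is the unstable coefficient, `dl x` the expansion of the unstable direction, `L x` the derivative at
`x` as an operator of `C`, and `DG f` the derivative of `G` at `f` as an operator from `B` to `C`.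
The expansion `dl x` is between `κ` and `Λ`, the functionals `p x` are bounded by `q`, and `M`, `β`
are the constant and the exponent of the Hölder estimates, which hold within `r` of the basic set.
The step need not be continuous in `B`: on the open set `dom n` its `n`-th iterate is a `C¹` map
into `C`. -/
structure RobustStep {A B C : Type*} [NormedAddCommGroup A] [NormedSpace ℝ A]
    [NormedAddCommGroup B] [NormedSpace ℝ B] [NormedAddCommGroup C] [NormedSpace ℝ C]
    (iAB : A →L[ℝ] B) (iBC : B →L[ℝ] C) (OA : Set A) (T : A → A) (K : Set A) (OB : Set B)
    (TB : B → B) (w : A → A) where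
  φ : A → A
  G : B → B
  dom : ℕ → Set B
  p : A → C →L[ℝ] ℝ
  L : A → C →L[ℝ] C
  dl : A → ℝ
  DG : B → B →L[ℝ] C
  κ : ℝ
  q : ℝ
  Λ : ℝ
  M : ℝ
  β : ℝ
  r : ℝ
  w_norm : ∀ x ∈ K, ‖w x‖ = 1
  w_cont : ContinuousOn w K
  κ_ge : 6 ≤ κ
  q_ge : 1 ≤ q
  Λ_ge : 1 ≤ Λ
  M_pos : 0 < M
  β_pos : 0 < β
  r_pos : 0 < r
  mapsTo : MapsTo φ K K
  injOn : InjOn φ K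
  φ_cont : ContinuousOn φ K
  conj : ∀ x ∈ K, G (iAB x) = iAB (φ x)
  p_norm : ∀ x ∈ K, ‖p x‖ ≤ q
  p_unstable : ∀ x ∈ K, p x (iBC (iAB (w x))) = 1
  κ_le : ∀ x ∈ K, κ ≤ dl x
  dl_le : ∀ x ∈ K, dl x ≤ Λ
  p_L : ∀ x ∈ K, ∀ v, p (φ x) (L x v) = dl x * p x v
  L_unstable : ∀ x ∈ K, L x (iBC (iAB (w x))) = dl x • iBC (iAB (w (φ x)))
  /-- The iterate is so large that the expansion dominates all that happens on `ker (p x)`. -/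
  L_slow : ∀ x ∈ K, ∀ v, ‖L x (v - p x v • iBC (iAB (w x)))‖ ≤ κ / 56 * ‖v‖
  remainder : ∀ x ∈ K, ∀ f₁ f₂ : B, ‖f₁ - iAB x‖ < r → ‖f₂ - iAB x‖ < r →
    ‖iBC (G f₁) - iBC (G f₂) - DG f₂ (f₁ - f₂)‖ ≤ M * ‖iBC (f₁ - f₂)‖ ^ (1 + β)
  /-- The derivative is Hölder continuous in the unstable direction only; in the other directions it
  is close to `L x` in comparison with the expansion. -/
  deriv_close : ∀ x ∈ K, ∀ f : B, ‖f - iAB x‖ < r → ∀ (t : ℝ) (v : B),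
    ‖DG f (t • iAB (w x) + v) - L x (iBC (t • iAB (w x) + v))‖ ≤
      |t| * (M * ‖f - iAB x‖ ^ β) + κ / 8 * ‖iBC v‖
  /-- In `B`, everything but the unstable part is contracted. -/
  approx_B : ∀ x ∈ K, ∀ v : B, ‖v‖ < r →
    ‖G (iAB x + v) - iAB (φ x) - (dl x * p x (iBC v)) • iAB (w (φ x))‖ ≤ 13 / 50 * ‖v‖
  /-- A later iterate expands the unstable part by more than any given factor `Θ`. -/
  approx_iterate_B : ∀ Θ : ℝ, ∃ J > 0, ∃ r' > 0, ∀ x ∈ K, ∀ v : B, ‖v‖ < r' → ∃ d ≥ Θ,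
    ‖G^[J] (iAB x + v) - iAB (φ^[J] x) - (d * p x (iBC v)) • iAB (w (φ^[J] x))‖ ≤ 1 / 2 * ‖v‖
  isOpen_dom : ∀ n, IsOpen (dom n)
  smooth : ∀ n, ContDiffOn ℝ 1 (fun y => iBC (G^[n] y)) (dom n)
  subset_dom : ∀ n (U : Set B), IsOpen U →
    (∀ y ∈ U, ∀ k ≤ n, ∃ x ∈ K, ‖G^[k] y - iAB x‖ < r) → U ⊆ dom n
  /-- In `A`, where the step is strictly differentiable, everything but the unstable part is
  contracted. -/
  approx_A : ∀ e > 0, ∃ r' > 0, ∀ x ∈ K, ∀ f₁ f₂ : A, ‖f₁ - x‖ < r' → ‖f₂ - x‖ < r' →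
    (1 + q * (‖iBC‖ * ‖iAB‖)) *
        ‖φ f₁ - φ f₂ - (dl x * p x (iBC (iAB (f₁ - f₂)))) • w (φ x)‖ ≤
      1 / 10 * ‖f₁ - f₂ - p x (iBC (iAB (f₁ - f₂))) • w x‖ + e * ‖f₁ - f₂‖
  projection_cont : ∀ e > 0, ∃ r' > 0, ∀ x ∈ K, ∀ y ∈ K, ‖x - y‖ < r' → ∀ v : A,
    ‖p x (iBC (iAB v)) • w x - p y (iBC (iAB v)) • w y‖ ≤ e * ‖v‖
  unstable_orbit : ∀ ε g f, f ∈ localUnstableSet OA T K ε g → ∃ x y : ℕ → A, x 0 = g ∧ y 0 = f ∧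
    ∀ n, x n ∈ K ∧ φ (x (n + 1)) = x n ∧ φ (y (n + 1)) = y n ∧
      G (iAB (y (n + 1))) = iAB (y n) ∧ ‖y n - x n‖ < ε
  stable_orbit : ∀ ε, ∀ x ∈ K, ∀ y ∈ localStableSet OB TB ε (iAB x), ∀ k,
    ‖G^[k] y - iAB (φ^[k] x)‖ < ε
  mem_stable : ∀ ε > 0, ∃ r' > 0, ∀ x ∈ K, ∀ y, (∀ k, ‖G^[k] y - iAB (φ^[k] x)‖ < r') →
    Tendsto (fun k => ‖G^[k] y - iAB (φ^[k] x)‖) atTop (𝓝 0) → y ∈ localStableSet OB TB ε (iAB x)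

section StepConstruction

variable {A B C D : Type*}
  [NormedAddCommGroup A] [NormedSpace ℝ A] [NormedAddCommGroup B] [NormedSpace ℝ B]
  [NormedAddCommGroup C] [NormedSpace ℝ C] [NormedAddCommGroup D] [NormedSpace ℝ D]
  {iAB : A →L[ℝ] B} {iBC : B →L[ℝ] C} {iCD : C →L[ℝ] D}
  {OA : Set A} {T : A → A} {K : Set A} {P : A → A →L[ℝ] A} {θ : ℝ}
  {w : A → A} {δ : A → ℝ} {C₀ lam : ℝ} {OB : Set B} {TB : B → B}
  {LB : A → B →L[ℝ] B} {LC : A → C →L[ℝ] C} {p : A → C →L[ℝ] ℝ} {ϱB ϱC E : ℝ}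

theorem IsHyperbolicBasicSet.contDiffAt_iterate (hK : IsHyperbolicBasicSet OA T K P θ 1)
    (hOA : IsOpen OA) (hT : ContDiffOn ℝ 2 T OA) (n : ℕ) {x : A} (hx : x ∈ K) :
    ContDiffAt ℝ 2 (T^[n]) x := by
  induction n with
  | zero => exact contDiffAt_id
  | succ n ih =>
    rw [Function.iterate_succ']
    exact (hK.contDiffAt hOA hT (hK.iterate_mem n hx)).comp x ih

/-- The iterates of `T` are strictly differentiable uniformly on the basic set. -/
theorem IsHyperbolicBasicSet.exists_uniform_strict (hK : IsHyperbolicBasicSet OA T K P θ 1)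
    (hOA : IsOpen OA) (hT : ContDiffOn ℝ 2 T OA) (n : ℕ) {e : ℝ} (he : 0 < e) :
    ∃ r > 0, ∀ x ∈ K, ∀ f₁ f₂ : A, ‖f₁ - x‖ < r → ‖f₂ - x‖ < r →
      ‖T^[n] f₁ - T^[n] f₂ - fderiv ℝ (T^[n]) x (f₁ - f₂)‖ ≤ e * ‖f₁ - f₂‖ := by
  have h1 : ∀ x ∈ K, ∃ r > 0, (∀ y ∈ ball x r, ‖fderiv ℝ (T^[n]) y - fderiv ℝ (T^[n]) x‖ ≤ e / 2) ∧
      ∀ f₁ ∈ ball x r, ∀ f₂ ∈ ball x r,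
        ‖T^[n] f₁ - T^[n] f₂ - fderiv ℝ (T^[n]) x (f₁ - f₂)‖ ≤ e / 2 * ‖f₁ - f₂‖ := by
    intro x hx
    have hc := hK.contDiffAt_iterate hOA hT n hx
    have hs := hc.hasStrictFDerivAt (by norm_num)
    have h2 := (hs.isLittleO.def (half_pos he))
    rw [nhds_prod_eq] at h2
    obtain ⟨r₁, hr₁, h3⟩ := (Metric.nhds_basis_ball.prod_self.eventually_iff).1 h2
    have hcont : ContinuousAt (fderiv ℝ (T^[n])) x :=
      (hc.fderiv_right (m := 1) (by norm_num)).continuousAt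
    obtain ⟨r₂, hr₂, h4⟩ := Metric.continuousAt_iff.1 hcont (e / 2) (half_pos he)
    refine ⟨min r₁ r₂, lt_min hr₁ hr₂, fun y hy => ?_, fun f₁ hf₁ f₂ hf₂ => ?_⟩
    · rw [← dist_eq_norm]
      exact (h4 ((mem_ball.1 hy).trans_le (min_le_right _ _))).le
    · exact h3 (x := (f₁, f₂)) ⟨ball_subset_ball (min_le_left _ _) hf₁,
        ball_subset_ball (min_le_left _ _) hf₂⟩
  choose! R hR0 hR1 hR2 using h1
  obtain ⟨r, hr, hleb⟩ := lebesgue_number_lemma_of_metric (c := fun g : K => ball (g : A) (R g))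
    hK.isCompact (fun g => isOpen_ball) (fun g hg =>
      mem_iUnion.2 ⟨⟨g, hg⟩, mem_ball_self (hR0 g hg)⟩)
  refine ⟨r, hr, fun x hx f₁ f₂ hf₁ hf₂ => ?_⟩
  obtain ⟨g, hg⟩ := hleb x hx
  have ha := hR1 g g.2 x (hg (mem_ball_self hr))
  have hb := hR2 g g.2 f₁ (hg (by rwa [mem_ball, dist_eq_norm])) f₂
    (hg (by rwa [mem_ball, dist_eq_norm]))
  have hc := (fderiv ℝ (T^[n]) x - fderiv ℝ (T^[n]) g).le_opNorm (f₁ - f₂)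
  rw [sub_apply] at hc
  set u := fderiv ℝ (T^[n]) x (f₁ - f₂)
  set u' := fderiv ℝ (T^[n]) g (f₁ - f₂)
  calc ‖T^[n] f₁ - T^[n] f₂ - u‖ = ‖(T^[n] f₁ - T^[n] f₂ - u') - (u - u')‖ := by congr 1; abel
    _ ≤ e / 2 * ‖f₁ - f₂‖ + e / 2 * ‖f₁ - f₂‖ :=
      (norm_sub_le _ _).trans (add_le_add hb (hc.trans (by gcongr)))
    _ = _ := by ring

theorem exists_pos_le_of_lt (f : ℕ → ℝ) (hf : ∀ n, 0 < f n) (n : ℕ) : ∃ r > 0, ∀ j < n, r ≤ f j := by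
  induction n with
  | zero => exact ⟨1, one_pos, by simp⟩
  | succ n ih =>
    obtain ⟨r, hr, h⟩ := ih
    refine ⟨min r (f n), lt_min hr (hf n), fun j hj => ?_⟩
    rcases Nat.lt_succ_iff_lt_or_eq.1 hj with h1 | rfl
    · exact (min_le_left _ _).trans (h j h1)
    · exact min_le_right _ _

/-- An orbit of the extended operator all of whose times divisible by `m` are close to an orbit of
the basic set, and asymptotic to it, is in the local stable set. -/
theorem IsRobust.exists_mem_localStableSet (hR : IsRobust iAB iBC iCD OA T K θ w C₀ lam OB TB)
    (hK : IsHyperbolicBasicSet OA T K P θ 1)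
    (hS : IsRobustSplitting iAB iBC T K P w lam TB LB LC p ϱB ϱC E) {m : ℕ} (hm : 0 < m)
    {ε : ℝ} (hε : 0 < ε) :
    ∃ r > 0, ∀ x ∈ K, ∀ y, (∀ k, ‖(TB^[m])^[k] y - iAB ((T^[m])^[k] x)‖ < r) →
      Tendsto (fun k => ‖(TB^[m])^[k] y - iAB ((T^[m])^[k] x)‖) atTop (𝓝 0) →
      y ∈ localStableSet OB TB ε (iAB x) := by
  choose M hM1 r hr h using hR.exists_lipschitz_B hK hS
  obtain ⟨r₁, hr₁, h₁⟩ := exists_pos_le_of_lt r hr m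
  obtain ⟨r₂, hr₂, h₂⟩ := hR.exists_ball_subset_iterateDomain hK m
  set N : ℝ := 1 + ∑ j ∈ Finset.range m, M j with hN
  have hM0 : ∀ j, 0 ≤ M j := fun j => zero_le_one.trans (hM1 j)
  have hNpos : 0 < N := by have := Finset.sum_nonneg fun j (_ : j ∈ Finset.range m) => hM0 j; linarith
  have hMN : ∀ j < m, M j ≤ N := fun j hj => by
    have := Finset.single_le_sum (fun j _ => hM0 j) (Finset.mem_range.2 hj)
    linarith
  refine ⟨min (min r₁ r₂) (ε / N), by positivity, fun x hx y hy hlim => ?_⟩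
  have key : ∀ n, ‖TB^[n] y - TB^[n] (iAB x)‖ ≤
      N * ‖(TB^[m])^[n / m] y - iAB ((T^[m])^[n / m] x)‖ := by
    intro n
    have hj : n % m < m := Nat.mod_lt n hm
    have hn : n = n % m + m * (n / m) := (Nat.mod_add_div n m).symm
    have h3 := hy (n / m)
    simp only [lt_min_iff] at h3
    have hx' : (T^[m])^[n / m] x ∈ K := by
      rw [← Function.iterate_mul]; exact hK.iterate_mem _ hx
    have h4 := h (n % m) _ hx' ((TB^[m])^[n / m] y) (h3.1.1.trans_le (h₁ _ hj))
    rw [hR.iterate_map_of_mem hK n hx]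
    conv_lhs => rw [hn]
    rw [Function.iterate_add_apply, Function.iterate_add_apply, Function.iterate_mul,
      Function.iterate_mul]
    exact h4.trans (by gcongr; exact hMN _ hj)
  have hlt : ∀ n, ‖TB^[n] y - TB^[n] (iAB x)‖ < ε := by
    intro n
    refine (key n).trans_lt ?_
    have h3 := (hy (n / m)).trans_le (min_le_right _ _)
    rw [lt_div_iff₀ hNpos] at h3
    linarith
  refine ⟨fun n => ?_, fun n => by rw [mem_ball, dist_eq_norm]; exact hlt n, ?_⟩
  · have hj : n % m < m := Nat.mod_lt n hm
    have hn : n = n % m + m * (n / m) := (Nat.mod_add_div n m).symm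
    have h3 := hy (n / m)
    simp only [lt_min_iff] at h3
    have hx' : (T^[m])^[n / m] x ∈ K := by
      rw [← Function.iterate_mul]; exact hK.iterate_mem _ hx
    have h5 : (TB^[m])^[n / m] y ∈ iterateDomain OB TB m :=
      h₂ _ hx' (by rw [mem_ball, dist_eq_norm]; exact h3.1.2)
    rw [hn, Function.iterate_add_apply, Function.iterate_mul]
    exact (interior_subset h5).2 _ hj
  · have h6 : Tendsto (fun n : ℕ => n / m) atTop atTop :=
      Nat.tendsto_div_const_atTop hm.ne'
    have h7 := (hlim.comp h6).const_mul N
    rw [mul_zero] at h7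
    exact squeeze_zero (fun n => norm_nonneg _) key h7

theorem IsRobust.exists_backward_orbit (hR : IsRobust iAB iBC iCD OA T K θ w C₀ lam OB TB)
    (m : ℕ) {ε : ℝ} {g f : A} (hf : f ∈ localUnstableSet OA T K ε g) :
    ∃ x y : ℕ → A, x 0 = g ∧ y 0 = f ∧
    ∀ n, x n ∈ K ∧ T^[m] (x (n + 1)) = x n ∧ T^[m] (y (n + 1)) = y n ∧
      TB^[m] (iAB (y (n + 1))) = iAB (y n) ∧ ‖y n - x n‖ < ε := by
  obtain ⟨x, y, hx0, hy0, hx, hy, -⟩ := hf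
  have hxj : ∀ j n, T^[j] (x (n + j)) = x n := by
    intro j
    induction j with
    | zero => simp
    | succ j ih => intro n; rw [Function.iterate_succ_apply, ← add_assoc, (hx _).2, ih]
  have hyj : ∀ j n, T^[j] (y (n + j)) = y n := by
    intro j
    induction j with
    | zero => simp
    | succ j ih => intro n; rw [Function.iterate_succ_apply, ← add_assoc, (hy _).2.2, ih]
  refine ⟨fun k => x (m * k), fun k => y (m * k), by simpa using hx0, by simpa using hy0,
    fun n => ⟨(hx _).1, ?_, ?_, ?_, ?_⟩⟩
  · dsimp only; rw [Nat.mul_succ]; exact hxj _ _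
  · dsimp only; rw [Nat.mul_succ]; exact hyj _ _
  · dsimp only
    rw [hR.iterate_map, Nat.mul_succ, hyj]
    intro k hk
    have e : m * (n + 1) = (m * n + (m - k)) + k := by rw [Nat.mul_succ]; omega
    rw [e, hyj]
    have e' : m * n + (m - k) = (m * n + (m - k) - 1) + 1 := by omega
    rw [e']
    exact (hy _).2.1
  · rw [← dist_eq_norm]; exact (hy _).1

theorem IsRobustSplitting.norm_linearCocycle_sub_le
    (hS : IsRobustSplitting iAB iBC T K P w lam TB LB LC p ϱB ϱC E)
    (hK : IsHyperbolicBasicSet OA T K P θ 1) (hw : IsUnstableDirection T K P w δ C₀ lam)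
    (n : ℕ) {x : A} (hx : x ∈ K) (v : B) :
    ‖linearCocycle T LB n x v - (unstableGrowth T δ n x * p x (iBC v)) • iAB (w (T^[n] x))‖ ≤
      E * ϱB ^ n * ‖v‖ := by
  have h1 := hS.split_B.slow x hx v n
  rw [map_sub, map_smul, hS.split_B.linearCocycle_unstable hK hw n hx, smul_smul, mul_comm] at h1
  exact h1

/-- A robust operator has a large iterate that satisfies all the estimates of `RobustStep`. -/
theorem IsRobust.nonempty_robustStep (hR : IsRobust iAB iBC iCD OA T K θ w C₀ lam OB TB)
    (hK : IsHyperbolicBasicSet OA T K P θ 1) (hOA : IsOpen OA) (hT : ContDiffOn ℝ 2 T OA)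
    (hw : IsUnstableDirection T K P w δ C₀ lam) :
    Nonempty (RobustStep iAB iBC OA T K OB TB w) := by
  obtain ⟨LB, LC, p, ϱB, ϱC, E, hS⟩ := hR.exists_isRobustSplitting hK hOA hT hw
  have hl := hw.one_lt_lam
  have hC0 := hw.C₀_pos
  have hE := hS.split_B.one_le
  have hϱB := hS.split_B.rate_pos
  have hϱC := hS.split_C.rate_pos
  have hθ := hK.exponent_pos
  obtain ⟨c₃, ⟨m₃, -, hc₃⟩, hB⟩ := hR.exists_approximation_B hK hS
  obtain ⟨c₂, ⟨m₂, -, hc₂⟩, hC⟩ := hR.exists_approximation_C hK hS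
  obtain ⟨c, hc, hcontr⟩ := hK.contracting
  have hlam : Tendsto (fun n : ℕ => C₀ * lam ^ n) atTop atTop :=
    (tendsto_pow_atTop_atTop_of_one_lt hl).const_mul_atTop hC0
  have hEB : Tendsto (fun n : ℕ => E * ϱB ^ n) atTop (𝓝 0) := by
    simpa using (tendsto_pow_atTop_nhds_zero_of_lt_one hϱB.le hS.rate_B).const_mul E
  have hEC : Tendsto (fun n : ℕ => E * (ϱC / lam) ^ n) atTop (𝓝 0) := by
    simpa using (tendsto_pow_atTop_nhds_zero_of_lt_one (by positivity)
      ((div_lt_one (by linarith)).2 hS.rate_C)).const_mul E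
  have hcA : 0 < 1 + E * (‖iBC‖ * ‖iAB‖) := by positivity
  have hcθ : Tendsto (fun n : ℕ => (1 + E * (‖iBC‖ * ‖iAB‖)) * c * θ ^ n) atTop (𝓝 0) := by
    simpa using (tendsto_pow_atTop_nhds_zero_of_lt_one hθ.le hK.exponent_lt_one).const_mul
      ((1 + E * (‖iBC‖ * ‖iAB‖)) * c)
  -- a single iterate beyond which all the asymptotic estimates are in force
  obtain ⟨m, hm0, hm₃, hm₂, hmlam, hmB, hmC, hmθ⟩ : ∃ m : ℕ, 0 < m ∧ m₃ < m ∧ m₂ < m ∧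
      6 ≤ C₀ * lam ^ m ∧ E * ϱB ^ m < 1 / 100 ∧ E * (ϱC / lam) ^ m < C₀ / 56 ∧
      (1 + E * (‖iBC‖ * ‖iAB‖)) * c * θ ^ m < 1 / 10 :=
    ((eventually_gt_atTop 0).and ((eventually_gt_atTop m₃).and ((eventually_gt_atTop m₂).and
      ((hlam.eventually_ge_atTop 6).and ((hEB.eventually (gt_mem_nhds (by norm_num))).and
      ((hEC.eventually (gt_mem_nhds (by positivity))).and
      (hcθ.eventually (gt_mem_nhds (by norm_num))))))))).exists
  obtain ⟨-, r₁, hr₁, h₁⟩ := hB m hm0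
  obtain ⟨-, r₂, hr₂, h₂⟩ := hC m hm0
  obtain ⟨ρ, hρ, hrem⟩ := hR.exists_remainder_iterate hK hw hS
  obtain ⟨M₁, hM₁, r₃, hr₃, h₃⟩ := hrem m
  obtain ⟨M₂, hM₂, r₄, hr₄, h₄⟩ := IsRobustSplitting.exists_holder_unstable hw hρ hm0 hS hK hM₁ hr₃ h₃
  obtain ⟨r₅, hr₅, h₅⟩ := hR.exists_ball_subset_iterateDomain hK m
  set κ : ℝ := C₀ * lam ^ m with hκ
  set r : ℝ := min (min (min r₁ r₂) (min r₃ r₄)) r₅ with hr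
  have hr₁' : r ≤ r₁ := (min_le_left _ _).trans ((min_le_left _ _).trans (min_le_left _ _))
  have hr₂' : r ≤ r₂ := (min_le_left _ _).trans ((min_le_left _ _).trans (min_le_right _ _))
  have hr₃' : r ≤ r₃ := (min_le_left _ _).trans ((min_le_right _ _).trans (min_le_left _ _))
  have hr₄' : r ≤ r₄ := (min_le_left _ _).trans ((min_le_right _ _).trans (min_le_right _ _))
  have hr₅' : r ≤ r₅ := min_le_right _ _
  have hlm : 0 < lam ^ m := by positivity
  have hgrow : ∀ x ∈ K, κ ≤ unstableGrowth T δ m x := fun x hx => (hw.lt_growth hm0 hx).le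
  have hit : ∀ x ∈ K, T^[m] x ∈ K := fun x hx => hK.iterate_mem m hx
  refine ⟨{
    φ := T^[m]
    G := TB^[m]
    dom := fun n => iterateDomain OB TB (m * n)
    p := p
    L := fun x => linearCocycle T LC m x
    dl := unstableGrowth T δ m
    DG := fun f => fderiv ℝ (fun y => iBC (TB^[m] y)) f
    κ := κ
    q := E
    Λ := E * (E ^ m * (‖iBC‖ * ‖iAB‖)) + 1
    M := max M₁ M₂
    β := ρ - 1
    r := r
    w_norm := hw.norm_eq_one
    w_cont := hw.continuousOn
    κ_ge := hmlam
    q_ge := hE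
    Λ_ge := by
      have : 0 ≤ E * (E ^ m * (‖iBC‖ * ‖iAB‖)) := by positivity
      linarith
    M_pos := lt_max_of_lt_left hM₁
    β_pos := by linarith
    r_pos := by positivity
    mapsTo := hit
    injOn := hK.bijOn.injOn.iterate hK.mapsTo m
    φ_cont := fun x hx =>
      (hK.hasFDerivAt_iterate hOA hT m hx).continuousAt.continuousWithinAt
    conj := fun x hx => hR.iterate_map_of_mem hK m hx
    p_norm := hS.split_C.coeff_norm_le
    p_unstable := hS.split_C.coeff_unstable
    κ_le := hgrow
    dl_le := ?_
    p_L := fun x hx v => hS.split_C.coeff_linearCocycle hS.rate_C hK hw m hx v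
    L_unstable := fun x hx => hS.split_C.linearCocycle_unstable hK hw m hx
    L_slow := ?_
    remainder := ?_
    deriv_close := ?_
    approx_B := ?_
    approx_iterate_B := ?_
    isOpen_dom := fun n => isOpen_interior
    smooth := ?_
    subset_dom := ?_
    approx_A := ?_
    projection_cont := ?_
    unstable_orbit := fun ε g f hf => hR.exists_backward_orbit m hf
    stable_orbit := ?_
    mem_stable := fun ε hε => hR.exists_mem_localStableSet hK hS hm0 hε }⟩
  · intro x hx
    have h6 := hS.split_C.coeff_linearCocycle hS.rate_C hK hw m hx (iBC (iAB (w x)))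
    rw [show p x (iBC (iAB (w x))) = 1 from hS.split_C.coeff_unstable x hx, mul_one] at h6
    have h7 : ‖iBC (iAB (w x))‖ ≤ ‖iBC‖ * ‖iAB‖ := by
      refine (iBC.le_opNorm _).trans ?_
      gcongr
      simpa [hw.norm_eq_one x hx] using iAB.le_opNorm (w x)
    rw [← h6]
    refine (le_abs_self _).trans ?_
    rw [← Real.norm_eq_abs]
    refine ((p (T^[m] x)).le_opNorm _).trans (le_trans ?_ (le_add_of_nonneg_right zero_le_one))
    gcongr
    · exact hS.split_C.coeff_norm_le _ (hit x hx)
    · refine (ContinuousLinearMap.le_opNorm _ _).trans ?_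
      gcongr
      exact norm_linearCocycle_le hK.mapsTo hE hS.split_C.norm_le m hx
  · intro x hx v
    refine (hS.split_C.slow x hx v m).trans ?_
    gcongr
    rw [div_pow, mul_div_assoc', div_lt_iff₀ hlm] at hmC
    rw [hκ]; linarith
  · intro x hx f₁ f₂ hf₁ hf₂
    rw [add_sub_cancel]
    refine (h₃ x hx f₁ f₂ (hf₁.trans_le hr₃') (hf₂.trans_le hr₃')).trans ?_
    gcongr
    exact le_max_left _ _
  · intro x hx f hf t v
    have h6 := h₄ x hx f (hf.trans_le hr₄')
    have h7 := h₂ x hx f (hf.trans_le hr₂') v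
    set Df := fderiv ℝ (fun y => iBC (TB^[m] y)) f
    have e : Df (t • iAB (w x) + v) - linearCocycle T LC m x (iBC (t • iAB (w x) + v)) =
        t • (Df (iAB (w x)) - linearCocycle T LC m x (iBC (iAB (w x)))) +
          (Df v - linearCocycle T LC m x (iBC v)) := by
      simp only [map_add, map_smul]; module
    rw [e]
    refine (norm_add_le _ _).trans (add_le_add ?_ (h7.trans ?_))
    · rw [norm_smul, Real.norm_eq_abs]
      gcongr
      exact h6.trans (by gcongr; exact le_max_right _ _)
    · gcongr
      rw [hκ]
      have := hc₂ m hm₂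
      nlinarith
  · intro x hx v hv
    have h6 := h₁ x hx v (hv.trans_le hr₁')
    have h7 := hS.norm_linearCocycle_sub_le hK hw m hx v
    have h8 := hc₃ m hm₃
    have hv0 := norm_nonneg v
    calc _ = ‖(TB^[m] (iAB x + v) - iAB (T^[m] x) - linearCocycle T LB m x v) +
          (linearCocycle T LB m x v -
            (unstableGrowth T δ m x * p x (iBC v)) • iAB (w (T^[m] x)))‖ := by congr 1; abel
      _ ≤ c₃ m * ‖v‖ + E * ϱB ^ m * ‖v‖ := (norm_add_le _ _).trans (add_le_add h6 h7)
      _ ≤ 1 / 4 * ‖v‖ + 1 / 100 * ‖v‖ := by gcongr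
      _ = _ := by ring
  · intro Θ
    have hmJ : Tendsto (fun J : ℕ => m * J) atTop atTop :=
      tendsto_id.const_mul_atTop' hm0
    obtain ⟨J, hJ0, hJ₃, hJlam, hJB⟩ : ∃ J : ℕ, 0 < J ∧ m₃ < m * J ∧ Θ ≤ C₀ * lam ^ (m * J) ∧
        E * ϱB ^ (m * J) < 1 / 4 :=
      ((eventually_gt_atTop 0).and ((hmJ.eventually_gt_atTop m₃).and
        (((hlam.comp hmJ).eventually_ge_atTop Θ).and
        ((hEB.comp hmJ).eventually (gt_mem_nhds (by norm_num)))))).exists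
    have hmJ0 : 0 < m * J := Nat.mul_pos hm0 hJ0
    obtain ⟨-, r₆, hr₆, h₆⟩ := hB (m * J) hmJ0
    refine ⟨J, hJ0, r₆, hr₆, fun x hx v hv => ⟨unstableGrowth T δ (m * J) x,
      hJlam.trans (hw.lt_growth hmJ0 hx).le, ?_⟩⟩
    have h6 := h₆ x hx v hv
    have h7 := hS.norm_linearCocycle_sub_le hK hw (m * J) hx v
    have h8 := hc₃ _ hJ₃
    have hv0 := norm_nonneg v
    rw [← Function.iterate_mul, ← Function.iterate_mul]
    calc _ = ‖(TB^[m * J] (iAB x + v) - iAB (T^[m * J] x) - linearCocycle T LB (m * J) x v) +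
          (linearCocycle T LB (m * J) x v -
            (unstableGrowth T δ (m * J) x * p x (iBC v)) • iAB (w (T^[m * J] x)))‖ := by
          congr 1; abel
      _ ≤ c₃ (m * J) * ‖v‖ + E * ϱB ^ (m * J) * ‖v‖ := (norm_add_le _ _).trans (add_le_add h6 h7)
      _ ≤ 1 / 4 * ‖v‖ + 1 / 4 * ‖v‖ := by gcongr
      _ = _ := by ring
  · intro n
    rcases Nat.eq_zero_or_pos n with rfl | hn
    · exact iBC.contDiff.contDiffOn
    · have h6 := (hR.smooth (m * n) (Nat.mul_pos hm0 hn)).2.1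
      simpa only [Function.iterate_mul] using h6
  · intro n U hU h6
    refine interior_maximal (fun y hy => ?_) hU
    have h7 : ∀ k ≤ n, (TB^[m])^[k] y ∈ iterateDomain OB TB m := by
      intro k hk
      obtain ⟨x, hx, hxy⟩ := h6 y hy k hk
      exact h₅ x hx (by rw [mem_ball, dist_eq_norm]; exact hxy.trans_le hr₅')
    refine ⟨(interior_subset (h7 0 (Nat.zero_le _))).1, fun i hi => ?_⟩
    have e : i = i % m + m * (i / m) := (Nat.mod_add_div i m).symm
    have h8 : i / m ≤ n := (Nat.div_lt_of_lt_mul hi).le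
    rw [e, Function.iterate_add_apply, Function.iterate_mul]
    exact (interior_subset (h7 _ h8)).2 _ (Nat.mod_lt i hm0)
  · intro e he
    obtain ⟨r', hr', h6⟩ := hK.exists_uniform_strict hOA hT m (div_pos he hcA)
    refine ⟨r', hr', fun x hx f₁ f₂ hf₁ hf₂ => ?_⟩
    have h7 := h6 x hx f₁ f₂ hf₁ hf₂
    rw [hK.fderiv_iterate hOA hT m hx] at h7
    set z := f₁ - f₂ with hz
    have hPz := hS.projection_eq x hx z
    have h8 : P x (z - P x z) = 0 := by
      rw [map_sub, sub_eq_zero]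
      exact (DFunLike.congr_fun (hK.projection x hx) z).symm
    have h9 := hcontr x hx m _ h8
    rw [hK.fderiv_iterate hOA hT m hx, hPz, map_sub, map_smul, hw.linearCocycle_apply hK m hx,
      smul_smul, mul_comm (p x _)] at h9
    calc _ = (1 + E * (‖iBC‖ * ‖iAB‖)) * ‖(linearCocycle T (fderiv ℝ T) m x z -
          (unstableGrowth T δ m x * p x (iBC (iAB z))) • w (T^[m] x)) +
          (T^[m] f₁ - T^[m] f₂ - linearCocycle T (fderiv ℝ T) m x z)‖ := by congr 2; abel
      _ ≤ (1 + E * (‖iBC‖ * ‖iAB‖)) * (c * θ ^ m * ‖z - p x (iBC (iAB z)) • w x‖ +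
          e / (1 + E * (‖iBC‖ * ‖iAB‖)) * ‖z‖) := by
        gcongr
        exact (norm_add_le _ _).trans (add_le_add h9 h7)
      _ = (1 + E * (‖iBC‖ * ‖iAB‖)) * c * θ ^ m * ‖z - p x (iBC (iAB z)) • w x‖ + e * ‖z‖ := by
        field_simp
      _ ≤ _ := by gcongr
  · intro e he
    have h6 := Metric.uniformContinuousOn_iff.1
      (hK.isCompact.uniformContinuousOn_of_continuous hK.continuous_splitting) e he
    obtain ⟨r', hr', h7⟩ := h6
    refine ⟨r', hr', fun x hx y hy hxy v => ?_⟩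
    rw [← hS.projection_eq x hx, ← hS.projection_eq y hy, ← sub_apply]
    refine (ContinuousLinearMap.le_opNorm _ _).trans ?_
    gcongr
    have := h7 x hx y hy (by rwa [dist_eq_norm])
    rw [dist_eq_norm] at this
    exact this.le
  · intro ε x hx y hy k
    have h6 := hy.2.1 (m * k)
    rw [mem_ball, dist_eq_norm, hR.iterate_map_of_mem hK _ hx, Function.iterate_mul,
      Function.iterate_mul] at h6
    exact h6

end StepConstruction

/-! ### Distance to the unstable line -/

section LineDist

variable {C : Type*} [NormedAddCommGroup C] [NormedSpace ℝ C]

/-- The distance of `z` to the line spanned by `v`. -/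
noncomputable def lineDist (v z : C) : ℝ := ⨅ t : ℝ, ‖z - t • v‖

theorem lineDist_le (v z : C) (t : ℝ) : lineDist v z ≤ ‖z - t • v‖ :=
  ciInf_le ⟨0, by rintro _ ⟨s, rfl⟩; exact norm_nonneg _⟩ t

theorem lineDist_nonneg (v z : C) : 0 ≤ lineDist v z := Real.iInf_nonneg fun _ => norm_nonneg _

theorem exists_lineDist_eq (v z : C) : ∃ t : ℝ, ‖z - t • v‖ = lineDist v z := by
  have h : ∃ t : ℝ, ∀ s : ℝ, ‖z - t • v‖ ≤ ‖z - s • v‖ := by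
    rcases eq_or_ne v 0 with rfl | hv
    · exact ⟨0, fun s => by simp⟩
    have hv' : 0 < ‖v‖ := norm_pos_iff.2 hv
    refine Continuous.exists_forall_le (by fun_prop) ?_
    refine tendsto_atTop_mono (f := fun t : ℝ => ‖t‖ * ‖v‖ + -‖z‖) (fun t => ?_) ?_
    · have := norm_sub_norm_le (t • v) z
      rw [norm_smul] at this
      rw [norm_sub_rev]
      linarith
    · exact tendsto_atTop_add_const_right _ _ (tendsto_norm_cocompact_atTop.atTop_mul_const hv')
  obtain ⟨t, ht⟩ := h
  exact ⟨t, le_antisymm (le_ciInf ht) (lineDist_le v z t)⟩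

theorem lineDist_add_le (v z z' : C) : lineDist v (z + z') ≤ lineDist v z + ‖z'‖ := by
  obtain ⟨t, ht⟩ := exists_lineDist_eq v z
  rw [← ht]
  refine (lineDist_le v _ t).trans ?_
  rw [add_sub_right_comm]
  exact norm_add_le _ _

theorem lineDist_smul (v z : C) (c : ℝ) : lineDist v (c • z) ≤ |c| * lineDist v z := by
  obtain ⟨t, ht⟩ := exists_lineDist_eq v z
  rw [← ht, ← Real.norm_eq_abs, ← norm_smul]
  refine (lineDist_le v _ (c * t)).trans_eq ?_
  rw [smul_sub, smul_smul]

theorem lineDist_le_norm (v z : C) : lineDist v z ≤ ‖z‖ := by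
  simpa using lineDist_le v z 0

theorem continuous_lineDist (v : C) : Continuous (lineDist v) := by
  refine LipschitzWith.continuous (K := 1) (LipschitzWith.of_le_add_mul 1 fun z z' => ?_)
  have := lineDist_add_le v z' (z - z')
  rw [add_sub_cancel] at this
  simpa [dist_eq_norm] using this

end LineDist

/-! ### Cone estimates for one step -/

/-- One step of a cone estimate. The numbers `P` and `D` stand for the unstable coefficient of a
vector and for its distance to the unstable line, `P'` and `D'` for those of its image; `d` is the
expansion along the unstable direction, `μ` measures the distance to the basic set and `ζ` is an
additional error. -/
structure ConeStep (κ q d μ ζ P D P' D' : ℝ) : Prop where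
  coeff : |P' - d * P| ≤ q * ((|P| + q * D) * μ + κ / 7 * D + ζ)
  dist : D' ≤ (|P| + q * D) * μ + κ / 6 * D + ζ

section ConeStep

variable {κ q d μ ζ P D P' D' e : ℝ}

/-- A narrow cone is mapped into itself, and the expansion in it is close to `d`. -/
theorem ConeStep.narrow (h : ConeStep κ q d μ 0 P D P' D') (hκ : 6 ≤ κ) (hd : κ ≤ d) (hq : 1 ≤ q)
    (hμ : 0 ≤ μ) (he : 0 ≤ e) (hD : D ≤ e * |P|) (hqe : q * (2 * μ + e) ≤ 1 / 4) :
    |P' - d * P| ≤ q * (2 * μ + e) * (d * |P|) ∧ D' ≤ (3 * μ + e / 4) * |P'| := by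
  have hP := abs_nonneg P
  have hqD : q * D ≤ |P| := by
    have h1 : q * e ≤ 1 := by nlinarith
    calc q * D ≤ q * (e * |P|) := by gcongr
      _ = (q * e) * |P| := by ring
      _ ≤ 1 * |P| := by gcongr
      _ = _ := one_mul _
  have h1 : (|P| + q * D) * μ ≤ 2 * |P| * μ := by gcongr; linarith
  have h2 : κ * D ≤ d * (e * |P|) := by
    calc κ * D ≤ κ * (e * |P|) := by gcongr
      _ ≤ d * (e * |P|) := by gcongr
  have hd1 : 1 ≤ d := by linarith
  have h3 : 2 * |P| * μ ≤ 2 * μ * (d * |P|) := by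
    have : |P| ≤ d * |P| := le_mul_of_one_le_left hP hd1
    nlinarith
  have hdP : 0 ≤ d * |P| := by positivity
  have h4 : |P' - d * P| ≤ q * (2 * μ + e) * (d * |P|) := by
    refine h.coeff.trans ?_
    rw [mul_assoc q]
    gcongr
    have : 0 ≤ e * (d * |P|) := by positivity
    nlinarith
  refine ⟨h4, ?_⟩
  have h5 : 3 / 4 * (d * |P|) ≤ |P'| := by
    have h6 : |d * P| = d * |P| := by rw [abs_mul, abs_of_nonneg (by linarith : 0 ≤ d)]
    have h7 : |d * P| ≤ |P'| + |P' - d * P| := by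
      rw [abs_sub_comm]; exact sub_le_iff_le_add'.1 (abs_sub_abs_le_abs_sub _ _)
    have h8 : q * (2 * μ + e) * (d * |P|) ≤ 1 / 4 * (d * |P|) := by gcongr
    linarith
  have h9 := h.dist
  calc D' ≤ (2 * μ + e / 6) * (d * |P|) := by linarith
    _ ≤ (2 * μ + e / 6) * (4 / 3 * |P'|) :=
      mul_le_mul_of_nonneg_left (by linarith) (by positivity)
    _ ≤ _ := by nlinarith [mul_nonneg hμ (abs_nonneg P'), mul_nonneg he (abs_nonneg P')]

theorem ConeStep.growth (h : ConeStep κ q d μ 0 P D P' D') (hκ : 6 ≤ κ) (hd : κ ≤ d) (hq : 1 ≤ q)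
    (hμ : 0 ≤ μ) (he : 0 ≤ e) (hD : D ≤ e * |P|) (hqe : q * (2 * μ + e) ≤ 1 / 4) (hP : 0 ≤ P) :
    3 / 4 * (d * P) ≤ P' := by
  have h1 := (h.narrow hκ hd hq hμ he hD hqe).1
  rw [abs_of_nonneg hP] at h1
  have h2 : q * (2 * μ + e) * (d * P) ≤ 1 / 4 * (d * P) := by
    have : 0 ≤ d * P := mul_nonneg (by linarith) hP
    gcongr
  have := (abs_le.1 (h1.trans h2)).1
  linarith

theorem ConeStep.growth_abs (h : ConeStep κ q d μ 0 P D P' D') (hκ : 6 ≤ κ) (hd : κ ≤ d)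
    (hq : 1 ≤ q) (hμ : 0 ≤ μ) (he : 0 ≤ e) (hD : D ≤ e * |P|) (hqe : q * (2 * μ + e) ≤ 1 / 4) :
    3 / 4 * (d * |P|) ≤ |P'| := by
  rcases le_total 0 P with hP | hP
  · rw [abs_of_nonneg hP]
    exact (h.growth hκ hd hq hμ he hD hqe hP).trans (le_abs_self _)
  · have h' : ConeStep κ q d μ 0 (-P) D (-P') D' := by
      refine ⟨?_, ?_⟩
      · rw [abs_neg, show -P' - d * -P = -(P' - d * P) by ring, abs_neg]; exact h.coeff
      · rw [abs_neg]; exact h.dist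
    rw [abs_of_nonpos hP]
    exact (h'.growth hκ hd hq hμ he (by rwa [abs_neg]) hqe (by linarith)).trans (neg_le_abs _)

/-- The norm `|P| + q * D` grows at most at the rate of the unstable direction. -/
theorem ConeStep.total_le (h : ConeStep κ q d μ ζ P D P' D') (hκ : 6 ≤ κ) (hd : κ ≤ d)
    (hq : 1 ≤ q) (hμ : 0 ≤ μ) (hD : 0 ≤ D) :
    |P'| + q * D' ≤ d * (1 + 2 * q * μ) * (|P| + q * D) + 2 * q * ζ := by
  have hP := abs_nonneg P
  have h1 : |P'| ≤ d * |P| + |P' - d * P| := by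
    have h6 : |d * P| = d * |P| := by rw [abs_mul, abs_of_nonneg (by linarith : 0 ≤ d)]
    have := abs_add_le (d * P) (P' - d * P)
    rw [add_sub_cancel, h6] at this
    exact this
  have h2 : q * D' ≤ q * ((|P| + q * D) * μ + κ / 6 * D + ζ) := by gcongr; exact h.dist
  have h3 := h.coeff
  have h4 : 0 ≤ |P| + q * D := by positivity
  have h5 : q * (κ * D) ≤ q * (d * D) := by gcongr
  have h7 : 2 * q * μ * (|P| + q * D) ≤ d * (2 * q * μ * (|P| + q * D)) :=
    le_mul_of_one_le_left (by positivity) (by linarith)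
  have hd0 : 0 ≤ d := by linarith
  have h8 : 0 ≤ q * (d * D) := by positivity
  nlinarith

/-- Outside the narrow cone the distance to the unstable line grows by a factor that is smaller
than the expansion in the cone. -/
theorem ConeStep.wide (h : ConeStep κ q d μ 0 P D P' D') (hκ : 6 ≤ κ)
    (hμ : 0 ≤ μ) (hμq : 256 * q * μ ≤ 1) (hD : |P| ≤ 32 * q * D) (hD0 : 0 ≤ D) :
    D' ≤ κ / 5 * D := by
  have h1 := h.dist
  have h2 : (|P| + q * D) * μ ≤ (33 * q * D) * μ := by gcongr; linarith
  have h3 : 33 * q * D * μ ≤ 33 / 256 * D := by nlinarith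
  nlinarith

end ConeStep

section Steps

variable {A B C : Type*}
  [NormedAddCommGroup A] [NormedSpace ℝ A] [NormedAddCommGroup B] [NormedSpace ℝ B]
  [NormedAddCommGroup C] [NormedSpace ℝ C]
  {iAB : A →L[ℝ] B} {iBC : B →L[ℝ] C}
  {OA : Set A} {T : A → A} {K : Set A} {OB : Set B} {TB : B → B} {w : A → A}

namespace RobustStep

/-- The distance in `C` to the unstable line at `x`. -/
noncomputable def udist (_ : RobustStep iAB iBC OA T K OB TB w) (x : A) (z : C) : ℝ :=
  lineDist (iBC (iAB (w x))) z

variable (S : RobustStep iAB iBC OA T K OB TB w)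

theorem udist_nonneg (x : A) (z : C) : 0 ≤ S.udist x z := lineDist_nonneg _ _

theorem abs_p_le {x : A} (hx : x ∈ K) (z : C) : |S.p x z| ≤ S.q * ‖z‖ := by
  rw [← Real.norm_eq_abs]
  exact ((S.p x).le_opNorm z).trans (by gcongr; exact S.p_norm x hx)

theorem norm_w_le (S : RobustStep iAB iBC OA T K OB TB w) {x : A} (hx : x ∈ K) : ‖iAB (w x)‖ ≤ ‖iAB‖ := by
  simpa [S.w_norm x hx] using iAB.le_opNorm (w x)

theorem norm_w_le' (S : RobustStep iAB iBC OA T K OB TB w) {x : A} (hx : x ∈ K) : ‖iBC (iAB (w x))‖ ≤ ‖iBC‖ * ‖iAB‖ :=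
  (iBC.le_opNorm _).trans (by gcongr; exact S.norm_w_le hx)

theorem udist_le {x : A} (hx : x ∈ K) (z : C) : ‖z‖ ≤
    (1 + ‖iBC‖ * ‖iAB‖) * (|S.p x z| + (1 + S.q) * S.udist x z) := by
  obtain ⟨t, ht⟩ := exists_lineDist_eq (iBC (iAB (w x))) z
  have hD := S.udist_nonneg x z
  have h1 : t = S.p x z - S.p x (z - t • iBC (iAB (w x))) := by
    rw [map_sub, map_smul, S.p_unstable x hx]; simp
  have h2 : |t| ≤ |S.p x z| + S.q * S.udist x z := by
    have h3 := S.abs_p_le hx (z - t • iBC (iAB (w x)))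
    rw [ht] at h3
    calc |t| = |S.p x z - S.p x (z - t • iBC (iAB (w x)))| := by rw [← h1]
      _ ≤ _ := (abs_sub _ _).trans (add_le_add le_rfl h3)
  have hq := S.q_ge
  have hc : 0 ≤ ‖iBC‖ * ‖iAB‖ := by positivity
  calc ‖z‖ = ‖t • iBC (iAB (w x)) + (z - t • iBC (iAB (w x)))‖ := by congr 1; abel
    _ ≤ |t| * (‖iBC‖ * ‖iAB‖) + S.udist x z := by
      refine (norm_add_le _ _).trans (add_le_add ?_ ht.le)
      rw [norm_smul, Real.norm_eq_abs]
      gcongr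
      exact S.norm_w_le' hx
    _ ≤ (|S.p x z| + S.q * S.udist x z) * (‖iBC‖ * ‖iAB‖) + S.udist x z := by gcongr
    _ ≤ _ := by
      have hP := abs_nonneg (S.p x z)
      have : 0 ≤ S.udist x z * (‖iBC‖ * ‖iAB‖) := by positivity
      nlinarith [mul_nonneg (by linarith : 0 ≤ S.q) hD]

/-- A vector `z₁` that is close to the image `L x z` obeys a cone estimate. -/
theorem coneStep {x : A} (hx : x ∈ K) {z z₁ : C} {μ ζ : ℝ} (hμ : 0 ≤ μ)
    (h : ∀ t : ℝ, ‖z₁ - S.L x z‖ ≤ |t| * μ + S.κ / 7 * ‖z - t • iBC (iAB (w x))‖ + ζ) :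
    ConeStep S.κ S.q (S.dl x) μ ζ (S.p x z) (S.udist x z) (S.p (S.φ x) z₁)
      (S.udist (S.φ x) z₁) := by
  obtain ⟨t, ht⟩ := exists_lineDist_eq (iBC (iAB (w x))) z
  have hD := S.udist_nonneg x z
  change _ = S.udist x z at ht
  set W := iBC (iAB (w x)) with hW
  set W' := iBC (iAB (w (S.φ x))) with hW'
  have hLW : S.L x W = S.dl x • W' := S.L_unstable x hx
  have hpW : S.p x W = 1 := S.p_unstable x hx
  obtain ⟨d, hd⟩ : ∃ d, d = z - t • W := ⟨_, rfl⟩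
  have h := h t
  rw [← hd] at ht h
  have h1 : t = S.p x z - S.p x d := by
    rw [hd, map_sub, map_smul, hpW]; simp
  have hq := S.q_ge
  have h2 : |t| ≤ |S.p x z| + S.q * S.udist x z := by
    have h3 := S.abs_p_le hx d
    rw [ht] at h3
    calc |t| = |S.p x z - S.p x d| := by rw [← h1]
      _ ≤ _ := (abs_sub _ _).trans (add_le_add le_rfl h3)
  have h4 : ‖z₁ - S.L x z‖ ≤
      (|S.p x z| + S.q * S.udist x z) * μ + S.κ / 7 * S.udist x z + ζ := by
    refine h.trans ?_
    rw [ht]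
    gcongr
  refine ⟨?_, ?_⟩
  · rw [← S.p_L x hx, ← map_sub]
    exact (S.abs_p_le (S.mapsTo hx) _).trans (by gcongr)
  · have h5 : S.L x z - ((t + S.p x d) * S.dl x) • W' = S.L x (d - S.p x d • W) := by
      have hz : S.L x z = t • S.dl x • W' + S.L x d := by
        rw [← hLW, ← map_smul, ← map_add, hd]; congr 1; abel
      rw [map_sub, map_smul, hLW, hz]
      module
    have h6 := S.L_slow x hx d
    rw [ht] at h6
    refine (lineDist_le W' z₁ ((t + S.p x d) * S.dl x)).trans ?_
    calc _ = ‖(z₁ - S.L x z) + S.L x (d - S.p x d • W)‖ := by rw [← h5]; congr 1; abel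
      _ ≤ _ := (norm_add_le _ _).trans (add_le_add h4 h6)
      _ ≤ _ := by
        have hκ := S.κ_ge
        nlinarith

/-- The constant of the modulus of continuity `N * σ ^ β` of the derivative. -/
noncomputable def N : ℝ := S.M + S.M * (‖iBC‖ * ‖iAB‖) * (2 * (‖iBC‖ + 1)) ^ S.β

theorem N_pos : 0 < S.N := by
  have := S.M_pos
  unfold N
  positivity

theorem exists_radius : ∃ r > 0, r ≤ S.r ∧ r ≤ 1 ∧ S.M * (2 * (‖iBC‖ + 1) * r) ^ S.β ≤ S.κ / 56 ∧
    1024 * S.q * (S.N * r ^ S.β) ≤ 1 := by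
  have hβ := S.β_pos
  have hcont : Continuous fun r : ℝ => S.M * (2 * (‖iBC‖ + 1) * r) ^ S.β :=
    ((continuous_const.mul continuous_id).rpow_const fun _ => Or.inr hβ.le).const_mul _
  have hcont' : Continuous fun r : ℝ => 1024 * S.q * (S.N * r ^ S.β) :=
    ((continuous_id.rpow_const fun _ => Or.inr hβ.le).const_mul _).const_mul _
  have h1 := hcont.tendsto 0
  have h2 := hcont'.tendsto 0
  rw [mul_zero, Real.zero_rpow hβ.ne', mul_zero] at h1
  rw [Real.zero_rpow hβ.ne', mul_zero, mul_zero] at h2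
  have hκ : 0 < S.κ / 56 := by linarith [S.κ_ge]
  have h3 : ∀ᶠ r : ℝ in 𝓝[>] 0, r < S.r ∧ r < 1 ∧
      S.M * (2 * (‖iBC‖ + 1) * r) ^ S.β < S.κ / 56 ∧ 1024 * S.q * (S.N * r ^ S.β) < 1 :=
    ((gt_mem_nhds S.r_pos).and ((gt_mem_nhds one_pos).and ((h1.eventually (gt_mem_nhds hκ)).and
      (h2.eventually (gt_mem_nhds one_pos))))).filter_mono nhdsWithin_le_nhds
  obtain ⟨r, ⟨h4, h5, h6, h7⟩, h0⟩ := (h3.and self_mem_nhdsWithin).exists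
  exact ⟨r, h0, h4.le, h5.le, h6.le, h7.le⟩

/-- The radius of the neighbourhood of the basic set in `B` in which the cone estimates hold. -/
noncomputable def radius : ℝ := S.exists_radius.choose

theorem radius_pos : 0 < S.radius := S.exists_radius.choose_spec.1
theorem radius_le : S.radius ≤ S.r := S.exists_radius.choose_spec.2.1
theorem radius_le_one : S.radius ≤ 1 := S.exists_radius.choose_spec.2.2.1
theorem radius_small : S.M * (2 * (‖iBC‖ + 1) * S.radius) ^ S.β ≤ S.κ / 56 :=
  S.exists_radius.choose_spec.2.2.2.1
theorem radius_modulus : 1024 * S.q * (S.N * S.radius ^ S.β) ≤ 1 :=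
  S.exists_radius.choose_spec.2.2.2.2

/-- The modulus of continuity of the derivative at distance `σ` of the basic set. -/
noncomputable def modulus (σ : ℝ) : ℝ := S.N * σ ^ S.β

theorem modulus_nonneg {σ : ℝ} (hσ : 0 ≤ σ) : 0 ≤ S.modulus σ := by
  have := S.N_pos
  unfold modulus; positivity

theorem modulus_le {σ : ℝ} (hσ : 0 ≤ σ) (h : σ ≤ S.radius) : 1024 * S.q * S.modulus σ ≤ 1 := by
  refine le_trans ?_ S.radius_modulus
  have := S.N_pos
  have := S.q_ge
  have := S.β_pos
  unfold modulus
  gcongr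

/-- The cone estimate for the derivative at a point near the basic set. -/
theorem linear_step {x : A} (hx : x ∈ K) {f v : B} {z₁ : C} {σ ζ : ℝ} (hf : ‖f - iAB x‖ ≤ σ)
    (hσ : σ < S.radius) (hz₁ : ‖z₁ - S.DG f v‖ ≤ ζ) :
    ConeStep S.κ S.q (S.dl x) (S.modulus σ) ζ (S.p x (iBC v)) (S.udist x (iBC v)) (S.p (S.φ x) z₁)
      (S.udist (S.φ x) z₁) := by
  have hσ0 : 0 ≤ σ := (norm_nonneg _).trans hf
  refine S.coneStep hx (S.modulus_nonneg hσ0) fun t => ?_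
  have h1 := S.deriv_close x hx f ((hf.trans_lt hσ).trans_le S.radius_le) t (v - t • iAB (w x))
  rw [add_sub_cancel, map_sub, map_smul] at h1
  have hβ := S.β_pos
  have hM := S.M_pos
  have hκ := S.κ_ge
  have h2 : S.M * ‖f - iAB x‖ ^ S.β ≤ S.modulus σ := by
    unfold modulus N
    have : S.M ≤ S.M + S.M * (‖iBC‖ * ‖iAB‖) * (2 * (‖iBC‖ + 1)) ^ S.β :=
      le_add_of_nonneg_right (by positivity)
    gcongr
  calc ‖z₁ - S.L x (iBC v)‖ = ‖(S.DG f v - S.L x (iBC v)) + (z₁ - S.DG f v)‖ := by congr 1; abel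
    _ ≤ (|t| * (S.M * ‖f - iAB x‖ ^ S.β) + S.κ / 8 * ‖iBC v - t • iBC (iAB (w x))‖) + ζ :=
      (norm_add_le _ _).trans (add_le_add h1 hz₁)
    _ ≤ _ := by
      gcongr
      norm_num

/-- The cone estimate for the difference of two orbits near the basic set. -/
theorem pair_step {x : A} (hx : x ∈ K) {f₁ f₂ : B} {σ : ℝ} (hf₁ : ‖f₁ - iAB x‖ ≤ σ)
    (hf₂ : ‖f₂ - iAB x‖ ≤ σ) (hσ : σ < S.radius) :
    ConeStep S.κ S.q (S.dl x) (S.modulus σ) 0 (S.p x (iBC (f₁ - f₂))) (S.udist x (iBC (f₁ - f₂)))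
      (S.p (S.φ x) (iBC (S.G f₁ - S.G f₂))) (S.udist (S.φ x) (iBC (S.G f₁ - S.G f₂))) := by
  have hσ0 : 0 ≤ σ := (norm_nonneg _).trans hf₁
  refine S.coneStep hx (S.modulus_nonneg hσ0) fun t => ?_
  obtain ⟨v, hv⟩ : ∃ v, v = f₁ - f₂ := ⟨_, rfl⟩
  rw [← hv]
  have hr₁ := (hf₁.trans_lt hσ).trans_le S.radius_le
  have hr₂ := (hf₂.trans_lt hσ).trans_le S.radius_le
  have h1 := S.deriv_close x hx f₂ hr₂ t (v - t • iAB (w x))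
  rw [add_sub_cancel, map_sub, map_smul] at h1
  have h3 := S.remainder x hx f₁ f₂ hr₁ hr₂
  rw [← hv] at h3
  have hβ := S.β_pos
  have hM := S.M_pos
  have hκ := S.κ_ge
  set d := iBC v - t • iBC (iAB (w x)) with hd
  have hvn : ‖iBC v‖ ≤ 2 * (‖iBC‖ + 1) * σ := by
    have e : v = (f₁ - iAB x) - (f₂ - iAB x) := by rw [hv]; abel
    have h4 : ‖v‖ ≤ 2 * σ := by
      rw [e]; exact (norm_sub_le _ _).trans (by linarith)
    calc ‖iBC v‖ ≤ ‖iBC‖ * ‖v‖ := iBC.le_opNorm _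
      _ ≤ (‖iBC‖ + 1) * (2 * σ) := by gcongr; linarith
      _ = _ := by ring
  have hvd : ‖iBC v‖ ≤ |t| * (‖iBC‖ * ‖iAB‖) + ‖d‖ := by
    calc ‖iBC v‖ = ‖t • iBC (iAB (w x)) + d‖ := by rw [hd]; congr 1; abel
      _ ≤ _ := (norm_add_le _ _).trans (by
        rw [norm_smul, Real.norm_eq_abs]; gcongr; exact S.norm_w_le' hx)
  have h5 : S.M * ‖iBC v‖ ^ (1 + S.β) ≤
      |t| * (S.M * (‖iBC‖ * ‖iAB‖) * (2 * (‖iBC‖ + 1)) ^ S.β * σ ^ S.β) + S.κ / 56 * ‖d‖ := by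
    rw [Real.rpow_add_of_nonneg (norm_nonneg _) zero_le_one hβ.le, Real.rpow_one]
    calc S.M * (‖iBC v‖ * ‖iBC v‖ ^ S.β)
        ≤ S.M * ((|t| * (‖iBC‖ * ‖iAB‖) + ‖d‖) * (2 * (‖iBC‖ + 1) * σ) ^ S.β) := by gcongr
      _ = |t| * (S.M * (‖iBC‖ * ‖iAB‖) * (2 * (‖iBC‖ + 1) * σ) ^ S.β) +
          (S.M * (2 * (‖iBC‖ + 1) * σ) ^ S.β) * ‖d‖ := by ring
      _ ≤ _ := by
        rw [Real.mul_rpow (by positivity) hσ0]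
        have h6 : S.M * (2 * (‖iBC‖ + 1) * σ) ^ S.β ≤ S.κ / 56 :=
          le_trans (by gcongr) S.radius_small
        rw [Real.mul_rpow (by positivity) hσ0] at h6
        exact add_le_add (le_of_eq (by ring)) (by gcongr)
  have h2 : S.M * ‖f₂ - iAB x‖ ^ S.β ≤ S.M * σ ^ S.β := by gcongr
  rw [map_sub]
  calc ‖iBC (S.G f₁) - iBC (S.G f₂) - S.L x (iBC v)‖
      = ‖(S.DG f₂ v - S.L x (iBC v)) + (iBC (S.G f₁) - iBC (S.G f₂) - S.DG f₂ v)‖ := by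
        congr 1; abel
    _ ≤ (|t| * (S.M * σ ^ S.β) + S.κ / 8 * ‖d‖) +
        (|t| * (S.M * (‖iBC‖ * ‖iAB‖) * (2 * (‖iBC‖ + 1)) ^ S.β * σ ^ S.β) + S.κ / 56 * ‖d‖) := by
      refine (norm_add_le _ _).trans (add_le_add (h1.trans ?_) (h3.trans h5))
      gcongr
    _ = _ := by unfold modulus N; ring

end RobustStep

end Steps

/-! ### Orbits in `B` near the basic set -/

/-- A sequence in which every term is controlled by the previous one and by a later one
decays exponentially as long as it stays bounded. -/
theorem le_half_pow_of_window {a : ℕ → ℝ} {J L : ℕ} {R : ℝ}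
    (hstep : ∀ k, k + 1 ≤ L → k + J ≤ L → a (k + 1) ≤ 1 / 3 * a k + 1 / 12 * a (k + J))
    (ha : ∀ k ≤ L, a k ≤ R) (hR : 0 ≤ R) (k : ℕ) :
    ∀ i, k ≤ i → i + k * J ≤ L → a i ≤ (1 / 2) ^ k * R := by
  induction k with
  | zero => intro i _ hi; simpa using ha i (by omega)
  | succ k ih =>
    intro i hki hi
    obtain ⟨i, rfl⟩ : ∃ i', i = i' + 1 := ⟨i - 1, by omega⟩
    have e : (k + 1) * J = k * J + J := by ring
    have h1 := hstep i (by omega) (by omega)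
    have h2 := ih i (by omega) (by omega)
    have h3 := ih (i + J) (by omega) (by omega)
    have h4 : 0 ≤ (1 / 2 : ℝ) ^ k * R := by positivity
    rw [pow_succ]
    linarith

theorem le_half_pow_of_bounded {a : ℕ → ℝ} {J : ℕ} {R : ℝ} (ha0 : ∀ k, 0 ≤ a k)
    (hstep : ∀ k, a (k + 1) ≤ 1 / 3 * a k + 1 / 12 * a (k + J)) (ha : ∀ k, a k ≤ R) (k : ℕ) :
    a k ≤ (1 / 2) ^ k * a 0 := by
  have hb : BddAbove (range a) := ⟨R, by rintro _ ⟨k, rfl⟩; exact ha k⟩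
  have hle : ∀ k, a k ≤ ⨆ i, a i := fun k => le_ciSup hb k
  have h0 : 0 ≤ ⨆ i, a i := (ha0 0).trans (hle 0)
  have h1 : ∀ j i, j ≤ i → a i ≤ (1 / 2) ^ j * ⨆ i, a i := fun j i hji =>
    le_half_pow_of_window (J := J) (L := i + j * J) (fun k _ _ => hstep k) (fun k _ => hle k) h0 j i
      hji le_rfl
  have h2 : ⨆ i, a i ≤ max (a 0) (1 / 2 * ⨆ i, a i) := by
    refine ciSup_le fun i => ?_
    rcases Nat.eq_zero_or_pos i with rfl | hi
    · exact le_max_left _ _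
    · exact (by simpa using h1 1 i hi : a i ≤ 1 / 2 * ⨆ i, a i).trans (le_max_right _ _)
  have h3 : ⨆ i, a i ≤ a 0 := by
    rcases le_max_iff.1 h2 with h | h
    · exact h
    · linarith [ha0 0]
  exact (h1 k k le_rfl).trans (by gcongr)

section Orbits

variable {A B C : Type*}
  [NormedAddCommGroup A] [NormedSpace ℝ A] [NormedAddCommGroup B] [NormedSpace ℝ B]
  [NormedAddCommGroup C] [NormedSpace ℝ C]
  {iAB : A →L[ℝ] B} {iBC : B →L[ℝ] C}
  {OA : Set A} {T : A → A} {K : Set A} {OB : Set B} {TB : B → B} {w : A → A}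

namespace RobustStep

variable (S : RobustStep iAB iBC OA T K OB TB w)

theorem iterate_mem (k : ℕ) {x : A} (hx : x ∈ K) : S.φ^[k] x ∈ K := S.mapsTo.iterate k hx

theorem iterate_conj (k : ℕ) {x : A} (hx : x ∈ K) : S.G^[k] (iAB x) = iAB (S.φ^[k] x) := by
  induction k with
  | zero => rfl
  | succ k ih =>
    rw [Function.iterate_succ_apply', Function.iterate_succ_apply', ih,
      S.conj _ (S.iterate_mem k hx)]

/-- The unstable coefficient, at time `k`, of the difference of the orbit of `y` from that of `x`. -/
noncomputable def coeffAt (x : A) (y : B) (k : ℕ) : ℝ :=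
  S.p (S.φ^[k] x) (iBC (S.G^[k] y - iAB (S.φ^[k] x)))

/-- The norm of the unstable coefficient on `B`. -/
noncomputable def cB (S : RobustStep iAB iBC OA T K OB TB w) : ℝ := S.q * (‖iBC‖ + 1)

theorem cB_ge : 1 ≤ S.cB := by
  have := S.q_ge
  have := norm_nonneg iBC
  unfold cB; nlinarith

theorem abs_p_iBC_le {x : A} (hx : x ∈ K) (v : B) : |S.p x (iBC v)| ≤ S.cB * ‖v‖ := by
  have := S.q_ge
  refine (S.abs_p_le hx _).trans ?_
  rw [cB, mul_assoc]
  gcongr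
  exact (iBC.le_opNorm v).trans (by gcongr; linarith)

/-- The size in `B` of the image of a unit of unstable coefficient. -/
noncomputable def gain (S : RobustStep iAB iBC OA T K OB TB w) : ℝ := S.Λ * ‖iAB‖ + 1

theorem gain_ge : 1 ≤ S.gain := by
  have := S.Λ_ge
  unfold gain
  have : 0 ≤ S.Λ * ‖iAB‖ := by positivity
  linarith

theorem step_B {x : A} (hx : x ∈ K) {y : B} (hy : ‖y - iAB x‖ < S.r) :
    ‖S.G y - iAB (S.φ x)‖ ≤ 13 / 50 * ‖y - iAB x‖ + S.gain * |S.p x (iBC (y - iAB x))| := by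
  have h1 := S.approx_B x hx (y - iAB x) hy
  rw [add_sub_cancel] at h1
  set P := S.p x (iBC (y - iAB x))
  have hd : 0 ≤ S.dl x := by linarith [S.κ_le x hx, S.κ_ge]
  have h2 : ‖(S.dl x * P) • iAB (w (S.φ x))‖ ≤ S.gain * |P| := by
    rw [norm_smul, Real.norm_eq_abs, abs_mul, abs_of_nonneg hd]
    calc S.dl x * |P| * ‖iAB (w (S.φ x))‖ ≤ S.Λ * |P| * ‖iAB‖ := by
          gcongr
          · have := S.Λ_ge; positivity
          · exact S.dl_le x hx
          · exact S.norm_w_le (S.mapsTo hx)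
      _ ≤ _ := by unfold gain; nlinarith [abs_nonneg P]
  calc _ = ‖(S.G y - iAB (S.φ x) - (S.dl x * P) • iAB (w (S.φ x))) +
        (S.dl x * P) • iAB (w (S.φ x))‖ := by congr 1; abel
    _ ≤ _ := (norm_add_le _ _).trans (add_le_add h1 h2)

/-- A Lipschitz constant of the step in `B`, at the points of the basic set. -/
noncomputable def lipB (S : RobustStep iAB iBC OA T K OB TB w) : ℝ := 1 + S.gain * S.cB

theorem lipB_ge : 1 ≤ S.lipB := by
  have := S.gain_ge
  have := S.cB_ge
  unfold lipB
  have : 0 ≤ S.gain * S.cB := by positivity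
  linarith

theorem step_lipB {x : A} (hx : x ∈ K) {y : B} (hy : ‖y - iAB x‖ < S.r) :
    ‖S.G y - iAB (S.φ x)‖ ≤ S.lipB * ‖y - iAB x‖ := by
  refine (S.step_B hx hy).trans ?_
  have h1 := S.abs_p_iBC_le hx (y - iAB x)
  have := S.gain_ge
  have h2 : S.gain * |S.p x (iBC (y - iAB x))| ≤ S.gain * (S.cB * ‖y - iAB x‖) := by gcongr
  unfold lipB
  nlinarith [norm_nonneg (y - iAB x)]

theorem iterate_lipB {x : A} (hx : x ∈ K) {y : B} {n : ℕ}
    (hy : S.lipB ^ n * ‖y - iAB x‖ < S.r) :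
    ‖S.G^[n] y - iAB (S.φ^[n] x)‖ ≤ S.lipB ^ n * ‖y - iAB x‖ := by
  have h1 := S.lipB_ge
  induction n with
  | zero => simp
  | succ n ih =>
    have h2 : S.lipB ^ n * ‖y - iAB x‖ < S.r := lt_of_le_of_lt (by
      gcongr
      exact Nat.le_succ n) hy
    have h3 := ih h2
    rw [Function.iterate_succ_apply', Function.iterate_succ_apply']
    refine (S.step_lipB (S.iterate_mem n hx) (h3.trans_lt h2)).trans ?_
    rw [pow_succ', mul_assoc]
    gcongr

/-- The hyperbolicity of the step in `B`: an orbit that stays near the basic set for the next `J`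
steps cannot have a large unstable part, so that it is contracted now. -/
theorem exists_contraction : ∃ J : ℕ, ∃ r' > 0, r' ≤ S.radius ∧ ∀ x ∈ K, ∀ y : B,
    ‖y - iAB x‖ < r' → ‖S.G y - iAB (S.φ x)‖ ≤
      1 / 3 * ‖y - iAB x‖ + 1 / 12 * ‖S.G^[J] y - iAB (S.φ^[J] x)‖ := by
  have hg := S.gain_ge
  have hc := S.cB_ge
  -- `J` is so large that the unstable part of `y - iAB x`, if it is not small compared to the
  -- distance, is visible in the distance after `J` steps
  obtain ⟨J, -, r', hr', h⟩ := S.approx_iterate_B (20 * S.gain * S.cB)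
  refine ⟨J, min r' S.radius, lt_min hr' S.radius_pos, min_le_right _ _, fun x hx y hy => ?_⟩
  obtain ⟨d, hd, h1⟩ := h x hx (y - iAB x) (hy.trans_le (min_le_left _ _))
  have h2 := S.step_B hx ((hy.trans_le (min_le_right _ _)).trans_le S.radius_le)
  rw [add_sub_cancel] at h1
  set P := S.p x (iBC (y - iAB x))
  set V := S.G^[J] y - iAB (S.φ^[J] x)
  have hxJ := S.iterate_mem J hx
  have h3 : S.p (S.φ^[J] x) (iBC (V - (d * P) • iAB (w (S.φ^[J] x)))) =
      S.p (S.φ^[J] x) (iBC V) - d * P := by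
    rw [map_sub, map_sub, map_smul, map_smul, S.p_unstable _ hxJ]; simp
  have h4 := S.abs_p_iBC_le hxJ (V - (d * P) • iAB (w (S.φ^[J] x)))
  rw [h3] at h4
  have h5 := S.abs_p_iBC_le hxJ V
  have hd0 : 0 ≤ d := le_trans (by positivity) hd
  have h6 : d * |P| ≤ S.cB * ‖V‖ + S.cB * (1 / 2 * ‖y - iAB x‖) := by
    have h7 : |d * P| ≤ |S.p (S.φ^[J] x) (iBC V)| + |S.p (S.φ^[J] x) (iBC V) - d * P| := by
      rw [abs_sub_comm]; exact sub_le_iff_le_add'.1 (abs_sub_abs_le_abs_sub _ _)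
    rw [abs_mul, abs_of_nonneg hd0] at h7
    have h8 : S.cB * ‖V - (d * P) • iAB (w (S.φ^[J] x))‖ ≤ S.cB * (1 / 2 * ‖y - iAB x‖) := by
      gcongr
    linarith
  have h9 : 20 * S.gain * S.cB * |P| ≤ d * |P| := by gcongr
  have h10 : S.gain * |P| ≤ 1 / 20 * ‖V‖ + 1 / 40 * ‖y - iAB x‖ := by
    have h11 : S.cB * (20 * (S.gain * |P|)) ≤ S.cB * (‖V‖ + 1 / 2 * ‖y - iAB x‖) := by linarith
    have := le_of_mul_le_mul_left h11 (by linarith)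
    linarith
  linarith [norm_nonneg V, norm_nonneg (y - iAB x)]

/-- The radius of a neighbourhood of the basic set in which bounded orbits are contracted. -/
noncomputable def stableRadius : ℝ := S.exists_contraction.choose_spec.choose

theorem stableRadius_pos : 0 < S.stableRadius := S.exists_contraction.choose_spec.choose_spec.1

theorem stableRadius_le : S.stableRadius ≤ S.radius :=
  S.exists_contraction.choose_spec.choose_spec.2.1

theorem contraction {x : A} (hx : x ∈ K) {y : B} {k : ℕ}
    (h : ‖S.G^[k] y - iAB (S.φ^[k] x)‖ < S.stableRadius) :
    ‖S.G^[k + 1] y - iAB (S.φ^[k + 1] x)‖ ≤ 1 / 3 * ‖S.G^[k] y - iAB (S.φ^[k] x)‖ +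
      1 / 12 * ‖S.G^[k + S.exists_contraction.choose] y -
        iAB (S.φ^[k + S.exists_contraction.choose] x)‖ := by
  have h1 := S.exists_contraction.choose_spec.choose_spec.2.2 _ (S.iterate_mem k hx) _ h
  simpa only [← Function.iterate_add_apply, ← Function.iterate_succ_apply', add_comm] using h1

theorem stable_decay {x : A} (hx : x ∈ K) {y : B}
    (h : ∀ k, ‖S.G^[k] y - iAB (S.φ^[k] x)‖ < S.stableRadius) (k : ℕ) :
    ‖S.G^[k] y - iAB (S.φ^[k] x)‖ ≤ (1 / 2) ^ k * ‖y - iAB x‖ :=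
  le_half_pow_of_bounded (a := fun k => ‖S.G^[k] y - iAB (S.φ^[k] x)‖) (fun _ => norm_nonneg _)
    (fun k => S.contraction hx (h k)) (fun k => (h k).le) k

/-- If a point close to `g` is on the local stable set of a point `g₀` of the local unstable set of
`g`, then `g₀` is close to `g`. -/
theorem exists_closeness {ε₀ : ℝ} (hε₀ : 0 < ε₀) (hε₀r : 2 * ε₀ * (1 + ‖iAB‖) < S.stableRadius)
    {e : ℝ} (he : 0 < e) : ∃ ε > 0, ∀ g ∈ K, ∀ g₀ ∈ K, g₀ ∈ localUnstableSet OA T K ε₀ g →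
      ∀ y : B, ‖y - iAB g‖ < ε → y ∈ localStableSet OB TB ε₀ (iAB g₀) →
        ‖iAB g₀ - iAB g‖ ≤ e := by
  have hr := S.stableRadius_pos
  have hH := S.lipB_ge
  obtain ⟨k, hk⟩ : ∃ k : ℕ, (1 / 2 : ℝ) ^ k * S.stableRadius < e := by
    obtain ⟨k, hk⟩ := exists_pow_lt_of_lt_one (div_pos he hr) (by norm_num : (1 / 2 : ℝ) < 1)
    exact ⟨k, (lt_div_iff₀ hr).1 hk⟩
  set J := S.exists_contraction.choose with hJ
  set L := k + k * J with hL
  have hε₀' : ε₀ * ‖iAB‖ < S.stableRadius ∧ 2 * ε₀ < S.stableRadius := by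
    have : 0 ≤ ε₀ * ‖iAB‖ := by positivity
    constructor <;> nlinarith
  -- the orbit of `x k` is followed for `k` steps by that of `z k`, and then, because `y` is close to
  -- `g`, for `k * J` further steps, which leaves time for `k` contractions
  refine ⟨ε₀ / S.lipB ^ L, by positivity, fun g hg g₀ hg₀ hu y hy hys => ?_⟩
  obtain ⟨x, z, hx0, hz0, hxz⟩ := S.unstable_orbit ε₀ g g₀ hu
  have hxk : ∀ i ≤ k, S.φ^[i] (x k) = x (k - i) := by
    intro i
    induction i with
    | zero => simp
    | succ i ih =>
      intro hi
      rw [Function.iterate_succ_apply', ih (by omega)]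
      have : k - i = (k - (i + 1)) + 1 := by omega
      rw [this, (hxz _).2.1]
  have hzk : ∀ i ≤ k, S.G^[i] (iAB (z k)) = iAB (z (k - i)) := by
    intro i
    induction i with
    | zero => simp
    | succ i ih =>
      intro hi
      rw [Function.iterate_succ_apply', ih (by omega)]
      have : k - i = (k - (i + 1)) + 1 := by omega
      rw [this, (hxz _).2.2.2.1]
  have hxK : x k ∈ K := (hxz k).1
  let a : ℕ → ℝ := fun i => ‖S.G^[i] (iAB (z k)) - iAB (S.φ^[i] (x k))‖
  have ha : ∀ i ≤ L, a i < S.stableRadius := by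
    intro i hi
    simp only [a]
    rcases le_total i k with hik | hik
    · rw [hxk i hik, hzk i hik, ← map_sub]
      refine (iAB.le_opNorm _).trans_lt ?_
      have := (hxz (k - i)).2.2.2.2.le
      calc ‖iAB‖ * _ ≤ ‖iAB‖ * ε₀ := by gcongr
        _ < _ := by linarith [hε₀'.1]
    · obtain ⟨l, rfl⟩ := Nat.exists_eq_add_of_le' hik
      rw [Function.iterate_add_apply, Function.iterate_add_apply, hxk k le_rfl, hzk k le_rfl,
        Nat.sub_self, hx0, hz0, S.iterate_conj l hg₀]
      have h1 := S.stable_orbit ε₀ g₀ hg₀ y hys l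
      have hpow : S.lipB ^ l * ‖y - iAB g‖ ≤ ε₀ := by
        rw [lt_div_iff₀ (by positivity)] at hy
        calc S.lipB ^ l * ‖y - iAB g‖ ≤ S.lipB ^ L * ‖y - iAB g‖ := by
              gcongr
              omega
          _ ≤ ε₀ := by linarith
      have h2 := S.iterate_lipB (n := l) hg
        (lt_of_le_of_lt hpow (by linarith [hε₀'.2, S.stableRadius_le, S.radius_le]))
      calc ‖iAB (S.φ^[l] g₀) - iAB (S.φ^[l] g)‖
          = ‖(S.G^[l] y - iAB (S.φ^[l] g)) - (S.G^[l] y - iAB (S.φ^[l] g₀))‖ := by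
            congr 1; abel
        _ ≤ _ := norm_sub_le _ _
        _ < _ := by linarith [hε₀'.2]
  have h3 := le_half_pow_of_window (a := a) (J := J) (L := L) (R := S.stableRadius)
    (fun i h1 h2 => S.contraction hxK (ha i (by omega))) (fun i hi => (ha i hi).le) hr.le
    k k le_rfl le_rfl
  simp only [a] at h3
  rw [hxk k le_rfl, hzk k le_rfl, Nat.sub_self, hx0, hz0] at h3
  exact h3.trans hk.le

/-- As long as the unstable coefficients stay below `s`, the orbit stays near the basic set. -/
theorem norm_le_of_coeffAt {x : A} (hx : x ∈ K) {y : B} {s : ℝ} (hs : 2 * S.gain * s < S.radius)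
    (hy : ‖y - iAB x‖ < s) {n : ℕ} (h : ∀ k < n, |S.coeffAt x y k| < s) :
    ∀ k ≤ n, ‖S.G^[k] y - iAB (S.φ^[k] x)‖ ≤ 2 * S.gain * s := by
  have hg := S.gain_ge
  have hs0 : 0 < s := (norm_nonneg _).trans_lt hy
  intro k
  induction k with
  | zero => intro _; simp only [Function.iterate_zero, id_eq]; nlinarith
  | succ k ih =>
    intro hk
    have h1 := ih (by omega)
    have h2 := S.step_B (S.iterate_mem k hx) ((h1.trans_lt hs).trans_le S.radius_le)
    rw [← Function.iterate_succ_apply' S.G, ← Function.iterate_succ_apply' S.φ] at h2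
    have h3 : S.gain * |S.coeffAt x y k| ≤ S.gain * s := by
      gcongr; exact (h k hk).le
    change _ ≤ _ + S.gain * |S.coeffAt x y k| at h2
    nlinarith

/-- The points of `B` close to `x` whose orbit has small unstable coefficients before time `n`. -/
def tube (x : A) (s : ℝ) (n : ℕ) : Set B :=
  {y | ‖y - iAB x‖ < s ∧ ∀ k < n, |S.coeffAt x y k| < s}

/-- The tubes are open, although the step is not assumed to be continuous in `B`: they are defined
through functionals that are continuous in the norm of `C`. -/
theorem isOpen_tube {x : A} (hx : x ∈ K) {s : ℝ} (hs : 2 * S.gain * s < S.radius) (n : ℕ) :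
    IsOpen (S.tube x s n) ∧ S.tube x s n ⊆ S.dom n := by
  have hdom : ∀ n, IsOpen (S.tube x s n) → S.tube x s n ⊆ S.dom n := by
    intro n hn
    refine S.subset_dom n _ hn fun y hy k hk => ⟨S.φ^[k] x, S.iterate_mem k hx, ?_⟩
    exact (S.norm_le_of_coeffAt hx hs hy.1 hy.2 k hk).trans_lt (hs.trans_le S.radius_le)
  suffices h : IsOpen (S.tube x s n) from ⟨h, hdom n h⟩
  induction n with
  | zero =>
    have : S.tube x s 0 = ball (iAB x) s := by
      ext y; simp [tube, dist_eq_norm]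
    rw [this]; exact isOpen_ball
  | succ n ih =>
    have hc : ContinuousOn (fun y => |S.coeffAt x y n|) (S.tube x s n) := by
      have h1 := ((S.smooth n).continuousOn.mono (hdom n ih))
      have h2 : (fun y => |S.coeffAt x y n|) = fun y =>
          |S.p (S.φ^[n] x) (iBC (S.G^[n] y) - iBC (iAB (S.φ^[n] x)))| := by
        funext y; rw [coeffAt, map_sub]
      rw [h2]
      exact ((S.p _).continuous.comp_continuousOn (h1.sub continuousOn_const)).abs
    have e : S.tube x s (n + 1) = S.tube x s n ∩ (fun y => |S.coeffAt x y n|) ⁻¹' Iio s := by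
      ext y
      simp only [tube, Set.mem_ofPred_eq, mem_inter_iff, mem_preimage, mem_Iio]
      constructor
      · rintro ⟨h1, h2⟩
        exact ⟨⟨h1, fun k hk => h2 k (by omega)⟩, h2 n (by omega)⟩
      · rintro ⟨⟨h1, h2⟩, h3⟩
        refine ⟨h1, fun k hk => ?_⟩
        rcases Nat.lt_succ_iff_lt_or_eq.1 hk with h | rfl
        · exact h2 k h
        · exact h3
    rw [e]
    exact hc.isOpen_inter_preimage ih isOpen_Iio

theorem mem_tube_of_norm {x : A} (hx : x ∈ K) {s : ℝ} {y : B} (hy : ‖y - iAB x‖ < s) {n : ℕ}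
    (h : ∀ k < n, S.cB * ‖S.G^[k] y - iAB (S.φ^[k] x)‖ < s) : y ∈ S.tube x s n :=
  ⟨hy, fun k hk => (S.abs_p_iBC_le (S.iterate_mem k hx) _).trans_lt (h k hk)⟩

theorem differentiableAt_of_mem_tube {x : A} (hx : x ∈ K) {s : ℝ}
    (hs : 2 * S.gain * s < S.radius) {n : ℕ} {y : B} (hy : y ∈ S.tube x s n) :
    ContDiffAt ℝ 1 (fun y => iBC (S.G^[n] y)) y :=
  (S.smooth n).contDiffAt ((S.isOpen_dom n).mem_nhds ((S.isOpen_tube hx hs n).2 hy))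

end RobustStep

end Orbits

/-! ### Differences of points of local unstable sets -/

section UnstableSide

variable {A B C : Type*}
  [NormedAddCommGroup A] [NormedSpace ℝ A] [NormedAddCommGroup B] [NormedSpace ℝ B]
  [NormedAddCommGroup C] [NormedSpace ℝ C]
  {iAB : A →L[ℝ] B} {iBC : B →L[ℝ] C}
  {OA : Set A} {T : A → A} {K : Set A} {OB : Set B} {TB : B → B} {w : A → A}

namespace RobustStep

variable (S : RobustStep iAB iBC OA T K OB TB w)

/-- The unstable coefficient of a vector of `A`. -/
noncomputable def coeffA (x V : A) : ℝ := S.p x (iBC (iAB V))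

/-- The norm of the unstable coefficient on `A`, plus one. -/
noncomputable def cA (S : RobustStep iAB iBC OA T K OB TB w) : ℝ := 1 + S.q * (‖iBC‖ * ‖iAB‖)

theorem cA_ge : 1 ≤ S.cA := by
  have := S.q_ge
  have : 0 ≤ S.q * (‖iBC‖ * ‖iAB‖) := by positivity
  unfold cA; linarith

theorem abs_coeffA_le {x : A} (hx : x ∈ K) (V : A) : |S.coeffA x V| ≤ (S.cA - 1) * ‖V‖ := by
  have := S.q_ge
  refine (S.abs_p_le hx _).trans ?_
  rw [cA, add_sub_cancel_left, mul_assoc]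
  gcongr
  calc ‖iBC (iAB V)‖ ≤ ‖iBC‖ * (‖iAB‖ * ‖V‖) :=
        (iBC.le_opNorm _).trans (by gcongr; exact iAB.le_opNorm _)
    _ = _ := by ring

theorem coeffA_sub (x V W : A) : S.coeffA x (V - W) = S.coeffA x V - S.coeffA x W := by
  simp [coeffA]

theorem coeffA_smul (x V : A) (t : ℝ) : S.coeffA x (t • V) = t * S.coeffA x V := by
  simp [coeffA]

theorem coeffA_w {x : A} (hx : x ∈ K) : S.coeffA x (w x) = 1 := S.p_unstable x hx

/-- The vectors of `A` in the cone of aperture `a` about the unstable direction at `x`. -/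
def NarrowA (a : ℝ) (x V : A) : Prop := ‖V - S.coeffA x V • w x‖ ≤ a * |S.coeffA x V|

theorem norm_smul_w (S : RobustStep iAB iBC OA T K OB TB w) {x : A} (hx : x ∈ K) (t : ℝ) : ‖t • w x‖ = |t| := by
  rw [norm_smul, S.w_norm x hx, mul_one, Real.norm_eq_abs]

theorem norm_le_coeffA {x : A} (hx : x ∈ K) (V : A) :
    ‖V‖ ≤ |S.coeffA x V| + ‖V - S.coeffA x V • w x‖ := by
  rw [← S.norm_smul_w hx]
  calc ‖V‖ = ‖S.coeffA x V • w x + (V - S.coeffA x V • w x)‖ := by congr 1; abel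
    _ ≤ _ := norm_add_le _ _

theorem NarrowA.norm_le {S : RobustStep iAB iBC OA T K OB TB w} {a : ℝ} {x V : A} (hx : x ∈ K)
    (h : S.NarrowA a x V) (ha : a ≤ 1) : ‖V‖ ≤ 2 * |S.coeffA x V| := by
  have h1 := S.norm_le_coeffA hx V
  have h2 : ‖V - S.coeffA x V • w x‖ ≤ a * |S.coeffA x V| := h
  nlinarith [abs_nonneg (S.coeffA x V)]

/-- Near the basic set the cone of `A` is mapped into itself and expanded, whereas vectors outside
the cone are contracted towards the unstable direction. -/
theorem exists_cone_A {a : ℝ} (ha : 0 < a) (ha1 : a ≤ 1) : ∃ r' > 0, ∀ x ∈ K, ∀ f₁ f₂ : A,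
    ‖f₁ - x‖ < r' → ‖f₂ - x‖ < r' →
    (S.NarrowA a x (f₁ - f₂) → 5 * |S.coeffA x (f₁ - f₂)| ≤ |S.coeffA (S.φ x) (S.φ f₁ - S.φ f₂)| ∧
      |S.coeffA (S.φ x) (S.φ f₁ - S.φ f₂)| ≤ (S.Λ + 1) * |S.coeffA x (f₁ - f₂)| ∧
      S.NarrowA a (S.φ x) (S.φ f₁ - S.φ f₂)) ∧
    (¬ S.NarrowA a x (f₁ - f₂) →
      ‖S.φ f₁ - S.φ f₂ - S.coeffA (S.φ x) (S.φ f₁ - S.φ f₂) • w (S.φ x)‖ ≤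
        1 / 2 * ‖f₁ - f₂ - S.coeffA x (f₁ - f₂) • w x‖) := by
  obtain ⟨r', hr', h⟩ := S.approx_A (a / 10) (by positivity)
  refine ⟨r', hr', fun x hx f₁ f₂ hf₁ hf₂ => ?_⟩
  have h := h x hx f₁ f₂ hf₁ hf₂
  have hx' := S.mapsTo hx
  set V := f₁ - f₂
  set V' := S.φ f₁ - S.φ f₂
  change S.cA * ‖V' - (S.dl x * S.coeffA x V) • w (S.φ x)‖ ≤
    1 / 10 * ‖V - S.coeffA x V • w x‖ + a / 10 * ‖V‖ at h
  have hV := S.norm_le_coeffA hx V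
  obtain ⟨P, hP⟩ : ∃ P, P = S.coeffA x V := ⟨_, rfl⟩
  obtain ⟨P', hP'⟩ : ∃ P', P' = S.coeffA (S.φ x) V' := ⟨_, rfl⟩
  have hcA := S.cA_ge
  rw [← hP] at h hV
  have e : S.coeffA (S.φ x) (V' - (S.dl x * P) • w (S.φ x)) = P' - S.dl x * P := by
    rw [coeffA_sub, coeffA_smul, S.coeffA_w hx', mul_one, hP']
  have h1 := S.abs_coeffA_le hx' (V' - (S.dl x * P) • w (S.φ x))
  rw [e] at h1
  have h2 : ‖V' - P' • w (S.φ x)‖ ≤ S.cA * ‖V' - (S.dl x * P) • w (S.φ x)‖ := by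
    calc ‖V' - P' • w (S.φ x)‖ = ‖(V' - (S.dl x * P) • w (S.φ x)) -
          (P' - S.dl x * P) • w (S.φ x)‖ := by congr 1; module
      _ ≤ ‖V' - (S.dl x * P) • w (S.φ x)‖ + (S.cA - 1) * ‖V' - (S.dl x * P) • w (S.φ x)‖ := by
        refine (norm_sub_le _ _).trans ?_
        rw [S.norm_smul_w hx']
        gcongr
      _ = _ := by ring
  have h3 : |P' - S.dl x * P| ≤ S.cA * ‖V' - (S.dl x * P) • w (S.φ x)‖ :=
    h1.trans (by gcongr; linarith)
  unfold NarrowA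
  rw [← hP, ← hP']
  set Dd := ‖V - P • w x‖
  set D' := ‖V' - P' • w (S.φ x)‖
  have hd := S.κ_le x hx
  have hκ := S.κ_ge
  have hΛ := S.dl_le x hx
  have hPn := abs_nonneg P
  have hD : 0 ≤ Dd := norm_nonneg _
  have h4 : a / 10 * ‖V‖ ≤ a / 10 * (|P| + Dd) := by gcongr
  have habs : |S.dl x * P| = S.dl x * |P| := by rw [abs_mul, abs_of_nonneg (by linarith)]
  constructor
  · intro hn
    have h5 : 1 / 10 * Dd + a / 10 * (|P| + Dd) ≤ 3 / 10 * a * |P| := by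
      have : a * Dd ≤ a * |P| := by gcongr; nlinarith
      linarith
    have h6 : |P' - S.dl x * P| ≤ 3 / 10 * a * |P| := by linarith
    have h7 : 3 / 10 * a * |P| ≤ 3 / 10 * |P| := by nlinarith
    have h8 : |S.dl x * P| ≤ |P'| + |P' - S.dl x * P| := by
      rw [abs_sub_comm]; exact sub_le_iff_le_add'.1 (abs_sub_abs_le_abs_sub _ _)
    have h9 : |P'| ≤ |S.dl x * P| + |P' - S.dl x * P| :=
      sub_le_iff_le_add'.1 (abs_sub_abs_le_abs_sub _ _)
    rw [habs] at h8 h9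
    have h10 : 6 * |P| ≤ S.dl x * |P| := by gcongr; linarith
    have h11 : 5 * |P| ≤ |P'| := by linarith
    refine ⟨h11, ?_, ?_⟩
    · have : S.dl x * |P| ≤ S.Λ * |P| := by gcongr
      linarith
    · have : a * (5 * |P|) ≤ a * |P'| := by gcongr
      nlinarith
  · intro hn
    rw [not_le] at hn
    have : a * Dd ≤ Dd := by nlinarith
    linarith

/-- The difference of two points of a local unstable set is in a narrow cone: along the backward
orbits, a vector outside the cone would have come from arbitrarily large vectors. -/
theorem exists_narrow_of_unstable {a : ℝ} (ha : 0 < a) (ha1 : a ≤ 1) : ∃ r' > 0, ∀ ε ≤ r',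
    ∀ g f₁ f₂ : A, f₁ ∈ localUnstableSet OA T K ε g → f₂ ∈ localUnstableSet OA T K ε g →
      S.NarrowA a g (f₁ - f₂) ∧ ‖f₁ - g‖ < ε ∧ ‖f₂ - g‖ < ε := by
  obtain ⟨r', hr', h⟩ := S.exists_cone_A ha ha1
  refine ⟨r', hr', fun ε hε g f₁ f₂ hf₁ hf₂ => ?_⟩
  obtain ⟨x, y₁, hx0, hy₁0, h₁⟩ := S.unstable_orbit ε g f₁ hf₁
  obtain ⟨x', y₂, hx'0, hy₂0, h₂⟩ := S.unstable_orbit ε g f₂ hf₂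
  have hxx : ∀ n, x' n = x n := by
    intro n
    induction n with
    | zero => rw [hx0, hx'0]
    | succ n ih =>
      exact S.injOn (h₂ _).1 (h₁ _).1 ((h₂ n).2.1.trans (ih.trans (h₁ n).2.1.symm))
  have hb₁ := fun n => (h₁ n).2.2.2.2
  have hb₂ : ∀ n, ‖y₂ n - x n‖ < ε := fun n => hxx n ▸ (h₂ n).2.2.2.2
  have hstep := fun n => h (x (n + 1)) (h₁ _).1 (y₁ (n + 1)) (y₂ (n + 1))
    ((hb₁ _).trans_le hε) ((hb₂ _).trans_le hε)
  have e : ∀ n, S.φ (x (n + 1)) = x n ∧ S.φ (y₁ (n + 1)) = y₁ n ∧ S.φ (y₂ (n + 1)) = y₂ n :=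
    fun n => ⟨(h₁ n).2.1, (h₁ n).2.2.1, (h₂ n).2.2.1⟩
  refine ⟨?_, by simpa [hx0, hy₁0] using hb₁ 0, by simpa [hx0, hy₂0] using hb₂ 0⟩
  by_contra hn
  have hnot : ∀ n, ¬ S.NarrowA a (x n) (y₁ n - y₂ n) := by
    intro n
    induction n with
    | zero => rwa [hx0, hy₁0, hy₂0]
    | succ n ih =>
      intro h3
      have := ((hstep n).1 h3).2.2
      rw [(e n).1, (e n).2.1, (e n).2.2] at this
      exact ih this
  let D : ℕ → ℝ := fun n => ‖y₁ n - y₂ n - S.coeffA (x n) (y₁ n - y₂ n) • w (x n)‖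
  have hD : ∀ n, D 0 ≤ (1 / 2) ^ n * D n := by
    intro n
    induction n with
    | zero => simp
    | succ n ih =>
      have h3 := (hstep n).2 (hnot _)
      rw [(e n).1, (e n).2.1, (e n).2.2] at h3
      refine ih.trans ?_
      rw [pow_succ, mul_assoc]
      gcongr
  have hcA := S.cA_ge
  have hDb : ∀ n, D n ≤ S.cA * (2 * ε) := by
    intro n
    have h4 : ‖y₁ n - y₂ n‖ ≤ 2 * ε := by
      calc ‖y₁ n - y₂ n‖ = ‖(y₁ n - x n) - (y₂ n - x n)‖ := by congr 1; abel
        _ ≤ _ := (norm_sub_le _ _).trans (by linarith [hb₁ n, hb₂ n])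
    have h5 := S.abs_coeffA_le (h₁ n).1 (y₁ n - y₂ n)
    refine (norm_sub_le _ _).trans ?_
    rw [S.norm_smul_w (h₁ n).1]
    nlinarith
  have h6 : D 0 ≤ 0 := by
    refine ge_of_tendsto' (x := atTop) (f := fun n : ℕ => (1 / 2 : ℝ) ^ n * (S.cA * (2 * ε)))
      ?_ (fun n => (hD n).trans (by gcongr; exact hDb n))
    simpa using (tendsto_pow_atTop_nhds_zero_of_lt_one (by norm_num : (0 : ℝ) ≤ 1 / 2)
      (by norm_num)).mul_const (S.cA * (2 * ε))
  refine hnot 0 (le_trans h6 ?_)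
  positivity

/-- The difference of two points of a local unstable set is in the narrow cone at either point. -/
theorem exists_narrow_of_unstable_base {a : ℝ} (ha : 0 < a) (ha1 : a ≤ 1) : ∃ r' > 0, ∀ ε ≤ r',
    ∀ g ∈ K, ∀ g₁ ∈ K, ∀ f : A, g₁ ∈ localUnstableSet OA T K ε g →
      f ∈ localUnstableSet OA T K ε g → S.NarrowA a g₁ (f - g₁) := by
  obtain ⟨r₁, hr₁, h₁⟩ := S.exists_narrow_of_unstable (a := a / 4) (by positivity) (by linarith)
  obtain ⟨r₂, hr₂, h₂⟩ := S.projection_cont (a / 8) (by positivity)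
  refine ⟨min r₁ r₂, lt_min hr₁ hr₂, fun ε hε g hg g₁ hg₁ f hu hf => ?_⟩
  obtain ⟨h3, -, h4⟩ := h₁ ε (hε.trans (min_le_left _ _)) g f g₁ hf hu
  have h5 := h₂ g₁ hg₁ g hg (h4.trans_le (hε.trans (min_le_right _ _))) (f - g₁)
  set V := f - g₁
  change ‖S.coeffA g₁ V • w g₁ - S.coeffA g V • w g‖ ≤ a / 8 * ‖V‖ at h5
  have h6 := h3.norm_le hg (by linarith)
  have h7 : |S.coeffA g V| ≤ |S.coeffA g₁ V| + a / 8 * ‖V‖ := by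
    rw [← S.norm_smul_w hg, ← S.norm_smul_w hg₁]
    have := norm_sub_norm_le (S.coeffA g V • w g) (S.coeffA g₁ V • w g₁)
    rw [norm_sub_rev] at this
    linarith
  have h8 : ‖V - S.coeffA g V • w g‖ ≤ a / 4 * |S.coeffA g V| := h3
  unfold NarrowA
  have h9 : ‖V - S.coeffA g₁ V • w g₁‖ ≤ a / 4 * |S.coeffA g V| + a / 8 * ‖V‖ := by
    calc ‖V - S.coeffA g₁ V • w g₁‖ = ‖(V - S.coeffA g V • w g) -
          (S.coeffA g₁ V • w g₁ - S.coeffA g V • w g)‖ := by congr 1; abel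
      _ ≤ _ := (norm_sub_le _ _).trans (add_le_add h8 h5)
  have h10 : a / 8 * ‖V‖ ≤ a / 4 * |S.coeffA g V| := by nlinarith
  have h11 : 3 / 4 * |S.coeffA g V| ≤ |S.coeffA g₁ V| := by nlinarith [abs_nonneg (S.coeffA g V)]
  have h12 : a * (3 / 4 * |S.coeffA g V|) ≤ a * |S.coeffA g₁ V| := by gcongr
  have h13 : 0 ≤ a * |S.coeffA g V| := by positivity
  linarith

/-- The orbits of two nearby points of the basic set whose difference is in the narrow cone
separate at an exponential rate, up to a time `N` at which their distance is macroscopic. -/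
theorem exists_escape {a : ℝ} (ha : 0 < a) (ha1 : a ≤ 1) : ∃ r' > 0, ∀ r₄ ≤ r', ∀ x ∈ K, ∀ y ∈ K,
    y ≠ x → ‖y - x‖ < r₄ → S.NarrowA a x (y - x) → ∃ N : ℕ,
      (∀ k ≤ N, S.NarrowA a (S.φ^[k] x) (S.φ^[k] y - S.φ^[k] x) ∧
        ‖S.φ^[k] y - S.φ^[k] x‖ < r₄ ∧
        ‖S.φ^[k] y - S.φ^[k] x‖ ≤ 2 * S.cA * (1 / 5) ^ (N - k) * r₄ ∧
        |S.coeffA x (y - x)| ≤ |S.coeffA (S.φ^[k] x) (S.φ^[k] y - S.φ^[k] x)|) ∧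
      (∀ k ≤ N, |S.coeffA (S.φ^[N] x) (S.φ^[N] y - S.φ^[N] x)| ≤
        (S.Λ + 1) ^ (N - k) * |S.coeffA (S.φ^[k] x) (S.φ^[k] y - S.φ^[k] x)|) ∧
      r₄ ≤ 2 * (S.Λ + 1) * |S.coeffA (S.φ^[N] x) (S.φ^[N] y - S.φ^[N] x)| := by
  obtain ⟨r', hr', h⟩ := S.exists_cone_A ha ha1
  refine ⟨r', hr', fun r₄ hr₄ x hx y hy hxy h0 hn => ?_⟩
  have hcA := S.cA_ge
  have hΛ := S.Λ_ge
  set V : ℕ → A := fun k => S.φ^[k] y - S.φ^[k] x with hV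
  set P : ℕ → ℝ := fun k => S.coeffA (S.φ^[k] x) (V k) with hP
  have hr₄0 : 0 < r₄ := (norm_nonneg _).trans_lt h0
  have hstep : ∀ k, ‖V k‖ < r₄ → S.NarrowA a (S.φ^[k] x) (V k) →
      5 * |P k| ≤ |P (k + 1)| ∧ |P (k + 1)| ≤ (S.Λ + 1) * |P k| ∧
        S.NarrowA a (S.φ^[k + 1] x) (V (k + 1)) := by
    intro k hk hnk
    have h1 := (h (S.φ^[k] x) (S.iterate_mem k hx) (S.φ^[k] y) (S.φ^[k] x) (hk.trans_le hr₄)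
      (by simpa using hr')).1 hnk
    simpa only [hP, hV, Function.iterate_succ_apply'] using h1
  have hnar : ∀ n, (∀ k < n, ‖V k‖ < r₄) → ∀ k ≤ n, S.NarrowA a (S.φ^[k] x) (V k) := by
    intro n hlt k
    induction k with
    | zero => intro _; exact hn
    | succ k ih => intro hk; exact (hstep k (hlt k (by omega)) (ih (by omega))).2.2
  have hP0 : 0 < |P 0| := by
    have h1 : ‖y - x‖ ≤ 2 * |P 0| := hn.norm_le hx ha1
    have h2 : 0 < ‖y - x‖ := norm_pos_iff.2 (sub_ne_zero.2 hxy)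
    linarith
  have hPle : ∀ k, |P k| ≤ S.cA * ‖V k‖ := fun k =>
    (S.abs_coeffA_le (S.iterate_mem k hx) (V k)).trans (by gcongr; linarith)
  have hex : ∃ k, r₄ ≤ ‖V k‖ := by
    by_contra! hall
    have hg : ∀ k, 5 ^ k * |P 0| ≤ |P k| := by
      intro k
      induction k with
      | zero => simp
      | succ k ih =>
        have := (hstep k (hall k) (hnar k (fun j _ => hall j) k le_rfl)).1
        rw [pow_succ']; linarith
    obtain ⟨k, hk⟩ := pow_unbounded_of_one_lt (S.cA * r₄ / |P 0|) (by norm_num : (1 : ℝ) < 5)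
    rw [div_lt_iff₀ hP0] at hk
    have h1 : S.cA * ‖V k‖ ≤ S.cA * r₄ := by gcongr; exact (hall k).le
    linarith [hg k, hPle k]
  classical
  -- `N` is the last time before the distance reaches `r₄`
  obtain ⟨N, hN, hmin⟩ : ∃ N, r₄ ≤ ‖V (N + 1)‖ ∧ ∀ k ≤ N, ‖V k‖ < r₄ := by
    have h1 : Nat.find hex ≠ 0 := by
      intro h2
      have := Nat.find_spec hex
      rw [h2] at this
      exact absurd this (not_le.2 h0)
    obtain ⟨N, hN⟩ := Nat.exists_eq_succ_of_ne_zero h1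
    exact ⟨N, by simpa [hN] using Nat.find_spec hex, fun k hk =>
      not_le.1 (Nat.find_min hex (by omega))⟩
  have hnarN := hnar (N + 1) (fun k hk => hmin k (by omega))
  have hgrow : ∀ i k, k + i = N → |P k| ≤ (1 / 5) ^ i * |P N| ∧ |P N| ≤ (S.Λ + 1) ^ i * |P k| := by
    intro i
    induction i with
    | zero => intro k hk; simp at hk; simp [hk]
    | succ i ih =>
      intro k hk
      obtain ⟨h1, h2⟩ := ih (k + 1) (by omega)
      obtain ⟨h3, h4, -⟩ := hstep k (hmin k (by omega)) (hnarN k (by omega))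
      constructor
      · rw [pow_succ]; linarith
      · refine h2.trans ?_
        rw [pow_succ, mul_assoc]
        gcongr
  have hP0k : ∀ k ≤ N, |P 0| ≤ |P k| := by
    intro k
    induction k with
    | zero => intro _; exact le_rfl
    | succ k ih =>
      intro hk
      have h1 := (hstep k (hmin k (by omega)) (hnarN k (by omega))).1
      linarith [ih (by omega), abs_nonneg (P k)]
  refine ⟨N, fun k hk => ⟨hnarN k (by omega), hmin k hk, ?_, hP0k k hk⟩, fun k hk => ?_, ?_⟩
  · have h1 := (hnarN k (by omega)).norm_le (S.iterate_mem k hx) ha1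
    have h2 := (hgrow (N - k) k (by omega)).1
    have h3 := hPle N
    have h4 : S.cA * ‖V N‖ ≤ S.cA * r₄ := by gcongr; exact (hmin N le_rfl).le
    change ‖V k‖ ≤ 2 * |P k| at h1
    calc ‖V k‖ ≤ 2 * ((1 / 5) ^ (N - k) * |P N|) := by linarith
      _ ≤ 2 * ((1 / 5) ^ (N - k) * (S.cA * r₄)) := by gcongr; linarith
      _ = _ := by ring
  · exact (hgrow (N - k) k (by omega)).2
  · have h1 := (hnarN (N + 1) le_rfl).norm_le (S.iterate_mem _ hx) ha1
    have h2 := (hstep N (hmin N le_rfl) (hnarN N (by omega))).2.1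
    change ‖V (N + 1)‖ ≤ 2 * |P (N + 1)| at h1
    change r₄ ≤ 2 * (S.Λ + 1) * |P N|
    linarith

end RobustStep

end UnstableSide

/-! ### Tangent vectors that are never expanded are tangent to the stable leaf -/

theorem ConeStep.smul {κ q d μ P D P' D' : ℝ} (h : ConeStep κ q d μ 0 P D P' D') (c : ℝ) :
    ConeStep κ q d μ 0 (c * P) (|c| * D) (c * P') (|c| * D') := by
  have hc := abs_nonneg c
  refine ⟨?_, ?_⟩
  · have := mul_le_mul_of_nonneg_left h.coeff hc
    rw [show c * P' - d * (c * P) = c * (P' - d * P) by ring, abs_mul, abs_mul]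
    linarith
  · have := mul_le_mul_of_nonneg_left h.dist hc
    rw [abs_mul]
    linarith

section Tangency

variable {A B C : Type*}
  [NormedAddCommGroup A] [NormedSpace ℝ A] [NormedAddCommGroup B] [NormedSpace ℝ B]
  [NormedAddCommGroup C] [NormedSpace ℝ C]
  {iAB : A →L[ℝ] B} {iBC : B →L[ℝ] C}
  {OA : Set A} {T : A → A} {K : Set A} {OB : Set B} {TB : B → B} {w : A → A}

namespace RobustStep

variable (S : RobustStep iAB iBC OA T K OB TB w)

theorem udist_smul (x : A) (c : ℝ) (z : C) : S.udist x (c • z) = |c| * S.udist x z := by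
  refine le_antisymm (lineDist_smul _ _ _) ?_
  rcases eq_or_ne c 0 with rfl | hc
  · simpa using S.udist_nonneg x (0 : C)
  · have h := lineDist_smul (iBC (iAB (w x))) (c • z) c⁻¹
    rw [smul_smul, inv_mul_cancel₀ hc, one_smul, abs_inv] at h
    rwa [← div_eq_inv_mul, le_div_iff₀' (abs_pos.2 hc)] at h

theorem udist_add_le (x : A) (z z' : C) : S.udist x (z + z') ≤ S.udist x z + ‖z'‖ :=
  lineDist_add_le _ _ _

theorem udist_le_of_near {x : A} (hx : x ∈ K) {z : C} {t m : ℝ}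
    (h : ‖z - t • iBC (iAB (w x))‖ ≤ m) : S.udist x z ≤ m ∧ |S.p x z - t| ≤ S.q * m := by
  refine ⟨(lineDist_le _ _ t).trans h, ?_⟩
  have h1 := S.abs_p_le hx (z - t • iBC (iAB (w x)))
  rw [map_sub, map_smul, S.p_unstable x hx, smul_eq_mul, mul_one] at h1
  exact h1.trans (by gcongr; exact zero_le_one.trans S.q_ge)

theorem continuous_udist (x : A) : Continuous (S.udist x) := continuous_lineDist _

/-- The aperture of the cone in `C` that is used to detect the expansion. -/
noncomputable def aperture : ℝ := 1 / (32 * S.q)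

theorem aperture_pos : 0 < S.aperture := by
  have := S.q_ge
  unfold aperture; positivity

theorem q_mul_aperture : S.q * S.aperture = 1 / 32 := by
  have := S.q_ge
  unfold aperture; field_simp

theorem modulus_le_aperture {σ : ℝ} (hσ : 0 ≤ σ) (h : σ ≤ S.radius) :
    32 * S.modulus σ ≤ S.aperture := by
  have h1 := S.modulus_le hσ h
  have hq := S.q_ge
  unfold aperture
  rw [le_div_iff₀ (by positivity)]
  linarith

/-- A vector in the cone, on the positive side, stays there, and its coefficient grows. -/
theorem cone_persist {x : A} (hx : x ∈ K) {σ P D P' D' : ℝ} (hσ0 : 0 ≤ σ) (hσ : σ ≤ S.radius)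
    (h : ConeStep S.κ S.q (S.dl x) (S.modulus σ) 0 P D P' D') {e : ℝ} (he : S.aperture / 2 ≤ e)
    (he' : e ≤ S.aperture) (hP : 0 < P) (hD : D ≤ e * P) :
    3 / 4 * S.κ * P ≤ P' ∧ D' < e * P' := by
  have hm := S.modulus_le_aperture hσ0 hσ
  have hm0 := S.modulus_nonneg hσ0
  have ha := S.aperture_pos
  have hqa := S.q_mul_aperture
  have hq := S.q_ge
  have hκ := S.κ_ge
  have hd := S.κ_le x hx
  have hqe : S.q * (2 * S.modulus σ + e) ≤ 1 / 4 := by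
    have : S.q * (2 * S.modulus σ + e) ≤ S.q * (2 * S.aperture) := by gcongr; linarith
    linarith
  have hD' : D ≤ e * |P| := by rwa [abs_of_pos hP]
  have h1 := h.growth hκ hd hq hm0 (by linarith) hD' hqe hP.le
  have h2 := (h.narrow hκ hd hq hm0 (by linarith) hD' hqe).2
  have h3 : S.κ * P ≤ S.dl x * P := by gcongr
  have h4 : 0 < S.κ * P := by positivity
  have hP' : 0 < P' := by linarith
  rw [abs_of_pos hP'] at h2
  refine ⟨by linarith, h2.trans_lt ?_⟩
  gcongr
  linarith

/-- Both orbits being in the tube, their difference obeys the cone estimate. -/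
theorem tube_pair_step {x : A} (hx : x ∈ K) {s : ℝ} (hs : 2 * S.gain * s < S.radius) {n : ℕ}
    {y y' : B} (hy : y ∈ S.tube x s n) (hy' : y' ∈ S.tube x s n) {k : ℕ} (hk : k ≤ n) :
    ConeStep S.κ S.q (S.dl (S.φ^[k] x)) (S.modulus (2 * S.gain * s)) 0
      (S.p (S.φ^[k] x) (iBC (S.G^[k] y - S.G^[k] y')))
      (S.udist (S.φ^[k] x) (iBC (S.G^[k] y - S.G^[k] y')))
      (S.p (S.φ^[k + 1] x) (iBC (S.G^[k + 1] y - S.G^[k + 1] y')))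
      (S.udist (S.φ^[k + 1] x) (iBC (S.G^[k + 1] y - S.G^[k + 1] y'))) := by
  have h := S.pair_step (S.iterate_mem k hx) (S.norm_le_of_coeffAt hx hs hy.1 hy.2 k hk)
    (S.norm_le_of_coeffAt hx hs hy'.1 hy'.2 k hk) hs
  simpa only [Function.iterate_succ_apply'] using h

theorem tube_antitone (x : A) (s : ℝ) : Antitone (S.tube x s) :=
  fun _ _ hmn _ hy => ⟨hy.1, fun k hk => hy.2 k (hk.trans_le hmn)⟩

/-- The derivative at `y` of the `n`-th iterate of the step. -/
noncomputable def tangent (S : RobustStep iAB iBC OA T K OB TB w) (y : B) (n : ℕ) : B →L[ℝ] C :=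
  fderiv ℝ (fun y => iBC (S.G^[n] y)) y

theorem tangent_zero (y v : B) : S.tangent y 0 v = iBC v := by
  simp only [tangent, Function.iterate_zero, id_eq]
  rw [show (fun y => iBC y) = iBC from rfl, iBC.fderiv]

theorem tendsto_tangent {x : A} (hx : x ∈ K) {s : ℝ} (hs : 2 * S.gain * s < S.radius) {n : ℕ}
    {y : B} (hy : y ∈ S.tube x s n) (v : B) :
    Tendsto (fun h : ℝ => h⁻¹ • iBC (S.G^[n] (y + h • v) - S.G^[n] y)) (𝓝[>] 0)
      (𝓝 (S.tangent y n v)) := by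
  have h1 := ((S.differentiableAt_of_mem_tube hx hs hy).differentiableAt
    one_ne_zero).hasFDerivAt.hasLineDerivAt v
  rw [HasLineDerivAt, hasDerivAt_iff_tendsto_slope_zero] at h1
  have h2 := h1.mono_left (nhdsGT_le_nhdsNE 0)
  refine h2.congr fun h => ?_
  simp

theorem eventually_mem_tube {x : A} (hx : x ∈ K) {s : ℝ} (hs : 2 * S.gain * s < S.radius) {n : ℕ}
    {y : B} (hy : y ∈ S.tube x s n) (v : B) :
    ∀ᶠ h : ℝ in 𝓝[>] 0, y + h • v ∈ S.tube x s n := by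
  have h1 : Tendsto (fun h : ℝ => y + h • v) (𝓝 0) (𝓝 y) := by
    have : Continuous fun h : ℝ => y + h • v := by fun_prop
    simpa using this.tendsto 0
  exact (h1.mono_left nhdsWithin_le_nhds).eventually ((S.isOpen_tube hx hs n).1.mem_nhds hy)

theorem tangent_step {x : A} (hx : x ∈ K) {s : ℝ} (hs : 2 * S.gain * s < S.radius) {n : ℕ}
    {y : B} (hy : y ∈ S.tube x s (n + 1)) (v : B) :
    ConeStep S.κ S.q (S.dl (S.φ^[n] x)) (S.modulus (2 * S.gain * s)) 0
      (S.p (S.φ^[n] x) (S.tangent y n v)) (S.udist (S.φ^[n] x) (S.tangent y n v))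
      (S.p (S.φ^[n + 1] x) (S.tangent y (n + 1) v))
      (S.udist (S.φ^[n + 1] x) (S.tangent y (n + 1) v)) := by
  have hyn := S.tube_antitone x s (Nat.le_succ n) hy
  have t0 := S.tendsto_tangent hx hs hyn v
  have t1 := S.tendsto_tangent hx hs hy v
  have hev : ∀ᶠ h : ℝ in 𝓝[>] 0, ConeStep S.κ S.q (S.dl (S.φ^[n] x))
      (S.modulus (2 * S.gain * s)) 0
      (S.p (S.φ^[n] x) (h⁻¹ • iBC (S.G^[n] (y + h • v) - S.G^[n] y)))
      (S.udist (S.φ^[n] x) (h⁻¹ • iBC (S.G^[n] (y + h • v) - S.G^[n] y)))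
      (S.p (S.φ^[n + 1] x) (h⁻¹ • iBC (S.G^[n + 1] (y + h • v) - S.G^[n + 1] y)))
      (S.udist (S.φ^[n + 1] x) (h⁻¹ • iBC (S.G^[n + 1] (y + h • v) - S.G^[n + 1] y))) := by
    filter_upwards [S.eventually_mem_tube hx hs hyn v] with h hh
    simp only [map_smul, smul_eq_mul, udist_smul]
    exact (S.tube_pair_step hx hs hh hyn le_rfl).smul _
  have p0 := ((S.p (S.φ^[n] x)).continuous.tendsto _).comp t0
  have p1 := ((S.p (S.φ^[n + 1] x)).continuous.tendsto _).comp t1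
  have d0 := ((S.continuous_udist (S.φ^[n] x)).tendsto _).comp t0
  have d1 := ((S.continuous_udist (S.φ^[n + 1] x)).tendsto _).comp t1
  constructor
  · exact le_of_tendsto_of_tendsto (p1.sub (p0.const_mul _)).abs
      (((((p0.abs.add (d0.const_mul _)).mul_const _).add (d0.const_mul _)).add_const _).const_mul _)
      (hev.mono fun h hh => hh.coeff)
  · exact le_of_tendsto_of_tendsto d1
      ((((p0.abs.add (d0.const_mul _)).mul_const _).add (d0.const_mul _)).add_const _)
      (hev.mono fun h hh => hh.dist)

/-- The unstable direction of the basic set is expanded along the orbits of the stable set. -/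
theorem tangent_unstable {x : A} (hx : x ∈ K) {s : ℝ} (hs : 2 * S.gain * s < S.radius) {y : B}
    (hy : ∀ n, y ∈ S.tube x s n) (n : ℕ) :
    (3 / 4 * S.κ) ^ n ≤ S.p (S.φ^[n] x) (S.tangent y n (iAB (w x))) ∧
      S.udist (S.φ^[n] x) (S.tangent y n (iAB (w x))) ≤
        S.aperture / 2 * S.p (S.φ^[n] x) (S.tangent y n (iAB (w x))) := by
  have ha := S.aperture_pos
  have hκ := S.κ_ge
  have hs0 : 0 ≤ 2 * S.gain * s := (norm_nonneg _).trans
    (S.norm_le_of_coeffAt hx hs (hy 0).1 (hy 0).2 0 le_rfl)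
  induction n with
  | zero =>
    simp only [tangent_zero, Function.iterate_zero, id_eq, pow_zero, S.p_unstable x hx, le_refl,
      true_and, mul_one]
    refine le_trans (lineDist_le _ _ 1) ?_
    rw [one_smul, sub_self, norm_zero]
    positivity
  | succ n ih =>
    have hP : 0 < S.p (S.φ^[n] x) (S.tangent y n (iAB (w x))) := lt_of_lt_of_le (by positivity) ih.1
    obtain ⟨h1, h2⟩ := S.cone_persist (S.iterate_mem n hx) hs0 hs.le
      (S.tangent_step hx hs (hy (n + 1)) _) le_rfl (by linarith) hP ih.2
    refine ⟨?_, h2.le⟩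
    rw [pow_succ']
    exact le_trans (by gcongr; exact ih.1) h1

/-- A vector that never enters the cone grows slowly. -/
theorem tangent_slow {x : A} (hx : x ∈ K) {s : ℝ} (hs : 2 * S.gain * s < S.radius) {y : B}
    (hy : ∀ n, y ∈ S.tube x s n) {v : B} (hv : ∀ n, S.aperture *
      |S.p (S.φ^[n] x) (S.tangent y n v)| ≤ S.udist (S.φ^[n] x) (S.tangent y n v)) :
    ∃ E, ∀ n, ‖S.tangent y n v‖ ≤ E * (S.κ / 5) ^ n := by
  have hq := S.q_ge
  have hκ := S.κ_ge
  have hs0 : 0 ≤ 2 * S.gain * s := (norm_nonneg _).trans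
    (S.norm_le_of_coeffAt hx hs (hy 0).1 (hy 0).2 0 le_rfl)
  have hP : ∀ n, |S.p (S.φ^[n] x) (S.tangent y n v)| ≤
      32 * S.q * S.udist (S.φ^[n] x) (S.tangent y n v) := by
    intro n
    have := hv n
    unfold aperture at this
    rwa [one_div_mul_eq_div, div_le_iff₀' (by positivity)] at this
  have hD : ∀ n, S.udist (S.φ^[n] x) (S.tangent y n v) ≤
      (S.κ / 5) ^ n * S.udist x (iBC v) := by
    intro n
    induction n with
    | zero => simp [tangent_zero]
    | succ n ih =>
      have h1 := S.modulus_le hs0 hs.le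
      have h2 : 0 ≤ S.q * S.modulus (2 * S.gain * s) :=
        mul_nonneg (by linarith) (S.modulus_nonneg hs0)
      refine ((S.tangent_step hx hs (hy (n + 1)) v).wide hκ (S.modulus_nonneg hs0) (by linarith)
        (hP n) (S.udist_nonneg _ _)).trans ?_
      rw [pow_succ', mul_assoc]
      gcongr
  refine ⟨(1 + ‖iBC‖ * ‖iAB‖) * (32 * S.q + (1 + S.q)) * S.udist x (iBC v), fun n => ?_⟩
  calc ‖S.tangent y n v‖ ≤ _ := S.udist_le (S.iterate_mem n hx) _
    _ ≤ (1 + ‖iBC‖ * ‖iAB‖) * (32 * S.q * S.udist (S.φ^[n] x) (S.tangent y n v) +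
        (1 + S.q) * S.udist (S.φ^[n] x) (S.tangent y n v)) := by gcongr; exact hP n
    _ = (1 + ‖iBC‖ * ‖iAB‖) * (32 * S.q + (1 + S.q)) *
        S.udist (S.φ^[n] x) (S.tangent y n v) := by ring
    _ ≤ (1 + ‖iBC‖ * ‖iAB‖) * (32 * S.q + (1 + S.q)) * ((S.κ / 5) ^ n * S.udist x (iBC v)) := by
      gcongr; exact hD n
    _ = _ := by ring

/-- The points whose orbit, before time `n`, stays in the tube and whose difference from the orbit
of `y` is, at time `n`, in the cone, on the side `ς = ±1`. -/
def escapeSet (x : A) (s : ℝ) (y : B) (ς : ℝ) : Set B :=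
  {y' | ∃ n, y' ∈ S.tube x s n ∧ S.udist (S.φ^[n] x) (iBC (S.G^[n] y' - S.G^[n] y)) <
    S.aperture * (ς * S.p (S.φ^[n] x) (iBC (S.G^[n] y' - S.G^[n] y)))}

theorem isOpen_escapeSet {x : A} (hx : x ∈ K) {s : ℝ} (hs : 2 * S.gain * s < S.radius) (y : B)
    (ς : ℝ) : IsOpen (S.escapeSet x s y ς) := by
  have h : S.escapeSet x s y ς = ⋃ n, (S.tube x s n ∩
      {y' | S.udist (S.φ^[n] x) (iBC (S.G^[n] y' - S.G^[n] y)) -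
        S.aperture * (ς * S.p (S.φ^[n] x) (iBC (S.G^[n] y' - S.G^[n] y))) < 0}) := by
    ext y'; simp [escapeSet]
  rw [h]
  refine isOpen_iUnion fun n => ?_
  have hc : ContinuousOn (fun y' => iBC (S.G^[n] y' - S.G^[n] y)) (S.tube x s n) := by
    simp only [map_sub]
    exact ((S.smooth n).continuousOn.mono (S.isOpen_tube hx hs n).2).sub continuousOn_const
  exact (((S.continuous_udist _).comp_continuousOn hc).sub
    ((((S.p _).continuous.comp_continuousOn hc).const_smul ς).const_smul
      S.aperture)).isOpen_inter_preimage (S.isOpen_tube hx hs n).1 isOpen_Iio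

/-- A difference that has entered the cone stays on its side, so that no orbit escapes on both
sides. -/
theorem disjoint_escapeSet {x : A} (hx : x ∈ K) {s : ℝ} (hs : 2 * S.gain * s < S.radius) {y : B}
    (hy : ∀ n, y ∈ S.tube x s n) : Disjoint (S.escapeSet x s y 1) (S.escapeSet x s y (-1)) := by
  have ha := S.aperture_pos
  have hκ := S.κ_ge
  have hs0 : 0 ≤ 2 * S.gain * s := (norm_nonneg _).trans
    (S.norm_le_of_coeffAt hx hs (hy 0).1 (hy 0).2 0 le_rfl)
  have key : ∀ (ς : ℝ), |ς| = 1 → ∀ n₁ n₂ : ℕ, n₁ ≤ n₂ → ∀ y', y' ∈ S.tube x s n₂ →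
      S.udist (S.φ^[n₁] x) (iBC (S.G^[n₁] y' - S.G^[n₁] y)) <
        S.aperture * (ς * S.p (S.φ^[n₁] x) (iBC (S.G^[n₁] y' - S.G^[n₁] y))) →
      0 < ς * S.p (S.φ^[n₂] x) (iBC (S.G^[n₂] y' - S.G^[n₂] y)) := by
    intro ς hς n₁ n₂ hn y' hy' h
    have hpos : ∀ n, S.udist (S.φ^[n] x) (iBC (S.G^[n] y' - S.G^[n] y)) <
        S.aperture * (ς * S.p (S.φ^[n] x) (iBC (S.G^[n] y' - S.G^[n] y))) →
        0 < ς * S.p (S.φ^[n] x) (iBC (S.G^[n] y' - S.G^[n] y)) := fun n h =>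
      pos_of_mul_pos_right ((S.udist_nonneg _ _).trans_lt h) ha.le
    refine hpos n₂ ?_
    induction n₂, hn using Nat.le_induction with
    | base => exact h
    | succ n hn ih =>
      have h2 := ih (S.tube_antitone x s (Nat.le_succ n) hy')
      have h1 := (S.tube_pair_step hx hs (S.tube_antitone x s (Nat.le_succ n) hy') (hy n)
        le_rfl).smul ς
      rw [hς, one_mul, one_mul] at h1
      exact (S.cone_persist (S.iterate_mem n hx) hs0 hs.le h1 (by linarith) le_rfl (hpos n h2)
        h2.le).2
  rw [Set.disjoint_left]
  rintro y' ⟨n₁, h₁, h₁'⟩ ⟨n₂, h₂, h₂'⟩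
  rcases le_total n₁ n₂ with h | h
  · have h3 := key 1 (by simp) n₁ n₂ h y' h₂ h₁'
    have h4 := pos_of_mul_pos_right ((S.udist_nonneg _ _).trans_lt h₂') ha.le
    linarith
  · have h3 := key (-1) (by simp) n₂ n₁ h y' h₁ h₂'
    have h4 := pos_of_mul_pos_right ((S.udist_nonneg _ _).trans_lt h₁') ha.le
    linarith

/-- If the direction `u` is in the open cone at some time, then the points `y + h u` escape. -/
theorem eventually_mem_escapeSet {x : A} (hx : x ∈ K) {s : ℝ} (hs : 2 * S.gain * s < S.radius)
    {y : B} (hy : ∀ n, y ∈ S.tube x s n) {u : B} {ς : ℝ} {n : ℕ}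
    (h : S.udist (S.φ^[n] x) (S.tangent y n u) <
      S.aperture * (ς * S.p (S.φ^[n] x) (S.tangent y n u))) :
    ∀ᶠ h : ℝ in 𝓝[>] 0, y + h • u ∈ S.escapeSet x s y ς := by
  have t := S.tendsto_tangent hx hs (hy n) u
  have p0 := (((S.p (S.φ^[n] x)).continuous.tendsto _).comp t)
  have d0 := ((S.continuous_udist (S.φ^[n] x)).tendsto _).comp t
  filter_upwards [d0.eventually_lt ((p0.const_mul ς).const_mul S.aperture) h,
    S.eventually_mem_tube hx hs (hy n) u, self_mem_nhdsWithin] with r h1 h2 h3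
  refine ⟨n, h2, ?_⟩
  have hr : (0 : ℝ) < r⁻¹ := inv_pos.2 h3
  simp only [Function.comp_apply, map_smul, smul_eq_mul, udist_smul, abs_of_pos hr] at h1
  refine lt_of_mul_lt_mul_left (h1.trans_eq ?_) hr.le
  ring

end RobustStep

end Tangency

section Leaf

variable {A B C : Type*}
  [NormedAddCommGroup A] [NormedSpace ℝ A] [NormedAddCommGroup B] [NormedSpace ℝ B]
  [NormedAddCommGroup C] [NormedSpace ℝ C]
  {iAB : A →L[ℝ] B} {iBC : B →L[ℝ] C}
  {OA : Set A} {T : A → A} {K : Set A} {OB : Set B} {TB : B → B} {w : A → A}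

namespace RobustStep

variable (S : RobustStep iAB iBC OA T K OB TB w)

/-- The radius of the tubes around the orbits of the basic set. -/
noncomputable def tubeRadius : ℝ := S.stableRadius / (4 * S.gain)

theorem tubeRadius_pos : 0 < S.tubeRadius := by
  have := S.stableRadius_pos
  have := S.gain_ge
  unfold tubeRadius; positivity

theorem tubeRadius_lt_stableRadius : 2 * S.gain * S.tubeRadius < S.stableRadius := by
  have := S.stableRadius_pos
  have := S.gain_ge
  unfold tubeRadius
  rw [mul_div_assoc', div_lt_iff₀ (by positivity)]
  nlinarith

theorem tubeRadius_lt : 2 * S.gain * S.tubeRadius < S.radius :=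
  S.tubeRadius_lt_stableRadius.trans_le S.stableRadius_le

theorem mem_tube {x : A} (hx : x ∈ K) {y : B} {s : ℝ}
    (h : ∀ k, ‖S.G^[k] y - iAB (S.φ^[k] x)‖ < S.stableRadius) (hy : S.cB * ‖y - iAB x‖ < s)
    (n : ℕ) : y ∈ S.tube x s n := by
  have hc := S.cB_ge
  refine S.mem_tube_of_norm hx (lt_of_le_of_lt ?_ hy) fun k _ => lt_of_le_of_lt ?_ hy
  · nlinarith [norm_nonneg (y - iAB x)]
  · gcongr
    refine (S.stable_decay hx h k).trans ?_
    exact mul_le_of_le_one_left (norm_nonneg _) (pow_le_one₀ (by norm_num) (by norm_num))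

/-- A point whose orbit does not escape from the orbit of `y` through the unstable cone has
small unstable coefficients for ever. -/
theorem exists_trapping : ∃ r₂ > 0, r₂ ≤ S.tubeRadius ∧ ∀ x ∈ K, ∀ y : B,
    (∀ k, ‖S.G^[k] y - iAB (S.φ^[k] x)‖ < S.stableRadius) → S.cB * ‖y - iAB x‖ < r₂ →
    ∀ y' : B, ‖y' - iAB x‖ < r₂ → y' ∉ S.escapeSet x S.tubeRadius y 1 →
      y' ∉ S.escapeSet x S.tubeRadius y (-1) → ∀ n, |S.coeffAt x y' n| < r₂ := by
  have hg := S.gain_ge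
  have hc := S.cB_ge
  have hl := S.lipB_ge
  have ha := S.aperture_pos
  have hq := S.q_ge
  have ht := S.tubeRadius_pos
  have hr := S.r_pos
  set C₁ : ℝ := ‖iBC‖ * (S.gain + 1) with hC₁
  have hC₁0 : 0 ≤ C₁ := by positivity
  obtain ⟨J, -, r', hr', h⟩ := S.approx_iterate_B (S.q * C₁ + C₁ / S.aperture + 1)
  set Q : ℝ := 4 * S.gain * S.cB * S.lipB ^ J with hQ
  have hlJ : 1 ≤ S.lipB ^ J := one_le_pow₀ hl
  have hQ0 : 0 < Q := by positivity
  have hm : 0 < min S.tubeRadius (min r' S.r) := lt_min ht (lt_min hr' hr)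
  set m : ℝ := min S.tubeRadius (min r' S.r) with hmdef
  have hQ1 : 1 ≤ Q := by
    have : 1 ≤ S.gain * S.cB * S.lipB ^ J := one_le_mul_of_one_le_of_one_le
      (one_le_mul_of_one_le_of_one_le hg hc) hlJ
    rw [hQ]; linarith
  refine ⟨m / Q, by positivity, (div_le_self hm.le hQ1).trans (min_le_left _ _), ?_⟩
  set r₂ : ℝ := m / Q with hr₂
  have hr₂0 : 0 < r₂ := by positivity
  have hQr : S.cB * (S.lipB ^ J * (2 * S.gain * r₂)) < m := by
    have : m = Q * r₂ := by rw [hr₂]; field_simp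
    have h0 : 0 < S.cB * (S.lipB ^ J * (2 * S.gain * r₂)) := by positivity
    rw [this, hQ]; linarith
  have hr₂s : r₂ ≤ S.tubeRadius := (div_le_self hm.le hQ1).trans (min_le_left _ _)
  intro x hx y hy hyx y' hy' he₁ he₂
  by_contra! hex
  classical
  -- at the first time `n` at which the coefficient reaches `r₂`, the distance to the orbit of `x` is
  -- still of the order of `r₂`; after `J` more steps the difference to the orbit of `y` is in the cone
  obtain ⟨n, hn, hmin⟩ : ∃ n, r₂ ≤ |S.coeffAt x y' n| ∧ ∀ k < n, |S.coeffAt x y' k| < r₂ :=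
    ⟨Nat.find hex, Nat.find_spec hex, fun k hk => not_le.1 (Nat.find_min hex hk)⟩
  have hxn := S.iterate_mem n hx
  have hgr : 2 * S.gain * r₂ < S.radius := lt_of_le_of_lt (by gcongr) S.tubeRadius_lt
  have h1 := S.norm_le_of_coeffAt hx hgr hy' hmin n le_rfl
  have h2 : ∀ j ≤ J, ‖S.G^[j + n] y' - iAB (S.φ^[j + n] x)‖ ≤ S.lipB ^ J * (2 * S.gain * r₂) := by
    intro j hj
    have h3 : S.lipB ^ j * ‖S.G^[n] y' - iAB (S.φ^[n] x)‖ ≤ S.lipB ^ J * (2 * S.gain * r₂) := by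
      gcongr
    rw [Function.iterate_add_apply, Function.iterate_add_apply]
    refine (S.iterate_lipB hxn (h3.trans_lt ?_)).trans h3
    calc S.lipB ^ J * (2 * S.gain * r₂) ≤ S.cB * (S.lipB ^ J * (2 * S.gain * r₂)) :=
          le_mul_of_one_le_left (by positivity) hc
      _ < m := hQr
      _ ≤ S.r := (min_le_right _ _).trans (min_le_right _ _)
  have htube : y' ∈ S.tube x S.tubeRadius (J + n) := by
    refine ⟨hy'.trans_le hr₂s, fun k hk => ?_⟩
    rcases lt_or_ge k n with hkn | hkn
    · exact (hmin k hkn).trans_le hr₂s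
    · obtain ⟨j, rfl⟩ := Nat.exists_eq_add_of_le' hkn
      calc |S.coeffAt x y' (j + n)| ≤ S.cB * ‖S.G^[j + n] y' - iAB (S.φ^[j + n] x)‖ :=
            S.abs_p_iBC_le (S.iterate_mem _ hx) _
        _ ≤ S.cB * (S.lipB ^ J * (2 * S.gain * r₂)) := by gcongr; exact h2 j (by omega)
        _ < m := hQr
        _ ≤ S.tubeRadius := min_le_left _ _
  have h3 : ‖S.G^[n] y' - iAB (S.φ^[n] x)‖ < r' := by
    refine h1.trans_lt ?_
    calc 2 * S.gain * r₂ ≤ S.cB * (S.lipB ^ J * (2 * S.gain * r₂)) := by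
          rw [← mul_assoc]
          exact le_mul_of_one_le_left (by positivity) (one_le_mul_of_one_le_of_one_le hc hlJ)
      _ < m := hQr
      _ ≤ r' := (min_le_right _ _).trans (min_le_left _ _)
  obtain ⟨d, hd, h4⟩ := h _ hxn (S.G^[n] y' - iAB (S.φ^[n] x)) h3
  rw [add_sub_cancel, ← Function.iterate_add_apply, ← Function.iterate_add_apply] at h4
  change ‖_ - (d * S.coeffAt x y' n) • _‖ ≤ _ at h4
  set P := S.coeffAt x y' n with hP
  have h5 : ‖S.G^[J + n] y - iAB (S.φ^[J + n] x)‖ ≤ r₂ := by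
    refine (S.stable_decay hx hy _).trans ?_
    calc (1 / 2 : ℝ) ^ (J + n) * ‖y - iAB x‖ ≤ S.cB * ‖y - iAB x‖ := by
          gcongr
          exact (pow_le_one₀ (by norm_num) (by norm_num)).trans hc
      _ ≤ r₂ := hyx.le
  have h6 : ‖iBC (S.G^[J + n] y' - S.G^[J + n] y) - (d * P) • iBC (iAB (w (S.φ^[J + n] x)))‖ ≤
      C₁ * r₂ := by
    calc _ = ‖iBC ((S.G^[J + n] y' - iAB (S.φ^[J + n] x) - (d * P) • iAB (w (S.φ^[J + n] x))) -
          (S.G^[J + n] y - iAB (S.φ^[J + n] x)))‖ := by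
          rw [← map_smul iBC, ← map_sub]; congr 2; abel
      _ ≤ ‖iBC‖ * (S.gain * r₂ + r₂) := by
        refine (iBC.le_opNorm _).trans ?_
        gcongr
        refine (norm_sub_le _ _).trans (add_le_add (h4.trans ?_) h5)
        linarith
      _ = _ := by rw [hC₁]; ring
  obtain ⟨h7, h8⟩ := S.udist_le_of_near (S.iterate_mem _ hx) h6
  set p' := S.p (S.φ^[J + n] x) (iBC (S.G^[J + n] y' - S.G^[J + n] y)) with hp'
  have hd0 : 0 ≤ d := le_trans (by positivity) hd
  have h9 : (S.q * C₁ + C₁ / S.aperture + 1) * r₂ ≤ d * |P| := by gcongr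
  have key : ∀ ς : ℝ, |ς| = 1 → ς * P = |P| → y' ∈ S.escapeSet x S.tubeRadius y ς := by
    intro ς hς hςP
    refine ⟨J + n, htube, h7.trans_lt ?_⟩
    have h10 : |ς * (p' - d * P)| ≤ S.q * (C₁ * r₂) := by rw [abs_mul, hς, one_mul]; exact h8
    have h11 : d * |P| - S.q * (C₁ * r₂) ≤ ς * p' := by
      have := (abs_le.1 h10).1
      have e : ς * (p' - d * P) = ς * p' - d * |P| := by rw [← hςP]; ring
      rw [e] at this
      linarith
    have h12 : C₁ / S.aperture * r₂ < ς * p' := by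
      have : (S.q * C₁ + C₁ / S.aperture + 1) * r₂ =
        S.q * (C₁ * r₂) + C₁ / S.aperture * r₂ + r₂ := by ring
      linarith
    calc C₁ * r₂ = S.aperture * (C₁ / S.aperture * r₂) := by field_simp
      _ < _ := by gcongr
  rcases le_total 0 P with h | h
  · exact he₁ (key 1 (by simp) (by rw [abs_of_nonneg h, one_mul]))
  · exact he₂ (key (-1) (by simp) (by rw [abs_of_nonpos h]; ring))

/-- A vector that is not tangent to the stable leaf enters the cone about the unstable direction.
Otherwise, it is expanded less than the unstable direction `w x`, so that arbitrarily small
multiples of `± w x` push the points `y + h v` to different sides of the leaf; the points in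
between that do not escape are on the leaf. -/
theorem exists_expansion {ε : ℝ} (hε : 0 < ε) : ∃ e > 0, S.cB * e ≤ S.tubeRadius ∧
    ∀ x ∈ K, ∀ y : B, (∀ k, ‖S.G^[k] y - iAB (S.φ^[k] x)‖ < S.stableRadius) → ‖y - iAB x‖ < e →
    ∀ v : B, v ∉ tangentConeAt ℝ (localStableSet OB TB ε (iAB x)) y →
      ∃ n, S.udist (S.φ^[n] x) (S.tangent y n v) <
        S.aperture * |S.p (S.φ^[n] x) (S.tangent y n v)| := by
  have hg := S.gain_ge
  have hc := S.cB_ge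
  have ha := S.aperture_pos
  have hqa := S.q_mul_aperture
  have hq := S.q_ge
  have hκ := S.κ_ge
  obtain ⟨r₂, hr₂, hr₂s, htrap⟩ := S.exists_trapping
  obtain ⟨r', hr', hmem⟩ := S.mem_stable ε hε
  refine ⟨min (r₂ / S.cB) r', lt_min (by positivity) hr', ?_, fun x hx y hy hyx v hv => ?_⟩
  · calc S.cB * min (r₂ / S.cB) r' ≤ S.cB * (r₂ / S.cB) := by gcongr; exact min_le_left _ _
      _ = r₂ := by field_simp
      _ ≤ _ := hr₂s
  by_contra! hslow
  have hyc : S.cB * ‖y - iAB x‖ < r₂ := by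
    have := hyx.trans_le (min_le_left _ _)
    rwa [lt_div_iff₀' (by linarith)] at this
  have htube := S.mem_tube hx hy (hyc.trans_le hr₂s)
  have hs := S.tubeRadius_lt
  obtain ⟨E, hE⟩ := S.tangent_slow hx hs htube hslow
  have hb := S.tangent_unstable hx hs htube
  set b : B := iAB (w x) with hbdef
  -- both directions `v ± k b` are in the cone at a late time
  have hcone : ∀ k > 0, ∀ ς : ℝ, |ς| = 1 → ∃ n, S.udist (S.φ^[n] x) (S.tangent y n
      (v + (ς * k) • b)) < S.aperture * (ς * S.p (S.φ^[n] x) (S.tangent y n (v + (ς * k) • b))) := by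
    intro k hk ς hς
    obtain ⟨n, hn⟩ : ∃ n : ℕ, (4 / 15 : ℝ) ^ n * (100 * S.q * E) < k := by
      have : Tendsto (fun n : ℕ => (4 / 15 : ℝ) ^ n * (100 * S.q * E)) atTop (𝓝 0) := by
        simpa using (tendsto_pow_atTop_nhds_zero_of_lt_one (by norm_num : (0 : ℝ) ≤ 4 / 15)
          (by norm_num)).mul_const (100 * S.q * E)
      exact (this.eventually (gt_mem_nhds hk)).exists
    refine ⟨n, ?_⟩
    obtain ⟨h1, h2⟩ := hb n
    set β := S.p (S.φ^[n] x) (S.tangent y n b)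
    have hβ : 0 < β := lt_of_lt_of_le (by positivity) h1
    have h3 : 100 * S.q * ‖S.tangent y n v‖ ≤ k * β := by
      calc 100 * S.q * ‖S.tangent y n v‖ ≤ 100 * S.q * (E * (S.κ / 5) ^ n) := by
            gcongr; exact hE n
        _ = ((4 / 15 : ℝ) ^ n * (100 * S.q * E)) * (3 / 4 * S.κ) ^ n := by
          rw [show S.κ / 5 = 4 / 15 * (3 / 4 * S.κ) by ring, mul_pow]; ring
        _ ≤ k * β := by gcongr
    have h4 := S.abs_p_le (S.iterate_mem n hx) (S.tangent y n v)
    set z := S.tangent y n v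
    have hςς : ς * ς = 1 := by rw [← abs_mul_abs_self, hς, one_mul]
    rw [map_add, map_smul, map_add, map_smul, smul_eq_mul, add_comm (S.tangent y n v)]
    have h5 := S.udist_add_le (S.φ^[n] x) ((ς * k) • S.tangent y n b) z
    rw [S.udist_smul, abs_mul, hς, one_mul, abs_of_pos hk] at h5
    have h6 : -(S.q * ‖z‖) ≤ ς * S.p (S.φ^[n] x) z := by
      have : |ς * S.p (S.φ^[n] x) z| ≤ S.q * ‖z‖ := by rw [abs_mul, hς, one_mul]; exact h4
      exact (abs_le.1 this).1
    have h7 : ς * (S.p (S.φ^[n] x) z + ς * k * β) = ς * S.p (S.φ^[n] x) z + k * β := by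
      rw [mul_add]
      rw [show ς * (ς * k * β) = (ς * ς) * (k * β) by ring, hςς, one_mul]
    rw [h7]
    have h8 : k * S.udist (S.φ^[n] x) (S.tangent y n b) ≤ k * (S.aperture / 2 * β) := by gcongr
    have h9 : 100 / 32 * ‖z‖ ≤ S.aperture * (k * β) := by
      calc 100 / 32 * ‖z‖ = S.aperture * (100 * S.q * ‖z‖) := by
            rw [show (100 : ℝ) / 32 = 100 * (1 / 32) by norm_num, ← hqa]; ring
        _ ≤ _ := by gcongr
    have h10 : S.aperture * (S.q * ‖z‖) = 1 / 32 * ‖z‖ := by rw [← mul_assoc, mul_comm S.aperture, hqa]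
    have h11 : S.aperture * (-(S.q * ‖z‖)) ≤ S.aperture * (ς * S.p (S.φ^[n] x) z) := by gcongr
    have h12 : 0 < S.aperture * (k * β) := by positivity
    have h13 := norm_nonneg z
    nlinarith
  -- near `y + h v` there is a point of the leaf, for arbitrarily small `h` and `k`
  have hpt : ∀ k : ℝ, 0 < k → ∃ h : ℝ, 0 < h ∧ h < k ∧ ∃ s : ℝ, |s| ≤ k ∧
      y + h • (v + s • b) ∈ localStableSet OB TB ε (iAB x) := by
    intro k hk
    obtain ⟨n₁, hn₁⟩ := hcone k hk 1 (by simp)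
    obtain ⟨n₂, hn₂⟩ := hcone k hk (-1) (by simp)
    have hsmall : ∀ᶠ h : ℝ in 𝓝[>] 0,
        ‖y - iAB x‖ + h * (‖v‖ + k * ‖b‖) < min (r₂ / S.cB) r' := by
      have h1 : Tendsto (fun h : ℝ => ‖y - iAB x‖ + h * (‖v‖ + k * ‖b‖)) (𝓝 0)
          (𝓝 (‖y - iAB x‖ + 0 * (‖v‖ + k * ‖b‖))) := by
        have : Continuous fun h : ℝ => ‖y - iAB x‖ + h * (‖v‖ + k * ‖b‖) := by fun_prop
        exact this.tendsto 0
      rw [zero_mul, add_zero] at h1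
      exact (h1.mono_left nhdsWithin_le_nhds).eventually (gt_mem_nhds hyx)
    obtain ⟨h, ⟨h1, h2, h3, h4⟩, h0⟩ := ((S.eventually_mem_escapeSet hx hs htube hn₁).and
      ((S.eventually_mem_escapeSet hx hs htube hn₂).and (hsmall.and
        (nhdsWithin_le_nhds (gt_mem_nhds hk))))).and self_mem_nhdsWithin |>.exists
    refine ⟨h, h0, h4, ?_⟩
    let f : ℝ → B := fun s => y + h • (v + s • b)
    have hf : Continuous f := by fun_prop
    obtain ⟨s, hsk, hs₁, hs₂⟩ : ∃ s ∈ Icc (-k) k, f s ∉ S.escapeSet x S.tubeRadius y 1 ∧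
        f s ∉ S.escapeSet x S.tubeRadius y (-1) := by
      by_contra! hno
      obtain ⟨s, -, hs₁, hs₂⟩ := (isPreconnected_Icc (a := -k) (b := k))
        (f ⁻¹' S.escapeSet x S.tubeRadius y 1) (f ⁻¹' S.escapeSet x S.tubeRadius y (-1))
        ((S.isOpen_escapeSet hx hs y 1).preimage hf) ((S.isOpen_escapeSet hx hs y (-1)).preimage hf)
        (fun s hs => by
          by_cases h5 : f s ∈ S.escapeSet x S.tubeRadius y 1
          · exact Or.inl h5
          · exact Or.inr (hno s hs h5))
        ⟨k, ⟨by linarith, le_rfl⟩, by simpa [f] using h1⟩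
        ⟨-k, ⟨le_rfl, by linarith⟩, by simpa [f] using h2⟩
      exact Set.disjoint_left.1 (S.disjoint_escapeSet hx hs htube) hs₁ hs₂
    have hsk' : |s| ≤ k := abs_le.2 hsk
    refine ⟨s, hsk', ?_⟩
    have h5 : ‖f s - iAB x‖ < min (r₂ / S.cB) r' := by
      refine lt_of_le_of_lt ?_ h3
      calc ‖f s - iAB x‖ = ‖(y - iAB x) + h • (v + s • b)‖ := by simp only [f]; congr 1; abel
        _ ≤ ‖y - iAB x‖ + h * (‖v‖ + |s| * ‖b‖) := by
          refine (norm_add_le _ _).trans ?_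
          rw [norm_smul, Real.norm_eq_abs, abs_of_pos h0]
          have : ‖v + s • b‖ ≤ ‖v‖ + |s| * ‖b‖ := by
            refine (norm_add_le _ _).trans ?_
            rw [norm_smul, Real.norm_eq_abs]
          have h00 : (0 : ℝ) ≤ h := le_of_lt h0
          gcongr
        _ ≤ _ := by
          have h00 : (0 : ℝ) ≤ h := le_of_lt h0
          gcongr
    have h6 : ‖f s - iAB x‖ < r₂ :=
      (h5.trans_le (min_le_left _ _)).trans_le (div_le_self hr₂.le hc)
    have h7 := htrap x hx y hy hyc (f s) h6 hs₁ hs₂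
    have hgr : 2 * S.gain * r₂ < S.stableRadius :=
      lt_of_le_of_lt (by gcongr) S.tubeRadius_lt_stableRadius
    have h8 : ∀ k, ‖S.G^[k] (f s) - iAB (S.φ^[k] x)‖ < S.stableRadius := fun k =>
      (S.norm_le_of_coeffAt hx (hgr.trans_le S.stableRadius_le) h6 (n := k) (fun j _ => h7 j) k
        le_rfl).trans_lt hgr
    have h9 := S.stable_decay hx h8
    refine hmem x hx (f s) (fun k => (h9 k).trans_lt ?_) ?_
    · refine lt_of_le_of_lt ?_ (h5.trans_le (min_le_right _ _))
      exact mul_le_of_le_one_left (norm_nonneg _) (pow_le_one₀ (by norm_num) (by norm_num))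
    · refine squeeze_zero (fun k => norm_nonneg _) h9 ?_
      simpa using (tendsto_pow_atTop_nhds_zero_of_lt_one (by norm_num : (0 : ℝ) ≤ 1 / 2)
        (by norm_num)).mul_const ‖f s - iAB x‖
  choose! h hh using hpt
  choose! s hs' using fun k hk => (hh k hk).2.2
  have hj : ∀ j : ℕ, (0 : ℝ) < 1 / ((j : ℝ) + 1) := fun j => by positivity
  have hlim := tendsto_one_div_add_atTop_nhds_zero_nat (𝕜 := ℝ)
  have t1 : Tendsto (fun j : ℕ => h (1 / ((j : ℝ) + 1))) atTop (𝓝 0) :=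
    squeeze_zero (fun j => (hh _ (hj j)).1.le) (fun j => (hh _ (hj j)).2.1.le) hlim
  have t2 : Tendsto (fun j : ℕ => s (1 / ((j : ℝ) + 1))) atTop (𝓝 0) :=
    squeeze_zero_norm (fun j => (hs' _ (hj j)).1) hlim
  have t3 : Tendsto (fun j : ℕ => v + s (1 / ((j : ℝ) + 1)) • b) atTop (𝓝 v) := by
    simpa using (t2.smul_const b).const_add v
  refine hv (mem_tangentConeAt_of_seq atTop (fun j : ℕ => (h (1 / ((j : ℝ) + 1)))⁻¹)
    (fun j : ℕ => h (1 / ((j : ℝ) + 1)) • (v + s (1 / ((j : ℝ) + 1)) • b)) ?_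
    (Eventually.of_forall fun j => (hs' _ (hj j)).2) ?_)
  · simpa using t1.smul t3
  · refine t3.congr fun j => ?_
    rw [smul_smul, inv_mul_cancel₀ (hh _ (hj j)).1.ne', one_smul]

end RobustStep

end Leaf

/-! ### Distortion estimates for expanding sequences -/

section Sequences

theorem le_mul_exp_of_step {x b d : ℕ → ℝ} {n : ℕ} (hb : ∀ k < n, 0 ≤ b k) (hd : ∀ k < n, 0 ≤ d k)
    (hx0 : 0 ≤ x 0) (h : ∀ k < n, x (k + 1) ≤ (1 + b k) * x k + d k) :
    x n ≤ (x 0 + ∑ k ∈ Finset.range n, d k) * Real.exp (∑ k ∈ Finset.range n, b k) := by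
  induction n with
  | zero => simp
  | succ n ih =>
    have h1 := ih (fun k hk => hb k (by omega)) (fun k hk => hd k (by omega))
      (fun k hk => h k (by omega))
    have h2 := h n (by omega)
    have hbn := hb n (by omega)
    have hdn := hd n (by omega)
    rw [Finset.sum_range_succ, Finset.sum_range_succ, Real.exp_add]
    have hS : 0 ≤ ∑ k ∈ Finset.range n, d k :=
      Finset.sum_nonneg fun k hk => hd k (by have := Finset.mem_range.1 hk; omega)
    have hB : 0 ≤ ∑ k ∈ Finset.range n, b k :=
      Finset.sum_nonneg fun k hk => hb k (by have := Finset.mem_range.1 hk; omega)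
    set Sd := ∑ k ∈ Finset.range n, d k
    set Sb := ∑ k ∈ Finset.range n, b k
    have h3 : 1 + b n ≤ Real.exp (b n) := by linarith [Real.add_one_le_exp (b n)]
    have h4 : 1 ≤ Real.exp Sb := Real.one_le_exp hB
    have h5 : 1 ≤ Real.exp (b n) := Real.one_le_exp hbn
    calc x (n + 1) ≤ (1 + b n) * x n + d n := h2
      _ ≤ (1 + b n) * ((x 0 + Sd) * Real.exp Sb) + d n := by gcongr
      _ ≤ Real.exp (b n) * ((x 0 + Sd) * Real.exp Sb) + d n * (Real.exp Sb * Real.exp (b n)) := by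
        gcongr
        exact le_mul_of_one_le_right hdn (one_le_mul_of_one_le_of_one_le h4 h5)
      _ = _ := by ring

variable {η : ℝ}

theorem sum_range_pow_le (h0 : 0 ≤ η) (h1 : η < 1) (n : ℕ) :
    ∑ k ∈ Finset.range n, η ^ k ≤ 1 / (1 - η) := by
  have := (summable_geometric_of_lt_one h0 h1).sum_le_tsum (Finset.range n)
    (fun k _ => by positivity)
  rwa [tsum_geometric_of_lt_one h0 h1, ← one_div] at this

theorem sum_range_pow_sub_le (h0 : 0 ≤ η) (h1 : η < 1) {n N : ℕ} (hn : n ≤ N) :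
    ∑ k ∈ Finset.range n, η ^ (N - k) ≤ η ^ (N - n) / (1 - η) := by
  have e : ∑ k ∈ Finset.range n, η ^ (N - k) = η ^ (N - n) * ∑ k ∈ Finset.range n, η ^ (k + 1) := by
    rw [← Finset.sum_range_reflect, Finset.mul_sum]
    refine Finset.sum_congr rfl fun k hk => ?_
    rw [← pow_add]
    congr 1
    have := Finset.mem_range.1 hk
    omega
  rw [e, div_eq_mul_one_div]
  gcongr
  refine le_trans (Finset.sum_le_sum fun k _ => ?_) (sum_range_pow_le h0 h1 n)
  exact pow_le_pow_of_le_one h0 h1.le (Nat.le_succ k)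

/-- The two-sided exponential bound for the distortion at time `k` of a piece of orbit of length
`N`: the orbit approaches the basic set at first, and separates from it at the end. -/
theorem sum_range_two_sided_le (h0 : 0 ≤ η) (h1 : η < 1) {n N : ℕ} (hn : n ≤ N) :
    ∑ k ∈ Finset.range n, (η ^ k + η ^ (N - k)) ≤ 2 / (1 - η) := by
  have h2 : 0 < 1 - η := by linarith
  rw [Finset.sum_add_distrib]
  have h3 := sum_range_pow_le h0 h1 n
  have h4 := sum_range_pow_sub_le h0 h1 hn
  have h5 : η ^ (N - n) / (1 - η) ≤ 1 / (1 - η) := by gcongr; exact pow_le_one₀ h0 h1.le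
  calc _ ≤ 1 / (1 - η) + 1 / (1 - η) := by linarith
    _ = _ := by ring

/-- Cone sequences: the aperture decays along with the distortion of the steps. -/
theorem cone_sequence {κ q Q : ℝ} {N : ℕ} {d μ P D : ℕ → ℝ} (hκ : 6 ≤ κ) (hq : 1 ≤ q)
    (hη : 1 / 2 ≤ η) (hη1 : η < 1) (hQ : 0 ≤ Q) (hd : ∀ k, κ ≤ d k) (hμ0 : ∀ k, 0 ≤ μ k)
    (hμ : ∀ k, 1024 * q * μ k ≤ 1) (hμQ : ∀ k ≤ N, μ k ≤ Q * (η ^ k + η ^ (N - k)))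
    (h : ∀ k < N, ConeStep κ q (d k) (μ k) 0 (P k) (D k) (P (k + 1)) (D (k + 1)))
    (h0 : D 0 ≤ 1 / (32 * q) * |P 0|) :
    (∀ k ≤ N, D k ≤ 1 / (32 * q) * |P k|) ∧ ∃ b : ℕ → ℝ, ∀ k < N,
      2 * q * μ k ≤ b k ∧ b k ≤ 1 / 4 ∧ b k ≤ q * (14 * Q + 1) * (η ^ k + η ^ (N - k)) ∧
      |P (k + 1) - d k * P k| ≤ b k * (d k * |P k|) ∧ 4 * |P k| ≤ |P (k + 1)| := by
  set a : ℝ := 1 / (32 * q) with ha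
  have ha0 : 0 < a := by positivity
  have hqa : q * a = 1 / 32 := by rw [ha]; field_simp
  have hμa : ∀ k, 32 * μ k ≤ a := by
    intro k
    rw [ha, le_div_iff₀ (by positivity)]
    linarith [hμ k]
  set t : ℕ → ℝ := fun k => (12 * Q + 1) * (η ^ k + η ^ (N - k)) with ht
  have ht0 : ∀ k, 0 ≤ t k := fun k => by positivity
  set e : ℕ → ℝ := fun k => min a (t k) with he
  have he0 : ∀ k, 0 ≤ e k := fun k => le_min ha0.le (ht0 k)
  have hqe : ∀ k, q * (2 * μ k + e k) ≤ 1 / 4 := by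
    intro k
    have : q * (2 * μ k + e k) ≤ q * (2 * a) := by
      gcongr
      linarith [hμa k, hμ0 k, min_le_left a (t k)]
    linarith
  have hD : ∀ k ≤ N, D k ≤ e k * |P k| := by
    intro k
    induction k with
    | zero =>
      intro _
      have h2 : a ≤ t 0 := by
        have h3 : a ≤ 1 := by
          rw [ha, div_le_one (by positivity)]; linarith
        have : 1 ≤ η ^ 0 + η ^ (N - 0) := by
          rw [pow_zero]; linarith [pow_nonneg (by linarith : 0 ≤ η) (N - 0)]
        have : 1 ≤ t 0 := one_le_mul_of_one_le_of_one_le (by linarith) this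
        linarith
      simpa [he, min_eq_left h2] using h0
    | succ k ih =>
      intro hk
      have h1 := ((h k hk).narrow hκ (hd k) hq (hμ0 k) (he0 k) (ih (by omega)) (hqe k)).2
      refine h1.trans ?_
      gcongr
      refine le_min ?_ ?_
      · linarith [hμa k, hμ0 k, min_le_left a (t k)]
      · have h2 : e k ≤ t k := min_le_right _ _
        have h3 := hμQ k (by omega)
        have h4 : η ^ k ≤ 2 * η ^ (k + 1) := by
          rw [pow_succ]; nlinarith [pow_pos (by linarith : 0 < η) k]
        have h5 : η ^ (N - k) ≤ 1 * η ^ (N - (k + 1)) := by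
          rw [one_mul]; exact pow_le_pow_of_le_one (by linarith) hη1.le (by omega)
        have h6 : 0 < η ^ (k + 1) := by positivity
        have h7 : 0 < η ^ (N - (k + 1)) := by positivity
        have h8 : η ^ k + η ^ (N - k) ≤ 2 * (η ^ (k + 1) + η ^ (N - (k + 1))) := by linarith
        calc 3 * μ k + e k / 4
            ≤ (3 * Q + (12 * Q + 1) / 4) * (η ^ k + η ^ (N - k)) := by
              simp only [ht] at h2
              linarith
          _ ≤ (3 * Q + (12 * Q + 1) / 4) * (2 * (η ^ (k + 1) + η ^ (N - (k + 1)))) := by gcongr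
          _ ≤ t (k + 1) := by simp only [ht]; nlinarith
  refine ⟨fun k hk => (hD k hk).trans (by gcongr; exact min_le_left _ _),
    fun k => q * (2 * μ k + e k), fun k hk => ⟨?_, hqe k, ?_, ?_, ?_⟩⟩
  · nlinarith [he0 k]
  · have h2 : e k ≤ t k := min_le_right _ _
    have h3 := hμQ k hk.le
    rw [mul_assoc q]
    refine mul_le_mul_of_nonneg_left ?_ (by linarith)
    simp only [ht] at h2
    linarith
  · exact ((h k hk).narrow hκ (hd k) hq (hμ0 k) (he0 k) (hD k hk.le) (hqe k)).1
  · have h1 := (h k hk).growth_abs hκ (hd k) hq (hμ0 k) (he0 k) (hD k hk.le) (hqe k)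
    have h2 : 6 * |P k| ≤ d k * |P k| := by gcongr; linarith [hd k]
    linarith [abs_nonneg (P k)]

/-- Two sequences that are expanded by nearly the same factors keep the same ratio. -/
theorem ratio_sequence {Q : ℝ} {N l k : ℕ} {d b b' P P' : ℕ → ℝ} (hη : 0 ≤ η) (hη1 : η < 1)
    (hQ : 0 ≤ Q) (hl : l ≤ N) (hkl : k ≤ l) (hd : ∀ k, 0 < d k) (hP0 : ∀ k ≤ N, P k ≠ 0)
    (hP0' : ∀ k ≤ N, P' k ≠ 0)
    (h : ∀ k < N, b k ≤ 1 / 4 ∧ b k ≤ Q * (η ^ k + η ^ (N - k)) ∧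
      |P (k + 1) - d k * P k| ≤ b k * (d k * |P k|))
    (h' : ∀ k < N, b' k ≤ 1 / 4 ∧ b' k ≤ Q * (η ^ k + η ^ (N - k)) ∧
      |P' (k + 1) - d k * P' k| ≤ b' k * (d k * |P' k|)) :
    |P k / P' k - 1| ≤ (|P l / P' l - 1| + 3 * Q * (η ^ k + η ^ (N - l)) / (1 - η)) *
      Real.exp (6 * Q / (1 - η)) := by
  have h1η : 0 < 1 - η := by linarith
  set x : ℕ → ℝ := fun j => |P (l - j) / P' (l - j) - 1| with hx
  set c : ℕ → ℝ := fun j => 3 * Q * (η ^ (l - (j + 1)) + η ^ (N - (l - (j + 1)))) with hc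
  have hc0 : ∀ j, 0 ≤ c j := fun j => by positivity
  have hstep : ∀ j < l - k, x (j + 1) ≤ (1 + c j) * x j + c j := by
    intro j hj
    obtain ⟨i, hi⟩ : ∃ i, i = l - (j + 1) := ⟨_, rfl⟩
    have hi' : l - j = i + 1 := by omega
    have hiN : i < N := by omega
    simp only [hx, hc, hi']
    rw [← hi]
    obtain ⟨a1, a2, a3⟩ := h i hiN
    obtain ⟨a1', a2', a3'⟩ := h' i hiN
    have hPi := hP0 i (by omega)
    have hPi' := hP0' i (by omega)
    have hdi := hd i
    have hrel : ∀ {p p₁ β : ℝ}, p ≠ 0 → |p₁ - d i * p| ≤ β * (d i * |p|) →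
        |p₁ / (d i * p) - 1| ≤ β := by
      intro p p₁ β hp hh
      have hdp : d i * p ≠ 0 := mul_ne_zero hdi.ne' hp
      rw [div_sub_one hdp, abs_div, abs_mul, abs_of_pos hdi, div_le_iff₀ (by positivity)]
      exact hh
    have r1 := hrel hPi a3
    have r2 := hrel hPi' a3'
    set α := P (i + 1) / (d i * P i) with hα
    set α' := P' (i + 1) / (d i * P' i) with hα'
    set B := Q * (η ^ i + η ^ (N - i)) with hB
    have hαpos : 3 / 4 ≤ α := by linarith [(abs_le.1 r1).1]
    have e : P i / P' i = (P (i + 1) / P' (i + 1)) * (α' / α) := by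
      have := hP0 (i + 1) (by omega)
      have := hP0' (i + 1) (by omega)
      rw [hα, hα']; field_simp
    have hu : |α' / α - 1| ≤ 3 * B := by
      rw [div_sub_one (by linarith), abs_div, abs_of_pos (by linarith : 0 < α),
        div_le_iff₀ (by linarith)]
      have h5 : |α' - α| ≤ 2 * B := by
        calc |α' - α| = |(α' - 1) - (α - 1)| := by ring_nf
          _ ≤ _ := (abs_sub _ _).trans (by linarith)
      have hB0 : 0 ≤ B := by positivity
      nlinarith
    rw [e]
    have hB0 : 0 ≤ B := by positivity
    set u := α' / α
    set X := P (i + 1) / P' (i + 1)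
    have e3 : 3 * Q * (η ^ i + η ^ (N - i)) = 3 * B := by rw [hB]; ring
    rw [e3]
    calc |X * u - 1| = |(X - 1) * u + (u - 1)| := by congr 1; ring
      _ ≤ |X - 1| * |u| + |u - 1| := by rw [← abs_mul]; exact abs_add_le _ _
      _ ≤ |X - 1| * (1 + 3 * B) + 3 * B := by
        gcongr
        have : |u| ≤ |u - 1| + 1 := by
          simpa using abs_add_le (u - 1) 1
        linarith
      _ = _ := by ring
  have hg := le_mul_exp_of_step (n := l - k) (fun j _ => hc0 j) (fun j _ => hc0 j)
    (abs_nonneg _) hstep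
  have e1 : ∑ j ∈ Finset.range (l - k), c j =
      3 * Q * ∑ j ∈ Finset.range (l - k), (η ^ (k + j) + η ^ (N - (k + j))) := by
    rw [← Finset.sum_range_reflect, Finset.mul_sum]
    refine Finset.sum_congr rfl fun j hj => ?_
    have := Finset.mem_range.1 hj
    simp only [hc]
    rw [show l - (l - k - 1 - j + 1) = k + j by omega]
  have e2 : ∑ j ∈ Finset.range (l - k), (η ^ (k + j) + η ^ (N - (k + j))) ≤
      (η ^ k + η ^ (N - l)) / (1 - η) := by
    rw [Finset.sum_add_distrib, add_div]
    refine add_le_add ?_ ?_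
    · simp only [pow_add]
      rw [← Finset.mul_sum, div_eq_mul_one_div]
      gcongr
      exact sum_range_pow_le hη hη1 _
    · have h6 := sum_range_pow_sub_le hη hη1 (n := l - k) (N := N - k) (by omega)
      rw [show N - k - (l - k) = N - l by omega] at h6
      refine le_trans (le_of_eq (Finset.sum_congr rfl fun j _ => ?_)) h6
      rw [Nat.sub_sub]
  have e3 : ∑ j ∈ Finset.range (l - k), c j ≤ 3 * Q * (η ^ k + η ^ (N - l)) / (1 - η) := by
    rw [e1, mul_div_assoc]
    gcongr
  have e4 : ∑ j ∈ Finset.range (l - k), c j ≤ 6 * Q / (1 - η) := by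
    have h7 : η ^ k ≤ 1 := pow_le_one₀ hη hη1.le
    have h8 : η ^ (N - l) ≤ 1 := pow_le_one₀ hη hη1.le
    have h9 : 3 * Q * (η ^ k + η ^ (N - l)) ≤ 3 * Q * (1 + 1) := by gcongr
    refine e3.trans (div_le_div_of_nonneg_right ?_ h1η.le)
    linarith
  simp only [hx] at hg
  rw [Nat.sub_zero, show l - (l - k) = k by omega] at hg
  refine hg.trans ?_
  gcongr

/-- The deviation `n` from proportionality of two expanding sequences `P` and `P₃` stays small
compared with `P`, up to an exponentially small time before they get large. -/
theorem deviation_sequence {Q H a : ℝ} {N : ℕ} {d c b P P₃ n : ℕ → ℝ} (hη : 0 ≤ η) (hη1 : η < 1)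
    (hQ : 0 ≤ Q) (hH : 0 ≤ H) (hd : ∀ k, 0 < d k) (hP0 : ∀ k ≤ N, P k ≠ 0) (hc0 : ∀ k, 0 ≤ c k)
    (h : ∀ k < N, c k ≤ b k ∧ b k ≤ 1 / 4 ∧ b k ≤ Q * (η ^ k + η ^ (N - k)) ∧
      |P (k + 1) - d k * P k| ≤ b k * (d k * |P k|) ∧ 4 * |P k| ≤ |P (k + 1)|)
    (hn0 : ∀ k, 0 ≤ n k) (hn : ∀ k ≤ N, |P k - a * P₃ k| ≤ n k)
    (hstep : ∀ k < N, n (k + 1) ≤ d k * (1 + c k) * n k +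
      H * η ^ (N - k) * (|P k| + |a| * |P₃ k|)) (h0 : n 0 ≤ H * η ^ N * |P 0|) :
    ∀ k ≤ N, n k ≤ (H + H / (1 - η)) * Real.exp ((6 * Q + H) / (1 - η)) * η ^ (N - k) * |P k| := by
  intro m hm
  have h1η : 0 < 1 - η := by linarith
  set x : ℕ → ℝ := fun k => n k / |P k| with hx
  have hx0 : ∀ k, 0 ≤ x k := fun k => div_nonneg (hn0 k) (abs_nonneg _)
  have hxs : ∀ k < m, x (k + 1) ≤
      (1 + (3 * Q * (η ^ k + η ^ (N - k)) + H * η ^ (N - k))) * x k + H * η ^ (N - k) := by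
    intro k hk
    obtain ⟨a1, a2, a3, a4, a5⟩ := h k (by omega)
    have hPk : 0 < |P k| := abs_pos.2 (hP0 k (by omega))
    have hPk' : 0 < |P (k + 1)| := abs_pos.2 (hP0 (k + 1) (by omega))
    have hdk := hd k
    have hs := hstep k (by omega)
    have hb0 : 0 ≤ b k := (hc0 k).trans a1
    have e1 : n k = x k * |P k| := by simp only [hx]; field_simp
    have e2 : d k * (1 - b k) * |P k| ≤ |P (k + 1)| := by
      have h6 : |d k * P k| = d k * |P k| := by rw [abs_mul, abs_of_pos hdk]
      have h7 : |d k * P k| ≤ |P (k + 1)| + |P (k + 1) - d k * P k| := by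
        rw [abs_sub_comm]; exact sub_le_iff_le_add'.1 (abs_sub_abs_le_abs_sub _ _)
      nlinarith
    have e3 : |a| * |P₃ k| ≤ (1 + x k) * |P k| := by
      have h7 := hn k (by omega)
      rw [e1] at h7
      rw [← abs_mul]
      have h8 := abs_sub_abs_le_abs_sub (a * P₃ k) (P k)
      rw [abs_sub_comm (a * P₃ k)] at h8
      linarith
    have hxk := hx0 k
    have hηk : 0 ≤ η ^ (N - k) := by positivity
    have e4 : d k * (1 + c k) * n k ≤ (1 + 3 * b k) * x k * |P (k + 1)| := by
      calc d k * (1 + c k) * n k = (1 + c k) * x k * (d k * |P k|) := by rw [e1]; ring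
        _ ≤ (1 + b k) * x k * (d k * |P k|) := by gcongr
        _ ≤ ((1 + 3 * b k) * (1 - b k)) * x k * (d k * |P k|) := by
          gcongr
          nlinarith
        _ = (1 + 3 * b k) * x k * (d k * (1 - b k) * |P k|) := by ring
        _ ≤ _ := by gcongr
    have e5 : H * η ^ (N - k) * (|P k| + |a| * |P₃ k|) ≤
        H * η ^ (N - k) * (1 + x k) * |P (k + 1)| := by
      calc H * η ^ (N - k) * (|P k| + |a| * |P₃ k|)
          ≤ H * η ^ (N - k) * (|P k| + (1 + x k) * |P k|) := by gcongr
        _ ≤ H * η ^ (N - k) * ((1 + x k) * (4 * |P k|)) := by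
          gcongr
          nlinarith
        _ ≤ H * η ^ (N - k) * ((1 + x k) * |P (k + 1)|) := by gcongr
        _ = _ := by ring
    have e6 : n (k + 1) ≤ ((1 + 3 * b k) * x k + H * η ^ (N - k) * (1 + x k)) * |P (k + 1)| := by
      linarith
    have e7 : x (k + 1) ≤ (1 + 3 * b k) * x k + H * η ^ (N - k) * (1 + x k) :=
      (div_le_iff₀ hPk').2 e6
    have e8 : 3 * b k * x k ≤ 3 * Q * (η ^ k + η ^ (N - k)) * x k := by
      gcongr ?_ * x k
      linarith
    linarith
  have hg := le_mul_exp_of_step (n := m) (fun k _ => by positivity) (fun k _ => by positivity)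
    (hx0 0) hxs
  have hP0m : 0 < |P m| := abs_pos.2 (hP0 m hm)
  have hP00 : 0 < |P 0| := abs_pos.2 (hP0 0 (by omega))
  have e1 : x 0 ≤ H * η ^ (N - m) := by
    refine (div_le_iff₀ hP00).2 (h0.trans ?_)
    gcongr ?_ * |P 0|
    gcongr ?_ * ?_
    exact pow_le_pow_of_le_one hη hη1.le (by omega)
  have e2 : ∑ k ∈ Finset.range m, H * η ^ (N - k) ≤ H * (η ^ (N - m) / (1 - η)) := by
    rw [← Finset.mul_sum]
    gcongr
    exact sum_range_pow_sub_le hη hη1 hm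
  have e3 : ∑ k ∈ Finset.range m, (3 * Q * (η ^ k + η ^ (N - k)) + H * η ^ (N - k)) ≤
      (6 * Q + H) / (1 - η) := by
    rw [Finset.sum_add_distrib, ← Finset.mul_sum]
    have h5 := sum_range_two_sided_le hη hη1 hm
    have h6 : H * (η ^ (N - m) / (1 - η)) ≤ H * (1 / (1 - η)) := by
      gcongr
      exact pow_le_one₀ hη hη1.le
    calc _ ≤ 3 * Q * (2 / (1 - η)) + H * (1 / (1 - η)) := by gcongr; exact e2.trans h6
      _ = _ := by ring
  refine (div_le_iff₀ hP0m).1 ?_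
  calc x m ≤ _ := hg
    _ ≤ (H * η ^ (N - m) + H * (η ^ (N - m) / (1 - η))) * Real.exp ((6 * Q + H) / (1 - η)) := by
      gcongr
    _ = _ := by ring

end Sequences

/-! ### Comparison of the differences on a transversal and on the unstable manifold -/

section Comparison

variable {A B C : Type*}
  [NormedAddCommGroup A] [NormedSpace ℝ A] [NormedAddCommGroup B] [NormedSpace ℝ B]
  [NormedAddCommGroup C] [NormedSpace ℝ C]
  {iAB : A →L[ℝ] B} {iBC : B →L[ℝ] C}
  {OA : Set A} {T : A → A} {K : Set A} {OB : Set B} {TB : B → B} {w : A → A}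

namespace RobustStep

variable (S : RobustStep iAB iBC OA T K OB TB w)

/-- The exponential rate of the distortion estimates. -/
noncomputable def rate : ℝ := max (1 / 2) ((1 / 2) ^ S.β)

theorem half_le_rate : 1 / 2 ≤ S.rate := le_max_left _ _

theorem rate_pos : 0 < S.rate := lt_of_lt_of_le (by norm_num) S.half_le_rate

theorem rate_lt_one : S.rate < 1 :=
  max_lt (by norm_num) (Real.rpow_lt_one (by norm_num) (by norm_num) S.β_pos)

theorem half_pow_le_rate (k : ℕ) : (1 / 2 : ℝ) ^ k ≤ S.rate ^ k := by
  gcongr; exact S.half_le_rate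

theorem half_pow_rpow_le_rate (k : ℕ) : ((1 / 2 : ℝ) ^ k) ^ S.β ≤ S.rate ^ k := by
  rw [← Real.rpow_natCast, ← Real.rpow_mul (by norm_num), mul_comm, Real.rpow_mul (by norm_num),
    Real.rpow_natCast]
  gcongr
  exact le_max_right _ _

/-- The norm on `C` that is adapted to the splitting at `x`. -/
noncomputable def tot (x : A) (z : C) : ℝ := |S.p x z| + S.q * S.udist x z

theorem tot_nonneg (x : A) (z : C) : 0 ≤ S.tot x z := by
  have := S.q_ge
  have := S.udist_nonneg x z
  unfold tot; positivity

theorem tot_le {x : A} (hx : x ∈ K) (z : C) : S.tot x z ≤ 2 * S.q * ‖z‖ := by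
  have := S.q_ge
  have h1 := S.abs_p_le hx z
  have h2 : S.q * S.udist x z ≤ S.q * ‖z‖ := by gcongr; exact lineDist_le_norm _ _
  unfold tot; linarith

theorem norm_le_tot {x : A} (hx : x ∈ K) (z : C) :
    ‖z‖ ≤ 2 * (1 + ‖iBC‖ * ‖iAB‖) * S.tot x z := by
  have hq := S.q_ge
  have hD := S.udist_nonneg x z
  have hP := abs_nonneg (S.p x z)
  refine (S.udist_le hx z).trans ?_
  rw [mul_comm 2, mul_assoc]
  gcongr
  unfold tot
  nlinarith

/-- The bound for the distance to the basic set at time `k`, for points that separate from it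
after time `N`. -/
noncomputable def dev (R : ℝ) (N k : ℕ) : ℝ :=
  min (S.radius / 2) (R * ((1 / 2) ^ k + (1 / 2) ^ (N - k)))

theorem dev_nonneg {R : ℝ} (hR : 0 ≤ R) (N k : ℕ) : 0 ≤ S.dev R N k :=
  le_min (by linarith [S.radius_pos]) (by positivity)

theorem dev_lt (R : ℝ) (N k : ℕ) : S.dev R N k < S.radius :=
  (min_le_left _ _).trans_lt (by linarith [S.radius_pos])

theorem modulus_dev_le {R : ℝ} (hR : 0 ≤ R) (N k : ℕ) :
    S.modulus (S.dev R N k) ≤ S.N * (2 * R) ^ S.β * (S.rate ^ k + S.rate ^ (N - k)) := by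
  have hβ := S.β_pos
  have hN := S.N_pos
  have h0 := S.dev_nonneg hR N k
  unfold modulus
  rw [mul_assoc]
  gcongr
  have h1 : S.dev R N k ≤ 2 * R * max ((1 / 2) ^ k) ((1 / 2) ^ (N - k)) := by
    refine (min_le_right _ _).trans ?_
    have h2 := le_max_left ((1 / 2 : ℝ) ^ k) ((1 / 2) ^ (N - k))
    have h3 := le_max_right ((1 / 2 : ℝ) ^ k) ((1 / 2) ^ (N - k))
    rw [mul_comm 2, mul_assoc]
    gcongr
    linarith
  calc S.dev R N k ^ S.β ≤ (2 * R * max ((1 / 2) ^ k) ((1 / 2) ^ (N - k))) ^ S.β := by gcongr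
    _ = (2 * R) ^ S.β * (max ((1 / 2) ^ k) ((1 / 2) ^ (N - k))) ^ S.β :=
      Real.mul_rpow (by positivity) (by positivity)
    _ ≤ (2 * R) ^ S.β * (S.rate ^ k + S.rate ^ (N - k)) := by
      gcongr
      have h4 := S.half_pow_rpow_le_rate k
      have h5 := S.half_pow_rpow_le_rate (N - k)
      have h6 : 0 < S.rate ^ k := pow_pos S.rate_pos k
      have h7 : 0 < S.rate ^ (N - k) := pow_pos S.rate_pos _
      rcases max_choice ((1 / 2 : ℝ) ^ k) ((1 / 2) ^ (N - k)) with h | h <;> rw [h] <;> linarith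

/-- The unstable coefficient at time `k` of the difference of the orbits of `y₂` and `y₁`, with
respect to the orbit of `x`. -/
noncomputable def pairCoeff (x : A) (y₁ y₂ : B) (k : ℕ) : ℝ :=
  S.p (S.φ^[k] x) (iBC (S.G^[k] y₂ - S.G^[k] y₁))

/-- The difference of `y₂` and `y₁` is in the cone at `x`, and it does not vanish. -/
def InCone (x : A) (y₁ y₂ : B) : Prop :=
  S.pairCoeff x y₁ y₂ 0 ≠ 0 ∧
    S.udist x (iBC (y₂ - y₁)) ≤ 1 / (32 * S.q) * |S.pairCoeff x y₁ y₂ 0|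

variable {S} in
theorem InCone.sequence {x : A} (hx : x ∈ K) {y₁ y₂ : B} {R : ℝ} (hR : 0 ≤ R) {N : ℕ}
    (h₁ : ∀ k ≤ N, ‖S.G^[k] y₁ - iAB (S.φ^[k] x)‖ ≤ S.dev R N k)
    (h₂ : ∀ k ≤ N, ‖S.G^[k] y₂ - iAB (S.φ^[k] x)‖ ≤ S.dev R N k) (h : S.InCone x y₁ y₂) :
    (∀ k ≤ N, S.udist (S.φ^[k] x) (iBC (S.G^[k] y₂ - S.G^[k] y₁)) ≤
      1 / (32 * S.q) * |S.pairCoeff x y₁ y₂ k|) ∧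
    (∀ k ≤ N, S.pairCoeff x y₁ y₂ k ≠ 0) ∧ ∃ b : ℕ → ℝ, ∀ k < N,
      2 * S.q * S.modulus (S.dev R N k) ≤ b k ∧ b k ≤ 1 / 4 ∧
      b k ≤ S.q * (14 * (S.N * (2 * R) ^ S.β) + 1) * (S.rate ^ k + S.rate ^ (N - k)) ∧
      |S.pairCoeff x y₁ y₂ (k + 1) - S.dl (S.φ^[k] x) * S.pairCoeff x y₁ y₂ k| ≤
        b k * (S.dl (S.φ^[k] x) * |S.pairCoeff x y₁ y₂ k|) ∧
      4 * |S.pairCoeff x y₁ y₂ k| ≤ |S.pairCoeff x y₁ y₂ (k + 1)| := by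
  have hN := S.N_pos
  obtain ⟨c1, b, c2⟩ := cone_sequence (N := N) (d := fun k => S.dl (S.φ^[k] x))
    (μ := fun k => S.modulus (S.dev R N k)) (P := S.pairCoeff x y₁ y₂)
    (D := fun k => S.udist (S.φ^[k] x) (iBC (S.G^[k] y₂ - S.G^[k] y₁)))
    (Q := S.N * (2 * R) ^ S.β) S.κ_ge S.q_ge S.half_le_rate S.rate_lt_one (by positivity)
    (fun k => S.κ_le _ (S.iterate_mem k hx)) (fun k => S.modulus_nonneg (S.dev_nonneg hR N k))
    (fun k => S.modulus_le (S.dev_nonneg hR N k) (S.dev_lt R N k).le)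
    (fun k _ => S.modulus_dev_le hR N k)
    (fun k hk => by
      have h3 := S.pair_step (S.iterate_mem k hx) (h₂ k hk.le) (h₁ k hk.le) (S.dev_lt R N k)
      simpa only [pairCoeff, Function.iterate_succ_apply'] using h3) h.2
  refine ⟨c1, fun k => ?_, b, c2⟩
  induction k with
  | zero => intro _; exact h.1
  | succ k ih =>
    intro hk
    have h3 := abs_pos.2 (ih (by omega))
    have h4 := (c2 k (by omega)).2.2.2.2
    exact abs_pos.1 (by linarith)

theorem iterate_growth {P : ℕ → ℝ} {N : ℕ} (h : ∀ k < N, 4 * |P k| ≤ |P (k + 1)|) :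
    ∀ i k, k + i = N → |P k| ≤ (1 / 2) ^ i * |P N| := by
  intro i
  induction i with
  | zero => intro k hk; simp at hk; simp [hk]
  | succ i ih =>
    intro k hk
    have h1 := ih (k + 1) (by omega)
    have h2 := h k (by omega)
    rw [pow_succ]
    linarith [abs_nonneg (P k)]

/-- The ratio of the differences of three orbits on one curve is nearly constant in time. -/
theorem exists_deviation {R H : ℝ} (hR : 0 ≤ R) (hH : 0 ≤ H) : ∃ E ≥ 0, ∀ x ∈ K, ∀ (y₁ y₂ y₃ : B)
    (N : ℕ) (a : ℝ), (∀ k ≤ N, ‖S.G^[k] y₁ - iAB (S.φ^[k] x)‖ ≤ S.dev R N k) →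
    (∀ k ≤ N, ‖S.G^[k] y₂ - iAB (S.φ^[k] x)‖ ≤ S.dev R N k) →
    (∀ k ≤ N, ‖S.G^[k] y₃ - iAB (S.φ^[k] x)‖ ≤ S.dev R N k) →
    S.InCone x y₁ y₂ → S.InCone x y₁ y₃ →
    S.tot x (iBC (y₂ - y₁ - a • (y₃ - y₁))) ≤ H * S.rate ^ N * |S.pairCoeff x y₁ y₂ 0| →
    ∀ k ≤ N, |S.pairCoeff x y₁ y₂ k - a * S.pairCoeff x y₁ y₃ k| ≤
      E * S.rate ^ (N - k) * |S.pairCoeff x y₁ y₂ k| := by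
  have hq := S.q_ge
  have hM := S.M_pos
  have hβ := S.β_pos
  have hN := S.N_pos
  have hrad := S.radius_pos
  have hη := S.rate_pos
  have hη1 := S.rate_lt_one
  set ct : ℝ := 2 * (1 + ‖iBC‖ * ‖iAB‖) * 2 with hct
  have hct0 : 0 ≤ ct := by positivity
  set H₁ : ℝ := 2 * S.q * (S.M * (ct * (ct * (S.q * ‖iBC‖ * S.radius)) ^ S.β)) with hH₁
  have hH₁0 : 0 ≤ H₁ := by positivity
  set Q : ℝ := S.q * (14 * (S.N * (2 * R) ^ S.β) + 1) with hQ
  have hQ0 : 0 ≤ Q := by positivity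
  have h1η : 0 < 1 - S.rate := by linarith
  refine ⟨(H + H₁ + (H + H₁) / (1 - S.rate)) * Real.exp ((6 * Q + (H + H₁)) / (1 - S.rate)),
    by positivity, ?_⟩
  intro x hx y₁ y₂ y₃ N a h₁ h₂ h₃ hc₂ hc₃ h0 k hk
  obtain ⟨c2, n2, b, s2⟩ := hc₂.sequence hx hR h₁ h₂
  obtain ⟨c3, n3, b₃, s3⟩ := hc₃.sequence hx hR h₁ h₃
  -- the norm in `C` of the differences is controlled by their coefficients
  have hz : ∀ y : B, (∀ k ≤ N, ‖S.G^[k] y - iAB (S.φ^[k] x)‖ ≤ S.dev R N k) →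
      (∀ k ≤ N, S.udist (S.φ^[k] x) (iBC (S.G^[k] y - S.G^[k] y₁)) ≤
        1 / (32 * S.q) * |S.pairCoeff x y₁ y k|) →
      (∀ k < N, 4 * |S.pairCoeff x y₁ y k| ≤ |S.pairCoeff x y₁ y (k + 1)|) → ∀ k ≤ N,
      ‖iBC (S.G^[k] y - S.G^[k] y₁)‖ ^ (1 + S.β) ≤
        (ct * (ct * (S.q * ‖iBC‖ * S.radius)) ^ S.β) * S.rate ^ (N - k) *
          |S.pairCoeff x y₁ y k| := by
    intro y hy hcy hgy k hk
    have h4 : ‖iBC (S.G^[k] y - S.G^[k] y₁)‖ ≤ ct * |S.pairCoeff x y₁ y k| := by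
      refine (S.norm_le_tot (S.iterate_mem k hx) _).trans ?_
      rw [hct, mul_assoc _ 2]
      gcongr
      unfold tot
      have h5 := hcy k hk
      have h6 : S.q * S.udist (S.φ^[k] x) (iBC (S.G^[k] y - S.G^[k] y₁)) ≤
          S.q * (1 / (32 * S.q) * |S.pairCoeff x y₁ y k|) := by gcongr
      have h7 : S.q * (1 / (32 * S.q) * |S.pairCoeff x y₁ y k|) =
          1 / 32 * |S.pairCoeff x y₁ y k| := by field_simp
      have h8 := abs_nonneg (S.pairCoeff x y₁ y k)
      change |S.pairCoeff x y₁ y k| + _ ≤ _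
      linarith
    have h5 : |S.pairCoeff x y₁ y N| ≤ S.q * ‖iBC‖ * S.radius := by
      have h6 : ‖S.G^[N] y - S.G^[N] y₁‖ ≤ S.radius := by
        have e : S.G^[N] y - S.G^[N] y₁ = (S.G^[N] y - iAB (S.φ^[N] x)) -
          (S.G^[N] y₁ - iAB (S.φ^[N] x)) := by abel
        rw [e]
        refine (norm_sub_le _ _).trans ?_
        have h7 : S.dev R N N ≤ S.radius / 2 := min_le_left _ _
        linarith [hy N le_rfl, h₁ N le_rfl]
      refine (S.abs_p_le (S.iterate_mem N hx) _).trans ?_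
      rw [mul_assoc]
      gcongr
      exact (iBC.le_opNorm _).trans (by gcongr)
    have h6 := iterate_growth hgy (N - k) k (by omega)
    rw [Real.rpow_add_of_nonneg (norm_nonneg _) zero_le_one hβ.le, Real.rpow_one]
    have h7 : ‖iBC (S.G^[k] y - S.G^[k] y₁)‖ ^ S.β ≤
        (ct * (S.q * ‖iBC‖ * S.radius)) ^ S.β * S.rate ^ (N - k) := by
      calc ‖iBC (S.G^[k] y - S.G^[k] y₁)‖ ^ S.β
          ≤ (ct * (S.q * ‖iBC‖ * S.radius) * (1 / 2) ^ (N - k)) ^ S.β := by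
            gcongr
            calc _ ≤ ct * |S.pairCoeff x y₁ y k| := h4
              _ ≤ ct * ((1 / 2) ^ (N - k) * (S.q * ‖iBC‖ * S.radius)) :=
                mul_le_mul_of_nonneg_left (h6.trans (by gcongr)) hct0
              _ = _ := by ring
        _ = (ct * (S.q * ‖iBC‖ * S.radius)) ^ S.β * ((1 / 2) ^ (N - k)) ^ S.β :=
          Real.mul_rpow (by positivity) (by positivity)
        _ ≤ _ := by gcongr; exact S.half_pow_rpow_le_rate _
    calc _ ≤ (ct * |S.pairCoeff x y₁ y k|) *
          ((ct * (S.q * ‖iBC‖ * S.radius)) ^ S.β * S.rate ^ (N - k)) := by gcongr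
      _ = _ := by ring
  let f : ℕ → B := fun k => S.G^[k] y₂ - S.G^[k] y₁ - a • (S.G^[k] y₃ - S.G^[k] y₁)
  have key := deviation_sequence (N := N) (η := S.rate) (d := fun k => S.dl (S.φ^[k] x))
    (c := fun k => 2 * S.q * S.modulus (S.dev R N k)) (b := b) (P := S.pairCoeff x y₁ y₂)
    (P₃ := S.pairCoeff x y₁ y₃) (n := fun k => S.tot (S.φ^[k] x) (iBC (f k))) (a := a)
    (Q := Q) (H := H + H₁) hη.le hη1 hQ0 (by positivity)
    (fun k => by have := S.κ_le _ (S.iterate_mem k hx); have := S.κ_ge; linarith) n2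
    (fun k => by have := S.modulus_nonneg (S.dev_nonneg hR N k); positivity) s2
    (fun k => S.tot_nonneg _ _)
    (fun k _ => by
      have e : S.pairCoeff x y₁ y₂ k - a * S.pairCoeff x y₁ y₃ k =
          S.p (S.φ^[k] x) (iBC (f k)) := by
        simp only [pairCoeff, f, map_sub iBC (S.G^[k] y₂ - S.G^[k] y₁), map_smul, map_sub (S.p _) (iBC (S.G^[k] y₂ - S.G^[k] y₁)), smul_eq_mul]
      rw [e]
      have := S.udist_nonneg (S.φ^[k] x) (iBC (f k))
      exact le_add_of_nonneg_right (by positivity))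
    (fun k hk => by
      have hxk := S.iterate_mem k hx
      have hr₁ := ((h₁ k hk.le).trans_lt (S.dev_lt R N k)).trans_le S.radius_le
      have hr₂ := ((h₂ k hk.le).trans_lt (S.dev_lt R N k)).trans_le S.radius_le
      have hr₃ := ((h₃ k hk.le).trans_lt (S.dev_lt R N k)).trans_le S.radius_le
      have r2 := S.remainder _ hxk _ _ hr₂ hr₁
      have r3 := S.remainder _ hxk _ _ hr₃ hr₁
      have z2 := hz y₂ h₂ c2 (fun k hk => (s2 k hk).2.2.2.2) k hk.le
      have z3 := hz y₃ h₃ c3 (fun k hk => (s3 k hk).2.2.2.2) k hk.le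
      set ch : ℝ := ct * (ct * (S.q * ‖iBC‖ * S.radius)) ^ S.β
      have hζ : ‖iBC (f (k + 1)) - S.DG (S.G^[k] y₁) (f k)‖ ≤
          S.M * (ch * S.rate ^ (N - k) *
            (|S.pairCoeff x y₁ y₂ k| + |a| * |S.pairCoeff x y₁ y₃ k|)) := by
        have e : iBC (f (k + 1)) - S.DG (S.G^[k] y₁) (f k) =
            (iBC (S.G (S.G^[k] y₂)) - iBC (S.G (S.G^[k] y₁)) -
              S.DG (S.G^[k] y₁) (S.G^[k] y₂ - S.G^[k] y₁)) -
            a • (iBC (S.G (S.G^[k] y₃)) - iBC (S.G (S.G^[k] y₁)) -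
              S.DG (S.G^[k] y₁) (S.G^[k] y₃ - S.G^[k] y₁)) := by
          simp only [f, Function.iterate_succ_apply', map_sub, map_smul]
          module
        rw [e]
        refine (norm_sub_le _ _).trans ?_
        rw [norm_smul, Real.norm_eq_abs]
        calc _ ≤ S.M * (ch * S.rate ^ (N - k) * |S.pairCoeff x y₁ y₂ k|) +
              |a| * (S.M * (ch * S.rate ^ (N - k) * |S.pairCoeff x y₁ y₃ k|)) := by
              gcongr
              · exact r2.trans (by gcongr)
              · exact r3.trans (by gcongr)
          _ = _ := by ring
      have hl := (S.linear_step hxk (h₁ k hk.le) (S.dev_lt R N k) hζ).total_le S.κ_ge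
        (S.κ_le _ hxk) hq (S.modulus_nonneg (S.dev_nonneg hR N k)) (S.udist_nonneg _ _)
      rw [← Function.iterate_succ_apply' S.φ] at hl
      refine hl.trans (add_le_add le_rfl ?_)
      have h9 : 0 ≤ S.rate ^ (N - k) *
          (|S.pairCoeff x y₁ y₂ k| + |a| * |S.pairCoeff x y₁ y₃ k|) := by positivity
      calc _ = H₁ * (S.rate ^ (N - k) *
            (|S.pairCoeff x y₁ y₂ k| + |a| * |S.pairCoeff x y₁ y₃ k|)) := by rw [hH₁]; ring
        _ ≤ (H + H₁) * (S.rate ^ (N - k) *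
            (|S.pairCoeff x y₁ y₂ k| + |a| * |S.pairCoeff x y₁ y₃ k|)) := by gcongr; linarith
        _ = _ := by ring)
    (h0.trans (by gcongr; linarith)) k hk
  refine le_trans ?_ key
  have e : S.pairCoeff x y₁ y₂ k - a * S.pairCoeff x y₁ y₃ k = S.p (S.φ^[k] x) (iBC (f k)) := by
    simp only [pairCoeff, f, map_sub iBC (S.G^[k] y₂ - S.G^[k] y₁), map_smul,
      map_sub (S.p _) (iBC (S.G^[k] y₂ - S.G^[k] y₁)), smul_eq_mul]
  rw [e]
  have := S.udist_nonneg (S.φ^[k] x) (iBC (f k))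
  exact le_add_of_nonneg_right (by positivity)

/-- The points `y₁`, `y₂` shadow the points `x`, `g` of the basic set, whose orbits separate after
time `N`, the differences being in the unstable cones. -/
structure Separation (x g : A) (y₁ y₂ : B) (R : ℝ) (N : ℕ) : Prop where
  mem : x ∈ K
  mem' : g ∈ K
  near₁ : ∀ k ≤ N, ‖S.G^[k] y₁ - iAB (S.φ^[k] x)‖ ≤ S.dev R N k
  near₂ : ∀ k ≤ N, ‖S.G^[k] y₂ - iAB (S.φ^[k] x)‖ ≤ S.dev R N k
  near : ∀ k ≤ N, ‖S.G^[k] (iAB g) - iAB (S.φ^[k] x)‖ ≤ S.dev R N k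
  shadow₁ : ∀ k, ‖S.G^[k] y₁ - iAB (S.φ^[k] x)‖ ≤ R * (1 / 2) ^ k
  shadow₂ : ∀ k, ‖S.G^[k] y₂ - iAB (S.φ^[k] g)‖ ≤ R * (1 / 2) ^ k
  cone : S.InCone x y₁ y₂
  cone' : S.InCone x (iAB x) (iAB g)
  large : 1 ≤ R * |S.pairCoeff x (iAB x) (iAB g) N|

theorem near_base {x : A} (hx : x ∈ K) {R : ℝ} (hR : 0 ≤ R) (N k : ℕ) :
    ‖S.G^[k] (iAB x) - iAB (S.φ^[k] x)‖ ≤ S.dev R N k := by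
  rw [S.iterate_conj k hx, sub_self, norm_zero]
  exact S.dev_nonneg hR N k

theorem exists_fraction : ∃ m : ℕ, 2 ≤ m ∧ 2 * (2 * S.Λ) ≤ 2 ^ (m - 1) := by
  obtain ⟨m, hm⟩ := pow_unbounded_of_one_lt (2 * (2 * S.Λ)) (by norm_num : (1 : ℝ) < 2)
  refine ⟨m + 2, by omega, hm.le.trans ?_⟩
  gcongr
  · norm_num
  · omega

/-- An integer `m` such that the transversal and the unstable manifold can be compared at the time
`l = N - N / m`, where `N` is the time of separation: the distance of the order of `2⁻ˡ` between
corresponding points is then small compared with the differences along the two curves, which are at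
least of the order of `(2 Λ)^(-N / m)`. -/
noncomputable def fraction : ℕ := S.exists_fraction.choose

theorem fraction_ge : 2 ≤ S.fraction := S.exists_fraction.choose_spec.1

theorem fraction_spec : 2 * (2 * S.Λ) ≤ 2 ^ (S.fraction - 1) := S.exists_fraction.choose_spec.2

/-- At the comparison time the difference on the transversal agrees with the difference on the
unstable manifold up to a small relative error, and so it does at earlier times. -/
theorem exists_agreement {R : ℝ} (hR : 0 ≤ R) : ∃ E ≥ 0, ∀ (x g : A) (y₁ y₂ : B) (N : ℕ),
    S.Separation x g y₁ y₂ R N → ∀ k, k ≤ N - N / S.fraction →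
      |S.pairCoeff x y₁ y₂ k / S.pairCoeff x (iAB x) (iAB g) k - 1| ≤
        E * (S.rate ^ (N / S.fraction) + S.rate ^ k) := by
  have hq := S.q_ge
  have hη := S.rate_pos
  have hη1 := S.rate_lt_one
  have h1η : 0 < 1 - S.rate := by linarith
  have hΛ := S.Λ_ge
  have hN := S.N_pos
  set Q : ℝ := S.q * (14 * (S.N * (2 * R) ^ S.β) + 1) with hQ
  have hQ0 : 0 ≤ Q := by positivity
  refine ⟨(S.q * ‖iBC‖ * (2 * R) * R + 3 * Q / (1 - S.rate)) * Real.exp (6 * Q / (1 - S.rate)),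
    by positivity, fun x g y₁ y₂ N h k hk => ?_⟩
  obtain ⟨-, n2, b, s2⟩ := h.cone.sequence h.mem hR h.near₁ h.near₂
  obtain ⟨-, n2', b', s2'⟩ := h.cone'.sequence h.mem hR (fun k _ => S.near_base h.mem hR N k) h.near
  set l := N - N / S.fraction with hl
  have hlN : l ≤ N := Nat.sub_le _ _
  have hr := ratio_sequence (N := N) (l := l) (k := k) (η := S.rate) (Q := Q)
    (d := fun k => S.dl (S.φ^[k] x)) hη.le hη1 hQ0 hlN hk
    (fun k => by have := S.κ_le _ (S.iterate_mem k h.mem); have := S.κ_ge; linarith) n2 n2'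
    (fun k hk => ⟨(s2 k hk).2.1, (s2 k hk).2.2.1, (s2 k hk).2.2.2.1⟩)
    (fun k hk => ⟨(s2' k hk).2.1, (s2' k hk).2.2.1, (s2' k hk).2.2.2.1⟩)
  -- the comparison at time `l`
  have hgrow : ∀ i k, k + i = N → |S.pairCoeff x (iAB x) (iAB g) N| ≤
      (2 * S.Λ) ^ i * |S.pairCoeff x (iAB x) (iAB g) k| := by
    intro i
    induction i with
    | zero => intro k hk; simp at hk; simp [hk]
    | succ i ih =>
      intro k hk
      have h1 := ih (k + 1) (by omega)
      obtain ⟨-, h2, -, h3, -⟩ := s2' k (by omega)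
      have hd := S.dl_le _ (S.iterate_mem k h.mem)
      have hd0 := S.κ_le _ (S.iterate_mem k h.mem)
      have hκ := S.κ_ge
      set P := S.pairCoeff x (iAB x) (iAB g) k
      set P' := S.pairCoeff x (iAB x) (iAB g) (k + 1)
      set d := S.dl (S.φ^[k] x)
      have h4 : |P'| ≤ 2 * S.Λ * |P| := by
        have h6 : |d * P| = d * |P| := by rw [abs_mul, abs_of_nonneg (by linarith : 0 ≤ d)]
        have h7 : |P'| ≤ |d * P| + |P' - d * P| :=
          sub_le_iff_le_add'.1 (abs_sub_abs_le_abs_sub _ _)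
        have h8 : b' k * (d * |P|) ≤ 1 / 4 * (d * |P|) := by
          have : 0 ≤ d * |P| := mul_nonneg (by linarith) (abs_nonneg _)
          gcongr
        have h9 : d * |P| ≤ S.Λ * |P| := by gcongr
        have h10 : 0 ≤ S.Λ * |P| := by positivity
        linarith
      refine h1.trans ?_
      rw [pow_succ, mul_assoc]
      gcongr
  have hlast : |S.pairCoeff x y₁ y₂ l / S.pairCoeff x (iAB x) (iAB g) l - 1| ≤
      S.q * ‖iBC‖ * (2 * R) * R * S.rate ^ (N / S.fraction) := by
    have hne := n2' l hlN
    rw [div_sub_one hne, abs_div, div_le_iff₀ (abs_pos.2 hne)]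
    have h1 : |S.pairCoeff x y₁ y₂ l - S.pairCoeff x (iAB x) (iAB g) l| ≤
        S.q * ‖iBC‖ * (2 * R) * (1 / 2) ^ l := by
      have e : S.pairCoeff x y₁ y₂ l - S.pairCoeff x (iAB x) (iAB g) l =
          S.p (S.φ^[l] x) (iBC ((S.G^[l] y₂ - iAB (S.φ^[l] g)) -
            (S.G^[l] y₁ - iAB (S.φ^[l] x)))) := by
        rw [pairCoeff, pairCoeff, ← map_sub, ← map_sub, S.iterate_conj l h.mem,
          S.iterate_conj l h.mem']
        congr 2; abel
      rw [e]
      refine (S.abs_p_le (S.iterate_mem l h.mem) _).trans ?_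
      calc S.q * _ ≤ S.q * (‖iBC‖ * (R * (1 / 2) ^ l + R * (1 / 2) ^ l)) := by
            gcongr
            refine (iBC.le_opNorm _).trans ?_
            gcongr
            exact (norm_sub_le _ _).trans (add_le_add (h.shadow₂ l) (h.shadow₁ l))
        _ = _ := by ring
    have h2 := hgrow (N / S.fraction) l (by have := Nat.div_le_self N S.fraction; omega)
    have h3 : 1 ≤ R * ((2 * S.Λ) ^ (N / S.fraction) * |S.pairCoeff x (iAB x) (iAB g) l|) :=
      h.large.trans (by gcongr)
    have h4 : (1 / 2 : ℝ) ^ l * (2 * S.Λ) ^ (N / S.fraction) ≤ S.rate ^ (N / S.fraction) := by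
      set i := N / S.fraction with hi
      have h5 : (S.fraction - 1) * i ≤ l := by
        have h6 := Nat.div_mul_le_self N S.fraction
        have h7 := S.fraction_ge
        rw [Nat.sub_mul, one_mul, hl, mul_comm]
        exact Nat.sub_le_sub_right h6 _
      calc (1 / 2 : ℝ) ^ l * (2 * S.Λ) ^ i ≤ (1 / 2) ^ ((S.fraction - 1) * i) * (2 * S.Λ) ^ i := by
            gcongr ?_ * _
            exact pow_le_pow_of_le_one (by norm_num) (by norm_num) h5
        _ = ((1 / 2) ^ (S.fraction - 1) * (2 * S.Λ)) ^ i := by rw [pow_mul, ← mul_pow]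
        _ ≤ (1 / 2) ^ i := by
          gcongr
          have h8 := S.fraction_spec
          rw [one_div, inv_pow, inv_mul_le_iff₀ (by positivity)]
          linarith
        _ ≤ _ := S.half_pow_le_rate i
    calc _ ≤ S.q * ‖iBC‖ * (2 * R) * (1 / 2) ^ l * 1 := by rw [mul_one]; exact h1
      _ ≤ S.q * ‖iBC‖ * (2 * R) * (1 / 2) ^ l *
          (R * ((2 * S.Λ) ^ (N / S.fraction) * |S.pairCoeff x (iAB x) (iAB g) l|)) := by gcongr
      _ = S.q * ‖iBC‖ * (2 * R) * R * ((1 / 2) ^ l * (2 * S.Λ) ^ (N / S.fraction)) *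
          |S.pairCoeff x (iAB x) (iAB g) l| := by ring
      _ ≤ _ := by gcongr
  refine hr.trans ?_
  have e : N - l = N / S.fraction := by
    have := Nat.div_le_self N S.fraction; omega
  rw [e]
  have h5 : 0 ≤ S.rate ^ k := by positivity
  calc _ ≤ (S.q * ‖iBC‖ * (2 * R) * R * S.rate ^ (N / S.fraction) +
        3 * Q * (S.rate ^ k + S.rate ^ (N / S.fraction)) / (1 - S.rate)) *
          Real.exp (6 * Q / (1 - S.rate)) := by gcongr
    _ ≤ (S.q * ‖iBC‖ * (2 * R) * R * (S.rate ^ (N / S.fraction) + S.rate ^ k) +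
        3 * Q * (S.rate ^ k + S.rate ^ (N / S.fraction)) / (1 - S.rate)) *
          Real.exp (6 * Q / (1 - S.rate)) := by
      gcongr
      linarith
    _ = _ := by ring

theorem Separation.dev_mono {R : ℝ} (hR : 0 ≤ R) {N N' k : ℕ} (hN : N ≤ N') (hk : k ≤ N) :
    S.dev R N' k ≤ S.dev R N k := by
  unfold dev
  gcongr min _ (R * (_ + ?_))
  exact pow_le_pow_of_le_one (by norm_num) (by norm_num) (by omega)

/-- The ratio `a` of the initial differences on the transversal is nearly equal to the ratio `a'`
of the initial differences on the unstable manifold. -/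
theorem exists_ratio_comparison {R H : ℝ} (hR : 0 ≤ R) (hH : 0 ≤ H) : ∃ E ≥ 0,
    ∀ (x g₂ g₃ : A) (y₁ y₂ y₃ : B) (N₂ N₃ : ℕ) (a a' : ℝ), N₂ ≤ N₃ →
    S.Separation x g₂ y₁ y₂ R N₂ → S.Separation x g₃ y₁ y₃ R N₃ →
    S.tot x (iBC (y₂ - y₁ - a • (y₃ - y₁))) ≤ H * S.rate ^ N₂ * |S.pairCoeff x y₁ y₂ 0| →
    S.tot x (iBC (iAB g₂ - iAB x - a' • (iAB g₃ - iAB x))) ≤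
      H * S.rate ^ N₂ * |S.pairCoeff x (iAB x) (iAB g₂) 0| →
    E * S.rate ^ (N₂ / S.fraction) ≤ 1 / 4 →
    |a' / a - 1| ≤ 12 * E * S.rate ^ (N₂ / S.fraction) := by
  obtain ⟨E₁, hE₁, h₁⟩ := S.exists_deviation hR hH
  obtain ⟨E₂, hE₂, h₂⟩ := S.exists_agreement hR
  refine ⟨E₁ + 2 * E₂, by positivity, fun x g₂ g₃ y₁ y₂ y₃ N₂ N₃ a a' hN s2 s3 i i' hE => ?_⟩
  have hη := S.rate_pos
  have hη1 := S.rate_lt_one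
  have hm := S.fraction_ge
  set k := N₂ - N₂ / S.fraction with hk
  set i₂ := N₂ / S.fraction with hi₂
  have hi₂' : i₂ ≤ N₂ := Nat.div_le_self _ _
  have h2i : 2 * i₂ ≤ N₂ := by
    have := Nat.div_mul_le_self N₂ S.fraction
    nlinarith
  have hkN : k ≤ N₂ := Nat.sub_le _ _
  have hki : N₂ - k = i₂ := by omega
  have hk3 : k ≤ N₃ - N₃ / S.fraction := by
    -- the function `N - N / m` is monotone
    have h3 : N₃ / S.fraction ≤ N₂ / S.fraction + (N₃ - N₂) := by
      have h4 := Nat.lt_mul_div_succ N₂ (by omega : 0 < S.fraction)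
      have h5 : N₃ - N₂ ≤ S.fraction * (N₃ - N₂) := Nat.le_mul_of_pos_left _ (by omega)
      refine Nat.lt_succ_iff.1 ((Nat.div_lt_iff_lt_mul (by omega)).2 ?_)
      calc N₃ = N₂ + (N₃ - N₂) := by omega
        _ < S.fraction * (N₂ / S.fraction + 1) + S.fraction * (N₃ - N₂) := by omega
        _ = _ := by rw [Nat.succ_eq_add_one]; ring
    omega
  have near3 : ∀ y, (∀ k ≤ N₃, ‖S.G^[k] y - iAB (S.φ^[k] x)‖ ≤ S.dev R N₃ k) →
      ∀ k ≤ N₂, ‖S.G^[k] y - iAB (S.φ^[k] x)‖ ≤ S.dev R N₂ k := fun y hy k hk =>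
    (hy k (hk.trans hN)).trans (Separation.dev_mono S hR hN hk)
  have d := h₁ x s2.mem y₁ y₂ y₃ N₂ a s2.near₁ s2.near₂ (near3 _ s3.near₂) s2.cone s3.cone i k hkN
  have d' := h₁ x s2.mem (iAB x) (iAB g₂) (iAB g₃) N₂ a' (fun k _ => S.near_base s2.mem hR N₂ k)
    s2.near (near3 _ s3.near) s2.cone' s3.cone' i' k hkN
  have r2 := h₂ x g₂ y₁ y₂ N₂ s2 k le_rfl
  have r3 := h₂ x g₃ y₁ y₃ N₃ s3 k hk3
  have n2 := (s2.cone.sequence s2.mem hR s2.near₁ s2.near₂).2.1 k hkN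
  have n2' := (s2.cone'.sequence s2.mem hR (fun k _ => S.near_base s2.mem hR N₂ k)
    s2.near).2.1 k hkN
  have n3 := (s3.cone.sequence s3.mem hR s3.near₁ s3.near₂).2.1 k (hkN.trans hN)
  have n3' := (s3.cone'.sequence s3.mem hR (fun k _ => S.near_base s3.mem hR N₃ k)
    s3.near).2.1 k (hkN.trans hN)
  rw [hki] at d d'
  have hηk : S.rate ^ k ≤ S.rate ^ i₂ := pow_le_pow_of_le_one hη.le hη1.le (by omega)
  have hη3 : S.rate ^ (N₃ / S.fraction) ≤ S.rate ^ i₂ :=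
    pow_le_pow_of_le_one hη.le hη1.le (Nat.div_le_div_right hN)
  have hηi : 0 < S.rate ^ i₂ := by positivity
  set p2 := S.pairCoeff x y₁ y₂ k
  set p3 := S.pairCoeff x y₁ y₃ k
  set p2' := S.pairCoeff x (iAB x) (iAB g₂) k
  set p3' := S.pairCoeff x (iAB x) (iAB g₃) k
  set e : ℝ := (E₁ + 2 * E₂) * S.rate ^ i₂ with he
  have hd : |a * p3 / p2 - 1| ≤ e := by
    rw [div_sub_one n2, abs_div, div_le_iff₀ (abs_pos.2 n2), abs_sub_comm]
    refine d.trans ?_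
    rw [he]
    gcongr
    linarith
  have hd' : |a' * p3' / p2' - 1| ≤ e := by
    rw [div_sub_one n2', abs_div, div_le_iff₀ (abs_pos.2 n2'), abs_sub_comm]
    refine d'.trans ?_
    rw [he]
    gcongr
    linarith
  have hr2 : |p2 / p2' - 1| ≤ e := by
    refine r2.trans ?_
    calc _ ≤ E₂ * (S.rate ^ i₂ + S.rate ^ i₂) := by gcongr
      _ ≤ e := by rw [he]; nlinarith
  have hr3 : |p3 / p3' - 1| ≤ e := by
    refine r3.trans ?_
    calc _ ≤ E₂ * (S.rate ^ i₂ + S.rate ^ i₂) := by gcongr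
      _ ≤ e := by rw [he]; nlinarith
  have e1 : (a' / a) * ((a * p3 / p2) * (p2 / p2')) = (a' * p3' / p2') * (p3 / p3') := by
    have ha : a ≠ 0 := by
      rintro rfl
      rw [zero_mul, zero_div, zero_sub, abs_neg, abs_one] at hd
      linarith
    field_simp
  obtain ⟨u1, u2⟩ := abs_le.1 hd
  obtain ⟨v1, v2⟩ := abs_le.1 hd'
  obtain ⟨w1, w2⟩ := abs_le.1 hr2
  obtain ⟨z1, z2⟩ := abs_le.1 hr3
  set U := a * p3 / p2
  set V := a' * p3' / p2'
  set W := p2 / p2'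
  set Z := p3 / p3'
  have he0 : 0 ≤ e := by positivity
  have hprod : ∀ X Y : ℝ, |X - 1| ≤ e → |Y - 1| ≤ e → |X * Y - 1| ≤ 9 / 4 * e := by
    intro X Y hX hY
    have hY1 : |Y| ≤ 5 / 4 := by
      have := abs_add_le (Y - 1) 1
      rw [sub_add_cancel, abs_one] at this
      linarith
    calc |X * Y - 1| = |(X - 1) * Y + (Y - 1)| := by congr 1; ring
      _ ≤ |X - 1| * |Y| + |Y - 1| := by rw [← abs_mul]; exact abs_add_le _ _
      _ ≤ e * (5 / 4) + e := by gcongr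
      _ = _ := by ring
  have hUW' := hprod U W hd hr2
  have hVZ' := hprod V Z hd' hr3
  have hUW : 1 / 2 ≤ U * W := by
    have : 0 ≤ U := by linarith
    have : (3 / 4 : ℝ) * (3 / 4) ≤ U * W := by gcongr <;> linarith
    linarith
  have e2 : a' / a - 1 = (V * Z - U * W) / (U * W) := by
    rw [eq_div_iff (by linarith), sub_mul, e1, one_mul]
  rw [e2, abs_div, abs_of_pos (by linarith : 0 < U * W), div_le_iff₀ (by linarith)]
  have h6 : |V * Z - U * W| ≤ 6 * e := by
    calc |V * Z - U * W| = |(V * Z - 1) - (U * W - 1)| := by congr 1; ring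
      _ ≤ _ := (abs_sub _ _).trans (by linarith)
  calc |V * Z - U * W| ≤ 6 * e := h6
    _ = 12 * (E₁ + 2 * E₂) * S.rate ^ i₂ * (1 / 2) := by rw [he]; ring
    _ ≤ _ := by gcongr

end RobustStep

end Comparison

section Initial

variable {A B C : Type*}
  [NormedAddCommGroup A] [NormedSpace ℝ A] [NormedAddCommGroup B] [NormedSpace ℝ B]
  [NormedAddCommGroup C] [NormedSpace ℝ C]
  {iAB : A →L[ℝ] B} {iBC : B →L[ℝ] C}
  {OA : Set A} {T : A → A} {K : Set A} {OB : Set B} {TB : B → B} {w : A → A}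

namespace RobustStep

variable (S : RobustStep iAB iBC OA T K OB TB w)

theorem one_add_modulus_le {σ : ℝ} (hσ : 0 ≤ σ) (h : σ ≤ S.radius) {x : A} (hx : x ∈ K) :
    S.dl x * (1 + 2 * S.q * S.modulus σ) ≤ 2 * S.Λ := by
  have h1 := S.modulus_le hσ h
  have h2 := S.dl_le x hx
  have h3 := S.κ_le x hx
  have hκ := S.κ_ge
  have h4 : 0 ≤ S.q * S.modulus σ :=
    mul_nonneg (by linarith [S.q_ge]) (S.modulus_nonneg hσ)
  calc _ ≤ S.dl x * 2 := by
        refine mul_le_mul_of_nonneg_left ?_ (by linarith)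
        linarith
    _ ≤ _ := by linarith

/-- The deviation from proportionality on a smooth curve stays small for a bounded time. -/
theorem exists_initial_deviation {H : ℝ} (hH : 0 ≤ H) (n : ℕ) : ∃ E ≥ 0, ∀ x ∈ K,
    ∀ (y₁ y₂ y₃ : B) (c₂ c₃ m : ℝ), (∀ k ≤ n, ‖S.G^[k] y₁ - iAB (S.φ^[k] x)‖ ≤ S.radius / 2) →
    (∀ k ≤ n, ‖S.G^[k] y₂ - iAB (S.φ^[k] x)‖ ≤ S.radius / 2) →
    (∀ k ≤ n, ‖S.G^[k] y₃ - iAB (S.φ^[k] x)‖ ≤ S.radius / 2) →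
    c₃ ≠ 0 → ‖y₂ - y₁‖ ≤ H * |c₂| → ‖y₃ - y₁‖ ≤ H * |c₃| →
    ‖y₂ - y₁ - (c₂ / c₃) • (y₃ - y₁)‖ ≤ H * |c₂| * m → |c₂| ^ S.β ≤ m → |c₃| ^ S.β ≤ m →
    S.tot (S.φ^[n] x) (iBC (S.G^[n] y₂ - S.G^[n] y₁ - (c₂ / c₃) • (S.G^[n] y₃ - S.G^[n] y₁))) ≤
      E * |c₂| * m := by
  have hq := S.q_ge
  have hM := S.M_pos
  have hβ := S.β_pos
  have hΛ := S.Λ_ge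
  have hrad := S.radius_pos
  set ct : ℝ := 2 * (1 + ‖iBC‖ * ‖iAB‖) with hct
  have hct0 : 0 ≤ ct := by positivity
  have hpair : ∀ n, ∃ E ≥ 0, ∀ x ∈ K, ∀ (y₁ y₂ : B) (c₂ : ℝ),
      (∀ k ≤ n, ‖S.G^[k] y₁ - iAB (S.φ^[k] x)‖ ≤ S.radius / 2) →
      (∀ k ≤ n, ‖S.G^[k] y₂ - iAB (S.φ^[k] x)‖ ≤ S.radius / 2) →
      ‖y₂ - y₁‖ ≤ H * |c₂| →
      S.tot (S.φ^[n] x) (iBC (S.G^[n] y₂ - S.G^[n] y₁)) ≤ E * |c₂| := by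
    intro n
    induction n with
    | zero =>
      refine ⟨2 * S.q * (‖iBC‖ * H), by positivity, fun x hx y₁ y₂ c₂ _ _ h => ?_⟩
      refine (S.tot_le hx _).trans ?_
      calc 2 * S.q * ‖iBC (y₂ - y₁)‖ ≤ 2 * S.q * (‖iBC‖ * (H * |c₂|)) := by
            gcongr; exact (iBC.le_opNorm _).trans (by gcongr)
        _ = _ := by ring
    | succ n ih =>
      obtain ⟨E, hE, h⟩ := ih
      refine ⟨2 * S.Λ * E, by positivity, fun x hx y₁ y₂ c₂ h1 h2 h3 => ?_⟩
      have h4 := h x hx y₁ y₂ c₂ (fun k hk => h1 k (by omega)) (fun k hk => h2 k (by omega)) h3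
      have hxn := S.iterate_mem n hx
      have h5 := (S.pair_step hxn (h2 n (by omega)) (h1 n (by omega)) (by linarith)).total_le
        S.κ_ge (S.κ_le _ hxn) hq (S.modulus_nonneg (by positivity)) (S.udist_nonneg _ _)
      rw [mul_zero, add_zero] at h5
      simp only [Function.iterate_succ_apply']
      calc _ ≤ _ := h5
        _ ≤ 2 * S.Λ * (E * |c₂|) :=
          mul_le_mul (S.one_add_modulus_le (by positivity) (by linarith) hxn) h4
            (S.tot_nonneg _ _) (by positivity)
        _ = _ := by ring
  induction n with
  | zero =>
    refine ⟨2 * S.q * (‖iBC‖ * H), by positivity, fun x hx y₁ y₂ y₃ c₂ c₃ m _ _ _ _ _ _ h _ _ => ?_⟩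
    refine (S.tot_le hx _).trans ?_
    calc 2 * S.q * ‖iBC (y₂ - y₁ - (c₂ / c₃) • (y₃ - y₁))‖ ≤
          2 * S.q * (‖iBC‖ * (H * |c₂| * m)) := by
          gcongr; exact (iBC.le_opNorm _).trans (by gcongr)
      _ = _ := by ring
  | succ n ih =>
    obtain ⟨E, hE, h⟩ := ih
    obtain ⟨E₁, hE₁, hp⟩ := hpair n
    refine ⟨2 * S.Λ * E + 2 * S.q * (S.M * (2 * (ct * E₁) ^ (1 + S.β))), by positivity,
      fun x hx y₁ y₂ y₃ c₂ c₃ m h1 h2 h3 hc hy2 hy3 hf hm2 hm3 => ?_⟩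
    have h4 := h x hx y₁ y₂ y₃ c₂ c₃ m (fun k hk => h1 k (by omega)) (fun k hk => h2 k (by omega))
      (fun k hk => h3 k (by omega)) hc hy2 hy3 hf hm2 hm3
    have p2 := hp x hx y₁ y₂ c₂ (fun k hk => h1 k (by omega)) (fun k hk => h2 k (by omega)) hy2
    have p3 := hp x hx y₁ y₃ c₃ (fun k hk => h1 k (by omega)) (fun k hk => h3 k (by omega)) hy3
    have hxn := S.iterate_mem n hx
    have hr : S.radius / 2 < S.r := by linarith [S.radius_le]
    have r2 := S.remainder _ hxn _ _ ((h2 n (by omega)).trans_lt hr) ((h1 n (by omega)).trans_lt hr)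
    have r3 := S.remainder _ hxn _ _ ((h3 n (by omega)).trans_lt hr) ((h1 n (by omega)).trans_lt hr)
    have hz : ∀ (z : C) (c : ℝ), S.tot (S.φ^[n] x) z ≤ E₁ * |c| → |c| ^ S.β ≤ m →
        ‖z‖ ^ (1 + S.β) ≤ (ct * E₁) ^ (1 + S.β) * (|c| * m) := by
      intro z c hz hcm
      calc ‖z‖ ^ (1 + S.β) ≤ (ct * E₁ * |c|) ^ (1 + S.β) := by
            gcongr
            refine (S.norm_le_tot hxn z).trans ?_
            rw [mul_assoc ct]
            gcongr
        _ = (ct * E₁) ^ (1 + S.β) * |c| ^ (1 + S.β) := Real.mul_rpow (by positivity) (abs_nonneg _)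
        _ = (ct * E₁) ^ (1 + S.β) * (|c| * |c| ^ S.β) := by
          rw [Real.rpow_add_of_nonneg (abs_nonneg _) zero_le_one hβ.le, Real.rpow_one]
        _ ≤ _ := by gcongr
    set a := c₂ / c₃ with ha
    have hac : |a| * |c₃| = |c₂| := by rw [← abs_mul, ha, div_mul_cancel₀ _ hc]
    set f : B := S.G^[n] y₂ - S.G^[n] y₁ - a • (S.G^[n] y₃ - S.G^[n] y₁) with hfdef
    have hm0 : 0 ≤ m := le_trans (by positivity) hm2
    have hζ : ‖iBC (S.G^[n + 1] y₂ - S.G^[n + 1] y₁ - a • (S.G^[n + 1] y₃ - S.G^[n + 1] y₁)) -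
        S.DG (S.G^[n] y₁) f‖ ≤ S.M * (2 * (ct * E₁) ^ (1 + S.β)) * |c₂| * m := by
      have e : iBC (S.G^[n + 1] y₂ - S.G^[n + 1] y₁ - a • (S.G^[n + 1] y₃ - S.G^[n + 1] y₁)) -
          S.DG (S.G^[n] y₁) f =
          (iBC (S.G (S.G^[n] y₂)) - iBC (S.G (S.G^[n] y₁)) -
            S.DG (S.G^[n] y₁) (S.G^[n] y₂ - S.G^[n] y₁)) -
          a • (iBC (S.G (S.G^[n] y₃)) - iBC (S.G (S.G^[n] y₁)) -
            S.DG (S.G^[n] y₁) (S.G^[n] y₃ - S.G^[n] y₁)) := by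
        simp only [hfdef, Function.iterate_succ_apply', map_sub, map_smul]
        module
      rw [e]
      refine (norm_sub_le _ _).trans ?_
      rw [norm_smul, Real.norm_eq_abs]
      calc _ ≤ S.M * ((ct * E₁) ^ (1 + S.β) * (|c₂| * m)) +
            |a| * (S.M * ((ct * E₁) ^ (1 + S.β) * (|c₃| * m))) := by
            gcongr
            · exact r2.trans (by gcongr; exact hz _ _ p2 hm2)
            · exact r3.trans (by gcongr; exact hz _ _ p3 hm3)
        _ = S.M * ((ct * E₁) ^ (1 + S.β) * (|c₂| * m)) +
            (|a| * |c₃|) * (S.M * ((ct * E₁) ^ (1 + S.β) * m)) := by ring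
        _ = _ := by rw [hac]; ring
    have hl := (S.linear_step hxn (h1 n (by omega)) (by linarith) hζ).total_le S.κ_ge
      (S.κ_le _ hxn) hq (S.modulus_nonneg (by positivity)) (S.udist_nonneg _ _)
    rw [← Function.iterate_succ_apply' S.φ] at hl
    refine hl.trans ?_
    have h6 := S.one_add_modulus_le (σ := S.radius / 2) (by positivity) (by linarith) hxn
    have h7 : S.dl (S.φ^[n] x) * (1 + 2 * S.q * S.modulus (S.radius / 2)) *
        (|S.p (S.φ^[n] x) (iBC f)| + S.q * S.udist (S.φ^[n] x) (iBC f)) ≤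
        2 * S.Λ * (E * |c₂| * m) :=
      mul_le_mul h6 h4 (S.tot_nonneg _ _) (by positivity)
    linarith

/-- After entering the cone the tangent vector gets well inside it. -/
theorem exists_narrow_tangent {x : A} (hx : x ∈ K) {s : ℝ} (hs : 2 * S.gain * s < S.radius) {y : B}
    (hy : ∀ n, y ∈ S.tube x s n) {v : B} {n : ℕ} (h : S.udist (S.φ^[n] x) (S.tangent y n v) <
      S.aperture * |S.p (S.φ^[n] x) (S.tangent y n v)|) : ∃ n,
    S.p (S.φ^[n] x) (S.tangent y n v) ≠ 0 ∧ S.udist (S.φ^[n] x) (S.tangent y n v) ≤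
      S.aperture / 2 * |S.p (S.φ^[n] x) (S.tangent y n v)| := by
  have ha := S.aperture_pos
  have hs0 : 0 ≤ 2 * S.gain * s := (norm_nonneg _).trans
    (S.norm_le_of_coeffAt hx hs (hy 0).1 (hy 0).2 0 le_rfl)
  have hm := S.modulus_le_aperture hs0 hs.le
  have hm0 := S.modulus_nonneg hs0
  have hq := S.q_ge
  have hκ := S.κ_ge
  have hxn := S.iterate_mem n hx
  have hst := S.tangent_step hx hs (hy (n + 1)) v
  have hqe : S.q * (2 * S.modulus (2 * S.gain * s) + S.aperture) ≤ 1 / 4 := by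
    have : S.q * (2 * S.modulus (2 * S.gain * s) + S.aperture) ≤ S.q * (2 * S.aperture) := by
      gcongr; linarith
    linarith [S.q_mul_aperture]
  have h1 := (hst.narrow hκ (S.κ_le _ hxn) hq hm0 ha.le h.le hqe).2
  have h2 := hst.growth_abs hκ (S.κ_le _ hxn) hq hm0 ha.le h.le hqe
  have h3 : 0 < |S.p (S.φ^[n] x) (S.tangent y n v)| :=
    pos_of_mul_pos_right ((S.udist_nonneg _ _).trans_lt h) ha.le
  refine ⟨n + 1, ?_, h1.trans ?_⟩
  · have h4 : 0 < S.dl (S.φ^[n] x) * |S.p (S.φ^[n] x) (S.tangent y n v)| :=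
      mul_pos (by linarith [S.κ_le _ hxn]) h3
    exact abs_pos.1 (by linarith)
  · gcongr
    linarith

/-- An exponent `θ` for which an error of the order of the exponential rate, at a separation time
`N`, is Hölder small in terms of the initial distance, which is at least of the order of
`(Λ + 1)⁻ᴺ`. -/
def IsExponent (S : RobustStep iAB iBC OA T K OB TB w) (θ : ℝ) : Prop :=
  ∀ n : ℕ, ∃ E : ℝ, 0 ≤ E ∧ ∀ N ≥ n,
    S.rate ^ ((N - n) / S.fraction) ≤ E * (((S.Λ + 1) ^ N)⁻¹ : ℝ) ^ θ

theorem exists_exponent : ∃ θ : ℝ, 0 < θ ∧ θ < 1 ∧ S.IsExponent θ := by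
  have hη := S.rate_pos
  have hη1 := S.rate_lt_one
  have hΛ := S.Λ_ge
  have hm := S.fraction_ge
  -- `fraction` steps multiply a distance by at most `(Λ + 1) ^ fraction`, and `rate` is less than a
  -- small power of the inverse of this factor
  obtain ⟨θ, ⟨hθ, hθ1⟩, hθ0⟩ : ∃ θ : ℝ, (S.rate < (((S.Λ + 1) ^ S.fraction)⁻¹ : ℝ) ^ θ ∧ θ < 1) ∧
      0 < θ := by
    have h1 : Tendsto (fun θ : ℝ => (((S.Λ + 1) ^ S.fraction)⁻¹ : ℝ) ^ θ) (𝓝 0) (𝓝 1) := by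
      have := (Real.continuous_const_rpow (a := (((S.Λ + 1) ^ S.fraction)⁻¹ : ℝ))
        (by positivity)).tendsto 0
      rwa [Real.rpow_zero] at this
    exact (((h1.eventually (lt_mem_nhds hη1)).and (gt_mem_nhds zero_lt_one)).filter_mono
      nhdsWithin_le_nhds |>.and self_mem_nhdsWithin).exists (f := 𝓝[>] 0)
  refine ⟨θ, hθ0, hθ1, fun n => ⟨((S.Λ + 1) ^ (n + S.fraction)) ^ θ, by positivity,
    fun N hN => ?_⟩⟩
  set i := (N - n) / S.fraction with hi
  have h1 : N ≤ n + S.fraction + S.fraction * i := by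
    have := Nat.lt_mul_div_succ (N - n) (by omega : 0 < S.fraction)
    rw [mul_add, mul_one, ← hi] at this
    omega
  have h2 : (S.Λ + 1) ^ N ≤ (S.Λ + 1) ^ (n + S.fraction) * ((S.Λ + 1) ^ S.fraction) ^ i := by
    rw [← pow_mul, ← pow_add]
    exact pow_le_pow_right₀ (by linarith) h1
  calc S.rate ^ i ≤ ((((S.Λ + 1) ^ S.fraction)⁻¹ : ℝ) ^ θ) ^ i := by gcongr
    _ = ((((S.Λ + 1) ^ S.fraction) ^ i)⁻¹ : ℝ) ^ θ := by
      rw [← Real.rpow_natCast, ← Real.rpow_mul (by positivity), mul_comm,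
        Real.rpow_mul (by positivity), Real.rpow_natCast, inv_pow]
    _ ≤ ((S.Λ + 1) ^ (n + S.fraction) * ((S.Λ + 1) ^ N)⁻¹) ^ θ := by
      gcongr
      rw [inv_le_iff_one_le_mul₀ (by positivity)]
      rw [mul_right_comm, ← div_eq_mul_inv, one_le_div (by positivity)]
      exact h2
    _ = _ := Real.mul_rpow (by positivity) (by positivity)

end RobustStep

end Initial

/-! ### The local comparison on a transversal -/

section Germ

variable {A B C : Type*}
  [NormedAddCommGroup A] [NormedSpace ℝ A] [NormedAddCommGroup B] [NormedSpace ℝ B]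
  [NormedAddCommGroup C] [NormedSpace ℝ C]
  {iAB : A →L[ℝ] B} {iBC : B →L[ℝ] C}
  {OA : Set A} {T : A → A} {K : Set A} {OB : Set B} {TB : B → B} {w : A → A}

namespace RobustStep

variable (S : RobustStep iAB iBC OA T K OB TB w)

/-- The aperture of the cones in `A`: they are mapped by the inclusion into the cones of `C`. -/
noncomputable def coneA (S : RobustStep iAB iBC OA T K OB TB w) : ℝ :=
  1 / (32 * S.q * (1 + ‖iBC‖ * ‖iAB‖))

theorem coneA_pos : 0 < S.coneA := by
  have := S.q_ge
  unfold coneA; positivity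

theorem coneA_le_one : S.coneA ≤ 1 := by
  have := S.q_ge
  have h : 0 ≤ S.q * (‖iBC‖ * ‖iAB‖) := by positivity
  unfold coneA
  rw [div_le_one (by positivity)]
  nlinarith

theorem norm_mul_coneA_le : ‖iBC‖ * ‖iAB‖ * S.coneA ≤ 1 / (32 * S.q) := by
  have := S.q_ge
  have h : 0 ≤ ‖iBC‖ * ‖iAB‖ := by positivity
  unfold coneA
  rw [mul_one_div, div_le_div_iff₀ (by positivity) (by positivity)]
  nlinarith

/-- A family of points `F r`, `r ∈ 𝒦`, of a curve with the points `γ r` of the basic set that they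
shadow, `ψ` being a parameter for the latter; `v` is the tangent vector of the curve `F` at `r₀`. -/
structure HolonomyGerm (F : ℝ → B) (γ : ℝ → A) (ψ : ℝ → ℝ) (𝒦 : Set ℝ) (r₀ : ℝ) (v : B) (H : ℝ) :
    Prop where
  H_nonneg : 0 ≤ H
  mem : r₀ ∈ 𝒦
  base : ∀ r ∈ 𝒦, γ r ∈ K
  shadow : ∀ r ∈ 𝒦, ∀ k, ‖S.G^[k] (F r) - iAB (S.φ^[k] (γ r))‖ ≤ S.radius / 4 * (1 / 2) ^ k
  narrow : ∀ r₁ ∈ 𝒦, ∀ r₂ ∈ 𝒦, S.NarrowA S.coneA (γ r₁) (γ r₂ - γ r₁)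
  inj : InjOn γ 𝒦
  cont : ContinuousWithinAt γ 𝒦 r₀
  F_lip : ∀ r₁ ∈ 𝒦, ∀ r₂ ∈ 𝒦, ‖F r₂ - F r₁‖ ≤ H * |r₂ - r₁|
  F_three : ∀ r₁ ∈ 𝒦, ∀ r₂ ∈ 𝒦, ∀ r₃ ∈ 𝒦, r₃ ≠ r₁ →
    ‖F r₂ - F r₁ - ((r₂ - r₁) / (r₃ - r₁)) • (F r₃ - F r₁)‖ ≤
      H * |r₂ - r₁| * (|r₂ - r₁| + |r₃ - r₁|)
  F_strict : ∀ e > 0, ∃ δ > 0, ∀ r₁ ∈ 𝒦, ∀ r₂ ∈ 𝒦, |r₁ - r₀| < δ → |r₂ - r₀| < δ →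
    ‖F r₂ - F r₁ - (r₂ - r₁) • v‖ ≤ e * |r₂ - r₁|
  γ_lip : ∀ r₁ ∈ 𝒦, ∀ r₂ ∈ 𝒦, ‖γ r₂ - γ r₁‖ ≤ H * |ψ r₂ - ψ r₁|
  γ_colip : ∀ r₁ ∈ 𝒦, ∀ r₂ ∈ 𝒦, |ψ r₂ - ψ r₁| ≤ H * ‖γ r₂ - γ r₁‖
  γ_three : ∀ r₁ ∈ 𝒦, ∀ r₂ ∈ 𝒦, ∀ r₃ ∈ 𝒦, ψ r₃ ≠ ψ r₁ →
    ‖γ r₂ - γ r₁ - ((ψ r₂ - ψ r₁) / (ψ r₃ - ψ r₁)) • (γ r₃ - γ r₁)‖ ≤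
      H * |ψ r₂ - ψ r₁| * (|ψ r₂ - ψ r₁| + |ψ r₃ - ψ r₁|)
  tube : ∀ n, F r₀ ∈ S.tube (γ r₀) S.tubeRadius n
  expand : ∃ n, S.p (S.φ^[n] (γ r₀)) (S.tangent (F r₀) n v) ≠ 0 ∧
    S.udist (S.φ^[n] (γ r₀)) (S.tangent (F r₀) n v) ≤
      S.aperture / 2 * |S.p (S.φ^[n] (γ r₀)) (S.tangent (F r₀) n v)|

variable {S} {F : ℝ → B} {γ : ℝ → A} {ψ : ℝ → ℝ} {𝒦 : Set ℝ} {r₀ : ℝ} {v : B} {H : ℝ}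

theorem continuousOn_iterate (S : RobustStep iAB iBC OA T K OB TB w) (n : ℕ) :
    ContinuousOn (S.φ^[n]) K := by
  induction n with
  | zero => exact continuousOn_id
  | succ n ih =>
    rw [Function.iterate_succ]
    exact ih.comp S.φ_cont S.mapsTo

/-- At a fixed time, the differences of nearby points of the curve are in the cone. -/
theorem HolonomyGerm.exists_cone (h : S.HolonomyGerm F γ ψ 𝒦 r₀ v H) : ∃ n : ℕ, ∃ δ > 0, ∃ c > 0,
    ∀ r₁ ∈ 𝒦, ∀ r₂ ∈ 𝒦, |r₁ - r₀| < δ → |r₂ - r₀| < δ → r₁ ≠ r₂ →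
      S.InCone (S.φ^[n] (γ r₁)) (S.G^[n] (F r₁)) (S.G^[n] (F r₂)) ∧
      c * |r₂ - r₁| ≤ |S.pairCoeff (S.φ^[n] (γ r₁)) (S.G^[n] (F r₁)) (S.G^[n] (F r₂)) 0| := by
  obtain ⟨n, hp0, hu0⟩ := h.expand
  have hx₀ := h.base r₀ h.mem
  have hxn := S.iterate_mem n hx₀
  have ha := S.aperture_pos
  have hqa := S.q_mul_aperture
  have hq := S.q_ge
  set z₀ := S.tangent (F r₀) n v with hz₀
  set p₀ := S.p (S.φ^[n] (γ r₀)) z₀ with hp₀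
  have hp₀' : 0 < |p₀| := abs_pos.2 hp0
  obtain ⟨t₀, ht₀⟩ := exists_lineDist_eq (iBC (iAB (w (S.φ^[n] (γ r₀))))) z₀
  change _ = S.udist _ z₀ at ht₀
  have ht : |p₀ - t₀| ≤ 1 / 64 * |p₀| := by
    refine (S.udist_le_of_near hxn (ht₀.le.trans hu0)).2.trans ?_
    rw [← mul_assoc, ← mul_div_assoc, hqa]; linarith
  set e : ℝ := S.aperture * |p₀| / 20 with he
  have he0 : 0 < e := by positivity
  -- the strict derivative at `F r₀`
  have hstrict : HasStrictFDerivAt (fun y => iBC (S.G^[n] y)) (S.tangent (F r₀) n) (F r₀) :=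
    (S.differentiableAt_of_mem_tube hx₀ S.tubeRadius_lt (h.tube n)).hasStrictFDerivAt one_ne_zero
  have hH := h.H_nonneg
  obtain ⟨δ₁, hδ₁, h₁⟩ : ∃ δ > 0, ∀ y₁ y₂ : B, ‖y₁ - F r₀‖ < δ → ‖y₂ - F r₀‖ < δ →
      ‖iBC (S.G^[n] y₂) - iBC (S.G^[n] y₁) - S.tangent (F r₀) n (y₂ - y₁)‖ ≤
        e / (2 * (H + 1)) * ‖y₂ - y₁‖ := by
    have h2 := hstrict.isLittleO.bound (by positivity : 0 < e / (2 * (H + 1)))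
    rw [Metric.eventually_nhds_iff] at h2
    obtain ⟨δ, hδ, h3⟩ := h2
    refine ⟨δ, hδ, fun y₁ y₂ hy₁ hy₂ => ?_⟩
    have h4 := @h3 (y₂, y₁) (by
      rw [Prod.dist_eq, max_lt_iff, dist_eq_norm, dist_eq_norm]; exact ⟨hy₂, hy₁⟩)
    exact h4
  obtain ⟨δ₂, hδ₂, h₂⟩ := h.F_strict (e / (2 * (‖S.tangent (F r₀) n‖ + 1))) (by positivity)
  have hcw : ContinuousWithinAt (fun r => t₀ • iBC (iAB (w (S.φ^[n] (γ r))))) 𝒦 r₀ := by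
    have h5 : ContinuousWithinAt (fun r => w (S.φ^[n] (γ r))) 𝒦 r₀ := by
      have h6 := S.w_cont.comp (continuousOn_iterate S n) (S.mapsTo.iterate n)
      exact (h6 (γ r₀) hx₀).comp h.cont h.base
    exact ((iBC.comp iAB).continuous.continuousAt.comp_continuousWithinAt h5).const_smul t₀
  obtain ⟨δ₃, hδ₃, h₃⟩ := Metric.continuousWithinAt_iff.1 hcw e he0
  refine ⟨n, min (min (δ₁ / (H + 1)) δ₂) δ₃, by positivity, 9 / 10 * |p₀|, by positivity,
    fun r₁ hr₁ r₂ hr₂ hd₁ hd₂ hne => ?_⟩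
  have hF : ∀ r ∈ 𝒦, |r - r₀| < min (min (δ₁ / (H + 1)) δ₂) δ₃ → ‖F r - F r₀‖ < δ₁ := by
    intro r hr hd
    have h4 := hd.trans_le ((min_le_left _ _).trans (min_le_left _ _))
    rw [lt_div_iff₀ (by positivity)] at h4
    have h5 := h.F_lip r₀ h.mem r hr
    nlinarith [abs_nonneg (r - r₀)]
  have h4 := h₁ (F r₁) (F r₂) (hF r₁ hr₁ hd₁) (hF r₂ hr₂ hd₂)
  have h5 := h₂ r₁ hr₁ r₂ hr₂ (hd₁.trans_le ((min_le_left _ _).trans (min_le_right _ _)))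
    (hd₂.trans_le ((min_le_left _ _).trans (min_le_right _ _)))
  have h6 := h₃ hr₁ (by rw [Real.dist_eq]; exact hd₁.trans_le (min_le_right _ _))
  rw [dist_eq_norm] at h6
  have hx₁ := S.iterate_mem n (h.base r₁ hr₁)
  set c := r₂ - r₁ with hc
  have hc0 : 0 < |c| := abs_pos.2 (sub_ne_zero.2 (Ne.symm hne))
  set W₀ := iBC (iAB (w (S.φ^[n] (γ r₀))))
  set W₁ := iBC (iAB (w (S.φ^[n] (γ r₁))))
  set Z := iBC (S.G^[n] (F r₂) - S.G^[n] (F r₁)) with hZ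
  have h7 : ‖Z - (c * t₀) • W₁‖ ≤ 3 / 5 * (S.aperture * |p₀|) * |c| := by
    have e1 : Z - (c * t₀) • W₁ = (iBC (S.G^[n] (F r₂)) - iBC (S.G^[n] (F r₁)) -
        S.tangent (F r₀) n (F r₂ - F r₁)) + S.tangent (F r₀) n (F r₂ - F r₁ - c • v) +
        c • (z₀ - t₀ • W₀) - c • (t₀ • W₁ - t₀ • W₀) := by
      rw [hZ, map_sub iBC, map_sub _ (F r₂ - F r₁), map_smul, hz₀]
      module
    have b1 : ‖iBC (S.G^[n] (F r₂)) - iBC (S.G^[n] (F r₁)) -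
        S.tangent (F r₀) n (F r₂ - F r₁)‖ ≤ e / 2 * |c| := by
      refine h4.trans ?_
      calc _ ≤ e / (2 * (H + 1)) * ((H + 1) * |c|) := by
            gcongr
            have := h.F_lip r₁ hr₁ r₂ hr₂
            nlinarith
        _ = _ := by field_simp
    have b2 : ‖S.tangent (F r₀) n (F r₂ - F r₁ - c • v)‖ ≤ e / 2 * |c| := by
      calc _ ≤ (‖S.tangent (F r₀) n‖ + 1) * (e / (2 * (‖S.tangent (F r₀) n‖ + 1)) * |c|) := by
            refine (ContinuousLinearMap.le_opNorm _ _).trans ?_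
            gcongr
            linarith
        _ = _ := by field_simp
    rw [e1]
    refine (norm_sub_le _ _).trans ?_
    have b3 : ‖c • (t₀ • W₁ - t₀ • W₀)‖ ≤ |c| * e := by
      rw [norm_smul, Real.norm_eq_abs]; gcongr
    have b4 : ‖c • (z₀ - t₀ • W₀)‖ ≤ |c| * (S.aperture / 2 * |p₀|) := by
      rw [norm_smul, Real.norm_eq_abs]; gcongr; exact ht₀.le.trans hu0
    have b5 := (norm_add_le _ _).trans (add_le_add (norm_add_le _ _ |>.trans (add_le_add b1 b2)) b4)
    have e2 : e / 2 * |c| + e / 2 * |c| + |c| * (S.aperture / 2 * |p₀|) + |c| * e =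
        3 / 5 * (S.aperture * |p₀|) * |c| := by rw [he]; ring
    linarith
  obtain ⟨h8, h9⟩ := S.udist_le_of_near hx₁ h7
  have h10 : 9 / 10 * |p₀| * |c| ≤ |S.p (S.φ^[n] (γ r₁)) Z| := by
    have h11 : S.q * (3 / 5 * (S.aperture * |p₀|) * |c|) = 3 / 160 * |p₀| * |c| := by
      rw [show S.q * (3 / 5 * (S.aperture * |p₀|) * |c|) =
        (S.q * S.aperture) * (3 / 5 * |p₀| * |c|) by ring, hqa]; ring
    rw [h11] at h9
    have h12 : |c * t₀| ≤ |S.p (S.φ^[n] (γ r₁)) Z| + |S.p (S.φ^[n] (γ r₁)) Z - c * t₀| := by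
      rw [abs_sub_comm]; exact sub_le_iff_le_add'.1 (abs_sub_abs_le_abs_sub _ _)
    have h13 : |p₀| ≤ |t₀| + |p₀ - t₀| := sub_le_iff_le_add'.1 (abs_sub_abs_le_abs_sub _ _)
    have h14 : |c| * (63 / 64 * |p₀|) ≤ |c * t₀| := by
      rw [abs_mul]; gcongr; linarith
    have : 0 < |p₀| * |c| := by positivity
    nlinarith
  have h15 : 0 < |p₀| * |c| := by positivity
  refine ⟨⟨?_, ?_⟩, h10⟩
  · change S.p (S.φ^[n] (γ r₁)) Z ≠ 0
    refine abs_pos.1 (lt_of_lt_of_le ?_ h10)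
    rw [mul_assoc]; positivity
  · change S.udist (S.φ^[n] (γ r₁)) Z ≤ S.aperture * |S.p (S.φ^[n] (γ r₁)) Z|
    refine h8.trans ?_
    have : S.aperture * (9 / 10 * |p₀| * |c|) ≤ S.aperture * |S.p (S.φ^[n] (γ r₁)) Z| := by gcongr
    nlinarith

/-- The orbits of two nearby points of the family separate after a long time. -/
theorem HolonomyGerm.exists_separation (h : S.HolonomyGerm F γ ψ 𝒦 r₀ v H) :
    ∃ n : ℕ, ∃ δ > 0, ∃ R ≥ 0, ∀ r₁ ∈ 𝒦, ∀ r₂ ∈ 𝒦, |r₁ - r₀| < δ → |r₂ - r₀| < δ → r₁ ≠ r₂ →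
      ∃ N ≥ n, S.Separation (S.φ^[n] (γ r₁)) (S.φ^[n] (γ r₂)) (S.G^[n] (F r₁)) (S.G^[n] (F r₂))
        R (N - n) ∧
      (∀ k ≤ n, ‖S.G^[k] (F r₁) - iAB (S.φ^[k] (γ r₁))‖ ≤ S.radius / 2 ∧
        ‖S.G^[k] (F r₂) - iAB (S.φ^[k] (γ r₁))‖ ≤ S.radius / 2 ∧
        ‖S.G^[k] (iAB (γ r₂)) - iAB (S.φ^[k] (γ r₁))‖ ≤ S.radius / 2) ∧
      ((S.Λ + 1) ^ N)⁻¹ ≤ R * |ψ r₂ - ψ r₁| ∧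
      |r₂ - r₁| ≤ R * (1 / 2) ^ (N - n) ∧ |ψ r₂ - ψ r₁| ≤ R * (1 / 2) ^ (N - n) ∧
      |r₂ - r₁| ≤ R * |S.pairCoeff (S.φ^[n] (γ r₁)) (S.G^[n] (F r₁)) (S.G^[n] (F r₂)) 0| ∧
      |ψ r₂ - ψ r₁| ≤
        R * |S.pairCoeff (S.φ^[n] (γ r₁)) (iAB (S.φ^[n] (γ r₁))) (iAB (S.φ^[n] (γ r₂))) 0| := by
  obtain ⟨n, δ₁, hδ₁, c, hc, hcone⟩ := h.exists_cone
  obtain ⟨r', hr', hesc⟩ := S.exists_escape S.coneA_pos S.coneA_le_one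
  have hH := h.H_nonneg
  have hrad := S.radius_pos
  have hrad1 := S.radius_le_one
  have hΛ := S.Λ_ge
  have hcA := S.cA_ge
  have hq := S.q_ge
  set r₄ : ℝ := min r' (S.radius / (4 * (‖iAB‖ + 1))) with hr₄def
  have hr₄ : 0 < r₄ := by positivity
  have hr₄B : ‖iAB‖ * r₄ ≤ S.radius / 4 := by
    have : r₄ ≤ S.radius / (4 * (‖iAB‖ + 1)) := min_le_right _ _
    rw [le_div_iff₀ (by positivity)] at this
    nlinarith
  -- the time of separation is larger than `n` near `r₀`
  set d₀ : ℝ := r₄ / (2 * (S.Λ + 1) * (S.Λ + 1) ^ n * S.cA) with hd₀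
  have hd₀0 : 0 < d₀ := by positivity
  have hd₀r : d₀ ≤ r₄ := by
    refine div_le_self hr₄.le ?_
    have h1 : (1 : ℝ) ≤ (S.Λ + 1) ^ n := one_le_pow₀ (by linarith)
    exact one_le_mul_of_one_le_of_one_le (one_le_mul_of_one_le_of_one_le (by linarith) h1) hcA
  obtain ⟨δ₂, hδ₂, hcont⟩ := Metric.continuousWithinAt_iff.1 h.cont (d₀ / 2) (by positivity)
  set L : ℝ := S.q * ‖iBC‖ * S.radius with hL
  set R : ℝ := S.radius + 2 * S.cA * (‖iAB‖ * r₄) + 2 * (S.Λ + 1) / r₄ +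
    2 * (S.Λ + 1) * S.cA * H / r₄ + L / c + 1 / c + 2 * H * (L + 1) with hR
  have t1 : 0 ≤ 2 * S.cA * (‖iAB‖ * r₄) := by positivity
  have t2 : 0 ≤ 2 * (S.Λ + 1) / r₄ := by positivity
  have t3 : 0 ≤ 2 * (S.Λ + 1) * S.cA * H / r₄ := by positivity
  have hL0 : 0 ≤ L := by positivity
  have t4 : 0 ≤ L / c := by positivity
  have t5 : 0 ≤ 1 / c := by positivity
  have t6 : 0 ≤ 2 * H * (L + 1) := by positivity
  have hR0 : 0 ≤ R := by positivity
  refine ⟨n, min δ₁ δ₂, by positivity, R, hR0, fun r₁ hr₁ r₂ hr₂ hd₁ hd₂ hne => ?_⟩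
  obtain ⟨hc1, hc2⟩ := hcone r₁ hr₁ r₂ hr₂ (hd₁.trans_le (min_le_left _ _))
    (hd₂.trans_le (min_le_left _ _)) hne
  have hx := h.base r₁ hr₁
  have hg := h.base r₂ hr₂
  have hV : ‖γ r₂ - γ r₁‖ < d₀ := by
    have g1 := hcont hr₁ (by rw [Real.dist_eq]; exact hd₁.trans_le (min_le_right _ _))
    have g2 := hcont hr₂ (by rw [Real.dist_eq]; exact hd₂.trans_le (min_le_right _ _))
    rw [← dist_eq_norm]
    linarith [dist_triangle_right (γ r₂) (γ r₁) (γ r₀)]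
  obtain ⟨N, e1, e2, e3⟩ := hesc r₄ (min_le_left _ _) (γ r₁) hx (γ r₂) hg
    (fun h' => hne (h.inj hr₂ hr₁ h').symm) (hV.trans_le hd₀r) (h.narrow r₁ hr₁ r₂ hr₂)
  have hP0 : |S.coeffA (γ r₁) (γ r₂ - γ r₁)| ≤ S.cA * ‖γ r₂ - γ r₁‖ :=
    (S.abs_coeffA_le hx _).trans (by gcongr; linarith)
  have hlow : r₄ ≤ 2 * (S.Λ + 1) * ((S.Λ + 1) ^ N * (S.cA * ‖γ r₂ - γ r₁‖)) := by
    have g1 := e2 0 (Nat.zero_le _)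
    simp only [Nat.sub_zero, Function.iterate_zero, id_eq] at g1
    refine e3.trans ?_
    gcongr
    exact g1.trans (by gcongr)
  have hnN : n ≤ N := by
    by_contra hlt
    have g1 : (S.Λ + 1) ^ N ≤ (S.Λ + 1) ^ n := pow_le_pow_right₀ (by linarith) (by omega)
    have g2 : 2 * (S.Λ + 1) * ((S.Λ + 1) ^ N * (S.cA * ‖γ r₂ - γ r₁‖)) <
        2 * (S.Λ + 1) * ((S.Λ + 1) ^ n * (S.cA * d₀)) := by
      have : (S.Λ + 1) ^ N * (S.cA * ‖γ r₂ - γ r₁‖) ≤ (S.Λ + 1) ^ n * (S.cA * ‖γ r₂ - γ r₁‖) := by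
        gcongr
      have : (S.Λ + 1) ^ n * (S.cA * ‖γ r₂ - γ r₁‖) < (S.Λ + 1) ^ n * (S.cA * d₀) := by gcongr
      exact mul_lt_mul_of_pos_left (lt_of_le_of_lt ‹_› this) (by positivity)
    have g3 : 2 * (S.Λ + 1) * ((S.Λ + 1) ^ n * (S.cA * d₀)) = r₄ := by
      rw [hd₀]; field_simp
    linarith
  have hshift : ∀ k (x : A), S.φ^[k] (S.φ^[n] x) = S.φ^[k + n] x := fun k x =>
    (Function.iterate_add_apply _ _ _ _).symm
  have hshiftG : ∀ k (y : B), S.G^[k] (S.G^[n] y) = S.G^[k + n] y := fun k y =>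
    (Function.iterate_add_apply _ _ _ _).symm
  -- distances to the base orbit
  have hq2 : ∀ k : ℕ, (1 / 2 : ℝ) ^ k ≤ 1 := fun k => pow_le_one₀ (by norm_num) (by norm_num)
  have f1 : ∀ k ≤ N, ‖iAB (S.φ^[k] (γ r₂)) - iAB (S.φ^[k] (γ r₁))‖ ≤ S.radius / 4 ∧
      ‖iAB (S.φ^[k] (γ r₂)) - iAB (S.φ^[k] (γ r₁))‖ ≤
        2 * S.cA * (‖iAB‖ * r₄) * (1 / 2) ^ (N - k) := by
    intro k hk
    obtain ⟨-, g1, g2, -⟩ := e1 k hk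
    rw [← map_sub]
    constructor
    · refine (iAB.le_opNorm _).trans (le_trans ?_ hr₄B)
      gcongr
    · refine (iAB.le_opNorm _).trans ?_
      have : (1 / 5 : ℝ) ^ (N - k) ≤ (1 / 2) ^ (N - k) :=
        pow_le_pow_left₀ (by norm_num) (by norm_num) _
      calc ‖iAB‖ * _ ≤ ‖iAB‖ * (2 * S.cA * (1 / 2) ^ (N - k) * r₄) := by
            gcongr
            exact g2.trans (by gcongr)
        _ = _ := by ring
  have s1 := h.shadow r₁ hr₁
  have s2 := h.shadow r₂ hr₂
  have f2 : ∀ k ≤ N, ‖S.G^[k] (F r₂) - iAB (S.φ^[k] (γ r₁))‖ ≤ S.radius / 4 * (1 / 2) ^ k +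
      ‖iAB (S.φ^[k] (γ r₂)) - iAB (S.φ^[k] (γ r₁))‖ := by
    intro k hk
    refine le_trans ?_ (add_le_add (s2 k) le_rfl)
    refine le_trans (le_of_eq ?_) (norm_add_le _ _)
    congr 1; abel
  have hsep : S.Separation (S.φ^[n] (γ r₁)) (S.φ^[n] (γ r₂)) (S.G^[n] (F r₁)) (S.G^[n] (F r₂))
        R (N - n) := by
    have hhalf : ∀ k, (1 / 2 : ℝ) ^ (k + n) ≤ (1 / 2) ^ k := fun k =>
      pow_le_pow_of_le_one (by norm_num) (by norm_num) (by omega)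
    have hRrad : S.radius / 4 ≤ R := by rw [hR]; linarith
    have hRA : 2 * S.cA * (‖iAB‖ * r₄) ≤ R := by rw [hR]; linarith
    have q1 : ∀ k, S.radius / 4 * (1 / 2) ^ (k + n) ≤ R * (1 / 2) ^ k := fun k =>
      mul_le_mul hRrad (hhalf k) (by positivity) hR0
    have q2 : ∀ k, S.radius / 4 * (1 / 2) ^ (k + n) ≤ S.radius / 4 := fun k =>
      mul_le_of_le_one_right (by positivity) (hq2 _)
    have q3 : ∀ k ≤ N - n, ‖iAB (S.φ^[k + n] (γ r₂)) - iAB (S.φ^[k + n] (γ r₁))‖ ≤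
        R * (1 / 2) ^ (N - n - k) := by
      intro k hk
      refine (f1 (k + n) (by omega)).2.trans ?_
      rw [show N - (k + n) = N - n - k by omega]
      gcongr
    have q4 : ∀ k : ℕ, 0 ≤ R * (1 / 2) ^ k := fun k => by positivity
    have hV' := fun k hk => (e1 k hk).1
    refine ⟨S.iterate_mem n hx, S.iterate_mem n hg, fun k hk => ?_, fun k hk => ?_, fun k hk => ?_,
      fun k => ?_, fun k => ?_, hc1, ⟨?_, ?_⟩, ?_⟩
    · rw [hshift, hshiftG]
      refine (s1 (k + n)).trans (le_min ((q2 k).trans (by linarith)) ?_)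
      rw [mul_add]
      linarith [q1 k, q4 (N - n - k)]
    · rw [hshift, hshiftG]
      refine (f2 (k + n) (by omega)).trans (le_min ?_ ?_)
      · linarith [q2 k, (f1 (k + n) (by omega)).1]
      · rw [mul_add]
        linarith [q1 k, q3 k hk]
    · rw [S.iterate_conj k (S.iterate_mem n hg), hshift, hshift]
      refine le_min ((f1 (k + n) (by omega)).1.trans (by linarith)) ?_
      rw [mul_add]
      linarith [q4 k, q3 k hk]
    · rw [hshift, hshiftG]
      exact (s1 (k + n)).trans (q1 k)
    · rw [hshift, hshiftG]
      exact (s2 (k + n)).trans (q1 k)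
    · change S.p (S.φ^[n] (γ r₁)) (iBC (iAB (S.φ^[n] (γ r₂)) - iAB (S.φ^[n] (γ r₁)))) ≠ 0
      rw [← map_sub]
      change S.coeffA (S.φ^[n] (γ r₁)) _ ≠ 0
      intro h0
      have g1 := e2 n hnN
      rw [h0, abs_zero, mul_zero] at g1
      have g2 := abs_nonneg (S.coeffA (S.φ^[N] (γ r₁)) (S.φ^[N] (γ r₂) - S.φ^[N] (γ r₁)))
      have g3 : |S.coeffA (S.φ^[N] (γ r₁)) (S.φ^[N] (γ r₂) - S.φ^[N] (γ r₁))| = 0 := le_antisymm g1 g2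
      rw [g3, mul_zero] at e3
      linarith
    · change S.udist _ _ ≤ _ * |S.p (S.φ^[n] (γ r₁)) (iBC (iAB (S.φ^[n] (γ r₂)) - iAB (S.φ^[n] (γ r₁))))|
      rw [← map_sub]
      have g1 := hV' n hnN
      set V := S.φ^[n] (γ r₂) - S.φ^[n] (γ r₁)
      change S.udist _ _ ≤ _ * |S.coeffA (S.φ^[n] (γ r₁)) V|
      refine (lineDist_le _ _ (S.coeffA (S.φ^[n] (γ r₁)) V)).trans ?_
      rw [← map_smul, ← map_smul, ← map_sub, ← map_sub]
      calc _ ≤ ‖iBC‖ * (‖iAB‖ * (S.coneA * |S.coeffA (S.φ^[n] (γ r₁)) V|)) := by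
            refine (iBC.le_opNorm _).trans ?_
            gcongr
            refine (iAB.le_opNorm _).trans ?_
            gcongr
            exact g1
        _ = ‖iBC‖ * ‖iAB‖ * S.coneA * |S.coeffA (S.φ^[n] (γ r₁)) V| := by ring
        _ ≤ _ := by gcongr; exact S.norm_mul_coneA_le
    · rw [pairCoeff, S.iterate_conj _ (S.iterate_mem n hg), S.iterate_conj _ (S.iterate_mem n hx),
        hshift, hshift, Nat.sub_add_cancel hnN, ← map_sub]
      change 1 ≤ R * |S.coeffA _ _|
      have g1 : 2 * (S.Λ + 1) / r₄ ≤ R := by rw [hR]; linarith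
      calc 1 ≤ 2 * (S.Λ + 1) / r₄ *
            |S.coeffA (S.φ^[N] (γ r₁)) (S.φ^[N] (γ r₂) - S.φ^[N] (γ r₁))| := by
            rw [div_mul_eq_mul_div, le_div_iff₀ hr₄, one_mul]; exact e3
        _ ≤ _ := by gcongr
  obtain ⟨-, -, b, sb⟩ := hsep.cone.sequence hsep.mem hR0 hsep.near₁ hsep.near₂
  obtain ⟨-, -, b', sb'⟩ := hsep.cone'.sequence hsep.mem hR0
    (fun k _ => S.near_base hsep.mem hR0 _ k) hsep.near
  have hfin : ∀ y₁ y₂ : B, ‖S.G^[N - n] y₁ - iAB (S.φ^[N - n] (S.φ^[n] (γ r₁)))‖ ≤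
        S.dev R (N - n) (N - n) →
      ‖S.G^[N - n] y₂ - iAB (S.φ^[N - n] (S.φ^[n] (γ r₁)))‖ ≤ S.dev R (N - n) (N - n) →
      |S.pairCoeff (S.φ^[n] (γ r₁)) y₁ y₂ (N - n)| ≤ L := by
    intro y₁ y₂ g1 g2
    have g3 : S.dev R (N - n) (N - n) ≤ S.radius / 2 := min_le_left _ _
    refine (S.abs_p_le (S.iterate_mem _ hsep.mem) _).trans ?_
    rw [hL, mul_assoc]
    gcongr
    refine (iBC.le_opNorm _).trans ?_
    gcongr
    refine le_trans (le_of_eq ?_) ((norm_sub_le (S.G^[N - n] y₂ - iAB (S.φ^[N - n] (S.φ^[n] (γ r₁))))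
      (S.G^[N - n] y₁ - iAB (S.φ^[N - n] (S.φ^[n] (γ r₁))))).trans ?_)
    · congr 1; abel
    · linarith
  have fin1 := hfin _ _ (hsep.near₁ _ le_rfl) (hsep.near₂ _ le_rfl)
  have fin2 := hfin _ _ (S.near_base hsep.mem hR0 _ _) (hsep.near _ le_rfl)
  have gr1 := iterate_growth (fun k hk => (sb k hk).2.2.2.2) (N - n) 0 (by omega)
  have gr2 := iterate_growth (fun k hk => (sb' k hk).2.2.2.2) (N - n) 0 (by omega)
  have hpow : 0 < (1 / 2 : ℝ) ^ (N - n) := by positivity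
  -- the parameter of the unstable manifold is controlled by the coefficient at time `n`
  have hψ : |ψ r₂ - ψ r₁| ≤ 2 * H *
      |S.pairCoeff (S.φ^[n] (γ r₁)) (iAB (S.φ^[n] (γ r₁))) (iAB (S.φ^[n] (γ r₂))) 0| := by
    have g1 := h.γ_colip r₁ hr₁ r₂ hr₂
    have g2 := (h.narrow r₁ hr₁ r₂ hr₂).norm_le hx S.coneA_le_one
    have g3 := (e1 n hnN).2.2.2
    have g4 : S.pairCoeff (S.φ^[n] (γ r₁)) (iAB (S.φ^[n] (γ r₁))) (iAB (S.φ^[n] (γ r₂))) 0 =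
        S.coeffA (S.φ^[n] (γ r₁)) (S.φ^[n] (γ r₂) - S.φ^[n] (γ r₁)) := by
      rw [coeffA, map_sub]; rfl
    rw [g4]
    calc |ψ r₂ - ψ r₁| ≤ H * ‖γ r₂ - γ r₁‖ := g1
      _ ≤ H * (2 * |S.coeffA (S.φ^[n] (γ r₁)) (S.φ^[n] (γ r₂) - S.φ^[n] (γ r₁))|) := by
        gcongr
        linarith
      _ = _ := by ring
  have hcc : |r₂ - r₁| ≤
      1 / c * |S.pairCoeff (S.φ^[n] (γ r₁)) (S.G^[n] (F r₁)) (S.G^[n] (F r₂)) 0| := by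
    rw [one_div_mul_eq_div, le_div_iff₀ hc, mul_comm]; exact hc2
  refine ⟨N, hnN, hsep, fun k hk => ⟨?_, ?_, ?_⟩, ?_, ?_, ?_, ?_, ?_⟩
  · refine (s1 k).trans ?_
    have := mul_le_of_le_one_right (by positivity : 0 ≤ S.radius / 4) (hq2 k)
    linarith
  · refine (f2 k (by omega)).trans ?_
    have := mul_le_of_le_one_right (by positivity : 0 ≤ S.radius / 4) (hq2 k)
    linarith [(f1 k (by omega)).1]
  · rw [S.iterate_conj k hg]
    linarith [(f1 k (by omega)).1]
  · have g1 : 2 * (S.Λ + 1) * S.cA * H / r₄ ≤ R := by rw [hR]; linarith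
    have g2 := h.γ_lip r₁ hr₁ r₂ hr₂
    calc ((S.Λ + 1) ^ N)⁻¹ ≤ 2 * (S.Λ + 1) * S.cA * H / r₄ * |ψ r₂ - ψ r₁| := by
          rw [inv_le_iff_one_le_mul₀ (by positivity), div_mul_eq_mul_div, div_mul_eq_mul_div,
            le_div_iff₀ hr₄, one_mul]
          refine hlow.trans ?_
          calc _ ≤ 2 * (S.Λ + 1) * ((S.Λ + 1) ^ N * (S.cA * (H * |ψ r₂ - ψ r₁|))) := by gcongr
            _ = _ := by ring
      _ ≤ _ := by gcongr
  · calc |r₂ - r₁| ≤ 1 / c * ((1 / 2) ^ (N - n) * L) := hcc.trans (by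
          gcongr; exact gr1.trans (by gcongr))
      _ = L / c * (1 / 2) ^ (N - n) := by ring
      _ ≤ _ := by gcongr; rw [hR]; linarith
  · calc |ψ r₂ - ψ r₁| ≤ 2 * H * ((1 / 2) ^ (N - n) * L) := hψ.trans (by
          gcongr; exact gr2.trans (by gcongr))
      _ = 2 * H * L * (1 / 2) ^ (N - n) := by ring
      _ ≤ _ := by
        gcongr
        have : 2 * H * L ≤ 2 * H * (L + 1) := by gcongr; linarith
        rw [hR]; linarith
  · refine hcc.trans ?_
    gcongr
    rw [hR]; linarith
  · refine hψ.trans ?_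
    gcongr
    have : 2 * H * 1 ≤ 2 * H * (L + 1) := by gcongr; linarith
    rw [hR]; linarith

end RobustStep

end Germ

section Germ

variable {A B C : Type*}
  [NormedAddCommGroup A] [NormedSpace ℝ A] [NormedAddCommGroup B] [NormedSpace ℝ B]
  [NormedAddCommGroup C] [NormedSpace ℝ C]
  {iAB : A →L[ℝ] B} {iBC : B →L[ℝ] C}
  {OA : Set A} {T : A → A} {K : Set A} {OB : Set B} {TB : B → B} {w : A → A}

namespace RobustStep

variable {S : RobustStep iAB iBC OA T K OB TB w}
  {F : ℝ → B} {γ : ℝ → A} {ψ : ℝ → ℝ} {𝒦 : Set ℝ} {r₀ : ℝ} {v : B} {H : ℝ}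

/-- Near a point where the family accumulates, the difference quotients of the holonomy vary in a
Hölder continuous way. -/
theorem HolonomyGerm.exists_slope_comparison {θ : ℝ} (hθ0 : 0 < θ) (hθ : S.IsExponent θ)
    (h : S.HolonomyGerm F γ ψ 𝒦 r₀ v H) :
    ∃ δ > 0, ∃ M ≥ 0, ∀ r₁ ∈ 𝒦, ∀ r₂ ∈ 𝒦, ∀ r₃ ∈ 𝒦, |r₁ - r₀| < δ → |r₂ - r₀| < δ → |r₃ - r₀| < δ →
      r₁ ≠ r₂ → r₁ ≠ r₃ →
      |slope ψ r₁ r₂ / slope ψ r₁ r₃ - 1| ≤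
        M * max |ψ r₂ - ψ r₁| |ψ r₃ - ψ r₁| ^ θ := by
  obtain ⟨n, δ₁, hδ₁, R, hR, hsep⟩ := h.exists_separation
  obtain ⟨E₀, hE₀, hexp⟩ := hθ n
  have hH := h.H_nonneg
  have hη := S.rate_pos
  have hβ := S.β_pos
  have hΛ := S.Λ_ge
  obtain ⟨Ed, hEd, hdev⟩ := S.exists_initial_deviation (H := H * (1 + ‖iAB‖)) (by positivity) n
  set Rm : ℝ := 2 * R + R ^ S.β with hRm
  have hRm0 : 0 ≤ Rm := by positivity
  obtain ⟨E, hE, hcomp⟩ := S.exists_ratio_comparison (H := Ed * R * Rm) hR (by positivity)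
  set c : ℝ := 12 * E * E₀ * R ^ θ with hc
  have hc0 : 0 ≤ c := by positivity
  set d : ℝ := (1 / (2 * (c + 1))) ^ (1 / θ) with hd
  have hd0 : 0 < d := by positivity
  have hdθ : c * d ^ θ ≤ 1 / 2 := by
    rw [hd, ← Real.rpow_mul (by positivity), one_div_mul_cancel hθ0.ne', Real.rpow_one,
      mul_one_div, div_le_div_iff₀ (by positivity) (by positivity)]
    linarith
  obtain ⟨δ₂, hδ₂, hcont⟩ := Metric.continuousWithinAt_iff.1 h.cont (d / (2 * (H + 1)))
    (by positivity)
  have hψd : ∀ r₁ ∈ 𝒦, ∀ r₂ ∈ 𝒦, |r₁ - r₀| < δ₂ → |r₂ - r₀| < δ₂ → |ψ r₂ - ψ r₁| ≤ d := by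
    intro r₁ h₁ r₂ h₂ d₁ d₂
    have g1 := hcont h₁ (by rwa [Real.dist_eq])
    have g2 := hcont h₂ (by rwa [Real.dist_eq])
    have g3 : ‖γ r₂ - γ r₁‖ ≤ d / (H + 1) := by
      rw [← dist_eq_norm]
      refine (dist_triangle_right (γ r₂) (γ r₁) (γ r₀)).trans ?_
      have : d / (H + 1) = d / (2 * (H + 1)) + d / (2 * (H + 1)) := by field_simp; ring
      linarith
    refine (h.γ_colip _ h₁ _ h₂).trans ?_
    calc H * ‖γ r₂ - γ r₁‖ ≤ (H + 1) * (d / (H + 1)) := by gcongr; linarith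
      _ = d := by field_simp
  choose! N hNn hs hrad hψlow hrN hψN hrP hψP using hsep
  have hpow : ∀ {t : ℝ} {k : ℕ}, |t| ≤ R * (1 / 2) ^ k → |t| ≤ R * S.rate ^ k ∧
      |t| ^ S.β ≤ R ^ S.β * S.rate ^ k := by
    intro t k ht
    refine ⟨ht.trans (by gcongr; exact S.half_le_rate), ?_⟩
    calc |t| ^ S.β ≤ (R * (1 / 2) ^ k) ^ S.β := by gcongr
      _ = R ^ S.β * ((1 / 2) ^ k) ^ S.β := Real.mul_rpow hR (by positivity)
      _ ≤ _ := by gcongr; exact S.half_pow_rpow_le_rate k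
  have key : ∀ r₁ ∈ 𝒦, ∀ r₂ ∈ 𝒦, ∀ r₃ ∈ 𝒦, |r₁ - r₀| < min δ₁ δ₂ → |r₂ - r₀| < min δ₁ δ₂ →
      |r₃ - r₀| < min δ₁ δ₂ → r₁ ≠ r₂ → r₁ ≠ r₃ → N r₁ r₂ ≤ N r₁ r₃ →
      |slope ψ r₁ r₂ / slope ψ r₁ r₃ - 1| ≤ c * |ψ r₂ - ψ r₁| ^ θ := by
    intro r₁ h₁ r₂ h₂ r₃ h₃ d₁ d₂ d₃ h12 h13 hN
    have d₁' := d₁.trans_le (min_le_left _ _)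
    have d₂' := d₂.trans_le (min_le_left _ _)
    have d₃' := d₃.trans_le (min_le_left _ _)
    have e₂ := d₂.trans_le (min_le_right _ _)
    have e₁ := d₁.trans_le (min_le_right _ _)
    have hn2 := hNn r₁ h₁ r₂ h₂ d₁' d₂' h12
    set j := N r₁ r₂ - n with hj
    have hjN : j ≤ N r₁ r₃ - n := by omega
    have hη1 : S.rate ^ (N r₁ r₃ - n) ≤ S.rate ^ j :=
      pow_le_pow_of_le_one hη.le S.rate_lt_one.le hjN
    have hhalf : R * (1 / 2 : ℝ) ^ (N r₁ r₃ - n) ≤ R * (1 / 2) ^ j := by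
      gcongr ?_ * ?_
      exact pow_le_pow_of_le_one (by norm_num) (by norm_num) hjN
    have hr2 := hpow (hrN r₁ h₁ r₂ h₂ d₁' d₂' h12)
    have hr3 := hpow ((hrN r₁ h₁ r₃ h₃ d₁' d₃' h13).trans hhalf)
    have hp2 := hpow (hψN r₁ h₁ r₂ h₂ d₁' d₂' h12)
    have hp3 := hpow ((hψN r₁ h₁ r₃ h₃ d₁' d₃' h13).trans hhalf)
    have hm : R ^ S.β * S.rate ^ j ≤ Rm * S.rate ^ j := by gcongr; rw [hRm]; linarith
    have hm' : R * S.rate ^ j + R * S.rate ^ j ≤ Rm * S.rate ^ j := by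
      rw [← add_mul]; gcongr; rw [hRm]; linarith [Real.rpow_nonneg hR S.β]
    have hψne : ∀ r ∈ 𝒦, r₁ ≠ r → ψ r - ψ r₁ ≠ 0 := by
      intro r hr hne h0
      have g := h.γ_lip r₁ h₁ r hr
      rw [h0, abs_zero, mul_zero, norm_le_zero_iff, sub_eq_zero] at g
      exact hne (h.inj hr h₁ g).symm
    have hiH : H ≤ H * (1 + ‖iAB‖) := le_mul_of_one_le_right hH (by linarith [norm_nonneg iAB])
    have hiH' : ‖iAB‖ * H ≤ H * (1 + ‖iAB‖) := by linarith
    have rad2 := hrad r₁ h₁ r₂ h₂ d₁' d₂' h12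
    have rad3 := hrad r₁ h₁ r₃ h₃ d₁' d₃' h13
    have b1 := h.base r₁ h₁
    have b2 := h.base r₂ h₂
    have b3 := h.base r₃ h₃
    -- the initial deviations on the transversal and on the unstable manifold
    have i1 := hdev (γ r₁) b1 (F r₁) (F r₂) (F r₃) (r₂ - r₁) (r₃ - r₁) (Rm * S.rate ^ j)
      (fun k hk => (rad2 k hk).1) (fun k hk => (rad2 k hk).2.1) (fun k hk => (rad3 k hk).2.1)
      (sub_ne_zero.2 (Ne.symm h13)) ((h.F_lip r₁ h₁ r₂ h₂).trans (by gcongr))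
      ((h.F_lip r₁ h₁ r₃ h₃).trans (by gcongr))
      ((h.F_three r₁ h₁ r₂ h₂ r₃ h₃ (Ne.symm h13)).trans (by
        gcongr; linarith [hr2.1, hr3.1])) (hr2.2.trans hm) (hr3.2.trans hm)
    have hlipA : ∀ r ∈ 𝒦, ‖iAB (γ r) - iAB (γ r₁)‖ ≤ H * (1 + ‖iAB‖) * |ψ r - ψ r₁| := by
      intro r hr
      rw [← map_sub]
      calc _ ≤ ‖iAB‖ * (H * |ψ r - ψ r₁|) :=
            (iAB.le_opNorm _).trans (by gcongr; exact h.γ_lip r₁ h₁ r hr)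
        _ = ‖iAB‖ * H * |ψ r - ψ r₁| := by ring
        _ ≤ _ := by gcongr
    have i2 := hdev (γ r₁) b1 (iAB (γ r₁)) (iAB (γ r₂)) (iAB (γ r₃)) (ψ r₂ - ψ r₁) (ψ r₃ - ψ r₁)
      (Rm * S.rate ^ j)
      (fun k _ => by
        rw [S.iterate_conj k b1, sub_self, norm_zero]; linarith [S.radius_pos])
      (fun k hk => (rad2 k hk).2.2) (fun k hk => (rad3 k hk).2.2) (hψne r₃ h₃ h13)
      (hlipA r₂ h₂) (hlipA r₃ h₃)
      (by
        rw [← map_sub, ← map_sub, ← map_smul, ← map_sub]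
        calc _ ≤ ‖iAB‖ * (H * |ψ r₂ - ψ r₁| * (|ψ r₂ - ψ r₁| + |ψ r₃ - ψ r₁|)) :=
              (iAB.le_opNorm _).trans (by
                gcongr
                exact h.γ_three r₁ h₁ r₂ h₂ r₃ h₃ (sub_ne_zero.1 (hψne r₃ h₃ h13)))
          _ = ‖iAB‖ * H * |ψ r₂ - ψ r₁| * (|ψ r₂ - ψ r₁| + |ψ r₃ - ψ r₁|) := by ring
          _ ≤ _ := by gcongr; linarith [hp2.1, hp3.1]) (hp2.2.trans hm) (hp3.2.trans hm)
    rw [S.iterate_conj n b1, S.iterate_conj n b2, S.iterate_conj n b3] at i2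
    have hsmall : 12 * E * S.rate ^ (j / S.fraction) ≤ c * |ψ r₂ - ψ r₁| ^ θ := by
      calc _ ≤ 12 * E * (E₀ * (((S.Λ + 1) ^ N r₁ r₂)⁻¹ : ℝ) ^ θ) := by
            gcongr; exact hexp _ hn2
        _ ≤ 12 * E * (E₀ * (R * |ψ r₂ - ψ r₁|) ^ θ) := by
            gcongr; exact hψlow r₁ h₁ r₂ h₂ d₁' d₂' h12
        _ = _ := by rw [Real.mul_rpow hR (abs_nonneg _), hc]; ring
    have hhalf' : c * |ψ r₂ - ψ r₁| ^ θ ≤ 1 / 2 := by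
      refine le_trans ?_ hdθ
      gcongr
      exact hψd r₁ h₁ r₂ h₂ e₁ e₂
    have h14 : E * S.rate ^ (j / S.fraction) ≤ 1 / 4 := by linarith
    have hfin := hcomp _ _ _ _ _ _ _ _ ((r₂ - r₁) / (r₃ - r₁)) ((ψ r₂ - ψ r₁) / (ψ r₃ - ψ r₁))
      hjN (hs r₁ h₁ r₂ h₂ d₁' d₂' h12) (hs r₁ h₁ r₃ h₃ d₁' d₃' h13)
      (i1.trans (by
        calc Ed * |r₂ - r₁| * (Rm * S.rate ^ j) ≤ Ed * (R * |S.pairCoeff (S.φ^[n] (γ r₁))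
              (S.G^[n] (F r₁)) (S.G^[n] (F r₂)) 0|) * (Rm * S.rate ^ j) := by
              gcongr; exact hrP r₁ h₁ r₂ h₂ d₁' d₂' h12
          _ = _ := by ring))
      (i2.trans (by
        calc Ed * |ψ r₂ - ψ r₁| * (Rm * S.rate ^ j) ≤ Ed * (R * |S.pairCoeff (S.φ^[n] (γ r₁))
              (iAB (S.φ^[n] (γ r₁))) (iAB (S.φ^[n] (γ r₂))) 0|) * (Rm * S.rate ^ j) := by
              gcongr; exact hψP r₁ h₁ r₂ h₂ d₁' d₂' h12
          _ = _ := by ring)) h14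
    refine le_trans (le_of_eq ?_) (hfin.trans hsmall)
    rw [slope_def_field, slope_def_field]
    congr 2
    simp only [div_div_div_eq]
    ring
  refine ⟨min δ₁ δ₂, by positivity, 2 * c, by positivity,
    fun r₁ h₁ r₂ h₂ r₃ h₃ d₁ d₂ d₃ h12 h13 => ?_⟩
  rcases le_total (N r₁ r₂) (N r₁ r₃) with hN | hN
  · refine (key r₁ h₁ r₂ h₂ r₃ h₃ d₁ d₂ d₃ h12 h13 hN).trans ?_
    have : |ψ r₂ - ψ r₁| ^ θ ≤ max |ψ r₂ - ψ r₁| |ψ r₃ - ψ r₁| ^ θ := by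
      gcongr; exact le_max_left _ _
    have h0 : 0 ≤ |ψ r₂ - ψ r₁| ^ θ := by positivity
    nlinarith
  · have g := key r₁ h₁ r₃ h₃ r₂ h₂ d₁ d₃ d₂ h13 h12 hN
    have hh : c * |ψ r₃ - ψ r₁| ^ θ ≤ 1 / 2 := by
      refine le_trans ?_ hdθ
      gcongr
      exact hψd r₁ h₁ r₃ h₃ (d₁.trans_le (min_le_right _ _)) (d₃.trans_le (min_le_right _ _))
    set t := slope ψ r₁ r₃ / slope ψ r₁ r₂ with ht
    have ht2 : 1 / 2 ≤ t := by linarith [(abs_le.1 (g.trans hh)).1]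
    have e : slope ψ r₁ r₂ / slope ψ r₁ r₃ - 1 = (1 - t) / t := by
      rw [← inv_div, ← ht]; field_simp
    rw [e, abs_div, abs_of_pos (by linarith : 0 < t), div_le_iff₀ (by linarith), abs_sub_comm]
    have : |ψ r₃ - ψ r₁| ^ θ ≤ max |ψ r₂ - ψ r₁| |ψ r₃ - ψ r₁| ^ θ := by
      gcongr; exact le_max_right _ _
    calc |t - 1| ≤ c * max |ψ r₂ - ψ r₁| |ψ r₃ - ψ r₁| ^ θ := g.trans (by gcongr)
      _ = 2 * c * max |ψ r₂ - ψ r₁| |ψ r₃ - ψ r₁| ^ θ * (1 / 2) := by ring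
      _ ≤ _ := by gcongr

end RobustStep

end Germ

/-! ### Extension of a function from a compact subset of the line -/

section WhitneyGap

/-- The derivative, in the coordinate `t ∈ [0, 1]` of a gap, of the interpolating polynomial:
it is equal to `p` at `0`, to `q` at `1`, and its mean is `σ`. -/
noncomputable def gapDeriv (k : ℕ) (p q σ t : ℝ) : ℝ :=
  let m := ((k + 1) * σ - p - q) / (k - 1)
  m + (p - m) * (1 - t) ^ k + (q - m) * t ^ k

/-- The interpolating polynomial on a gap. -/
noncomputable def gapPrim (k : ℕ) (p q σ t : ℝ) : ℝ :=
  let m := ((k + 1) * σ - p - q) / (k - 1)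
  m * t + (p - m) * ((1 - (1 - t) ^ (k + 1)) / (k + 1)) + (q - m) * (t ^ (k + 1) / (k + 1))

variable {k : ℕ} {p q σ t s c C : ℝ}

theorem gapDeriv_zero (hk : 2 ≤ k) : gapDeriv k p q σ 0 = p := by
  simp [gapDeriv, show k ≠ 0 by omega]

theorem gapDeriv_one (hk : 2 ≤ k) : gapDeriv k p q σ 1 = q := by
  simp [gapDeriv, show k ≠ 0 by omega]

theorem gapPrim_zero : gapPrim k p q σ 0 = 0 := by
  simp [gapPrim]

theorem gapPrim_one (hk : 2 ≤ k) : gapPrim k p q σ 1 = σ := by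
  have h1 : (2 : ℝ) ≤ k := by exact_mod_cast hk
  have h2 : (k : ℝ) - 1 ≠ 0 := by linarith
  have h3 : (k : ℝ) + 1 ≠ 0 := by linarith
  simp only [gapPrim, sub_self, one_pow, mul_one, ne_eq, Nat.add_eq_zero_iff, one_ne_zero, and_false,
    not_false_eq_true, zero_pow, sub_zero]
  field_simp
  ring

theorem hasDerivAt_gapPrim : HasDerivAt (gapPrim k p q σ) (gapDeriv k p q σ t) t := by
  have h3 : (k : ℝ) + 1 ≠ 0 := by positivity
  have h1 : HasDerivAt (fun t : ℝ => (1 - t) ^ (k + 1)) (-((k + 1) * (1 - t) ^ k)) t := by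
    refine (((hasDerivAt_id t).const_sub 1).fun_pow (k + 1)).congr_deriv ?_
    simp
  have h2 : HasDerivAt (fun t : ℝ => t ^ (k + 1)) ((k + 1) * t ^ k) t := by
    refine ((hasDerivAt_id t).fun_pow (k + 1)).congr_deriv ?_
    simp
  unfold gapPrim gapDeriv
  refine HasDerivAt.congr_deriv ((((hasDerivAt_id t).const_mul _).add
    (((h1.const_sub 1).div_const ((k : ℝ) + 1)).const_mul _)).add
    ((h2.div_const ((k : ℝ) + 1)).const_mul _)) ?_
  field_simp

theorem abs_pow_sub_pow_le_of_mem (ht : t ∈ Icc (0 : ℝ) 1) (hs : s ∈ Icc (0 : ℝ) 1) :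
    |t ^ k - s ^ k| ≤ k * |t - s| := by
  induction k with
  | zero => simp
  | succ k ih =>
    have h1 : t ^ (k + 1) - s ^ (k + 1) = (t ^ k - s ^ k) * t + s ^ k * (t - s) := by ring
    rw [h1]
    refine (abs_add_le _ _).trans ?_
    rw [abs_mul, abs_mul, abs_of_nonneg ht.1, abs_of_nonneg (pow_nonneg hs.1 k)]
    have h2 : |t ^ k - s ^ k| * t ≤ k * |t - s| * 1 := by
      gcongr
      · exact ht.1
      · exact ht.2
    have h3 : s ^ k * |t - s| ≤ 1 * |t - s| := by
      gcongr
      exact pow_le_one₀ hs.1 hs.2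
    push_cast
    linarith

theorem abs_gapDeriv_sub_le {w : ℝ} (hk : 2 ≤ k) (hp : |p - σ| ≤ w) (hq : |q - σ| ≤ w)
    (ht : t ∈ Icc (0 : ℝ) 1) (hs : s ∈ Icc (0 : ℝ) 1) :
    |gapDeriv k p q σ t - gapDeriv k p q σ s| ≤ 6 * k * w * |t - s| := by
  have h1 : (2 : ℝ) ≤ k := by exact_mod_cast hk
  have hw : 0 ≤ w := (abs_nonneg _).trans hp
  set m := ((k + 1) * σ - p - q) / ((k : ℝ) - 1) with hm
  have hmσ : |σ - m| ≤ 2 * w := by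
    have e : σ - m = ((p - σ) + (q - σ)) / ((k : ℝ) - 1) := by
      rw [hm, eq_div_iff (by linarith), sub_mul, div_mul_cancel₀ _ (by linarith)]
      ring
    rw [e, abs_div, abs_of_pos (by linarith : (0 : ℝ) < k - 1)]
    refine (div_le_self (abs_nonneg _) (by linarith)).trans ?_
    exact (abs_add_le _ _).trans (by linarith)
  have hpm : |p - m| ≤ 3 * w := by
    have := abs_add_le (p - σ) (σ - m)
    rw [sub_add_sub_cancel] at this
    linarith
  have hqm : |q - m| ≤ 3 * w := by
    have := abs_add_le (q - σ) (σ - m)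
    rw [sub_add_sub_cancel] at this
    linarith
  have e : gapDeriv k p q σ t - gapDeriv k p q σ s =
      (p - m) * ((1 - t) ^ k - (1 - s) ^ k) + (q - m) * (t ^ k - s ^ k) := by
    simp only [gapDeriv, ← hm]; ring
  rw [e]
  refine (abs_add_le _ _).trans ?_
  rw [abs_mul, abs_mul]
  have h2 := abs_pow_sub_pow_le_of_mem (k := k) ht hs
  have h3 := abs_pow_sub_pow_le_of_mem (k := k) (t := 1 - t) (s := 1 - s)
    ⟨by linarith [ht.2], by linarith [ht.1]⟩ ⟨by linarith [hs.2], by linarith [hs.1]⟩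
  rw [show 1 - t - (1 - s) = -(t - s) by ring, abs_neg] at h3
  calc _ ≤ 3 * w * (k * |t - s|) + 3 * w * (k * |t - s|) := by gcongr
    _ = _ := by ring

/-- If the degree is large, the interpolating polynomial is increasing. -/
theorem gapDeriv_pos (hk : 2 ≤ k) (hc : 0 < c) (hkC : 2 * C < (k + 1) * c) (hp : p ∈ Icc c C)
    (hq : q ∈ Icc c C) (hσ : c ≤ σ) (ht : t ∈ Icc (0 : ℝ) 1) : 0 < gapDeriv k p q σ t := by
  have h1 : (2 : ℝ) ≤ k := by exact_mod_cast hk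
  set m := ((k + 1) * σ - p - q) / ((k : ℝ) - 1) with hm
  have hm0 : 0 < m := by
    refine div_pos ?_ (by linarith)
    have : (k + 1) * c ≤ (k + 1) * σ := by gcongr
    linarith [hp.2, hq.2]
  have e : gapDeriv k p q σ t = m * (1 - (1 - t) ^ k - t ^ k) + p * (1 - t) ^ k + q * t ^ k := by
    simp only [gapDeriv, ← hm]; ring
  have w1 : 0 ≤ (1 - t) ^ k := pow_nonneg (by linarith [ht.2]) _
  have w2 : 0 ≤ t ^ k := pow_nonneg ht.1 _
  have w3 : (1 - t) ^ k ≤ 1 - t := pow_le_of_le_one (by linarith [ht.2]) (by linarith [ht.1])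
    (by omega)
  have w4 : t ^ k ≤ t := pow_le_of_le_one ht.1 ht.2 (by omega)
  have hp0 : 0 < p := hc.trans_le hp.1
  have hq0 : 0 < q := hc.trans_le hq.1
  rw [e]
  set u := min m (min p q) with hu
  have hu0 : 0 < u := lt_min hm0 (lt_min hp0 hq0)
  have u1 : u ≤ m := min_le_left _ _
  have u2 : u ≤ p := (min_le_right _ _).trans (min_le_left _ _)
  have u3 : u ≤ q := (min_le_right _ _).trans (min_le_right _ _)
  have v1 := mul_le_mul_of_nonneg_right u1 (by linarith : 0 ≤ 1 - (1 - t) ^ k - t ^ k)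
  have v2 := mul_le_mul_of_nonneg_right u2 w1
  have v3 := mul_le_mul_of_nonneg_right u3 w2
  nlinarith

theorem abs_gapPrim_sub_le {w : ℝ} (hk : 2 ≤ k) (hp : |p - σ| ≤ w) (hq : |q - σ| ≤ w)
    (ht : t ∈ Icc (0 : ℝ) 1) : |gapPrim k p q σ t - p * t| ≤ 6 * k * w * t * t ∧
      |σ - gapPrim k p q σ t - q * (1 - t)| ≤ 6 * k * w * (1 - t) * (1 - t) := by
  have hw : 0 ≤ w := (abs_nonneg _).trans hp
  constructor
  · have h := (convex_Icc (0 : ℝ) t).norm_image_sub_le_of_norm_hasDerivWithin_le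
      (f := fun x => gapPrim k p q σ x - p * x) (f' := fun x => gapDeriv k p q σ x - p * 1)
      (C := 6 * k * w * t)
      (fun x _ => (hasDerivAt_gapPrim.sub ((hasDerivAt_id x).const_mul p)).hasDerivWithinAt)
      (fun x hx => by
        have := abs_gapDeriv_sub_le hk hp hq (t := x) (s := 0) ⟨hx.1, hx.2.trans ht.2⟩ (by simp)
        rw [gapDeriv_zero hk] at this
        rw [mul_one, Real.norm_eq_abs]
        refine this.trans ?_
        rw [sub_zero, abs_of_nonneg hx.1]
        gcongr
        exact hx.2) (left_mem_Icc.2 ht.1) (right_mem_Icc.2 ht.1)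
    simpa [gapPrim_zero, abs_of_nonneg ht.1] using h
  · have h := (convex_Icc t (1 : ℝ)).norm_image_sub_le_of_norm_hasDerivWithin_le
      (f := fun x => gapPrim k p q σ x - q * x) (f' := fun x => gapDeriv k p q σ x - q * 1)
      (C := 6 * k * w * (1 - t))
      (fun x _ => (hasDerivAt_gapPrim.sub ((hasDerivAt_id x).const_mul q)).hasDerivWithinAt)
      (fun x hx => by
        have := abs_gapDeriv_sub_le hk hp hq (t := x) (s := 1) ⟨ht.1.trans hx.1, hx.2⟩ (by simp)
        rw [gapDeriv_one hk] at this
        rw [mul_one, Real.norm_eq_abs]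
        refine this.trans ?_
        rw [abs_sub_comm, abs_of_nonneg (by linarith [hx.2])]
        gcongr
        exact hx.1) (left_mem_Icc.2 ht.2) (right_mem_Icc.2 ht.2)
    rw [gapPrim_one hk, Real.norm_eq_abs, Real.norm_eq_abs, abs_of_nonneg (sub_nonneg.2 ht.2)] at h
    refine le_trans (le_of_eq ?_) h
    congr 1; ring

end WhitneyGap

/-- A jet of order one of class `C^{1+θ}` on a compact set `𝒦` of the line with the endpoints
`a`, `b`, with positive difference quotients and derivatives. -/
structure IncreasingJet (𝒦 : Set ℝ) (a b : ℝ) (ψ d : ℝ → ℝ) (c C M θ : ℝ) : Prop where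
  isCompact : IsCompact 𝒦
  left_mem : a ∈ 𝒦
  right_mem : b ∈ 𝒦
  subset : 𝒦 ⊆ Icc a b
  c_pos : 0 < c
  θ_pos : 0 < θ
  θ_le : θ ≤ 1
  M_nonneg : 0 ≤ M
  jet : ∀ r ∈ 𝒦, ∀ s ∈ 𝒦, |ψ s - ψ r - d r * (s - r)| ≤ M * |s - r| ^ θ * |s - r|
  deriv_mem : ∀ r ∈ 𝒦, d r ∈ Icc c C
  slope_ge : ∀ r ∈ 𝒦, ∀ s ∈ 𝒦, r < s → c ≤ slope ψ r s

namespace IncreasingJet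

variable {𝒦 : Set ℝ} {a b : ℝ} {ψ d : ℝ → ℝ} {c C M θ : ℝ}

/-- The largest point of `𝒦` on the left of `x`. -/
noncomputable def leftPt (𝒦 : Set ℝ) (x : ℝ) : ℝ := sSup (𝒦 ∩ Iic x)

/-- The smallest point of `𝒦` on the right of `x`. -/
noncomputable def rightPt (𝒦 : Set ℝ) (x : ℝ) : ℝ := sInf (𝒦 ∩ Ici x)

/-- The degree of the interpolating polynomials. -/
noncomputable def degree (c C : ℝ) : ℕ := max 2 (Nat.ceil (2 * C / c))

theorem two_le_degree (c C : ℝ) : 2 ≤ degree c C := le_max_left _ _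

theorem degree_spec (hc : 0 < c) : 2 * C < (degree c C + 1) * c := by
  have h1 : 2 * C / c ≤ degree c C :=
    (Nat.le_ceil _).trans (by unfold degree; exact_mod_cast le_max_right _ _)
  rw [div_le_iff₀ hc] at h1
  linarith

/-- The extension of `ψ`, by polynomials on the gaps of `𝒦`. -/
noncomputable def ext (𝒦 : Set ℝ) (ψ d : ℝ → ℝ) (k : ℕ) (x : ℝ) : ℝ :=
  ψ (leftPt 𝒦 x) + (rightPt 𝒦 x - leftPt 𝒦 x) *
    gapPrim k (d (leftPt 𝒦 x)) (d (rightPt 𝒦 x)) (slope ψ (leftPt 𝒦 x) (rightPt 𝒦 x))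
      ((x - leftPt 𝒦 x) / (rightPt 𝒦 x - leftPt 𝒦 x))

/-- The derivative of the extension. On `𝒦` itself the two neighbours of `x` are equal, and
division by zero gives `t = 0`. -/
noncomputable def extDeriv (𝒦 : Set ℝ) (ψ d : ℝ → ℝ) (k : ℕ) (x : ℝ) : ℝ :=
  gapDeriv k (d (leftPt 𝒦 x)) (d (rightPt 𝒦 x)) (slope ψ (leftPt 𝒦 x) (rightPt 𝒦 x))
      ((x - leftPt 𝒦 x) / (rightPt 𝒦 x - leftPt 𝒦 x))

variable (h : IncreasingJet 𝒦 a b ψ d c C M θ)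
include h

theorem isGreatest_leftPt {x : ℝ} (hx : x ∈ Icc a b) : IsGreatest (𝒦 ∩ Iic x) (leftPt 𝒦 x) :=
  (h.isCompact.inter_right isClosed_Iic).isGreatest_sSup ⟨a, h.left_mem, hx.1⟩

theorem isLeast_rightPt {x : ℝ} (hx : x ∈ Icc a b) : IsLeast (𝒦 ∩ Ici x) (rightPt 𝒦 x) :=
  (h.isCompact.inter_right isClosed_Ici).isLeast_sInf ⟨b, h.right_mem, hx.2⟩

end IncreasingJet

namespace IncreasingJet

variable {𝒦 : Set ℝ} {a b : ℝ} {ψ d : ℝ → ℝ} {c C M θ : ℝ}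
  (h : IncreasingJet 𝒦 a b ψ d c C M θ)
include h

theorem leftPt_eq {x : ℝ} (hx : x ∈ 𝒦) : leftPt 𝒦 x = x :=
  (h.isGreatest_leftPt (h.subset hx)).unique ⟨⟨hx, le_refl x⟩, fun _ hy => hy.2⟩

theorem rightPt_eq {x : ℝ} (hx : x ∈ 𝒦) : rightPt 𝒦 x = x :=
  (h.isLeast_rightPt (h.subset hx)).unique ⟨⟨hx, le_refl x⟩, fun _ hy => hy.2⟩

theorem leftPt_lt {x : ℝ} (hx : x ∈ Icc a b) (hx' : x ∉ 𝒦) : leftPt 𝒦 x < x := by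
  obtain ⟨h1, h2⟩ := (h.isGreatest_leftPt hx).1
  exact lt_of_le_of_ne h2 fun e => hx' (e ▸ h1)

theorem lt_rightPt {x : ℝ} (hx : x ∈ Icc a b) (hx' : x ∉ 𝒦) : x < rightPt 𝒦 x := by
  obtain ⟨h1, h2⟩ := (h.isLeast_rightPt hx).1
  exact lt_of_le_of_ne h2 fun e => hx' (e ▸ h1)

/-- Two points without points of `𝒦` between them are in the same gap. -/
theorem same_gap {x y : ℝ} (hx : x ∈ Icc a b) (hy : y ∈ Icc a b) (hxy : x ≤ y)
    (hd : ∀ z ∈ 𝒦, z ∉ Icc x y) : leftPt 𝒦 y = leftPt 𝒦 x ∧ rightPt 𝒦 y = rightPt 𝒦 x := by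
  obtain ⟨⟨p1, p2⟩, p3⟩ := h.isGreatest_leftPt hx
  obtain ⟨⟨q1, q2⟩, q3⟩ := h.isLeast_rightPt hy
  constructor
  · refine (h.isGreatest_leftPt hy).unique ⟨⟨p1, le_trans p2 hxy⟩, fun z hz => p3 ⟨hz.1, ?_⟩⟩
    by_contra hlt
    exact hd z hz.1 ⟨(not_le.1 hlt).le, hz.2⟩
  · refine ((h.isLeast_rightPt hx).unique ⟨⟨q1, le_trans hxy q2⟩, fun z hz => q3 ⟨hz.1, ?_⟩⟩).symm
    by_contra hlt
    exact hd z hz.1 ⟨hz.2, (not_le.1 hlt).le⟩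

theorem abs_deriv_sub_slope_le {r s : ℝ} (hr : r ∈ 𝒦) (hs : s ∈ 𝒦) (hne : r ≠ s) :
    |d r - slope ψ r s| ≤ M * |s - r| ^ θ := by
  have h0 : 0 < |s - r| := abs_pos.2 (sub_ne_zero.2 hne.symm)
  have h1 := h.jet r hr s hs
  have h2 : ψ s - ψ r - d r * (s - r) = -((d r - slope ψ r s) * (s - r)) := by
    rw [slope_def_field, sub_mul, div_mul_cancel₀ _ (sub_ne_zero.2 hne.symm)]; ring
  rw [h2, abs_neg, abs_mul] at h1
  exact le_of_mul_le_mul_right h1 h0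

theorem abs_deriv_sub_le {r s : ℝ} (hr : r ∈ 𝒦) (hs : s ∈ 𝒦) :
    |d r - d s| ≤ 2 * M * |s - r| ^ θ := by
  rcases eq_or_ne r s with rfl | hne
  · simp [h.θ_pos.ne']
  have h1 := h.abs_deriv_sub_slope_le hr hs hne
  have h2 := h.abs_deriv_sub_slope_le hs hr hne.symm
  rw [slope_comm, abs_sub_comm r s] at h2
  rw [abs_sub_comm] at h2
  have := abs_add_le (d r - slope ψ r s) (slope ψ r s - d s)
  rw [sub_add_sub_cancel] at this
  linarith

theorem ext_eq {x : ℝ} (hx : x ∈ 𝒦) (k : ℕ) : ext 𝒦 ψ d k x = ψ x := by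
  simp [ext, h.leftPt_eq hx, h.rightPt_eq hx]

theorem extDeriv_eq {x : ℝ} (hx : x ∈ 𝒦) : extDeriv 𝒦 ψ d (degree c C) x = d x := by
  simp [extDeriv, h.leftPt_eq hx, h.rightPt_eq hx, gapDeriv_zero (two_le_degree c C)]

/-- The geometry of the gap that contains `x`. -/
theorem gap {x : ℝ} (hx : x ∈ Icc a b) (hx' : x ∉ 𝒦) :
    leftPt 𝒦 x ∈ 𝒦 ∧ rightPt 𝒦 x ∈ 𝒦 ∧ leftPt 𝒦 x < x ∧ x < rightPt 𝒦 x ∧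
      |d (leftPt 𝒦 x) - slope ψ (leftPt 𝒦 x) (rightPt 𝒦 x)| ≤
        M * (rightPt 𝒦 x - leftPt 𝒦 x) ^ θ ∧
      |d (rightPt 𝒦 x) - slope ψ (leftPt 𝒦 x) (rightPt 𝒦 x)| ≤
        M * (rightPt 𝒦 x - leftPt 𝒦 x) ^ θ := by
  have h1 := (h.isGreatest_leftPt hx).1.1
  have h2 := (h.isLeast_rightPt hx).1.1
  have h3 := h.leftPt_lt hx hx'
  have h4 := h.lt_rightPt hx hx'
  have h5 : |rightPt 𝒦 x - leftPt 𝒦 x| = rightPt 𝒦 x - leftPt 𝒦 x := abs_of_pos (by linarith)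
  refine ⟨h1, h2, h3, h4, ?_, ?_⟩
  · rw [← h5]
    exact h.abs_deriv_sub_slope_le h1 h2 (by linarith)
  · rw [← h5, slope_comm, abs_sub_comm (rightPt 𝒦 x)]
    exact h.abs_deriv_sub_slope_le h2 h1 (by linarith)

omit h in
theorem rpow_mul_div_le {θ ℓ t : ℝ} (hθ1 : θ ≤ 1) (hℓ : 0 < ℓ) (ht : 0 ≤ t) (htℓ : t ≤ ℓ) :
    ℓ ^ θ * (t / ℓ) ≤ t ^ θ := by
  have h1 : t / ℓ ≤ 1 := (div_le_one hℓ).2 htℓ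
  have h2 : t / ℓ ≤ (t / ℓ) ^ θ := Real.self_le_rpow_of_le_one (by positivity) h1 hθ1
  calc ℓ ^ θ * (t / ℓ) ≤ ℓ ^ θ * (t / ℓ) ^ θ := by gcongr
    _ = t ^ θ := by rw [← Real.mul_rpow hℓ.le (by positivity), mul_div_cancel₀ _ hℓ.ne']

/-- The jets at the left end of the gap and in the gap. -/
theorem left_estimate {x : ℝ} (hx : x ∈ Icc a b) :
    |ext 𝒦 ψ d (degree c C) x - ψ (leftPt 𝒦 x) - d (leftPt 𝒦 x) * (x - leftPt 𝒦 x)| ≤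
        6 * degree c C * M * (x - leftPt 𝒦 x) ^ θ * (x - leftPt 𝒦 x) ∧
      |extDeriv 𝒦 ψ d (degree c C) x - d (leftPt 𝒦 x)| ≤
        6 * degree c C * M * (x - leftPt 𝒦 x) ^ θ := by
  by_cases hx' : x ∈ 𝒦
  · rw [h.ext_eq hx', h.extDeriv_eq hx', h.leftPt_eq hx']
    simp [h.θ_pos.ne']
  obtain ⟨-, -, g3, g4, g5, g6⟩ := h.gap hx hx'
  have hM := h.M_nonneg
  have hθ1 := h.θ_le
  have hk := two_le_degree c C
  rw [ext, extDeriv]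
  set α := leftPt 𝒦 x
  set β := rightPt 𝒦 x
  set k := degree c C
  set ℓ := β - α with hℓ
  have hℓ0 : 0 < ℓ := by linarith
  set t := (x - α) / ℓ with ht
  have ht0 : 0 ≤ t := div_nonneg (by linarith) hℓ0.le
  have ht01 : t ∈ Icc (0 : ℝ) 1 := ⟨ht0, (div_le_one hℓ0).2 (by linarith)⟩
  have htx : ℓ * t = x - α := mul_div_cancel₀ _ hℓ0.ne'
  have hr := rpow_mul_div_le hθ1 hℓ0 (by linarith : 0 ≤ x - α) (by linarith)
  rw [← ht] at hr
  constructor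
  · have e := (abs_gapPrim_sub_le hk g5 g6 ht01).1
    rw [← htx, show ψ α + ℓ * gapPrim k (d α) (d β) (slope ψ α β) t - ψ α - d α * (ℓ * t) =
      ℓ * (gapPrim k (d α) (d β) (slope ψ α β) t - d α * t) by ring, abs_mul, abs_of_pos hℓ0]
    calc ℓ * _ ≤ ℓ * (6 * k * (M * ℓ ^ θ) * t * t) := by gcongr
      _ = 6 * k * M * (ℓ ^ θ * t) * (ℓ * t) := by ring
      _ ≤ _ := by rw [htx]; gcongr
  · have e := abs_gapDeriv_sub_le hk g5 g6 ht01 (s := 0) (by simp)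
    rw [gapDeriv_zero hk, sub_zero, abs_of_nonneg ht0] at e
    calc _ ≤ _ := e
      _ = 6 * k * M * (ℓ ^ θ * t) := by ring
      _ ≤ _ := by gcongr

/-- The jets at the right end of the gap and in the gap. -/
theorem right_estimate {x : ℝ} (hx : x ∈ Icc a b) :
    |ext 𝒦 ψ d (degree c C) x - ψ (rightPt 𝒦 x) - d (rightPt 𝒦 x) * (x - rightPt 𝒦 x)| ≤
        6 * degree c C * M * (rightPt 𝒦 x - x) ^ θ * (rightPt 𝒦 x - x) ∧
      |extDeriv 𝒦 ψ d (degree c C) x - d (rightPt 𝒦 x)| ≤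
        6 * degree c C * M * (rightPt 𝒦 x - x) ^ θ := by
  by_cases hx' : x ∈ 𝒦
  · rw [h.ext_eq hx', h.extDeriv_eq hx', h.rightPt_eq hx']
    simp [h.θ_pos.ne']
  obtain ⟨-, -, g3, g4, g5, g6⟩ := h.gap hx hx'
  have hM := h.M_nonneg
  have hθ1 := h.θ_le
  have hk := two_le_degree c C
  rw [ext, extDeriv]
  set α := leftPt 𝒦 x
  set β := rightPt 𝒦 x
  set k := degree c C
  set ℓ := β - α with hℓ
  have hℓ0 : 0 < ℓ := by linarith
  set t := (x - α) / ℓ with ht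
  have ht0 : 0 ≤ t := div_nonneg (by linarith) hℓ0.le
  have ht01 : t ∈ Icc (0 : ℝ) 1 := ⟨ht0, (div_le_one hℓ0).2 (by linarith)⟩
  have ht1 : 0 ≤ 1 - t := sub_nonneg.2 ht01.2
  have htx : ℓ * t = x - α := mul_div_cancel₀ _ hℓ0.ne'
  have htx' : ℓ * (1 - t) = β - x := by rw [mul_sub, htx]; linarith
  have hr := rpow_mul_div_le hθ1 hℓ0 (by linarith : 0 ≤ β - x) (by linarith)
  have hte : (β - x) / ℓ = 1 - t := by rw [← htx', mul_div_cancel_left₀ _ hℓ0.ne']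
  rw [hte] at hr
  constructor
  · have e := (abs_gapPrim_sub_le hk g5 g6 ht01).2
    have hσ : ψ β = ψ α + ℓ * slope ψ α β := by
      rw [slope_def_field, ← hℓ, mul_div_cancel₀ _ hℓ0.ne']; ring
    rw [show x - β = -(ℓ * (1 - t)) by rw [htx']; ring, ← htx', hσ,
      show ψ α + ℓ * gapPrim k (d α) (d β) (slope ψ α β) t - (ψ α + ℓ * slope ψ α β) -
        d β * -(ℓ * (1 - t)) =
      -(ℓ * (slope ψ α β - gapPrim k (d α) (d β) (slope ψ α β) t - d β * (1 - t))) by ring, abs_neg,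
      abs_mul, abs_of_pos hℓ0]
    calc ℓ * _ ≤ ℓ * (6 * k * (M * ℓ ^ θ) * (1 - t) * (1 - t)) := by gcongr
      _ = 6 * k * M * (ℓ ^ θ * (1 - t)) * (ℓ * (1 - t)) := by ring
      _ ≤ _ := by rw [htx']; gcongr
  · have e := abs_gapDeriv_sub_le hk g5 g6 ht01 (s := 1) (by simp)
    rw [gapDeriv_one hk, abs_sub_comm t, abs_of_nonneg ht1] at e
    calc _ ≤ _ := e
      _ = 6 * k * M * (ℓ ^ θ * (1 - t)) := by ring
      _ ≤ _ := by gcongr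

/-- The extension has the given jet at the points of `𝒦`. -/
theorem exists_ext_jet : ∃ L ≥ 0, ∀ r ∈ 𝒦, ∀ x ∈ Icc a b,
    |ext 𝒦 ψ d (degree c C) x - ψ r - d r * (x - r)| ≤ L * |x - r| ^ θ * |x - r| := by
  have hM := h.M_nonneg
  have hθ := h.θ_pos
  set L := 6 * degree c C * M with hL
  have hL0 : 0 ≤ L := by positivity
  have key : ∀ r ∈ 𝒦, ∀ s ∈ 𝒦, ∀ x,
      |ext 𝒦 ψ d (degree c C) x - ψ s - d s * (x - s)| ≤ L * |x - s| ^ θ * |x - s| →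
      |x - s| ≤ |x - r| → |s - r| ≤ |x - r| →
      |ext 𝒦 ψ d (degree c C) x - ψ r - d r * (x - r)| ≤ (L + 3 * M) * |x - r| ^ θ * |x - r| := by
    intro r hr s hs x hx h1 h2
    have e : ext 𝒦 ψ d (degree c C) x - ψ r - d r * (x - r) =
        (ext 𝒦 ψ d (degree c C) x - ψ s - d s * (x - s)) + (ψ s - ψ r - d r * (s - r)) -
          (d r - d s) * (x - s) := by ring
    rw [e]
    refine (abs_sub _ _).trans ?_
    have e1 := abs_add_le (ext 𝒦 ψ d (degree c C) x - ψ s - d s * (x - s))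
      (ψ s - ψ r - d r * (s - r))
    have e2 : |(d r - d s) * (x - s)| ≤ 2 * M * |x - r| ^ θ * |x - r| := by
      rw [abs_mul]
      gcongr
      exact (h.abs_deriv_sub_le hr hs).trans (by gcongr)
    have e3 : |ψ s - ψ r - d r * (s - r)| ≤ M * |x - r| ^ θ * |x - r| :=
      (h.jet r hr s hs).trans (by gcongr)
    have e4 : L * |x - s| ^ θ * |x - s| ≤ L * |x - r| ^ θ * |x - r| := by gcongr
    linarith
  refine ⟨L + 3 * M, by positivity, fun r hr x hx => ?_⟩
  obtain ⟨⟨p1, p2⟩, p3⟩ := h.isGreatest_leftPt hx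
  obtain ⟨⟨q1, q2⟩, q3⟩ := h.isLeast_rightPt hx
  rw [mem_Iic] at p2
  rw [mem_Ici] at q2
  rcases le_total r x with hrx | hrx
  · have hr' := p3 ⟨hr, hrx⟩
    have e := (h.left_estimate hx).1
    refine key r hr _ p1 x ?_ ?_ ?_
    · rwa [abs_of_nonneg (sub_nonneg.2 p2)]
    · rw [abs_of_nonneg (sub_nonneg.2 p2), abs_of_nonneg (sub_nonneg.2 hrx)]; linarith
    · rw [abs_of_nonneg (sub_nonneg.2 hr'), abs_of_nonneg (sub_nonneg.2 hrx)]; linarith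
  · have hr' := q3 ⟨hr, hrx⟩
    have e := (h.right_estimate hx).1
    refine key r hr _ q1 x ?_ ?_ ?_
    · rwa [abs_sub_comm x, abs_of_nonneg (sub_nonneg.2 q2)]
    · rw [abs_sub_comm x, abs_sub_comm x, abs_of_nonneg (sub_nonneg.2 q2),
        abs_of_nonneg (sub_nonneg.2 hrx)]; linarith
    · rw [abs_sub_comm _ r, abs_sub_comm x, abs_of_nonneg (sub_nonneg.2 hr'),
        abs_of_nonneg (sub_nonneg.2 hrx)]; linarith

theorem hasDerivWithinAt_ext {x : ℝ} (hx : x ∈ Icc a b) :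
    HasDerivWithinAt (ext 𝒦 ψ d (degree c C)) (extDeriv 𝒦 ψ d (degree c C) x) (Icc a b) x := by
  by_cases hx' : x ∈ 𝒦
  · obtain ⟨L, hL, hjet⟩ := h.exists_ext_jet
    rw [h.extDeriv_eq hx', hasDerivWithinAt_iff_isLittleO, Asymptotics.isLittleO_iff]
    intro e he
    have hlim : Tendsto (fun y => L * |y - x| ^ θ) (𝓝[Icc a b] x) (𝓝 0) := by
      have hc : ContinuousAt (fun y : ℝ => L * |y - x| ^ θ) x :=
        continuousAt_const.mul (ContinuousAt.rpow_const (by fun_prop) (Or.inr h.θ_pos.le))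
      have := hc.tendsto
      simp only [sub_self, abs_zero, Real.zero_rpow h.θ_pos.ne', mul_zero] at this
      exact this.mono_left nhdsWithin_le_nhds
    filter_upwards [hlim.eventually_lt_const he, self_mem_nhdsWithin] with y hy hy'
    rw [h.ext_eq hx', Real.norm_eq_abs, Real.norm_eq_abs, smul_eq_mul, mul_comm (y - x)]
    exact (hjet x hx' y hy').trans (by gcongr)
  · obtain ⟨g1, g2, g3, g4, -, -⟩ := h.gap hx hx'
    have hα := h.subset g1
    have hβ := h.subset g2
    have hev : ∀ᶠ y in 𝓝 x, ext 𝒦 ψ d (degree c C) y = ψ (leftPt 𝒦 x) +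
        (rightPt 𝒦 x - leftPt 𝒦 x) * gapPrim (degree c C) (d (leftPt 𝒦 x)) (d (rightPt 𝒦 x))
          (slope ψ (leftPt 𝒦 x) (rightPt 𝒦 x))
          ((y - leftPt 𝒦 x) / (rightPt 𝒦 x - leftPt 𝒦 x)) := by
      filter_upwards [Ioo_mem_nhds g3 g4] with y hy
      have hy' : y ∈ Icc a b := ⟨hα.1.trans hy.1.le, hy.2.le.trans hβ.2⟩
      have hs : leftPt 𝒦 y = leftPt 𝒦 x ∧ rightPt 𝒦 y = rightPt 𝒦 x := by
        rcases le_total x y with hxy | hxy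
        · refine h.same_gap hx hy' hxy fun z hz hz' => ?_
          have := (h.isLeast_rightPt hx).2 ⟨hz, hz'.1⟩
          linarith [hz'.2, hy.2]
        · have := h.same_gap hy' hx hxy fun z hz hz' => ?_
          · exact ⟨this.1.symm, this.2.symm⟩
          have := (h.isGreatest_leftPt hx).2 ⟨hz, hz'.2⟩
          linarith [hz'.1, hy.1]
      rw [ext, hs.1, hs.2]
    refine (HasDerivAt.congr_of_eventuallyEq ?_ hev).hasDerivWithinAt
    have hℓ : rightPt 𝒦 x - leftPt 𝒦 x ≠ 0 := by linarith
    have hd := (hasDerivAt_gapPrim (k := degree c C) (p := d (leftPt 𝒦 x)) (q := d (rightPt 𝒦 x))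
      (σ := slope ψ (leftPt 𝒦 x) (rightPt 𝒦 x))).comp x
      (((hasDerivAt_id x).sub_const (leftPt 𝒦 x)).div_const (rightPt 𝒦 x - leftPt 𝒦 x))
    refine ((hd.const_mul (rightPt 𝒦 x - leftPt 𝒦 x)).const_add _).congr_deriv ?_
    rw [extDeriv]
    simp only [id]
    field_simp

theorem extDeriv_pos {x : ℝ} (hx : x ∈ Icc a b) : 0 < extDeriv 𝒦 ψ d (degree c C) x := by
  by_cases hx' : x ∈ 𝒦
  · rw [h.extDeriv_eq hx']
    exact h.c_pos.trans_le (h.deriv_mem x hx').1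
  obtain ⟨g1, g2, g3, g4, -, -⟩ := h.gap hx hx'
  have hℓ0 : 0 < rightPt 𝒦 x - leftPt 𝒦 x := by linarith
  exact gapDeriv_pos (two_le_degree c C) h.c_pos (degree_spec h.c_pos) (h.deriv_mem _ g1)
    (h.deriv_mem _ g2) (h.slope_ge _ g1 _ g2 (g3.trans g4))
    ⟨div_nonneg (by linarith) hℓ0.le, (div_le_one hℓ0).2 (by linarith)⟩

theorem exists_extDeriv_holder : ∃ L : ℝ, ∀ x ∈ Icc a b, ∀ y ∈ Icc a b,
    |extDeriv 𝒦 ψ d (degree c C) x - extDeriv 𝒦 ψ d (degree c C) y| ≤ L * |x - y| ^ θ := by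
  have hM := h.M_nonneg
  have hθ := h.θ_pos
  set L := 6 * degree c C * M with hL
  have hL0 : 0 ≤ L := by positivity
  have key : ∀ x ∈ Icc a b, ∀ y ∈ Icc a b, x ≤ y →
      |extDeriv 𝒦 ψ d (degree c C) x - extDeriv 𝒦 ψ d (degree c C) y| ≤
        (2 * L + 2 * M) * |x - y| ^ θ := by
    intro x hx y hy hxy
    have hxy' : |x - y| = y - x := by rw [abs_sub_comm, abs_of_nonneg (sub_nonneg.2 hxy)]
    rw [hxy']
    by_cases hd : ∀ z ∈ 𝒦, z ∉ Icc x y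
    · obtain ⟨s1, s2⟩ := h.same_gap hx hy hxy hd
      have hx' : x ∉ 𝒦 := fun hx' => hd x hx' ⟨le_rfl, hxy⟩
      have hy' : y ∉ 𝒦 := fun hy' => hd y hy' ⟨hxy, le_rfl⟩
      obtain ⟨-, -, g3, g4, g5, g6⟩ := h.gap hx hx'
      have g4' := h.lt_rightPt hy hy'
      rw [s2] at g4'
      rw [extDeriv, extDeriv, s1, s2]
      set α := leftPt 𝒦 x
      set β := rightPt 𝒦 x
      set ℓ := β - α with hℓ
      have hℓ0 : 0 < ℓ := by linarith
      have e := abs_gapDeriv_sub_le (two_le_degree c C) g5 g6 (t := (x - α) / ℓ)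
        (s := (y - α) / ℓ) ⟨div_nonneg (by linarith) hℓ0.le, (div_le_one hℓ0).2 (by linarith)⟩
        ⟨div_nonneg (by linarith) hℓ0.le, (div_le_one hℓ0).2 (by linarith)⟩
      rw [← sub_div, sub_sub_sub_cancel_right, abs_div, hxy', abs_of_pos hℓ0] at e
      calc _ ≤ _ := e
        _ = L * (ℓ ^ θ * ((y - x) / ℓ)) := by rw [hL]; ring
        _ ≤ L * (y - x) ^ θ := by
          gcongr
          exact rpow_mul_div_le h.θ_le hℓ0 (by linarith) (by linarith)
        _ ≤ _ := by
          have : 0 ≤ (y - x) ^ θ := Real.rpow_nonneg (by linarith) _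
          gcongr
          linarith
    · push Not at hd
      obtain ⟨z, hz, hz'⟩ := hd
      have e1 := (h.right_estimate hx).2
      have e2 := (h.left_estimate hy).2
      obtain ⟨⟨p1, p2⟩, p3⟩ := h.isGreatest_leftPt hy
      obtain ⟨⟨q1, q2⟩, q3⟩ := h.isLeast_rightPt hx
      have p4 := p3 ⟨hz, hz'.2⟩
      have q4 := q3 ⟨hz, hz'.1⟩
      rw [mem_Iic] at p2
      rw [mem_Ici] at q2
      have e3 := h.abs_deriv_sub_le q1 p1
      rw [abs_of_nonneg (by linarith : 0 ≤ leftPt 𝒦 y - rightPt 𝒦 x)] at e3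
      have f1 : L * (rightPt 𝒦 x - x) ^ θ ≤ L * (y - x) ^ θ := by
        gcongr; linarith
      have f2 : L * (y - leftPt 𝒦 y) ^ θ ≤ L * (y - x) ^ θ := by
        gcongr; linarith
      have f3 : 2 * M * (leftPt 𝒦 y - rightPt 𝒦 x) ^ θ ≤ 2 * M * (y - x) ^ θ := by
        gcongr; linarith
      rw [abs_sub_comm] at e2
      rw [abs_le] at e1 e2 e3 ⊢
      constructor <;> linarith [e1.1, e1.2, e2.1, e2.2, e3.1, e3.2]
  refine ⟨2 * L + 2 * M, fun x hx y hy => ?_⟩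
  rcases le_total x y with hxy | hxy
  · exact key x hx y hy hxy
  · rw [abs_sub_comm, abs_sub_comm x]
    exact key y hy x hx hxy

end IncreasingJet

section Slopes

variable {𝒦 : Set ℝ} {a b : ℝ} {ψ : ℝ → ℝ} {θ : ℝ}

/-- Two-sided bounds and Hölder continuity of the difference quotients of `ψ` on `𝒦`, at the scale
`δ` and for the base points in `s`. -/
def SlopesBoundedBy (𝒦 : Set ℝ) (ψ : ℝ → ℝ) (θ : ℝ) (s : Set ℝ) (δ c C M : ℝ) : Prop :=
  ∀ r₁ ∈ s ∩ 𝒦, ∀ r₂ ∈ 𝒦, r₁ ≠ r₂ → |r₂ - r₁| < δ →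
    slope ψ r₁ r₂ ∈ Icc c C ∧ ∀ r₃ ∈ 𝒦, r₁ ≠ r₃ → |r₃ - r₁| < δ →
      |slope ψ r₁ r₂ - slope ψ r₁ r₃| ≤ M * max |r₂ - r₁| |r₃ - r₁| ^ θ

theorem SlopesBoundedBy.mono {s s' : Set ℝ} {δ δ' c c' C C' M M' : ℝ}
    (h : SlopesBoundedBy 𝒦 ψ θ s δ c C M) (hs : s' ⊆ s) (hδ : δ' ≤ δ) (hc : c' ≤ c) (hC : C ≤ C')
    (hM : M ≤ M') : SlopesBoundedBy 𝒦 ψ θ s' δ' c' C' M' := by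
  intro r₁ h₁ r₂ h₂ hne hd
  obtain ⟨e1, e2⟩ := h r₁ ⟨hs h₁.1, h₁.2⟩ r₂ h₂ hne (hd.trans_le hδ)
  refine ⟨⟨hc.trans e1.1, e1.2.trans hC⟩, fun r₃ h₃ hne' hd' => ?_⟩
  refine (e2 r₃ h₃ hne' (hd'.trans_le hδ)).trans ?_
  gcongr

/-- The comparison of the difference quotients near a point bounds them. -/
theorem exists_slopesBoundedBy_nhds (hθ : 0 < θ) (hsub : 𝒦 ⊆ Icc a b)
    (hcont : ContinuousOn ψ (Icc a b)) (hmono : StrictMonoOn ψ (Icc a b)) {r₀ : ℝ} (hr₀ : r₀ ∈ 𝒦)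
    {δ M : ℝ} (hδ : 0 < δ) (hM : 0 ≤ M)
    (h : ∀ r₁ ∈ 𝒦, ∀ r₂ ∈ 𝒦, ∀ r₃ ∈ 𝒦, |r₁ - r₀| < δ → |r₂ - r₀| < δ → |r₃ - r₀| < δ →
      r₁ ≠ r₂ → r₁ ≠ r₃ →
      |slope ψ r₁ r₂ / slope ψ r₁ r₃ - 1| ≤ M * max |ψ r₂ - ψ r₁| |ψ r₃ - ψ r₁| ^ θ) :
    ∃ s ∈ 𝓝 r₀, ∃ δ' > 0, ∃ c > 0, ∃ C M' : ℝ, 0 ≤ M' ∧ SlopesBoundedBy 𝒦 ψ θ s δ' c C M' := by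
  have hpos : ∀ r₁ ∈ 𝒦, ∀ r₂ ∈ 𝒦, r₁ ≠ r₂ → 0 < slope ψ r₁ r₂ := by
    intro r₁ h₁ r₂ h₂ hne
    rw [slope_def_field]
    rcases lt_or_gt_of_ne hne with hlt | hlt
    · exact div_pos (sub_pos.2 (hmono (hsub h₁) (hsub h₂) hlt)) (sub_pos.2 hlt)
    · exact div_pos_of_neg_of_neg (sub_neg.2 (hmono (hsub h₂) (hsub h₁) hlt)) (sub_neg.2 hlt)
  -- near `r₀` the ratios of the difference quotients are in `[1/2, 3/2]`
  set e : ℝ := (1 / (2 * (M + 1))) ^ (1 / θ) with he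
  have he0 : 0 < e := by positivity
  have heθ : M * e ^ θ ≤ 1 / 2 := by
    rw [he, ← Real.rpow_mul (by positivity), one_div_mul_cancel hθ.ne', Real.rpow_one,
      mul_one_div, div_le_div_iff₀ (by positivity) (by positivity)]
    linarith
  obtain ⟨δ₂, hδ₂, hc⟩ := Metric.continuousWithinAt_iff.1 (hcont r₀ (hsub hr₀)) (e / 2)
    (by positivity)
  set η := min δ δ₂ with hη
  have hη0 : 0 < η := lt_min hδ hδ₂
  have hψ : ∀ r₁ ∈ 𝒦, ∀ r₂ ∈ 𝒦, |r₁ - r₀| < η → |r₂ - r₀| < η → |ψ r₂ - ψ r₁| ≤ e := by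
    intro r₁ h₁ r₂ h₂ d₁ d₂
    have g1 := hc (hsub h₁) (by rw [Real.dist_eq]; exact d₁.trans_le (min_le_right _ _))
    have g2 := hc (hsub h₂) (by rw [Real.dist_eq]; exact d₂.trans_le (min_le_right _ _))
    rw [← Real.dist_eq]
    linarith [dist_triangle_right (ψ r₂) (ψ r₁) (ψ r₀)]
  have h' : ∀ r₁ ∈ 𝒦, ∀ r₂ ∈ 𝒦, ∀ r₃ ∈ 𝒦, |r₁ - r₀| < η → |r₂ - r₀| < η → |r₃ - r₀| < η →
      r₁ ≠ r₂ → r₁ ≠ r₃ → |slope ψ r₁ r₂ - slope ψ r₁ r₃| ≤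
        M * max |ψ r₂ - ψ r₁| |ψ r₃ - ψ r₁| ^ θ * slope ψ r₁ r₃ ∧
        |slope ψ r₁ r₂ - slope ψ r₁ r₃| ≤ 1 / 2 * slope ψ r₁ r₃ := by
    intro r₁ h₁ r₂ h₂ r₃ h₃ d₁ d₂ d₃ h12 h13
    have g := h r₁ h₁ r₂ h₂ r₃ h₃ (d₁.trans_le (min_le_left _ _)) (d₂.trans_le (min_le_left _ _))
      (d₃.trans_le (min_le_left _ _)) h12 h13
    have p3 := hpos r₁ h₁ r₃ h₃ h13
    have e1 : |slope ψ r₁ r₂ - slope ψ r₁ r₃| =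
        |slope ψ r₁ r₂ / slope ψ r₁ r₃ - 1| * slope ψ r₁ r₃ := by
      rw [← abs_of_pos p3, ← abs_mul, abs_of_pos p3, sub_mul, div_mul_cancel₀ _ p3.ne', one_mul]
    rw [e1]
    have e2 : M * max |ψ r₂ - ψ r₁| |ψ r₃ - ψ r₁| ^ θ ≤ 1 / 2 := by
      refine le_trans ?_ heθ
      gcongr
      exact max_le (hψ r₁ h₁ r₂ h₂ d₁ d₂) (hψ r₁ h₁ r₃ h₃ d₁ d₃)
    exact ⟨by gcongr, by gcongr; exact g.trans e2⟩
  have hloc : ∀ r₁ ∈ ball r₀ (η / 2), ∀ r₂, |r₂ - r₁| < η / 2 → |r₁ - r₀| < η ∧ |r₂ - r₀| < η := by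
    intro r₁ h₁ r₂ h₂
    rw [mem_ball, Real.dist_eq] at h₁
    have := abs_add_le (r₂ - r₁) (r₁ - r₀)
    rw [sub_add_sub_cancel] at this
    exact ⟨by linarith, by linarith⟩
  refine ⟨ball r₀ (η / 2), ball_mem_nhds _ (by positivity), η / 2, by positivity, ?_⟩
  by_cases hpair : ∃ s ∈ 𝒦, ∃ t ∈ 𝒦, |s - r₀| < η ∧ |t - r₀| < η ∧ s ≠ t
  swap
  · refine ⟨1, one_pos, 0, 0, le_rfl, fun r₁ h₁ r₂ h₂ hne hd => absurd ?_ hpair⟩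
    obtain ⟨d₁, d₂⟩ := hloc r₁ h₁.1 r₂ hd
    exact ⟨r₁, h₁.2, r₂, h₂, d₁, d₂, hne⟩
  obtain ⟨s, hs, t, ht, ds, dt, hst⟩ := hpair
  set σ := slope ψ s t with hσ
  have hσ0 : 0 < σ := hpos s hs t ht hst
  have hbd : ∀ r₁ ∈ 𝒦, ∀ r₂ ∈ 𝒦, |r₁ - r₀| < η → |r₂ - r₀| < η → r₁ ≠ r₂ →
      slope ψ r₁ r₂ ∈ Icc (σ / 4) (9 * σ / 4) := by
    intro r₁ h₁ r₂ h₂ d₁ d₂ hne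
    have key : ∀ z ∈ 𝒦, ∀ z' ∈ 𝒦, |z - r₀| < η → |z' - r₀| < η → z ≠ z' → r₁ ≠ z →
        slope ψ z z' = σ → slope ψ r₁ r₂ ∈ Icc (σ / 4) (9 * σ / 4) := by
      intro z hz z' hz' dz dz' hzz hrz he
      have g1 := (h' r₁ h₁ r₂ h₂ z hz d₁ d₂ dz hne hrz).2
      have g2 := (h' z hz r₁ h₁ z' hz' dz d₁ dz' hrz.symm hzz).2
      rw [slope_comm ψ z r₁, he] at g2
      rw [abs_le] at g1 g2
      constructor <;> linarith [g1.1, g1.2, g2.1, g2.2]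
    by_cases hrs : r₁ = s
    · exact key t ht s hs dt ds hst.symm (hrs ▸ hst) (by rw [slope_comm])
    · exact key s hs t ht ds dt hst hrs rfl
  refine ⟨σ / 4, by positivity, 9 * σ / 4, M * (9 * σ / 4) ^ θ * (9 * σ / 4), by positivity,
    fun r₁ h₁ r₂ h₂ hne hd => ?_⟩
  obtain ⟨d₁, d₂⟩ := hloc r₁ h₁.1 r₂ hd
  refine ⟨hbd r₁ h₁.2 r₂ h₂ d₁ d₂ hne, fun r₃ h₃ hne' hd' => ?_⟩
  obtain ⟨-, d₃⟩ := hloc r₁ h₁.1 r₃ hd'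
  have hlip : ∀ r ∈ 𝒦, |r - r₀| < η → r₁ ≠ r → |ψ r - ψ r₁| ≤ 9 * σ / 4 * |r - r₁| := by
    intro r hr dr hne
    have g := hbd r₁ h₁.2 r hr d₁ dr hne
    have e1 : ψ r - ψ r₁ = slope ψ r₁ r * (r - r₁) := by
      rw [slope_def_field, div_mul_cancel₀ _ (sub_ne_zero.2 hne.symm)]
    rw [e1, abs_mul, abs_of_pos (hpos r₁ h₁.2 r hr hne)]
    gcongr
    exact g.2
  refine (h' r₁ h₁.2 r₂ h₂ r₃ h₃ d₁ d₂ d₃ hne hne').1.trans ?_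
  have hmax : max |ψ r₂ - ψ r₁| |ψ r₃ - ψ r₁| ≤ 9 * σ / 4 * max |r₂ - r₁| |r₃ - r₁| := by
    refine max_le ((hlip r₂ h₂ d₂ hne).trans ?_) ((hlip r₃ h₃ d₃ hne').trans ?_)
    · gcongr; exact le_max_left _ _
    · gcongr; exact le_max_right _ _
  have hm0 : 0 ≤ max |r₂ - r₁| |r₃ - r₁| := le_max_of_le_left (abs_nonneg _)
  have hm1 : 0 ≤ max |ψ r₂ - ψ r₁| |ψ r₃ - ψ r₁| := le_max_of_le_left (abs_nonneg _)
  calc M * max |ψ r₂ - ψ r₁| |ψ r₃ - ψ r₁| ^ θ * slope ψ r₁ r₃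
      ≤ M * (9 * σ / 4 * max |r₂ - r₁| |r₃ - r₁|) ^ θ * (9 * σ / 4) := by
        gcongr
        · exact (hpos r₁ h₁.2 r₃ h₃ hne').le
        · exact (hbd r₁ h₁.2 r₃ h₃ d₁ d₃ hne').2
    _ = _ := by rw [Real.mul_rpow (by positivity) hm0]; ring

/-- Difference quotients which are locally comparable are bounded and Hölder continuous. -/
theorem exists_slopesBoundedBy (hθ : 0 < θ) (hK : IsCompact 𝒦) (hsub : 𝒦 ⊆ Icc a b)
    (hcont : ContinuousOn ψ (Icc a b)) (hmono : StrictMonoOn ψ (Icc a b))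
    (h : ∀ r₀ ∈ 𝒦, ∃ δ > 0, ∃ M ≥ 0, ∀ r₁ ∈ 𝒦, ∀ r₂ ∈ 𝒦, ∀ r₃ ∈ 𝒦,
      |r₁ - r₀| < δ → |r₂ - r₀| < δ → |r₃ - r₀| < δ → r₁ ≠ r₂ → r₁ ≠ r₃ →
      |slope ψ r₁ r₂ / slope ψ r₁ r₃ - 1| ≤ M * max |ψ r₂ - ψ r₁| |ψ r₃ - ψ r₁| ^ θ) :
    ∃ c > 0, ∃ C M : ℝ, 0 ≤ M ∧ ∀ r₁ ∈ 𝒦, ∀ r₂ ∈ 𝒦, r₁ ≠ r₂ →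
      slope ψ r₁ r₂ ∈ Icc c C ∧ ∀ r₃ ∈ 𝒦, r₁ ≠ r₃ →
        |slope ψ r₁ r₂ - slope ψ r₁ r₃| ≤ M * max |r₂ - r₁| |r₃ - r₁| ^ θ := by
  obtain ⟨δ, hδ, c, hc, C, M, hM, hloc⟩ : ∃ δ > 0, ∃ c > 0, ∃ C M : ℝ, 0 ≤ M ∧
      SlopesBoundedBy 𝒦 ψ θ 𝒦 δ c C M := by
    refine hK.induction_on (p := fun s => ∃ δ > 0, ∃ c > 0, ∃ C M : ℝ, 0 ≤ M ∧
      SlopesBoundedBy 𝒦 ψ θ s δ c C M) ?_ ?_ ?_ ?_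
    · exact ⟨1, one_pos, 1, one_pos, 0, 0, le_rfl, fun r₁ h₁ => absurd h₁.1 (notMem_empty _)⟩
    · rintro s t hst ⟨δ, hδ, c, hc, C, M, hM, h⟩
      exact ⟨δ, hδ, c, hc, C, M, hM, h.mono hst le_rfl le_rfl le_rfl le_rfl⟩
    · rintro s t ⟨δ, hδ, c, hc, C, M, hM, h⟩ ⟨δ', hδ', c', hc', C', M', hM', h'⟩
      refine ⟨min δ δ', by positivity, min c c', by positivity, max C C', max M M',
        le_max_of_le_left hM, ?_⟩
      rintro r₁ ⟨h₁ | h₁, h₁'⟩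
      · exact h.mono subset_rfl (min_le_left _ _) (min_le_left _ _) (le_max_left _ _)
          (le_max_left _ _) r₁ ⟨h₁, h₁'⟩
      · exact h'.mono subset_rfl (min_le_right _ _) (min_le_right _ _) (le_max_right _ _)
          (le_max_right _ _) r₁ ⟨h₁, h₁'⟩
    · intro r₀ hr₀
      obtain ⟨δ, hδ, M, hM, h₀⟩ := h r₀ hr₀
      obtain ⟨s, hs, H⟩ := exists_slopesBoundedBy_nhds hθ hsub hcont hmono hr₀ hδ hM h₀
      exact ⟨s, mem_nhdsWithin_of_mem_nhds hs, H⟩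
  -- the lower bound for the difference quotients at a large scale
  obtain ⟨m, hm, hmle⟩ : ∃ m > 0, ∀ r₁ ∈ 𝒦, ∀ r₂ ∈ 𝒦, δ ≤ |r₂ - r₁| → m ≤ |ψ r₂ - ψ r₁| := by
    have hcomp : IsCompact ((𝒦 ×ˢ 𝒦) ∩ {p : ℝ × ℝ | δ ≤ |p.2 - p.1|}) :=
      (hK.prod hK).inter_right (isClosed_le continuous_const (by fun_prop))
    have hcψ : ContinuousOn (fun p : ℝ × ℝ => |ψ p.2 - ψ p.1|)
        ((𝒦 ×ˢ 𝒦) ∩ {p : ℝ × ℝ | δ ≤ |p.2 - p.1|}) := by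
      have h0 := hcont.mono hsub
      refine ContinuousOn.abs (ContinuousOn.sub ?_ ?_)
      · exact h0.comp continuousOn_snd fun p hp => hp.1.2
      · exact h0.comp continuousOn_fst fun p hp => hp.1.1
    obtain ⟨m, hm, hmle⟩ := hcomp.exists_forall_le' hcψ (a := 0) (by
      rintro ⟨r₁, r₂⟩ ⟨⟨h₁, h₂⟩, hd⟩
      refine abs_pos.2 (sub_ne_zero.2 fun he => ?_)
      have := hmono.injOn (hsub h₂) (hsub h₁) he
      simp only [mem_ofPred_eq] at hd
      rw [show r₂ = r₁ from this, sub_self, abs_zero] at hd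
      linarith)
    exact ⟨m, hm, fun r₁ h₁ r₂ h₂ hd => hmle (r₁, r₂) ⟨⟨h₁, h₂⟩, hd⟩⟩
  rcases 𝒦.eq_empty_or_nonempty with rfl | ⟨x₀, hx₀⟩
  · exact ⟨1, one_pos, 0, 0, le_rfl, fun r₁ h₁ => absurd h₁ (notMem_empty _)⟩
  have hab : a ≤ b := (hsub hx₀).1.trans (hsub hx₀).2
  have hψab : ∀ r ∈ 𝒦, ψ r ∈ Icc (ψ a) (ψ b) := fun r hr =>
    ⟨hmono.monotoneOn (left_mem_Icc.2 hab) (hsub hr) (hsub hr).1,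
      hmono.monotoneOn (hsub hr) (right_mem_Icc.2 hab) (hsub hr).2⟩
  have hnn : ∀ r₁ ∈ 𝒦, ∀ r₂ ∈ 𝒦, slope ψ r₁ r₂ = |ψ r₂ - ψ r₁| / |r₂ - r₁| := by
    intro r₁ h₁ r₂ h₂
    rw [slope_def_field, ← abs_div, abs_of_nonneg]
    rcases le_total r₁ r₂ with hlt | hlt
    · exact div_nonneg (sub_nonneg.2 (hmono.monotoneOn (hsub h₁) (hsub h₂) hlt)) (sub_nonneg.2 hlt)
    · exact div_nonneg_of_nonpos (sub_nonpos.2 (hmono.monotoneOn (hsub h₂) (hsub h₁) hlt))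
        (sub_nonpos.2 hlt)
  set C' := max C ((ψ b - ψ a) / δ) with hC'
  have hC'0 : 0 ≤ C' := le_max_of_le_right (div_nonneg (by linarith [(hψab x₀ hx₀).1,
    (hψab x₀ hx₀).2]) hδ.le)
  set c' := min c (m / (b - a + 1)) with hc'
  have hc'0 : 0 < c' := lt_min hc (div_pos hm (by linarith))
  have hbd : ∀ r₁ ∈ 𝒦, ∀ r₂ ∈ 𝒦, r₁ ≠ r₂ → slope ψ r₁ r₂ ∈ Icc c' C' := by
    intro r₁ h₁ r₂ h₂ hne
    rcases lt_or_ge |r₂ - r₁| δ with hd | hd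
    · obtain ⟨e1, e2⟩ := (hloc r₁ ⟨h₁, h₁⟩ r₂ h₂ hne hd).1
      exact ⟨(min_le_left _ _).trans e1, e2.trans (le_max_left _ _)⟩
    · rw [hnn r₁ h₁ r₂ h₂]
      have e1 : |r₂ - r₁| ≤ b - a + 1 := by
        rw [abs_le]; constructor <;> linarith [(hsub h₁).1, (hsub h₁).2, (hsub h₂).1, (hsub h₂).2]
      have e2 : |ψ r₂ - ψ r₁| ≤ ψ b - ψ a := by
        rw [abs_le]
        constructor <;> linarith [(hψab _ h₁).1, (hψab _ h₁).2, (hψab _ h₂).1, (hψab _ h₂).2]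
      constructor
      · refine (min_le_right _ _).trans ?_
        have := hmle r₁ h₁ r₂ h₂ hd
        gcongr
      · refine le_trans ?_ (le_max_right _ _)
        gcongr
        exact (abs_nonneg _).trans e2
  refine ⟨c', hc'0, C', M + C' / δ ^ θ, by positivity, fun r₁ h₁ r₂ h₂ hne =>
    ⟨hbd r₁ h₁ r₂ h₂ hne, fun r₃ h₃ hne' => ?_⟩⟩
  have hm0 : 0 ≤ max |r₂ - r₁| |r₃ - r₁| := le_max_of_le_left (abs_nonneg _)
  rcases lt_or_ge (max |r₂ - r₁| |r₃ - r₁|) δ with hd | hd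
  · rw [max_lt_iff] at hd
    refine ((hloc r₁ ⟨h₁, h₁⟩ r₂ h₂ hne hd.1).2 r₃ h₃ hne' hd.2).trans ?_
    gcongr
    linarith [show 0 ≤ C' / δ ^ θ by positivity]
  · obtain ⟨u1, u2⟩ := hbd r₁ h₁ r₂ h₂ hne
    obtain ⟨v1, v2⟩ := hbd r₁ h₁ r₃ h₃ hne'
    calc |slope ψ r₁ r₂ - slope ψ r₁ r₃| ≤ C' := by
          rw [abs_le]; constructor <;> linarith
      _ = C' / δ ^ θ * δ ^ θ := (div_mul_cancel₀ _ (by positivity)).symm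
      _ ≤ C' / δ ^ θ * max |r₂ - r₁| |r₃ - r₁| ^ θ := by gcongr
      _ ≤ _ := by
        gcongr
        linarith

/-- An increasing function whose difference quotients on a compact set are bounded and Hölder
continuous has a jet of order one there. -/
theorem exists_increasingJet (hab : a < b) (hθ : 0 < θ) (hθ1 : θ ≤ 1) (hK : IsCompact 𝒦)
    (hsub : 𝒦 ⊆ Icc a b) (ha : a ∈ 𝒦) (hb : b ∈ 𝒦) {c C M : ℝ} (hc : 0 < c) (hM : 0 ≤ M)
    (h : ∀ r₁ ∈ 𝒦, ∀ r₂ ∈ 𝒦, r₁ ≠ r₂ → slope ψ r₁ r₂ ∈ Icc c C ∧ ∀ r₃ ∈ 𝒦, r₁ ≠ r₃ →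
        |slope ψ r₁ r₂ - slope ψ r₁ r₃| ≤ M * max |r₂ - r₁| |r₃ - r₁| ^ θ) :
    ∃ d, IncreasingJet 𝒦 a b ψ d c C M θ := by
  have hd : ∀ r ∈ 𝒦, ∃ d ∈ Icc c C, ∀ s ∈ 𝒦, r ≠ s → |slope ψ r s - d| ≤ M * |s - r| ^ θ := by
    intro r hr
    set f : ℝ → ℝ := fun s => max (slope ψ r s - M * |s - r| ^ θ) c with hf
    obtain ⟨s₀, hs₀, hne₀⟩ : ∃ s ∈ 𝒦, r ≠ s := by
      by_cases hra : r = a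
      · exact ⟨b, hb, by rw [hra]; exact hab.ne⟩
      · exact ⟨a, ha, hra⟩
    have hle : ∀ s ∈ 𝒦, r ≠ s → ∀ t ∈ 𝒦, r ≠ t → f s ≤ slope ψ r t + M * |t - r| ^ θ := by
      intro s hs hrs t ht hrt
      have g1 := (h r hr t ht hrt).1.1
      have g2 := (h r hr s hs hrs).2 t ht hrt
      have g0 : 0 ≤ |t - r| ^ θ := by positivity
      have g0' : 0 ≤ |s - r| ^ θ := by positivity
      have g3 : max |s - r| |t - r| ^ θ ≤ |s - r| ^ θ + |t - r| ^ θ := by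
        rcases max_choice |s - r| |t - r| with e | e <;> rw [e] <;> linarith
      have g4 := mul_le_mul_of_nonneg_left g3 hM
      rw [abs_le] at g2
      refine max_le (by linarith [g2.2]) ?_
      have := mul_nonneg hM g0
      linarith
    set I := f '' {s | s ∈ 𝒦 ∧ r ≠ s} with hI
    have hne : I.Nonempty := ⟨_, s₀, ⟨hs₀, hne₀⟩, rfl⟩
    have hbdd : BddAbove I := ⟨_, by
      rintro _ ⟨s, ⟨hs, hrs⟩, rfl⟩
      exact hle s hs hrs s₀ hs₀ hne₀⟩
    refine ⟨sSup I, ⟨(le_max_right _ _).trans (le_csSup hbdd ⟨s₀, ⟨hs₀, hne₀⟩, rfl⟩),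
      csSup_le hne ?_⟩, fun s hs hrs => ?_⟩
    · rintro _ ⟨s, ⟨hs, hrs⟩, rfl⟩
      obtain ⟨g1, g2⟩ := (h r hr s hs hrs).1
      have : 0 ≤ M * |s - r| ^ θ := by positivity
      exact max_le (by linarith) (g1.trans g2)
    · have g1 : f s ≤ sSup I := le_csSup hbdd ⟨s, ⟨hs, hrs⟩, rfl⟩
      have g2 : sSup I ≤ slope ψ r s + M * |s - r| ^ θ := by
        refine csSup_le hne ?_
        rintro _ ⟨t, ⟨ht, hrt⟩, rfl⟩
        exact hle t ht hrt s hs hrs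
      have g3 := (le_max_left _ _).trans g1
      rw [abs_le]
      constructor <;> linarith
  choose! d hdm hdj using hd
  refine ⟨d, hK, ha, hb, hsub, hc, hθ, hθ1, hM, fun r hr s hs => ?_, hdm,
    fun r hr s hs hlt => (h r hr s hs hlt.ne).1.1⟩
  rcases eq_or_ne r s with rfl | hne
  · simp
  have e : ψ s - ψ r - d r * (s - r) = (slope ψ r s - d r) * (s - r) := by
    rw [slope_def_field, sub_mul, div_mul_cancel₀ _ (sub_ne_zero.2 hne.symm)]
  rw [e, abs_mul]
  gcongr
  exact hdj r hr s hs hne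

/-- The comparison of difference quotients on `𝒦` is kept when endpoints are added to `𝒦`. -/
theorem exists_comparison_insert (hK : IsCompact 𝒦) {s : Set ℝ} (hs : s.Finite)
    (h : ∀ r₀ ∈ 𝒦, ∃ δ > 0, ∃ M ≥ 0, ∀ r₁ ∈ 𝒦, ∀ r₂ ∈ 𝒦, ∀ r₃ ∈ 𝒦,
      |r₁ - r₀| < δ → |r₂ - r₀| < δ → |r₃ - r₀| < δ → r₁ ≠ r₂ → r₁ ≠ r₃ →
      |slope ψ r₁ r₂ / slope ψ r₁ r₃ - 1| ≤ M * max |ψ r₂ - ψ r₁| |ψ r₃ - ψ r₁| ^ θ) :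
    ∀ r₀ ∈ 𝒦 ∪ s, ∃ δ > 0, ∃ M ≥ 0, ∀ r₁ ∈ 𝒦 ∪ s, ∀ r₂ ∈ 𝒦 ∪ s, ∀ r₃ ∈ 𝒦 ∪ s,
      |r₁ - r₀| < δ → |r₂ - r₀| < δ → |r₃ - r₀| < δ → r₁ ≠ r₂ → r₁ ≠ r₃ →
      |slope ψ r₁ r₂ / slope ψ r₁ r₃ - 1| ≤ M * max |ψ r₂ - ψ r₁| |ψ r₃ - ψ r₁| ^ θ := by
  intro r₀ hr₀
  have hfin : (s \ {r₀}).Finite := hs.subset sdiff_subset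
  have h1 : (s \ {r₀})ᶜ ∈ 𝓝 r₀ := hfin.isClosed.isOpen_compl.mem_nhds (by simp)
  by_cases hr : r₀ ∈ 𝒦
  · obtain ⟨δ, hδ, M, hM, h₀⟩ := h r₀ hr
    obtain ⟨e, he, hball⟩ := Metric.mem_nhds_iff.1 h1
    have hin : ∀ r ∈ 𝒦 ∪ s, |r - r₀| < min δ e → r ∈ 𝒦 := by
      rintro r (hr' | hr') hd
      · exact hr'
      · have := hball (show r ∈ ball r₀ e from hd.trans_le (min_le_right _ _))
        simp only [mem_compl_iff, Set.mem_sdiff, mem_singleton_iff, not_and, not_not] at this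
        rw [this hr']; exact hr
    exact ⟨min δ e, by positivity, M, hM, fun r₁ h₁ r₂ h₂ r₃ h₃ d₁ d₂ d₃ =>
      h₀ r₁ (hin r₁ h₁ d₁) r₂ (hin r₂ h₂ d₂) r₃ (hin r₃ h₃ d₃) (d₁.trans_le (min_le_left _ _))
        (d₂.trans_le (min_le_left _ _)) (d₃.trans_le (min_le_left _ _))⟩
  · have h2 : 𝒦ᶜ ∈ 𝓝 r₀ := hK.isClosed.isOpen_compl.mem_nhds hr
    obtain ⟨e, he, hball⟩ := Metric.mem_nhds_iff.1 (inter_mem h1 h2)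
    have hin : ∀ r ∈ 𝒦 ∪ s, |r - r₀| < e → r = r₀ := by
      rintro r (hr' | hr') hd
      · exact absurd hr' (hball (show r ∈ ball r₀ e from hd)).2
      · have := (hball (show r ∈ ball r₀ e from hd)).1
        simp only [mem_compl_iff, Set.mem_sdiff, mem_singleton_iff, not_and, not_not] at this
        exact this hr'
    exact ⟨e, he, 0, le_rfl, fun r₁ h₁ r₂ h₂ r₃ h₃ d₁ d₂ d₃ hne =>
      absurd ((hin r₁ h₁ d₁).trans (hin r₂ h₂ d₂).symm) hne⟩

/-- An increasing function, whose difference quotients on a compact set `𝒦` are locally comparable,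
agrees on `𝒦` with a diffeomorphism of class `C^{1+θ}` which has the same image. -/
theorem exists_increasing_extension (hab : a < b) (hθ : 0 < θ) (hθ1 : θ ≤ 1) (hK : IsCompact 𝒦)
    (hsub : 𝒦 ⊆ Icc a b) (hcont : ContinuousOn ψ (Icc a b)) (hmono : StrictMonoOn ψ (Icc a b))
    (h : ∀ r₀ ∈ 𝒦, ∃ δ > 0, ∃ M ≥ 0, ∀ r₁ ∈ 𝒦, ∀ r₂ ∈ 𝒦, ∀ r₃ ∈ 𝒦,
      |r₁ - r₀| < δ → |r₂ - r₀| < δ → |r₃ - r₀| < δ → r₁ ≠ r₂ → r₁ ≠ r₃ →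
      |slope ψ r₁ r₂ / slope ψ r₁ r₃ - 1| ≤ M * max |ψ r₂ - ψ r₁| |ψ r₃ - ψ r₁| ^ θ) :
    ∃ Ψ Ψ' : ℝ → ℝ, (∀ r ∈ 𝒦, Ψ r = ψ r) ∧ MapsTo Ψ (Icc a b) (Icc (ψ a) (ψ b)) ∧
      (∀ r ∈ Icc a b, HasDerivWithinAt Ψ (Ψ' r) (Icc a b) r) ∧ (∀ r ∈ Icc a b, 0 < Ψ' r) ∧
      ∃ L : ℝ, ∀ r ∈ Icc a b, ∀ s ∈ Icc a b, |Ψ' r - Ψ' s| ≤ L * |r - s| ^ θ := by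
  have hfin : ({a, b} : Set ℝ).Finite := toFinite _
  have hK' : IsCompact (𝒦 ∪ {a, b}) := hK.union hfin.isCompact
  have hsub' : 𝒦 ∪ {a, b} ⊆ Icc a b :=
    union_subset hsub (by rintro _ (rfl | rfl) <;> simp [hab.le])
  obtain ⟨c, hc, C, M, hM, hslope⟩ := exists_slopesBoundedBy hθ hK' hsub' hcont hmono
    (exists_comparison_insert hK hfin h)
  obtain ⟨d, hj⟩ := exists_increasingJet hab hθ hθ1 hK' hsub' (by simp) (by simp) hc hM hslope
  have hder := fun x (hx : x ∈ Icc a b) => hj.hasDerivWithinAt_ext hx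
  have hincr : MonotoneOn (IncreasingJet.ext (𝒦 ∪ {a, b}) ψ d (IncreasingJet.degree c C))
      (Icc a b) := by
    refine monotoneOn_of_hasDerivWithinAt_nonneg (convex_Icc a b)
      (fun x hx => (hder x hx).continuousWithinAt)
      (fun x hx => (hder x (interior_subset hx)).mono interior_subset)
      (fun x hx => (hj.extDeriv_pos (interior_subset hx)).le)
  refine ⟨_, _, fun r hr => hj.ext_eq (Or.inl hr) _, fun r hr => ⟨?_, ?_⟩, hder,
    fun r hr => hj.extDeriv_pos hr, hj.exists_extDeriv_holder⟩
  · rw [← hj.ext_eq (x := a) (by simp) (IncreasingJet.degree c C)]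
    exact hincr (left_mem_Icc.2 hab.le) hr hr.1
  · rw [← hj.ext_eq (x := b) (by simp) (IncreasingJet.degree c C)]
    exact hincr hr (right_mem_Icc.2 hab.le) hr.2

end Slopes

section Extension

variable {𝒦 : Set ℝ} {a b : ℝ} {ψ : ℝ → ℝ} {θ : ℝ}

/-- A continuous injective function, whose difference quotients on a compact set `𝒦` are locally
comparable, agrees on `𝒦` with a diffeomorphism of class `C^{1+θ}` with values in its image. -/
theorem exists_diffeo_extension (hab : a < b) (hθ : 0 < θ) (hθ1 : θ ≤ 1) (hK : IsCompact 𝒦)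
    (hsub : 𝒦 ⊆ Icc a b) (hcont : ContinuousOn ψ (Icc a b)) (hinj : InjOn ψ (Icc a b))
    (h : ∀ r₀ ∈ 𝒦, ∃ δ > 0, ∃ M ≥ 0, ∀ r₁ ∈ 𝒦, ∀ r₂ ∈ 𝒦, ∀ r₃ ∈ 𝒦,
      |r₁ - r₀| < δ → |r₂ - r₀| < δ → |r₃ - r₀| < δ → r₁ ≠ r₂ → r₁ ≠ r₃ →
      |slope ψ r₁ r₂ / slope ψ r₁ r₃ - 1| ≤ M * max |ψ r₂ - ψ r₁| |ψ r₃ - ψ r₁| ^ θ) :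
    ∃ Ψ Ψ' : ℝ → ℝ, EqOn Ψ ψ 𝒦 ∧ MapsTo Ψ (Icc a b) (ψ '' Icc a b) ∧ InjOn Ψ (Icc a b) ∧
      (∀ r ∈ Icc a b, HasDerivWithinAt Ψ (Ψ' r) (Icc a b) r) ∧ (∀ r ∈ Icc a b, Ψ' r ≠ 0) ∧
      ∃ L : ℝ, ∀ r ∈ Icc a b, ∀ s ∈ Icc a b, |Ψ' r - Ψ' s| ≤ L * |r - s| ^ θ := by
  have hincr : ∀ {χ : ℝ → ℝ}, ContinuousOn χ (Icc a b) → StrictMonoOn χ (Icc a b) →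
      (∀ r₀ ∈ 𝒦, ∃ δ > 0, ∃ M ≥ 0, ∀ r₁ ∈ 𝒦, ∀ r₂ ∈ 𝒦, ∀ r₃ ∈ 𝒦,
      |r₁ - r₀| < δ → |r₂ - r₀| < δ → |r₃ - r₀| < δ → r₁ ≠ r₂ → r₁ ≠ r₃ →
      |slope χ r₁ r₂ / slope χ r₁ r₃ - 1| ≤ M * max |χ r₂ - χ r₁| |χ r₃ - χ r₁| ^ θ) →
      ∃ Ψ Ψ' : ℝ → ℝ, EqOn Ψ χ 𝒦 ∧ MapsTo Ψ (Icc a b) (χ '' Icc a b) ∧ InjOn Ψ (Icc a b) ∧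
      (∀ r ∈ Icc a b, HasDerivWithinAt Ψ (Ψ' r) (Icc a b) r) ∧ (∀ r ∈ Icc a b, Ψ' r ≠ 0) ∧
      ∃ L : ℝ, ∀ r ∈ Icc a b, ∀ s ∈ Icc a b, |Ψ' r - Ψ' s| ≤ L * |r - s| ^ θ := by
    intro χ hχ hmono hc
    obtain ⟨Ψ, Ψ', h1, h2, h3, h4, h5⟩ :=
      exists_increasing_extension hab hθ hθ1 hK hsub hχ hmono hc
    have hm : StrictMonoOn Ψ (Icc a b) := strictMonoOn_of_hasDerivWithinAt_pos (convex_Icc a b)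
      (fun x hx => (h3 x hx).continuousWithinAt)
      (fun x hx => (h3 x (interior_subset hx)).mono interior_subset)
      (fun x hx => h4 x (interior_subset hx))
    exact ⟨Ψ, Ψ', h1, fun r hr => intermediate_value_Icc hab.le hχ (h2 hr), hm.injOn, h3,
      fun r hr => (h4 r hr).ne', h5⟩
  rcases hcont.strictMonoOn_of_injOn_Icc' hab.le hinj with hmono | hanti
  · exact hincr hcont hmono h
  · obtain ⟨Ψ, Ψ', h1, h2, h3, h4, h5, L, hL⟩ := hincr (χ := fun r => -ψ r) hcont.neg
      (fun x hx y hy hxy => neg_lt_neg (hanti hx hy hxy)) (by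
        have hs : ∀ r s, slope (fun r => -ψ r) r s = -slope ψ r s := fun r s => by
          simp only [slope_def_field]; ring
        have hd : ∀ r s, |-ψ r - -ψ s| = |ψ r - ψ s| := fun r s => by
          rw [← abs_neg]; congr 1; ring
        simpa only [hs, hd, neg_div_neg_eq] using h)
    refine ⟨fun r => -Ψ r, fun r => -Ψ' r, fun r hr => ?_, fun r hr => ?_, fun r hr s hs e => ?_,
      fun r hr => (h4 r hr).neg, fun r hr => neg_ne_zero.2 (h5 r hr), L, fun r hr s hs => ?_⟩
    · simp [h1 hr]
    · obtain ⟨s, hs, e⟩ := h2 hr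
      exact ⟨s, hs, by simp only [← e, neg_neg]⟩
    · exact h3 hr hs (neg_injective e)
    · rw [← abs_neg]
      convert hL r hr s hs using 2
      ring

end Extension

/-! ### Curves of class `C²` -/

section Curve

variable {E : Type*} [NormedAddCommGroup E] [NormedSpace ℝ E] {F : ℝ → E} {a b : ℝ}

/-- The estimates for a curve of class `C²` on a compact interval. -/
theorem exists_taylor_bound (hab : a < b) (hF : ContDiffOn ℝ 2 F (Icc a b)) : ∃ H ≥ 0,
    ∀ r ∈ Icc a b, ∀ s ∈ Icc a b, ‖F s - F r‖ ≤ H * |s - r| ∧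
      ‖F s - F r - (s - r) • derivWithin F (Icc a b) r‖ ≤ H * |s - r| * |s - r| ∧
      ‖derivWithin F (Icc a b) s - derivWithin F (Icc a b) r‖ ≤ H * |s - r| := by
  have hu := uniqueDiffOn_Icc hab
  set F' := derivWithin F (Icc a b) with hF'
  have h1 : ContDiffOn ℝ 1 F' (Icc a b) := hF.derivWithin hu (by norm_num)
  have hd0 : ∀ x ∈ Icc a b, HasDerivWithinAt F (F' x) (Icc a b) x := fun x hx =>
    (hF.differentiableOn (by norm_num) x hx).hasDerivWithinAt
  have hd1 : ∀ x ∈ Icc a b, HasDerivWithinAt F' (derivWithin F' (Icc a b) x) (Icc a b) x :=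
    fun x hx => (h1.differentiableOn (by norm_num) x hx).hasDerivWithinAt
  obtain ⟨H₁, hH₁⟩ := isCompact_Icc.exists_bound_of_continuousOn h1.continuousOn
  obtain ⟨H₂, hH₂⟩ := isCompact_Icc.exists_bound_of_continuousOn
    (h1.continuousOn_derivWithin hu le_rfl)
  have hH₁0 : 0 ≤ H₁ := (norm_nonneg _).trans (hH₁ a (left_mem_Icc.2 hab.le))
  have hH₂0 : 0 ≤ H₂ := (norm_nonneg _).trans (hH₂ a (left_mem_Icc.2 hab.le))
  have hlip : ∀ r ∈ Icc a b, ∀ s ∈ Icc a b, ‖F' s - F' r‖ ≤ H₂ * |s - r| := fun r hr s hs =>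
    (convex_Icc a b).norm_image_sub_le_of_norm_hasDerivWithin_le hd1 hH₂ hr hs
  refine ⟨H₁ + H₂, by positivity, fun r hr s hs => ⟨?_, ?_, ?_⟩⟩
  · refine ((convex_Icc a b).norm_image_sub_le_of_norm_hasDerivWithin_le hd0 hH₁ hr hs).trans ?_
    rw [Real.norm_eq_abs]
    gcongr
    linarith
  · have hsub : uIcc r s ⊆ Icc a b := ordConnected_Icc.uIcc_subset hr hs
    have h := (convex_uIcc r s).norm_image_sub_le_of_norm_hasDerivWithin_le
      (f := fun x => F x - x • F' r) (f' := fun x => F' x - (1 : ℝ) • F' r) (C := H₂ * |s - r|)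
      (fun x hx => (((hd0 x (hsub hx)).mono hsub).sub
        ((hasDerivWithinAt_id x _).smul_const (F' r))))
      (fun x hx => by
        rw [one_smul]
        refine (hlip r hr x (hsub hx)).trans ?_
        gcongr ?_ * ?_
        exact abs_sub_left_of_mem_uIcc hx) left_mem_uIcc right_mem_uIcc
    refine le_trans (le_of_eq ?_) (h.trans ?_)
    · congr 1; module
    · rw [Real.norm_eq_abs]
      gcongr
      linarith
  · refine (hlip r hr s hs).trans ?_
    gcongr
    linarith

/-- On a curve of class `C²`, three points are nearly collinear. -/
theorem norm_three_le {H : ℝ} {v : E} {x₁ x₂ x₃ : E} {c₂ c₃ : ℝ} (hc : c₃ ≠ 0)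
    (h₂ : ‖x₂ - x₁ - c₂ • v‖ ≤ H * |c₂| * |c₂|) (h₃ : ‖x₃ - x₁ - c₃ • v‖ ≤ H * |c₃| * |c₃|) :
    ‖x₂ - x₁ - (c₂ / c₃) • (x₃ - x₁)‖ ≤ H * |c₂| * (|c₂| + |c₃|) := by
  have e : x₂ - x₁ - (c₂ / c₃) • (x₃ - x₁) =
      (x₂ - x₁ - c₂ • v) - (c₂ / c₃) • (x₃ - x₁ - c₃ • v) := by
    rw [smul_sub (c₂ / c₃) (x₃ - x₁), smul_smul, div_mul_cancel₀ _ hc]; abel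
  have h0 : 0 < |c₃| := abs_pos.2 hc
  rw [e]
  refine (norm_sub_le _ _).trans ?_
  rw [norm_smul, Real.norm_eq_abs, abs_div]
  calc _ ≤ H * |c₂| * |c₂| + |c₂| / |c₃| * (H * |c₃| * |c₃|) := by gcongr
    _ = _ := by field_simp

/-- The strict derivative of a curve of class `C²`. -/
theorem exists_strict_bound (hab : a < b) (hF : ContDiffOn ℝ 2 F (Icc a b)) {r₀ : ℝ}
    (hr₀ : r₀ ∈ Icc a b) {e : ℝ} (he : 0 < e) : ∃ δ > 0, ∀ r ∈ Icc a b, ∀ s ∈ Icc a b,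
      |r - r₀| < δ → |s - r₀| < δ →
      ‖F s - F r - (s - r) • derivWithin F (Icc a b) r₀‖ ≤ e * |s - r| := by
  obtain ⟨H, hH, h⟩ := exists_taylor_bound hab hF
  refine ⟨e / (3 * (H + 1)), by positivity, fun r hr s hs dr ds => ?_⟩
  obtain ⟨-, h2, -⟩ := h r hr s hs
  obtain ⟨-, -, h3⟩ := h r₀ hr₀ r hr
  set v := derivWithin F (Icc a b)
  have e1 : F s - F r - (s - r) • v r₀ = (F s - F r - (s - r) • v r) + (s - r) • (v r - v r₀) := by
    module
  have e2 : |s - r| ≤ 2 * (e / (3 * (H + 1))) := by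
    have := abs_sub_le s r₀ r
    rw [abs_sub_comm r₀] at this
    linarith
  rw [e1]
  refine (norm_add_le _ _).trans ?_
  rw [norm_smul, Real.norm_eq_abs]
  calc _ ≤ H * |s - r| * (2 * (e / (3 * (H + 1)))) + |s - r| * (H * (e / (3 * (H + 1)))) := by
        gcongr
        · exact h2.trans (by gcongr)
        · exact h3.trans (by gcongr)
    _ = (H / (H + 1)) * (e * |s - r|) := by field_simp; ring
    _ ≤ 1 * (e * |s - r|) := by
        gcongr
        rw [div_le_one (by positivity)]; linarith
    _ = _ := one_mul _

/-- A regular curve is locally expanding at a definite rate. -/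
theorem exists_lower_bound (hab : a < b) (hF : ContDiffOn ℝ 2 F (Icc a b)) {r₀ : ℝ}
    (hr₀ : r₀ ∈ Icc a b) (hne : derivWithin F (Icc a b) r₀ ≠ 0) : ∃ δ > 0, ∃ H ≥ 0,
    ∀ r ∈ Icc a b, ∀ s ∈ Icc a b, |r - r₀| < δ → |s - r₀| < δ → |s - r| ≤ H * ‖F s - F r‖ := by
  have h0 : 0 < ‖derivWithin F (Icc a b) r₀‖ := norm_pos_iff.2 hne
  obtain ⟨δ, hδ, h⟩ := exists_strict_bound hab hF hr₀ (half_pos h0)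
  refine ⟨δ, hδ, 2 / ‖derivWithin F (Icc a b) r₀‖, by positivity, fun r hr s hs dr ds => ?_⟩
  have h1 := h r hr s hs dr ds
  have h2 := norm_sub_norm_le ((s - r) • derivWithin F (Icc a b) r₀) (F s - F r)
  rw [norm_sub_rev _ (F s - F r), norm_smul, Real.norm_eq_abs] at h2
  rw [div_mul_eq_mul_div, le_div_iff₀ h0]
  linarith

/-- The inverse of a continuous injective map on a compact set is continuous. -/
theorem continuousOn_invFunOn {X : Type*} [TopologicalSpace X] [T2Space X] {f : ℝ → X} {s : Set ℝ}
    (hs : IsCompact s) (hf : ContinuousOn f s) (hinj : InjOn f s) :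
    ContinuousOn (Function.invFunOn f s) (f '' s) := by
  have hinv := hinj.leftInvOn_invFunOn
  rw [continuousOn_iff_isClosed]
  intro t ht
  refine ⟨f '' (s ∩ t), ((hs.inter_right ht).image_of_continuousOn
    (hf.mono inter_subset_left)).isClosed, ?_⟩
  ext y
  constructor
  · rintro ⟨hy, x, hx, rfl⟩
    rw [mem_preimage, hinv hx] at hy
    exact ⟨⟨x, ⟨hx, hy⟩, rfl⟩, x, hx, rfl⟩
  · rintro ⟨⟨x, ⟨hx, hxt⟩, rfl⟩, hy⟩
    refine ⟨?_, hy⟩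
    rw [mem_preimage, hinv hx]
    exact hxt

end Curve

/-! ### The holonomy of a transversal -/

section Transversal

variable {A B C : Type*}
  [NormedAddCommGroup A] [NormedSpace ℝ A] [NormedAddCommGroup B] [NormedSpace ℝ B]
  [NormedAddCommGroup C] [NormedSpace ℝ C]
  {iAB : A →L[ℝ] B} {iBC : B →L[ℝ] C}
  {OA : Set A} {T : A → A} {K : Set A} {OB : Set B} {TB : B → B} {w : A → A}

namespace RobustStep

variable (S : RobustStep iAB iBC OA T K OB TB w)

/-- The comparison of the difference quotients of the holonomy, expressed by `ψ` in the coordinates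
`F` of a transversal and `u` of the unstable manifold. -/
theorem exists_slope_comparison {θ : ℝ} (hθ0 : 0 < θ) (hθ : S.IsExponent θ) {ε₀ e : ℝ}
    (hε₀ : ε₀ ≤ S.radius / 4) (hε₀' : ε₀ ≤ S.stableRadius)
    (hnarrow : ∀ g ∈ K, ∀ g₁ ∈ K, ∀ f : A, g₁ ∈ localUnstableSet OA T K ε₀ g →
      f ∈ localUnstableSet OA T K ε₀ g → S.NarrowA S.coneA g₁ (f - g₁))
    (he : S.cB * e ≤ S.tubeRadius)
    (hexp : ∀ x ∈ K, ∀ y : B, (∀ k, ‖S.G^[k] y - iAB (S.φ^[k] x)‖ < S.stableRadius) →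
      ‖y - iAB x‖ < e → ∀ v : B, v ∉ tangentConeAt ℝ (localStableSet OB TB ε₀ (iAB x)) y →
      ∃ n, S.udist (S.φ^[n] x) (S.tangent y n v) < S.aperture * |S.p (S.φ^[n] x) (S.tangent y n v)|)
    {g : A} (hg : g ∈ K) {u : ℝ → A} {a b : ℝ} (hab : a < b) (hu : ContDiffOn ℝ 2 u (Icc a b))
    (hu' : ∀ t ∈ Icc a b, derivWithin u (Icc a b) t ≠ 0)
    {F : ℝ → B} {α β : ℝ} (hαβ : α < β) (hF : ContDiffOn ℝ 2 F (Icc α β))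
    {𝒦 : Set ℝ} (h𝒦 : 𝒦 ⊆ Icc α β) {ψ : ℝ → ℝ} (hψ : ContinuousOn ψ 𝒦)
    (hψm : MapsTo ψ 𝒦 (Icc a b)) (hinj : InjOn (fun r => u (ψ r)) 𝒦)
    (hK : ∀ r ∈ 𝒦, u (ψ r) ∈ K) (hW : ∀ r ∈ 𝒦, u (ψ r) ∈ localUnstableSet OA T K ε₀ g)
    (hs : ∀ r ∈ 𝒦, F r ∈ localStableSet OB TB ε₀ (iAB (u (ψ r))))
    (hclose : ∀ r ∈ 𝒦, ‖F r - iAB (u (ψ r))‖ < e)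
    (htrans : ∀ r ∈ 𝒦, derivWithin F (Icc α β) r ∉
      tangentConeAt ℝ (localStableSet OB TB ε₀ (iAB (u (ψ r)))) (F r)) {r₀ : ℝ} (hr₀ : r₀ ∈ 𝒦) :
    ∃ δ > 0, ∃ M ≥ 0, ∀ r₁ ∈ 𝒦, ∀ r₂ ∈ 𝒦, ∀ r₃ ∈ 𝒦,
      |r₁ - r₀| < δ → |r₂ - r₀| < δ → |r₃ - r₀| < δ → r₁ ≠ r₂ → r₁ ≠ r₃ →
      |slope ψ r₁ r₂ / slope ψ r₁ r₃ - 1| ≤ M * max |ψ r₂ - ψ r₁| |ψ r₃ - ψ r₁| ^ θ := by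
  obtain ⟨H₁, hH₁, h₁⟩ := exists_taylor_bound hαβ hF
  obtain ⟨H₂, hH₂, h₂⟩ := exists_taylor_bound hab hu
  obtain ⟨δ₁, hδ₁, H₃, hH₃, h₃⟩ := exists_lower_bound hab hu (hψm hr₀) (hu' _ (hψm hr₀))
  obtain ⟨δ₂, hδ₂, hc⟩ := Metric.continuousWithinAt_iff.1 (hψ r₀ hr₀) δ₁ hδ₁
  have horb : ∀ r ∈ 𝒦, ∀ k, ‖S.G^[k] (F r) - iAB (S.φ^[k] (u (ψ r)))‖ < ε₀ := fun r hr =>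
    S.stable_orbit ε₀ _ (hK r hr) _ (hs r hr)
  have hnear : ∀ r ∈ 𝒦, |r - r₀| < δ₂ → |ψ r - ψ r₀| < δ₁ := fun r hr hd => by
    have := hc hr (by rwa [Real.dist_eq])
    rwa [Real.dist_eq] at this
  have htube : ∀ n, F r₀ ∈ S.tube (u (ψ r₀)) S.tubeRadius n := fun n =>
    S.mem_tube (hK r₀ hr₀) (fun k => (horb r₀ hr₀ k).trans_le hε₀')
      (lt_of_lt_of_le (mul_lt_mul_of_pos_left (hclose r₀ hr₀) (by linarith [S.cB_ge])) he) n
  obtain ⟨n, hn⟩ := hexp _ (hK r₀ hr₀) _ (fun k => (horb r₀ hr₀ k).trans_le hε₀') (hclose r₀ hr₀) _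
    (htrans r₀ hr₀)
  have hgerm : S.HolonomyGerm F (fun r => u (ψ r)) ψ (𝒦 ∩ ball r₀ δ₂) r₀
      (derivWithin F (Icc α β) r₀) (H₁ + H₂ + H₃) := by
    have hH1 : H₁ ≤ H₁ + H₂ + H₃ := by linarith
    have hH2 : H₂ ≤ H₁ + H₂ + H₃ := by linarith
    have hH3 : H₃ ≤ H₁ + H₂ + H₃ := by linarith
    have hball : ∀ r ∈ 𝒦 ∩ ball r₀ δ₂, |ψ r - ψ r₀| < δ₁ := fun r hr =>
      hnear r hr.1 (by rw [← Real.dist_eq]; exact hr.2)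
    refine ⟨by positivity, ⟨hr₀, mem_ball_self hδ₂⟩, fun r hr => hK r hr.1, fun r hr k => ?_,
      fun r₁ m₁ r₂ m₂ => hnarrow g hg _ (hK _ m₁.1) _ (hW _ m₁.1) (hW _ m₂.1),
      hinj.mono inter_subset_left, ?_, fun r₁ m₁ r₂ m₂ => ?_, fun r₁ m₁ r₂ m₂ r₃ m₃ hne => ?_,
      fun e he => ?_, fun r₁ m₁ r₂ m₂ => ?_, fun r₁ m₁ r₂ m₂ => ?_,
      fun r₁ m₁ r₂ m₂ r₃ m₃ hne => ?_, htube, S.exists_narrow_tangent (hK r₀ hr₀) S.tubeRadius_lt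
        htube hn⟩
    · refine (S.stable_decay (hK r hr.1) (fun k => (horb r hr.1 k).trans_le hε₀') k).trans ?_
      rw [mul_comm]
      gcongr
      exact (horb r hr.1 0).le.trans hε₀
    · exact ContinuousWithinAt.comp (t := Icc a b) (hu.continuousOn _ (hψm hr₀))
        ((hψ r₀ hr₀).mono inter_subset_left) fun r hr => hψm hr.1
    · exact (h₁ r₁ (h𝒦 m₁.1) r₂ (h𝒦 m₂.1)).1.trans (by gcongr)
    · refine (norm_three_le (sub_ne_zero.2 hne) (h₁ r₁ (h𝒦 m₁.1) r₂ (h𝒦 m₂.1)).2.1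
        (h₁ r₁ (h𝒦 m₁.1) r₃ (h𝒦 m₃.1)).2.1).trans (by gcongr)
    · obtain ⟨δ, hδ, h⟩ := exists_strict_bound hαβ hF (h𝒦 hr₀) he
      exact ⟨δ, hδ, fun r₁ m₁ r₂ m₂ => h r₁ (h𝒦 m₁.1) r₂ (h𝒦 m₂.1)⟩
    · exact (h₂ _ (hψm m₁.1) _ (hψm m₂.1)).1.trans (by gcongr)
    · exact (h₃ _ (hψm m₁.1) _ (hψm m₂.1) (hball _ m₁) (hball _ m₂)).trans (by gcongr)
    · refine (norm_three_le (sub_ne_zero.2 hne) (h₂ _ (hψm m₁.1) _ (hψm m₂.1)).2.1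
        (h₂ _ (hψm m₁.1) _ (hψm m₃.1)).2.1).trans (by gcongr)
  obtain ⟨δ, hδ, M, hM, h⟩ := hgerm.exists_slope_comparison hθ0 hθ
  have hin : ∀ r ∈ 𝒦, |r - r₀| < min δ δ₂ → r ∈ 𝒦 ∩ ball r₀ δ₂ := fun r hr hd =>
    ⟨hr, by rw [mem_ball, Real.dist_eq]; exact hd.trans_le (min_le_right _ _)⟩
  exact ⟨min δ δ₂, by positivity, M, hM, fun r₁ m₁ r₂ m₂ r₃ m₃ d₁ d₂ d₃ =>
    h r₁ (hin r₁ m₁ d₁) r₂ (hin r₂ m₂ d₂) r₃ (hin r₃ m₃ d₃) (d₁.trans_le (min_le_left _ _))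
      (d₂.trans_le (min_le_left _ _)) (d₃.trans_le (min_le_left _ _))⟩

end RobustStep

end Transversal

theorem localUnstableSet_mono {E : Type*} [NormedAddCommGroup E] {O : Set E} {T : E → E} {K : Set E}
    {ε ε' : ℝ} (h : ε ≤ ε') (x : E) : localUnstableSet O T K ε x ⊆ localUnstableSet O T K ε' x := by
  rintro y ⟨p, q, h1, h2, h3, h4, h5⟩
  exact ⟨p, q, h1, h2, h3, fun n => ⟨ball_subset_ball h (h4 n).1, (h4 n).2⟩, h5⟩

theorem theorem7p1 {A B C D S : Type*}
    [NormedAddCommGroup A] [NormedSpace ℝ A] [CompleteSpace A]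
    [NormedAddCommGroup B] [NormedSpace ℝ B] [CompleteSpace B]
    [NormedAddCommGroup C] [NormedSpace ℝ C] [CompleteSpace C]
    [NormedAddCommGroup D] [NormedSpace ℝ D] [CompleteSpace D]
    [Finite S] [TopologicalSpace S] [DiscreteTopology S]
    (iAB : A →L[ℝ] B) (iBC : B →L[ℝ] C) (iCD : C →L[ℝ] D)
    -- the `C²` operator, its hyperbolic basic set and the unstable direction
    (OA : Set A) (hOA : IsOpen OA) (T : A → A) (hT : ContDiffOn ℝ 2 T OA)
    (K : Set A) (P : A → A →L[ℝ] A) (θ : ℝ) (hK : IsHyperbolicBasicSet OA T K P θ 1)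
    (w : A → A) (δ : A → ℝ) (C₀ lam : ℝ) (hw : IsUnstableDirection T K P w δ C₀ lam)
    -- robustness
    (OB : Set B) (TB : B → B) (hR : IsRobust iAB iBC iCD OA T K θ w C₀ lam OB TB)
    -- conjugacy to a shift of finite type
    (X : Set (ℤ → S)) (hX : IsShiftOfFiniteType X) (H : X ≃ₜ K) (hH : IsShiftConjugacy H T)
    -- the parametrized local unstable manifolds
    (η : ℝ) (hη : 0 < η) (a b : A → ℝ) (u : A → ℝ → A)
    (hu : IsUnstableParametrization OA T K w η a b u) :
    ∃ εmax > 0, ∀ ε₀ ε₁ : ℝ, 0 < ε₀ → ε₀ < εmax → ε₀ ≤ ε₁ → ε₁ ≤ η →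
      HasBoundedGeometry H OA T a b u ε₁ →
      ∃ ε : ℝ, 0 < ε ∧ ε < ε₀ ∧ ∀ g ∈ K, ∀ μ₀ > 0, ∀ F : ℝ → B,
        IsOrderedTransversal iAB OA T K OB TB ε₀ ε g μ₀ F →
        ∃ θ' : ℝ, 0 < θ' ∧ θ' < 1 ∧
          HolonomyExtendsToC1HolderDiffeo iAB OA T K OB TB ε₀ g (a g) (b g) (u g) μ₀ F θ' := by
  obtain ⟨R⟩ := hR.nonempty_robustStep hK hOA hT hw
  obtain ⟨θ', hθ0, hθ1, hθ⟩ := R.exists_exponent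
  obtain ⟨r', hr', hnarrow⟩ := R.exists_narrow_of_unstable_base R.coneA_pos R.coneA_le_one
  have hrad := R.radius_pos
  have hstab := R.stableRadius_pos
  refine ⟨min r' (min (R.radius / 4) (R.stableRadius / (2 * (1 + ‖iAB‖)))), by positivity,
    fun ε₀ ε₁ hε₀ hmax h01 h1η _ => ?_⟩
  rw [lt_min_iff, lt_min_iff] at hmax
  obtain ⟨hm1, hm2, hm3⟩ := hmax
  rw [lt_div_iff₀ (by positivity)] at hm3
  have hε₀s : ε₀ ≤ R.stableRadius := by nlinarith [norm_nonneg iAB]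
  obtain ⟨e, he, hce, hexp⟩ := R.exists_expansion hε₀
  obtain ⟨ε', hε', hclose⟩ := R.exists_closeness hε₀ (by linarith) (half_pos he)
  refine ⟨min ε' (min (ε₀ / 2) (e / 2)), by positivity,
    ((min_le_right _ _).trans (min_le_left _ _)).trans_lt (half_lt_self hε₀),
    fun g hg μ₀ hμ₀ F hF => ⟨θ', hθ0, hθ1, ?_⟩⟩
  obtain ⟨Φ, hΦc, hΦi, hΦm, hΦ, hΦK⟩ := hF.ordered
  set I := Icc (-μ₀) μ₀ with hI
  have hIlt : -μ₀ < μ₀ := by linarith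
  have hFI : MapsTo F I (F '' I) := mapsTo_image F I
  have hab : a g < b g := by
    obtain ⟨μ, hμ, hμab, -⟩ := hu.continuity
    linarith [(hμab g hg).1, (hμab g hg).2]
  have hWη : ∀ r ∈ I, ∃ t ∈ Ioo (a g) (b g), u g t = Φ (F r) := fun r hr => by
    have h := localUnstableSet_mono (h01.trans h1η) g (hΦm (hFI hr))
    rwa [← hu.image_eq g hg] at h
  -- the homeomorphic extension of the holonomy in coordinates
  set ψ : ℝ → ℝ := fun r => Function.invFunOn (u g) (Icc (a g) (b g)) (Φ (F r)) with hψ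
  have hψ' : ∀ r ∈ I, ψ r ∈ Ioo (a g) (b g) ∧ u g (ψ r) = Φ (F r) := by
    intro r hr
    obtain ⟨t, ht, e⟩ := hWη r hr
    have : ψ r = t := by
      rw [hψ]
      simp only [← e]
      exact (hu.injOn g hg).leftInvOn_invFunOn (Ioo_subset_Icc_self ht)
    rw [this]
    exact ⟨ht, e⟩
  have hΦF : ContinuousOn (fun r => Φ (F r)) I := hΦc.comp hF.contDiffOn.continuousOn hFI
  have hΦFi : InjOn (fun r => Φ (F r)) I := hΦi.comp hF.injOn hFI
  have hψc : ContinuousOn ψ I := by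
    refine (continuousOn_invFunOn isCompact_Icc (hu.contDiffOn g hg).continuousOn
      (hu.injOn g hg)).comp hΦF fun r hr => ?_
    obtain ⟨t, ht, e⟩ := hWη r hr
    exact ⟨t, Ioo_subset_Icc_self ht, e⟩
  have hψi : InjOn ψ I := fun r hr s hs e => hΦFi hr hs (by
    simp only
    rw [← (hψ' r hr).2, ← (hψ' s hs).2, e])
  set 𝒦 : Set ℝ := {r | r ∈ I ∧ Φ (F r) ∈ K} with h𝒦
  have h𝒦I : 𝒦 ⊆ I := fun r hr => hr.1
  have h𝒦c : IsCompact 𝒦 := isCompact_Icc.of_isClosed_subset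
    (hΦF.preimage_isClosed_of_isClosed isClosed_Icc hK.isCompact.isClosed) h𝒦I
  have hhol : ∀ r ∈ 𝒦, IsHolonomyImage iAB OA T K OB TB ε₀ g (F r) (Φ (F r)) := by
    intro r hr
    have h : Φ (F r) ∈ Φ '' (F '' I) ∩ K := ⟨⟨F r, hFI hr.1, rfl⟩, hr.2⟩
    rw [← hΦK] at h
    obtain ⟨s, hs, hs'⟩ := h
    have : s = r := hΦFi hs hr.1 (hΦ s hs _ hs')
    rwa [this] at hs'
  have huψ : ∀ r ∈ 𝒦, u g (ψ r) = Φ (F r) := fun r hr => (hψ' r hr.1).2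
  obtain ⟨Ψ, Ψ', hΨ1, hΨ2, hΨ3, hΨ4, hΨ5, L, hΨ6⟩ := exists_diffeo_extension hIlt hθ0 hθ1.le h𝒦c
    h𝒦I hψc hψi fun r₀ hr₀ => R.exists_slope_comparison hθ0 hθ hm2.le hε₀s
      (hnarrow ε₀ hm1.le) hce hexp hg hab (hu.contDiffOn g hg) (hu.deriv_ne_zero g hg) hIlt
      hF.contDiffOn h𝒦I (hψc.mono h𝒦I) (fun r hr => Ioo_subset_Icc_self (hψ' r hr.1).1)
      (fun r hr s hs e => hΦFi hr.1 hs.1 (by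
        simp only at e ⊢
        rwa [huψ r hr, huψ s hs] at e))
      (fun r hr => by rw [huψ r hr]; exact hr.2)
      (fun r hr => by rw [huψ r hr]; exact (hhol r hr).2.1)
      (fun r hr => by rw [huψ r hr]; exact (hhol r hr).2.2)
      (fun r hr => by
        rw [huψ r hr]
        have h1 := hF.mapsTo hr.1
        rw [mem_ball, dist_eq_norm, lt_min_iff, lt_min_iff] at h1
        have h2 := hclose g hg _ hr.2 (hhol r hr).2.1 (F r) h1.1 (hhol r hr).2.2
        have h3 := norm_sub_le_norm_sub_add_norm_sub (F r) (iAB g) (iAB (Φ (F r)))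
        rw [norm_sub_rev (iAB g)] at h3
        linarith [h1.2.2])
      (fun r hr => by
        rw [huψ r hr]
        exact hF.transversal r hr.1 _ hr.2 (hhol r hr).2.2) hr₀
  have hFinv : ∀ r ∈ I, Function.invFunOn F I (F r) = r := fun r hr =>
    hF.injOn.leftInvOn_invFunOn hr
  have hud : UniqueDiffOn ℝ I := uniqueDiffOn_Icc hIlt
  have hder : ∀ r ∈ I, derivWithin Ψ I r = Ψ' r := fun r hr => (hΨ4 r hr).derivWithin (hud r hr)
  have hΨ'c : ContinuousOn Ψ' I := by
    intro r hr
    have hlim : Tendsto (fun s => L * |s - r| ^ θ') (𝓝[I] r) (𝓝 0) := by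
      have hc : ContinuousAt (fun s : ℝ => L * |s - r| ^ θ') r :=
        continuousAt_const.mul (ContinuousAt.rpow_const (by fun_prop) (Or.inr hθ0.le))
      have := hc.tendsto
      simp only [sub_self, abs_zero, Real.zero_rpow hθ0.ne', mul_zero] at this
      exact this.mono_left nhdsWithin_le_nhds
    rw [ContinuousWithinAt, tendsto_iff_dist_tendsto_zero]
    refine squeeze_zero' (Eventually.of_forall fun _ => dist_nonneg) ?_ hlim
    filter_upwards [self_mem_nhdsWithin] with s hs
    rw [Real.dist_eq]
    exact hΨ6 s hs r hr
  refine ⟨fun y => u g (Ψ (Function.invFunOn F I y)), ?_, fun r hr g₀ hg₀ => ?_, Ψ, ⟨?_, hΨ3,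
    fun r hr => ?_, L, fun r hr s hs => ?_⟩, fun r hr => ⟨?_, ?_⟩⟩
  · rintro _ ⟨r, hr, rfl⟩
    obtain ⟨s, hs, e⟩ := hΨ2 hr
    simp only
    rw [hFinv r hr, ← e, (hψ' s hs).2]
    exact hΦm (hFI hs)
  · have e := hΦ r hr g₀ hg₀
    have hr' : r ∈ 𝒦 := ⟨hr, by rw [e]; exact hg₀.1⟩
    simp only
    rw [hFinv r hr, hΨ1 hr', huψ r hr', e]
  · rw [contDiffOn_one_iff_derivWithin hud]
    exact ⟨fun r hr => (hΨ4 r hr).differentiableWithinAt, hΨ'c.congr hder⟩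
  · rw [hder r hr]
    exact hΨ5 r hr
  · rw [hder r hr, hder s hs]
    exact hΨ6 r hr s hs
  · obtain ⟨s, hs, e⟩ := hΨ2 hr
    rw [← e]
    exact (hψ' s hs).1
  · simp only
    rw [hFinv r hr]
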